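/- For real $\kappa,\tau$ with $\kappa\neq 4\tau^2$, let $\mathbb{E}(\kappa,\tau)$ denote the simply connected homogeneous Riemannian $3$-manifold with $4$-dimensional isometry group, base curvature $\kappa$ and bundle curvature $\tau$. It carries a unit Killing field $\xi$ tangent to the fibers (the vertical field) and is oriented so that $\bar\nabla_X\xi=\tau X\times\xi$. Concretely it is: - for $\kappa\leqslant 0$, the set $\{(x,y,z)\in\mathbb{R}^3:1+\frac\kappa4(x^2+y^2)>0\}$ with the metric $\lambda^2(dx^2+dy^2)+(\tau\lambda(y\,dx-x\,dy)+dz)^2$, where $\lambda=(1+\frac\kappa4(x^2+y^2))^{-1}$, and $\xi=\partial_z$; - for $\kappa>0$, $\tau=0$, the product of the round $2$-sphere of curvature $\kappa$ with $\mathbb{R}$, and $\xi$ the unit field of the factor $\mathbb{R}$; - for $\kappa>0$, $\tau\neq0$, the unit sphere $\mathbb{S}^3\subset\mathbb{C}^2$ with the metric $\frac4\kappa\left(\langle X,Y\rangle+\left(\frac{4\tau^2}\kappa-1\right)\langle X,V\rangle\langle Y,V\rangle\right)$, where $\langle\cdot,\cdot\rangle$ is the Euclidean inner product and $V(z_1,z_2)=(iz_1,-iz_2)$,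 and $\xi=\frac\kappa{4\tau}V$. For a conformal immersion $x$ of a Riemann surface $\Sigma$ into $\mathbb{E}(\kappa,\tau)$, let $N$ be the unit normal compatible with the orientation of $\Sigma$. The shape operator is $\mathrm{S}X=-\bar\nabla_XN$, regarded as an operator on $\mathrm{T}\Sigma$, and the mean curvature is $\frac12\operatorname{tr}\mathrm{S}$. Let $\mathrm{I}$ and $\mathrm{J}$ be the identity and the rotation by $\frac\pi2$ on $\mathrm{T}\Sigma$. **Theorem.** Let $\mathbb{E}_1=\mathbb{E}(\kappa_1,\tau_1)$ and $\mathbb{E}_2=\mathbb{E}(\kappa_2,\tau_2)$ with $\kappa_1-4\tau_1^2=\kappa_2-4\tau_2^2\neq0$, and let $\xi_1,\xi_2$ be their vertical fields. Let $H_1,H_2,\theta\in\mathbb{R}$ satisfy $$\tau_1^2+H_1^2=\tau_2^2+H_2^2,\qquad \tau_2+iH_2=e^{i\theta}(\tau_1+iH_1).$$ Let $\Sigma$ be a simply connected Riemann surface and $x_1:\Sigma\to\mathbb{E}_1$ a smooth conformal immersion of constant mean curvature $H_1$, with unit normal $N_1$ and shape operator $\mathrm{S}_1$. Let $T_1$ be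 the vector field on $\Sigma$ such that $dx_1(T_1)$ is the orthogonal projection of $\xi_1$ onto the tangent planes of the surface, and let $\nu=\langle N_1,\xi_1\rangle$. Then there exists a smooth conformal immersion $x_2:\Sigma\to\mathbb{E}_2$, with unit normal $N_2$, such that 1. $x_1$ and $x_2$ induce the same metric on $\Sigma$; 2. the shape operator of $x_2$ is $e^{\theta\mathrm{J}}(\mathrm{S}_1-H_1\mathrm{I})+H_2\mathrm{I}$; 3. $\xi_2=dx_2(e^{\theta\mathrm{J}}T_1)+\nu N_2$. Moreover, any two conformal immersions $\Sigma\to\mathbb{E}_2$ satisfying 1, 2 and 3 differ by an isometry of $\mathbb{E}_2$ preserving the orientations of both the fibers and the base of the fibration, and every such immersion has constant mean curvature $H_2$. -/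

import Mathlib

open scoped Manifold ContDiff

noncomputable section

namespace HomSpace

/-! ### The simply connected homogeneous 3-manifolds with base curvature `κ` and bundle curvature `τ`

Each space `E(κ, τ)` is realised as a 3-dimensional submanifold of `ℝ⁴` (coordinates `p 0, …, p 3`)
with the restriction of a Riemannian metric defined on a neighbourhood of it in `ℝ⁴`:

* `κ > 0`, `τ ≠ 0`: the unit sphere `S³ ⊂ ℂ²` with the round metric rescaled along the Hopf fibres;
* `κ > 0`, `τ = 0`: the product `S²(1/√κ) × ℝ` with the Euclidean metric of `ℝ⁴`;
* `κ ≤ 0`: the set `{(x, y, z) : 1 + κ/4 (x² + y²) > 0}` of `ℝ³ = {p 3 = 0}` with the metric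
  `lam² (dx² + dy²) + (τ lam (y dx - x dy) + dz)²`. -/

/-- The coordinate space `ℝ⁴`. -/
abbrev R4 : Type := Fin 4 → ℝ

/-- The Euclidean inner product of `ℝ⁴`. -/
def dot (u v : R4) : ℝ := ∑ i, u i * v i

/-- The conformal factor `1 / (1 + κ/4 (x² + y²))`. -/
def lam (κ : ℝ) (p : R4) : ℝ := 1 / (1 + κ / 4 * (p 0 ^ 2 + p 1 ^ 2))

/-- The tangent field `(i z₁, - i z₂)` of the Hopf fibres of `S³ ⊂ ℂ²`. -/
def hopf (p : R4) : R4 := ![-p 1, p 0, p 3, -p 2]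

/-- The set of points of `E(κ, τ)`. -/
def carrier (κ τ : ℝ) : Set R4 :=
  {p | if 0 < κ then
      (if τ = 0 then p 0 ^ 2 + p 1 ^ 2 + p 2 ^ 2 = 1 / κ
        else p 0 ^ 2 + p 1 ^ 2 + p 2 ^ 2 + p 3 ^ 2 = 1)
    else 0 < 1 + κ / 4 * (p 0 ^ 2 + p 1 ^ 2) ∧ p 3 = 0}

/-- A Euclidean normal vector of `E(κ, τ) ⊂ ℝ⁴` at `p`; it fixes the tangent space of `E(κ, τ)` and,
by its direction, the orientation of `E(κ, τ)`. -/
def conormal (κ τ : ℝ) (p : R4) : R4 :=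
  if 0 < κ then (if τ = 0 then ![p 0, p 1, p 2, 0] else τ • p) else ![0, 0, 0, -1]

/-- The tangent space of `E(κ, τ)` at `p`, as a subset of `ℝ⁴`. -/
def tangent (κ τ : ℝ) (p : R4) : Set R4 := {u | dot (conormal κ τ p) u = 0}

/-- The Riemannian metric. -/
def metric (κ τ : ℝ) (p u v : R4) : ℝ :=
  if 0 < κ then
    (if τ = 0 then dot u v
      else 4 / κ * (dot u v + (4 * τ ^ 2 / κ - 1) * (dot (hopf p) u * dot (hopf p) v)))
  else
    lam κ p ^ 2 * (u 0 * v 0 + u 1 * v 1)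
      + (τ * lam κ p * (p 1 * u 0 - p 0 * u 1) + u 2)
        * (τ * lam κ p * (p 1 * v 0 - p 0 * v 1) + v 2)
      + u 3 * v 3

/-- The vertical vector field `ξ`: the unit Killing field tangent to the fibres. -/
def vertical (κ τ : ℝ) (p : R4) : R4 :=
  if 0 < κ then (if τ = 0 then ![0, 0, 0, 1] else (κ / (4 * τ)) • hopf p) else ![0, 0, 1, 0]

/-- The tangent vectors `u, v, w` at `p` form a direct basis of the tangent space of `E(κ, τ)`.
The orientation is the one for which the Levi-Civita connection satisfies
`∇_X ξ = τ (X × ξ)`. -/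
def IsDirect (κ τ : ℝ) (p u v w : R4) : Prop :=
  0 < Matrix.det (Matrix.of ![conormal κ τ p, u, v, w])

/-- `⟨Γ(u, v), w⟩`, where `Γ` are the Christoffel symbols of the metric in the coordinates of `ℝ⁴`:
`2 ⟨Γ(u, v), w⟩ = ∂_u⟨v, w⟩ + ∂_v⟨u, w⟩ - ∂_w⟨u, v⟩`. -/
def christoffel (κ τ : ℝ) (p u v w : R4) : ℝ :=
  (fderiv ℝ (fun q => metric κ τ q v w) p u + fderiv ℝ (fun q => metric κ τ q u w) p v
    - fderiv ℝ (fun q => metric κ τ q u v) p w) / 2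

/-- An isometry of `E(κ, τ)` preserving the orientation of the fibres (it preserves `ξ`) and that of
the base (it preserves `ξ` and the orientation of `E(κ, τ)`). Only the restriction of `Φ` to
`E(κ, τ)` matters. -/
structure IsOrientedIsometry (κ τ : ℝ) (Φ : R4 → R4) : Prop where
  bijOn : Set.BijOn Φ (carrier κ τ) (carrier κ τ)
  smooth : ∀ p ∈ carrier κ τ, ContDiffAt ℝ ∞ Φ p
  metric_eq : ∀ p ∈ carrier κ τ, ∀ u ∈ tangent κ τ p, ∀ v ∈ tangent κ τ p,
    metric κ τ (Φ p) (fderiv ℝ Φ p u) (fderiv ℝ Φ p v) = metric κ τ p u v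
  vertical_eq : ∀ p ∈ carrier κ τ, fderiv ℝ Φ p (vertical κ τ p) = vertical κ τ (Φ p)
  direct : ∀ p ∈ carrier κ τ, ∀ u ∈ tangent κ τ p, ∀ v ∈ tangent κ τ p, ∀ w ∈ tangent κ τ p,
    IsDirect κ τ p u v w →
      IsDirect κ τ (Φ p) (fderiv ℝ Φ p u) (fderiv ℝ Φ p v) (fderiv ℝ Φ p w)

/-! ### Surfaces in `E(κ, τ)`

The tangent space of a Riemann surface `S` at `p` is `ℂ` (read in the preferred chart at `p`), and
the rotation `J` of angle `π/2` of a metric conformal to the complex structure is the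
multiplication by `i`. -/

section Surface

variable {S : Type*} [TopologicalSpace S] [ChartedSpace ℂ S]

/-- The (real) differential at `p` of a map from the Riemann surface `S` to `ℝ⁴`. -/
def diff (x : S → R4) (p : S) : ℂ →L[ℝ] R4 := mfderiv 𝓘(ℝ, ℂ) 𝓘(ℝ, R4) x p

/-- The metric induced on `S` by a map `x` into `E(κ, τ)`. -/
def inducedMetric (κ τ : ℝ) (x : S → R4) (p : S) (v w : ℂ) : ℝ :=
  metric κ τ (x p) (diff x p v) (diff x p w)

/-- `x` is a (smooth) conformal immersion of `S` into `E(κ, τ)`: the induced metric is a positive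
multiple of `Re (v w̄)`. In particular the differential of `x` is injective at each point. -/
structure IsConformalImmersion (κ τ : ℝ) (x : S → R4) : Prop where
  smooth : ContMDiff 𝓘(ℝ, ℂ) 𝓘(ℝ, R4) ∞ x
  mem : ∀ p, x p ∈ carrier κ τ
  conformal : ∀ p, ∃ ρ : ℝ, 0 < ρ ∧
    ∀ v w : ℂ, inducedMetric κ τ x p v w = ρ * (v * (starRingEnd ℂ) w).re

/-- `N` is the unit normal field of `x` in `E(κ, τ)` compatible with the orientation of `S`. -/
structure IsUnitNormal (κ τ : ℝ) (x N : S → R4) : Prop where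
  smooth : ContMDiff 𝓘(ℝ, ℂ) 𝓘(ℝ, R4) ∞ N
  tangent : ∀ p, N p ∈ tangent κ τ (x p)
  unit : ∀ p, metric κ τ (x p) (N p) (N p) = 1
  orthogonal : ∀ p v, metric κ τ (x p) (N p) (diff x p v) = 0
  direct : ∀ p, IsDirect κ τ (x p) (diff x p 1) (diff x p Complex.I) (N p)

/-- `⟨∇_v N, dx w⟩`, where `∇_v N` is the covariant derivative at `p` in the direction `v` of the
field `N` along `x`. The Levi-Civita connection of `E(κ, τ)` is the tangential part of that of the
metric of `ℝ⁴`, so that, `dx w` being tangent to `E(κ, τ)`, both give the same number. -/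
def covDerivInner (κ τ : ℝ) (x N : S → R4) (p : S) (v w : ℂ) : ℝ :=
  metric κ τ (x p) (diff N p v) (diff x p w)
    + christoffel κ τ (x p) (diff x p v) (N p) (diff x p w)

/-- `A` is the operator induced on `S` by the shape operator `X ↦ -∇_X N` of `x`. -/
def IsShapeOperator (κ τ : ℝ) (x N : S → R4) (A : S → ℂ →ₗ[ℝ] ℂ) : Prop :=
  ∀ (p : S) (v w : ℂ), inducedMetric κ τ x p (A p v) w = -covDerivInner κ τ x N p v w

/-- `dx (T)` is the orthogonal projection of `ξ` onto the tangent plane of the surface. -/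
def IsTangentPart (κ τ : ℝ) (x : S → R4) (T : S → ℂ) : Prop :=
  ∀ (p : S) (w : ℂ),
    metric κ τ (x p) (vertical κ τ (x p) - diff x p (T p)) (diff x p w) = 0

/-- The mean curvature (half the trace of the shape operator `A`) is constant equal to `H`. -/
def HasConstantMeanCurvature (A : S → ℂ →ₗ[ℝ] ℂ) (H : ℝ) : Prop :=
  ∀ p : S, LinearMap.trace ℝ ℂ (A p) / 2 = H

end Surface

/-- The rotation `e^{θJ}` of a tangent plane of a Riemann surface. -/
def rot (θ : ℝ) : ℂ →ₗ[ℝ] ℂ := LinearMap.mulLeft ℝ (Complex.exp (θ * Complex.I))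

/-- The conformal immersion `x₂` into `E(κ₂, τ₂)`, with unit normal `N₂`, induces the same metric as
the immersion `x₁` into `E(κ₁, τ₁)`, has shape operator `e^{θJ}(A₁ - H₁ I) + H₂ I`, and satisfies
`ξ₂ = dx₂(e^{θJ} T₁) + ν N₂`. -/
structure IsSister {S : Type*} [TopologicalSpace S] [ChartedSpace ℂ S]
    (κ₁ τ₁ κ₂ τ₂ H₁ H₂ θ : ℝ) (x₁ : S → R4) (A₁ : S → ℂ →ₗ[ℝ] ℂ) (T₁ : S → ℂ) (ν : S → ℝ)
    (x₂ N₂ : S → R4) : Prop where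
  immersion : IsConformalImmersion κ₂ τ₂ x₂
  normal : IsUnitNormal κ₂ τ₂ x₂ N₂
  metric_eq : ∀ p v w, inducedMetric κ₂ τ₂ x₂ p v w = inducedMetric κ₁ τ₁ x₁ p v w
  shape_eq : IsShapeOperator κ₂ τ₂ x₂ N₂
    (fun p => rot θ ∘ₗ (A₁ p - H₁ • LinearMap.id) + H₂ • LinearMap.id)
  vertical_eq : ∀ p,
    vertical κ₂ τ₂ (x₂ p) = diff x₂ p (rot θ (T₁ p)) + ν p • N₂ p

end HomSpace

end

/-!
The sister correspondence between constant mean curvature surfaces of the spaces `E(κ, τ)`.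

Each space `E(κ, τ)` is the image of a 4-dimensional group: the matrices `(a, -κ/4 b̄; b, ā)` of
determinant one, with a height `s` along the fibres. An element `(a, b, s)` defines a point `proj`
and a direct orthonormal basis `frame` of the tangent space there, whose last vector is `ξ`
(`metric_frame`, `isDirect_frame`, `frame_vertical`). A map from a domain of `ℂ` to `E(κ, τ)` lifts
locally to the group, and is then described by three real or complex 1-forms: the components `φ`
(horizontal, complex) and `η` (vertical) of its differential in the frame, and a connection form
`β`. They satisfy the structure equations

  `dφ = 2iβ ∧ φ`, `dη = -2τ σ`, `dβ = (κ/2) σ`, where `σ(v, w) = Im (conj (φ v) φ w)`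

(`IsGroupLift.curl_φ`, `IsLift.curl_η`, `IsGroupLift.curl_β`). Conversely, forms satisfying these
equations come from a map (`exists_isLift_of_forms`, a linear Frobenius theorem), which is unique up
to the action of the group by translations, and these are isometries preserving the orientations of
the fibres and of the base (`isOrientedIsometry_translation`).

The Levi-Civita connection in the frame (`frame_leviCivita`) expresses the shape operator by `φ`,
`η`, `β` and the coordinates `(n, ν)` of the unit normal. The constancy of the mean curvature is
equivalent to equations for the divergences of `φ` and `η` (`IsSurfaceLift.mean_curvature`). The
sister surface is the one with forms

  `φ₂ = φ ∘ e^{-θJ}`, `η₂ = η ∘ e^{-θJ}`, `β₂ = β + η (sin θ (H₂ + iτ₂) ·)`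

and the same `(n, ν)`. The exterior derivative of a rotated form combines the exterior derivative and
the divergence of the original form, so that the structure equations of `E(κ₁, τ₁)` and the mean
curvature equations for `H₁` give the structure equations of `E(κ₂, τ₂)` (`curl_sisterForm_φ`,
`curl_sisterForm_η`, `curl_sisterConn`); the relations between the parameters are what makes this
work. The induced metric, the shape operator and the vertical field are then the prescribed ones
(`IsLift.isSisterJet`). Conversely, any sister immersion has local lifts with these forms
(`exists_isLift_sister`), because the horizontal form determines the rotation of the frame and the
shape operator determines the connection form.

Hence the sister immersions of a domain are locally determined, up to a translation, by their first
order jet at a point. On a simply connected surface, the local solutions glue to a global one by a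
monodromy argument (`exists_global_solution`, applied to first order jets in
`IsCMCSurface.exists_sister`), and two global solutions differ by a translation by unique
continuation (`IsSisterOn.movedBy`). Finally the rotation of a trace-free symmetric operator is
trace-free, so that a sister immersion has mean curvature `H₂`
(`IsSister.hasConstantMeanCurvature`).
-/

noncomputable section

set_option linter.unusedSimpArgs false

namespace HomSpace

/-! ### Linear total differential equations -/

section Frobenius

open Filter Topology Metric Set
open scoped NNReal

variable {E W : Type*} [NormedAddCommGroup E] [NormedSpace ℝ E]
  [NormedAddCommGroup W] [NormedSpace ℝ W]

/-- A linear differential equation with a coefficient of norm at most `1/2` has a solution on `[0, 1]`.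
The bound keeps the Picard iteration in the ball of radius `‖y₀‖` around `y₀`. -/
theorem exists_linear_ode_solution [CompleteSpace W] {A : ℝ → W →L[ℝ] W}
    (hA : ContinuousOn A (Icc 0 1)) (hb : ∀ t ∈ Icc (0 : ℝ) 1, ‖A t‖ ≤ 1 / 2) (y₀ : W) :
    ∃ y : ℝ → W, y 0 = y₀ ∧
      ∀ t ∈ Icc (0 : ℝ) 1, HasDerivWithinAt y (A t (y t)) (Icc 0 1) t := by
  have h : IsPicardLindelof (fun t x => A t x) (tmin := 0) (tmax := 1)
      (⟨0, by simp⟩ : Icc (0 : ℝ) 1) y₀ ‖y₀‖₊ 0 ‖y₀‖₊ (1 / 2) := by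
    refine ⟨fun t ht => ?_, fun x _ => hA.clm_apply continuousOn_const, fun t ht x hx => ?_, ?_⟩
    · refine LipschitzWith.lipschitzOnWith ((A t).lipschitz.weaken ?_)
      rw [← NNReal.coe_le_coe]
      simpa using hb t ht
    · have hx' : ‖x‖ ≤ 2 * ‖y₀‖ := by
        have h1 := norm_sub_norm_le x y₀
        rw [mem_closedBall, dist_eq_norm] at hx
        have : ‖x - y₀‖ ≤ ‖y₀‖ := hx
        linarith
      calc ‖A t x‖ ≤ ‖A t‖ * ‖x‖ := (A t).le_opNorm x
        _ ≤ 1 / 2 * (2 * ‖y₀‖) := by gcongr; exact hb t ht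
        _ = ‖y₀‖ := by ring
    · simp
  obtain ⟨y, h0, hy⟩ := h.exists_eq_forall_mem_Icc_hasDerivWithinAt₀
  exact ⟨y, h0, hy⟩

/-- The first order Taylor formula for the coefficient of the equation, with a uniform bound. -/
theorem exists_taylor_bound {F : Type*} [NormedAddCommGroup F] [NormedSpace ℝ F] {B : E → F}
    {U : Set E} (hU : IsOpen U) (hB : ContDiffOn ℝ 2 B U) {p : E} (hp : p ∈ U) :
    ∃ R > 0, ∃ M ≥ 0, ball p R ⊆ U ∧ ∀ x ∈ ball p R, ‖B x‖ ≤ M ∧ ‖fderiv ℝ B x‖ ≤ M ∧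
      ∀ y ∈ ball p R, ‖B y - B x - fderiv ℝ B x (y - x)‖ ≤ M * ‖y - x‖ * ‖y - x‖ := by
  have hBp : ContDiffAt ℝ 2 B p := hB.contDiffAt (hU.mem_nhds hp)
  have hD : ContDiffAt ℝ 1 (fderiv ℝ B) p := hBp.fderiv_right (by norm_num)
  obtain ⟨K, t, ht, hK⟩ := hD.exists_lipschitzOnWith
  have h1 : ∀ᶠ x in 𝓝 p, ‖B x‖ < ‖B p‖ + 1 :=
    hBp.continuousAt.norm.eventually_lt continuousAt_const (by simp)
  have h2 : ∀ᶠ x in 𝓝 p, ‖fderiv ℝ B x‖ < ‖fderiv ℝ B p‖ + 1 :=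
    hD.continuousAt.norm.eventually_lt continuousAt_const (by simp)
  obtain ⟨R, hR, hball⟩ := Metric.eventually_nhds_iff_ball.1
    ((h1.and h2).and ((hU.eventually_mem hp).and ht))
  refine ⟨R, hR, ‖B p‖ + 1 + (‖fderiv ℝ B p‖ + 1) + K, by positivity,
    fun x hx => (hball x hx).2.1, fun x hx => ⟨?_, ?_, fun y hy => ?_⟩⟩
  · linarith [(hball x hx).1.1, norm_nonneg (fderiv ℝ B p), K.coe_nonneg]
  · linarith [(hball x hx).1.2, norm_nonneg (B p), K.coe_nonneg]
  · have hseg : segment ℝ x y ⊆ ball p R := (convex_ball p R).segment_subset hx hy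
    have := (convex_segment x y).norm_image_sub_le_of_norm_hasFDerivWithin_le' (f := B)
      (f' := fderiv ℝ B) (φ := fderiv ℝ B x) (C := K * ‖y - x‖)
      (fun z hz => ((hB.contDiffAt (hU.mem_nhds (hball z (hseg hz)).2.1)).differentiableAt
        (by norm_num)).hasFDerivAt.hasFDerivWithinAt) (fun z hz => ?_)
      (left_mem_segment ℝ x y) (right_mem_segment ℝ x y)
    · refine this.trans ?_
      gcongr
      linarith [norm_nonneg (fderiv ℝ B p), norm_nonneg (B p)]
    · refine (hK.norm_sub_le (hball z (hseg hz)).2.2 (hball x hx).2.2).trans ?_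
      gcongr
      rw [← dist_eq_norm, ← dist_eq_norm, dist_comm y x, dist_comm z x]
      have := dist_add_dist_of_mem_segment hz
      linarith [dist_nonneg (x := z) (y := y)]

set_option maxHeartbeats 1000000 in
/-- Frobenius theorem for linear total differential equations `dy = B(·) y`: on small balls, there
is a solution with any given value at any given point, when the curvature of `B` vanishes.

The solution is constructed along the rays from `q`. For two nearby rays, ending at `ζ` and
`ζ + δ`, the difference `y_{ζ+δ}(t) - y_ζ(t) - t B(δ) y_ζ(t)` satisfies, because of the vanishing of
the curvature, a linear differential equation up to an error `O(‖δ‖²)`, and Grönwall's inequality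
shows that it is `O(‖δ‖²)` itself. -/
theorem exists_totalDifferential_solution [CompleteSpace W] {B : E → E →L[ℝ] W →L[ℝ] W}
    {U : Set E} (hU : IsOpen U) (hB : ContDiffOn ℝ 2 B U) {p : E} (hp : p ∈ U)
    (hflat : ∀ x ∈ U, ∀ u v, fderiv ℝ B x u v - fderiv ℝ B x v u
      = (B x u) ∘L (B x v) - (B x v) ∘L (B x u)) :
    ∃ R > 0, ∀ r ≤ R, ball p r ⊆ U ∧ ∀ q ∈ ball p r, ∀ y₀ : W, ∃ y : E → W, y q = y₀ ∧
      ∀ x ∈ ball p r, HasFDerivAt y ((B x).flip (y x)) x := by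
  obtain ⟨R₀, hR₀, M, hM, hsub, hbd⟩ := exists_taylor_bound hU hB hp
  refine ⟨min R₀ (1 / (4 * (M + 1))), by positivity, fun r hr => ?_⟩
  have hrR : ball p r ⊆ ball p R₀ := ball_subset_ball (hr.trans (min_le_left _ _))
  refine ⟨hrR.trans hsub, fun q hq y₀ => ?_⟩
  have hrM : M * (2 * r) ≤ 1 / 2 := by
    have h1 : r ≤ 1 / (4 * (M + 1)) := hr.trans (min_le_right _ _)
    rw [le_div_iff₀ (by positivity)] at h1
    have h0 : 0 < r := (dist_nonneg.trans_lt hq)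
    nlinarith
  have hr0 : 0 < r := (dist_nonneg.trans_lt hq)
  -- the ray from `q` to `x`
  have hray : ∀ x ∈ ball p r, ∀ t ∈ Icc (0 : ℝ) 1, q + t • (x - q) ∈ ball p r := by
    intro x hx t ht
    have := (convex_ball p r).add_smul_sub_mem hq hx ht
    exact this
  have hdist : ∀ x ∈ ball p r, ‖x - q‖ ≤ 2 * r := by
    intro x hx
    rw [← dist_eq_norm]
    linarith [dist_triangle_right x q p, mem_ball.1 hx, mem_ball.1 hq]
  have hBc : ContinuousOn B (ball p r) := hB.continuousOn.mono (hrR.trans hsub)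
  have hAb : ∀ x ∈ ball p r, ∀ t ∈ Icc (0 : ℝ) 1, ‖B (q + t • (x - q)) (x - q)‖ ≤ 1 / 2 := by
    intro x hx t ht
    refine ((B _).le_opNorm _).trans (le_trans ?_ hrM)
    gcongr
    · exact (hbd _ (hrR (hray x hx t ht))).1
    · exact hdist x hx
  have hsol : ∀ x ∈ ball p r, ∃ y : ℝ → W, y 0 = y₀ ∧ ∀ t ∈ Icc (0 : ℝ) 1,
      HasDerivWithinAt y (B (q + t • (x - q)) (x - q) (y t)) (Icc 0 1) t := by
    intro x hx
    refine exists_linear_ode_solution (A := fun t => B (q + t • (x - q)) (x - q)) ?_ (hAb x hx) y₀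
    refine ContinuousOn.clm_apply (hBc.comp (by fun_prop) (fun t ht => hray x hx t ht))
      continuousOn_const
  choose! Y hY0 hY using hsol
  refine ⟨fun x => Y x 1, ?_, fun x hx => ?_⟩
  · have hc : ∀ t ∈ Icc (0 : ℝ) 1, Y q t = Y q 0 := by
      apply constant_of_derivWithin_zero (fun t ht => (hY q hq t ht).differentiableWithinAt)
      intro t ht
      rw [(hY q hq t (Ico_subset_Icc_self ht)).derivWithin (uniqueDiffOn_Icc zero_lt_one t
        (Ico_subset_Icc_self ht))]
      simp
    exact (hc 1 (by simp)).trans (hY0 q hq)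
  · have hYc : ContinuousOn (Y x) (Icc 0 1) := fun t ht => (hY x hx t ht).continuousWithinAt
    obtain ⟨C, hC⟩ := isCompact_Icc.exists_bound_of_continuousOn hYc
    have hC0 : 0 ≤ C := (norm_nonneg _).trans (hC 0 (by simp))
    -- the quadratic estimate
    have key : ∀ x' ∈ ball p r, ‖Y x' 1 - Y x 1 - B x (x' - x) (Y x 1)‖
        ≤ gronwallBound 0 (1 / 2) ((M * (2 * r) + M + (M * (2 * r) + M) * M) * C * ‖x' - x‖ ^ 2)
          1 := by
      intro x' hx'
      set δ := x' - x with hδ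
      set c : ℝ → E := fun t => q + t • (x - q) with hc
      set c' : ℝ → E := fun t => q + t • (x' - q) with hc'
      have hcc : ∀ t, c' t - c t = t • δ := fun t => by
        simp only [hc, hc', hδ]; module
      let u : ℝ → W := fun t => Y x' t - Y x t - t • B (c t) δ (Y x t)
      let u' : ℝ → W := fun t => B (c' t) (x' - q) (Y x' t) - B (c t) (x - q) (Y x t)
        - (t • (fderiv ℝ B (c t) (x - q) δ (Y x t) + B (c t) δ (B (c t) (x - q) (Y x t)))
          + (1 : ℝ) • B (c t) δ (Y x t))
      have hu : ∀ t ∈ Icc (0 : ℝ) 1, HasDerivWithinAt u (u' t) (Icc 0 1) t := by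
        intro t ht
        have hcm := hray x hx t ht
        have hBd : HasFDerivAt B (fderiv ℝ B (c t)) (c t) :=
          ((hB.contDiffAt (hU.mem_nhds (hsub (hrR hcm)))).differentiableAt
            (by norm_num)).hasFDerivAt
        have hcd : HasDerivWithinAt c (x - q) (Icc 0 1) t := by
          have := ((hasDerivAt_id t).smul_const (x - q)).const_add q
          rw [one_smul] at this
          exact this.hasDerivWithinAt
        have hBc' : HasDerivWithinAt (fun t => B (c t)) (fderiv ℝ B (c t) (x - q)) (Icc 0 1) t :=
          HasFDerivAt.comp_hasDerivWithinAt (E := E →L[ℝ] W →L[ℝ] W) (f := c) t hBd hcd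
        have h1 := (hBc'.clm_apply (hasDerivWithinAt_const t (Icc 0 1) δ)).clm_apply (hY x hx t ht)
        have h2 := (hasDerivWithinAt_id t (Icc (0 : ℝ) 1)).smul h1
        have h3 := ((hY x' hx' t ht).sub (hY x hx t ht)).sub h2
        refine h3.congr_deriv ?_
        simp [u', c, c']
      have hub : ∀ t ∈ Ico (0 : ℝ) 1, ‖u' t‖ ≤ 1 / 2 * ‖u t‖
          + (M * (2 * r) + M + (M * (2 * r) + M) * M) * C * ‖δ‖ ^ 2 := by
        intro t ht
        have htI := Ico_subset_Icc_self ht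
        have hcm := hray x hx t htI
        have hcm' := hray x' hx' t htI
        have ht1 : |t| ≤ 1 := abs_le.2 ⟨by linarith [ht.1], ht.2.le⟩
        obtain ⟨b1, b2, b3⟩ := hbd _ (hrR hcm)
        have b3 := b3 _ (hrR hcm')
        have hfl := congrArg (fun T : W →L[ℝ] W => T (Y x t))
          (hflat _ (hsub (hrR hcm)) δ (x - q))
        simp only [sub_apply, ContinuousLinearMap.comp_apply] at hfl
        -- the decomposition of `u'` for which the flatness of `B` is used
        have hdec : u' t = B (c' t) (x' - q) (u t)
            + ((B (c' t) - B (c t) - fderiv ℝ B (c t) (c' t - c t)) (x' - q) (Y x t)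
              + t • fderiv ℝ B (c t) δ δ (Y x t)
              + t • ((B (c' t) - B (c t)) (x' - q) (B (c t) δ (Y x t))
                  + B (c t) δ (B (c t) δ (Y x t)))) := by
          have e1 : x' - q = (x - q) + δ := by rw [hδ]; abel
          have e2 : fderiv ℝ B (c t) (x - q) δ (Y x t) = fderiv ℝ B (c t) δ (x - q) (Y x t)
              - (B (c t) δ (B (c t) (x - q) (Y x t)) - B (c t) (x - q) (B (c t) δ (Y x t))) := by
            rw [← hfl]; abel
          rw [hcc]
          simp only [u, u', e2]
          simp only [e1, map_add, map_sub, map_smul, add_apply,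
            sub_apply, smul_apply, smul_add, smul_sub]
          module
        have hdB : ‖B (c' t) - B (c t)‖ ≤ M * ‖δ‖ := by
          have := (convex_ball p r).norm_image_sub_le_of_norm_fderiv_le (𝕜 := ℝ) (f := B) (C := M)
            (fun z hz => (hB.contDiffAt (hU.mem_nhds (hsub (hrR hz)))).differentiableAt
              (by norm_num)) (fun z hz => (hbd z (hrR hz)).2.1) hcm hcm'
          refine this.trans ?_
          change M * ‖c' t - c t‖ ≤ _
          rw [hcc, norm_smul, Real.norm_eq_abs]
          gcongr
          exact mul_le_of_le_one_left (norm_nonneg _) ht1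
        have n1 : ‖B (c' t) (x' - q) (u t)‖ ≤ 1 / 2 * ‖u t‖ :=
          ((B (c' t) (x' - q)).le_opNorm _).trans (by gcongr; exact hAb x' hx' t htI)
        have hYt : ‖Y x t‖ ≤ C := hC t htI
        have n2 : ‖(B (c' t) - B (c t) - fderiv ℝ B (c t) (c' t - c t)) (x' - q) (Y x t)‖
            ≤ M * ‖δ‖ * ‖δ‖ * (2 * r) * C := by
          refine (ContinuousLinearMap.le_opNorm₂ _ _ _).trans ?_
          gcongr
          · refine b3.trans ?_
            change M * ‖c' t - c t‖ * ‖c' t - c t‖ ≤ _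
            rw [hcc, norm_smul, Real.norm_eq_abs]
            gcongr <;> exact mul_le_of_le_one_left (norm_nonneg _) ht1
          · exact hdist x' hx'
        have n3 : ‖t • fderiv ℝ B (c t) δ δ (Y x t)‖ ≤ M * ‖δ‖ * ‖δ‖ * C := by
          rw [norm_smul, Real.norm_eq_abs]
          refine (mul_le_of_le_one_left (norm_nonneg _) ht1).trans ?_
          refine (ContinuousLinearMap.le_opNorm₂ _ _ _).trans ?_
          gcongr
          exact (ContinuousLinearMap.le_opNorm _ _).trans
            (mul_le_mul_of_nonneg_right b2 (norm_nonneg _))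
        have n0 : ‖B (c t) δ (Y x t)‖ ≤ M * ‖δ‖ * C := by
          refine (ContinuousLinearMap.le_opNorm₂ _ _ _).trans ?_
          gcongr
        have n4 : ‖t • ((B (c' t) - B (c t)) (x' - q) (B (c t) δ (Y x t))
                  + B (c t) δ (B (c t) δ (Y x t)))‖
            ≤ M * ‖δ‖ * (2 * r) * (M * ‖δ‖ * C) + M * ‖δ‖ * (M * ‖δ‖ * C) := by
          rw [norm_smul, Real.norm_eq_abs]
          refine (mul_le_of_le_one_left (norm_nonneg _) ht1).trans ?_
          refine (norm_add_le _ _).trans ?_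
          gcongr
          · refine (ContinuousLinearMap.le_opNorm₂ _ _ _).trans ?_
            gcongr
            exact hdist x' hx'
          · refine (ContinuousLinearMap.le_opNorm₂ _ _ _).trans ?_
            gcongr
        rw [hdec]
        refine (norm_add_le _ _).trans (add_le_add n1 ?_)
        refine (norm_add₃_le).trans ?_
        refine (add_le_add (add_le_add n2 n3) n4).trans (le_of_eq ?_)
        ring
      have := norm_le_gronwallBound_of_norm_deriv_right_le (f := u) (f' := u') (δ := 0)
        (fun t ht => (hu t ht).continuousWithinAt)
        (fun t ht => (hu t (Ico_subset_Icc_self ht)).mono_of_mem_nhdsWithin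
          (Icc_mem_nhdsGE_of_mem ht)) (by simp [u, hY0 x hx, hY0 x' hx']) hub 1 (by simp)
      simpa [u, c] using this
    rw [hasFDerivAt_iff_isLittleO]
    have hO : (fun x' => Y x' 1 - Y x 1 - ((B x).flip (Y x 1)) (x' - x))
        =O[𝓝 x] fun x' => ‖x' - x‖ ^ 2 := by
      refine Asymptotics.IsBigO.of_bound
        ((M * (2 * r) + M + (M * (2 * r) + M) * M) * C / (1 / 2) * (Real.exp (1 / 2 * 1) - 1)) ?_
      filter_upwards [isOpen_ball.mem_nhds hx] with x' hx'
      refine (key x' hx').trans (le_of_eq ?_)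
      rw [gronwallBound_of_K_ne_0 (by norm_num)]
      simp only [norm_pow, norm_norm]
      ring
    refine hO.trans_isLittleO ?_
    have := (Asymptotics.isLittleO_pow_id (𝕜 := ℝ) (n := 2) (by norm_num)).comp_tendsto
      (tendsto_norm_sub_self x)
    exact (this.trans_isBigO (Asymptotics.isBigO_of_le _ fun x' => by simp))

/-- Solutions of total differential equations with smooth coefficients are smooth. -/
theorem contDiffOn_of_totalDifferential {B : E → E →L[ℝ] W →L[ℝ] W} {U : Set E} (hU : IsOpen U)
    (hB : ContDiffOn ℝ ∞ B U) {y : E → W} (hy : ∀ x ∈ U, HasFDerivAt y ((B x).flip (y x)) x) :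
    ContDiffOn ℝ ∞ y U := by
  rw [contDiffOn_infty]
  intro n
  induction n with
  | zero =>
    exact contDiffOn_zero.2 fun x hx => (hy x hx).continuousAt.continuousWithinAt
  | succ n ih =>
    refine (contDiffOn_succ_iff_fderiv_of_isOpen (n := n) hU).2
      ⟨fun x hx => (hy x hx).differentiableAt.differentiableWithinAt, by simp, ?_⟩
    have hf := LinearIsometryEquiv.contDiff (𝕜 := ℝ) (n := n) (E := E →L[ℝ] W →L[ℝ] W)
      (F := W →L[ℝ] E →L[ℝ] W) (ContinuousLinearMap.flipₗᵢ ℝ E W W)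
    have hBf : ContDiffOn ℝ n (fun x => (B x).flip) U :=
      ContDiff.comp_contDiffOn (F := E →L[ℝ] W →L[ℝ] W) (G := W →L[ℝ] E →L[ℝ] W) hf
        (contDiffOn_infty.1 hB n)
    have : ContDiffOn ℝ n (fun x => (B x).flip (y x)) U :=
      ContDiffOn.clm_apply (F := W) (G := E →L[ℝ] W) hBf ih
    exact this.congr fun x hx => (hy x hx).fderiv

end Frobenius

/-! ### Global solutions on simply connected spaces -/

section Monodromy

open Filter Topology

variable {X Y : Type*} [TopologicalSpace X]

/-- The total space of the values of the local solutions of a problem: the pairs `(p, f p)`, where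
`f` is a solution near `p`. It is the étalé space of the sheaf of solutions as soon as a solution
near `p` is determined there by its value at `p`. -/
abbrev SolSpace (Sol : (X → Y) → X → Prop) : Type _ :=
  {e : X × Y // ∃ f, Sol f e.1 ∧ f e.1 = e.2}

/-- The topology for which the graphs of the local solutions are open. -/
@[reducible] def solTopology (Sol : (X → Y) → X → Prop)
    (hopen : ∀ f p, Sol f p → ∀ᶠ q in 𝓝 p, Sol f q) : TopologicalSpace (SolSpace Sol) where
  IsOpen A := ∀ f q, Sol f q → (∃ e ∈ A, e.1 = (q, f q)) → ∀ᶠ q' in 𝓝 q, ∃ e ∈ A, e.1 = (q', f q')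
  isOpen_univ := fun f q hf _ => (hopen f q hf).mono fun q' h => ⟨⟨(q', f q'), f, h, rfl⟩, trivial, rfl⟩
  isOpen_inter := by
    rintro A B hA hB f q hf ⟨e, ⟨h1, h2⟩, he⟩
    filter_upwards [hA f q hf ⟨e, h1, he⟩, hB f q hf ⟨e, h2, he⟩]
    rintro q' ⟨e1, h1, e1e⟩ ⟨e2, h2, e2e⟩
    have : e1 = e2 := Subtype.ext (e1e.trans e2e.symm)
    exact ⟨e1, ⟨h1, this ▸ h2⟩, e1e⟩
  isOpen_sUnion := by
    rintro 𝒜 h f q hf ⟨e, ⟨A, hA, heA⟩, he⟩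
    filter_upwards [h A hA f q hf ⟨e, heA, he⟩]
    rintro q' ⟨e', h', h''⟩
    exact ⟨e', ⟨A, hA, h'⟩, h''⟩

/-- Monodromy principle: on a simply connected space, a problem whose local solutions are
determined near a point by their value at this point, and extend to a fixed neighbourhood of each
point, has a global solution as soon as it has a local one. -/
theorem exists_global_solution [SimplyConnectedSpace X] [LocallyPathConnectedSpace X]
    (Sol : (X → Y) → X → Prop)
    (hopen : ∀ f p, Sol f p → ∀ᶠ q in 𝓝 p, Sol f q)
    (hcongr : ∀ f g p, Sol f p → f =ᶠ[𝓝 p] g → Sol g p)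
    (huniq : ∀ f g p, Sol f p → Sol g p → f p = g p → f =ᶠ[𝓝 p] g)
    (hext : ∀ p, ∃ U : Set X, IsOpen U ∧ p ∈ U ∧
      (∀ q ∈ U, ∀ f, Sol f q → ∃ g, g q = f q ∧ ∀ q' ∈ U, Sol g q') ∧
      (∀ f g, (∀ q ∈ U, Sol f q) → (∀ q ∈ U, Sol g q) →
        ∀ q ∈ U, f q = g q → Set.EqOn f g U))
    (hne : ∃ f p, Sol f p) : ∃ F, ∀ p, Sol F p := by
  classical
  let _ := solTopology Sol hopen
  obtain ⟨f₀, p₀, h₀⟩ := hne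
  let e₀ : SolSpace Sol := ⟨(p₀, f₀ p₀), f₀, h₀, rfl⟩
  let π : SolSpace Sol → X := fun e => e.1.1
  have : Nonempty (X → SolSpace Sol) := ⟨fun _ => e₀⟩
  have hcov : IsCoveringMap π := by
    intro p
    obtain ⟨U, hU, hpU, hU1, hU2⟩ := hext p
    by_cases hemp : IsEmpty (π ⁻¹' {p})
    · refine IsEvenlyCovered.of_preimage_eq_empty _ (hU.mem_nhds hpU) ?_
      rw [Set.eq_empty_iff_forall_notMem]
      rintro ⟨⟨q, y⟩, f, hf, hy⟩ hq
      obtain ⟨g, -, hg⟩ := hU1 q hq f hf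
      exact hemp.false ⟨⟨(p, g p), g, hg p hpU, rfl⟩, rfl⟩
    · have : Nonempty (π ⁻¹' {p}) := not_isEmpty_iff.1 hemp
      have : ∀ e : π ⁻¹' {p}, ∃ g, g p = e.1.1.2 ∧ ∀ q' ∈ U, Sol g q' := by
        rintro ⟨⟨⟨q, y⟩, f, hf, hy⟩, rfl⟩
        obtain ⟨g, hg, hg'⟩ := hU1 _ hpU f hf
        exact ⟨g, hg.trans hy, hg'⟩
      choose g hgp hg using this
      let _ : TopologicalSpace (π ⁻¹' {p}) := ⊥
      have : DiscreteTopology (π ⁻¹' {p}) := ⟨rfl⟩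
      let V : (π ⁻¹' {p}) → Set (SolSpace Sol) := fun i => {e | e.1.1 ∈ U ∧ e.1.2 = g i e.1.1}
      have ht : ∃ t : Bundle.Trivialization (π ⁻¹' {p}) π, t.baseSet = U := by
        refine ⟨IsOpen.trivializationDiscrete V U hU ?_ ?_ ?_ ?_ ?_, rfl⟩
        · intro i W hW
          constructor
          · rintro hWo f q hf ⟨e, ⟨heW, heU, hev⟩, he⟩
            rw [Set.mem_preimage] at heW
            simp only [π, he] at heW heU hev
            filter_upwards [huniq f (g i) q hf (hg i q heU) hev, hWo.mem_nhds heW, hopen f q hf]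
              with q' h1 h2 h3
            exact ⟨⟨(q', f q'), f, h3, rfl⟩, ⟨h2, hW h2, h1⟩, rfl⟩
          · intro h
            rw [isOpen_iff_mem_nhds]
            intro q hq
            have hs := hg i q (hW hq)
            filter_upwards [h (g i) q hs ⟨⟨(q, g i q), g i, hs, rfl⟩, ⟨hq, hW hq, rfl⟩, rfl⟩]
            rintro q' ⟨e, ⟨he, -⟩, he'⟩
            simpa [π, he'] using he
        · rintro i ⟨⟨q, y⟩, f⟩ ⟨-, h⟩ ⟨⟨q', y'⟩, f'⟩ ⟨-, h'⟩ (hqq : q = q')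
          apply Subtype.ext
          simp only at h h' ⊢
          rw [h, h', hqq]
        · intro i q hq
          exact ⟨⟨(q, g i q), g i, hg i q hq, rfl⟩, ⟨hq, rfl⟩, rfl⟩
        · intro i j hij
          rw [Function.onFun, Set.disjoint_left]
          rintro ⟨⟨q, y⟩, f⟩ ⟨h1, h2⟩ ⟨-, h3⟩
          simp only at h1 h2 h3
          apply hij
          have := hU2 _ _ (hg i) (hg j) q h1 (h2.symm.trans h3) hpU
          rw [hgp, hgp] at this
          exact Subtype.ext (Subtype.ext (Prod.ext (i.2.trans j.2.symm) this))
        · rintro ⟨⟨q, y⟩, f, hf, hy⟩ (hq : q ∈ U)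
          obtain ⟨k, hk, hk'⟩ := hU1 q hq f hf
          rw [Set.mem_iUnion]
          let i : π ⁻¹' {p} := ⟨⟨(p, k p), k, hk' p hpU, rfl⟩, rfl⟩
          have hgi : k p = g i p := (hgp i).symm
          exact ⟨i, hq, (hy.symm.trans hk.symm).trans (hU2 _ _ hk' (hg i) p hpU hgi hq)⟩
      obtain ⟨t, ht⟩ := ht
      exact (IsEvenlyCovered.of_trivialization (t := t) (ht ▸ hpU)).to_isEvenlyCovered_preimage
  obtain ⟨F, ⟨-, hF⟩, -⟩ := hcov.existsUnique_continuousMap_lifts (ContinuousMap.id X) p₀ e₀ rfl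
  have hF' : ∀ q, (F q).1.1 = q := fun q => congrFun hF q
  refine ⟨fun q => (F q).1.2, fun p => ?_⟩
  obtain ⟨f, hf, hfp⟩ := (F p).2
  rw [hF'] at hf hfp
  have ho : IsOpen {e : SolSpace Sol | Sol f e.1.1 ∧ e.1.2 = f e.1.1} := by
    rintro h q hh ⟨e, ⟨h1, h2⟩, he⟩
    simp only [he] at h1 h2
    filter_upwards [huniq h f q hh h1 h2, hopen f q h1, hopen h q hh] with q' a b c
    exact ⟨⟨(q', h q'), h, c, rfl⟩, ⟨b, a⟩, rfl⟩
  refine hcongr f _ p hf ?_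
  filter_upwards [F.continuous.continuousAt.preimage_mem_nhds
    (ho.mem_nhds (x := F p) ⟨by rwa [hF'], by rw [hF', hfp]⟩)] with q hq
  rw [hq.2, hF']

end Monodromy

/-! ### Adapted frames of `E(κ, τ)` parametrized by a group -/

section Models

open Complex ComplexConjugate

/-- The quadric `|a|² + κ/4 |b|² = 1` of `ℂ²`. It is a double cover of the group of direct isometries
of the simply connected surface of curvature `κ`, the matrices being `(a, -κ/4 b̄; b, ā)`. -/
def OnGroup (κ : ℝ) (a b : ℂ) : Prop := normSq a + κ / 4 * normSq b = 1

/-- The point of `ℝ⁴ = ℂ²` with complex coordinates `(z̄, w)`; the Hopf field is the multiplication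
by `-i` in these coordinates. -/
def pair (z w : ℂ) : R4 := ![z.re, -z.im, w.re, w.im]

/-- The rotation of the coordinates `pair` along the Hopf fibres. -/
def phase (κ τ s : ℝ) : ℂ := exp (-(((κ / (4 * τ) * s : ℝ) : ℂ) * I))

/-- The point of `E(κ, τ)` defined by an element `(a, b)` of the group and a height `s`. -/
def proj (κ τ : ℝ) (a b : ℂ) (s : ℝ) : R4 :=
  if 0 < κ then
    (if τ = 0 then
        ![(conj a * b).re, (conj a * b).im, (normSq a - κ / 4 * normSq b) / √κ, s]
      else pair (phase κ τ s * a) (phase κ τ s * (((√κ / 2 : ℝ) : ℂ) * b)))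
  else ![(b / a).re, (b / a).im, s, 0]

/-- The tangent vector of `E(κ, τ)` at `proj κ τ a b s` with horizontal coordinate `n` and vertical
coordinate `m` in the adapted orthonormal frame defined by `(a, b)` and `s`. -/
def frame (κ τ : ℝ) (a b : ℂ) (s : ℝ) (n : ℂ) (m : ℝ) : R4 :=
  if 0 < κ then
    (if τ = 0 then
        ![(conj a ^ 2 * n - ((κ / 4 : ℝ) : ℂ) * b ^ 2 * conj n).re,
          (conj a ^ 2 * n - ((κ / 4 : ℝ) : ℂ) * b ^ 2 * conj n).im,
          -√κ * (conj a * conj b * n).re, m]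
      else pair
          (phase κ τ s * (-((κ / 4 : ℝ) : ℂ) * conj b * n - I * ((κ / (4 * τ) * m : ℝ) : ℂ) * a))
          (phase κ τ s * (((√κ / 2 : ℝ) : ℂ)
            * (conj a * n - I * ((κ / (4 * τ) * m : ℝ) : ℂ) * b))))
  else ![(n / a ^ 2).re, (n / a ^ 2).im, m + τ * (conj b * n / a).im, 0]

/-- First component of the derivative of an element of the group, in terms of its Maurer-Cartan
form `(iβ, -κ/4 φ̄; φ, -iβ)`. -/
def mcA (κ : ℝ) (a b φ : ℂ) (β : ℝ) : ℂ := I * β * a - ((κ / 4 : ℝ) : ℂ) * φ * conj b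

/-- Second component of the derivative of an element of the group. -/
def mcB (a b φ : ℂ) (β : ℝ) : ℂ := I * β * b + φ * conj a

/-- Derivative of the height when the vertical component of the derivative of `proj` is `η`. -/
def mcS (κ τ : ℝ) (a b φ : ℂ) (η β : ℝ) : ℝ :=
  η + if 0 < κ then 4 * τ / κ * β else τ * (conj b * φ / a).im

variable {κ τ : ℝ} {a b : ℂ} {s : ℝ}

theorem OnGroup.ne_zero (h : OnGroup κ a b) (hκ : ¬0 < κ) : a ≠ 0 := by
  rintro rfl
  have := normSq_nonneg b
  simp only [OnGroup, map_zero] at h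
  nlinarith

/-- Half of the square root of the curvature, as a variable for polynomial identities. -/
theorem exists_half_sqrt (hκ : 0 ≤ κ) : ∃ k : ℝ, √κ / 2 = k ∧ κ / 4 = k ^ 2 :=
  ⟨√κ / 2, rfl, by rw [div_pow, Real.sq_sqrt hκ]; norm_num⟩

theorem proj_product (hκ : 0 < κ) (a b : ℂ) (s : ℝ) : proj κ 0 a b s =
    ![(conj a * b).re, (conj a * b).im, (normSq a - κ / 4 * normSq b) / √κ, s] := by
  simp [proj, hκ]

theorem proj_sphere (hκ : 0 < κ) (hτ : τ ≠ 0) (a b : ℂ) (s : ℝ) : proj κ τ a b s =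
    pair (phase κ τ s * a) (phase κ τ s * (((√κ / 2 : ℝ) : ℂ) * b)) := by
  simp [proj, hκ, hτ]

theorem proj_nonpos (hκ : ¬0 < κ) (τ : ℝ) (a b : ℂ) (s : ℝ) : proj κ τ a b s =
    ![(b / a).re, (b / a).im, s, 0] := by
  simp [proj, hκ]

theorem frame_product (hκ : 0 < κ) (a b : ℂ) (s : ℝ) (n : ℂ) (m : ℝ) : frame κ 0 a b s n m =
    ![(conj a ^ 2 * n - ((κ / 4 : ℝ) : ℂ) * b ^ 2 * conj n).re,
      (conj a ^ 2 * n - ((κ / 4 : ℝ) : ℂ) * b ^ 2 * conj n).im,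
      -√κ * (conj a * conj b * n).re, m] := by
  simp only [frame, hκ, if_true]

theorem frame_sphere (hκ : 0 < κ) (hτ : τ ≠ 0) (a b : ℂ) (s : ℝ) (n : ℂ) (m : ℝ) :
    frame κ τ a b s n m = pair
      (phase κ τ s * (-((κ / 4 : ℝ) : ℂ) * conj b * n - I * ((κ / (4 * τ) * m : ℝ) : ℂ) * a))
      (phase κ τ s * (((√κ / 2 : ℝ) : ℂ) * (conj a * n - I * ((κ / (4 * τ) * m : ℝ) : ℂ) * b))) := by
  simp only [frame, hκ, hτ, if_true, if_false]

theorem frame_nonpos (hκ : ¬0 < κ) (τ : ℝ) (a b : ℂ) (s : ℝ) (n : ℂ) (m : ℝ) :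
    frame κ τ a b s n m = ![(n / a ^ 2).re, (n / a ^ 2).im, m + τ * (conj b * n / a).im, 0] := by
  simp only [frame, hκ, if_false]

theorem normSq_phase (κ τ s : ℝ) : normSq (phase κ τ s) = 1 := by
  rw [normSq_eq_norm_sq, phase, ← neg_mul, ← ofReal_neg, norm_exp_ofReal_mul_I, one_pow]

theorem dot_pair (z w z' w' : ℂ) :
    dot (pair z w) (pair z' w') = (z * conj z').re + (w * conj w').re := by
  simp [dot, pair, Fin.sum_univ_four]; ring

theorem hopf_pair (z w : ℂ) : hopf (pair z w) = pair (-I * z) (-I * w) := by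
  funext i; fin_cases i <;> simp [hopf, pair]

theorem frame_add (κ τ : ℝ) (a b : ℂ) (s : ℝ) (n n' : ℂ) (m m' : ℝ) :
    frame κ τ a b s (n + n') (m + m') = frame κ τ a b s n m + frame κ τ a b s n' m' := by
  have h1 : (n + n') / a ^ 2 = n / a ^ 2 + n' / a ^ 2 := by ring
  have h2 : conj b * (n + n') / a = conj b * n / a + conj b * n' / a := by ring
  unfold frame pair
  split_ifs <;> (funext i; fin_cases i) <;> simp [h1, h2] <;> ring

theorem frame_smul (κ τ : ℝ) (a b : ℂ) (s c : ℝ) (n : ℂ) (m : ℝ) :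
    frame κ τ a b s (c * n) (c * m) = c • frame κ τ a b s n m := by
  unfold frame pair
  have h1 : (c : ℂ) * n / a ^ 2 = c * (n / a ^ 2) := by ring
  have h2 : conj b * (c * n) / a = c * (conj b * n / a) := by ring
  split_ifs <;> (funext i; fin_cases i) <;> simp [h1, h2] <;> ring

/-- `frame` as a linear map of its coordinates. -/
def frameL (κ τ : ℝ) (a b : ℂ) (s : ℝ) : ℂ × ℝ →ₗ[ℝ] R4 where
  toFun v := frame κ τ a b s v.1 v.2
  map_add' v w := frame_add κ τ a b s v.1 w.1 v.2 w.2
  map_smul' c v := by simpa using frame_smul κ τ a b s c v.1 v.2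

/-! ### The metric and the tangent spaces in the adapted frames -/

theorem dot_hopf_frame (hκ : 0 < κ) (hτ : τ ≠ 0) (h : OnGroup κ a b) (n : ℂ) (m : ℝ) :
    dot (hopf (proj κ τ a b s)) (frame κ τ a b s n m) = κ / (4 * τ) * m := by
  have hu := normSq_phase κ τ s
  obtain ⟨k, hk, hk4⟩ := exists_half_sqrt hκ.le
  rw [proj_sphere hκ hτ, frame_sphere hκ hτ, hopf_pair, dot_pair]
  generalize phase κ τ s = u at hu
  generalize κ / (4 * τ) * m = c
  simp only [OnGroup, normSq_apply, hk4] at h hu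
  simp only [hk, hk4, map_mul, map_sub, map_add, map_neg, map_pow, conj_I, conj_ofReal, Complex.conj_conj,
    mul_re, mul_im, sub_re, sub_im, add_re, add_im, neg_re, neg_im, I_re, I_im, ofReal_re, ofReal_im,
    conj_re, conj_im, pow_two, one_re, one_im, zero_re, zero_im]
  linear_combination (c * (a.re * a.re + a.im * a.im + k ^ 2 * (b.re * b.re + b.im * b.im))) * hu
    + c * h

theorem dot_frame_frame (hκ : 0 < κ) (hτ : τ ≠ 0) (h : OnGroup κ a b) (n n' : ℂ) (m m' : ℝ) :
    dot (frame κ τ a b s n m) (frame κ τ a b s n' m')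
      = κ / 4 * (n * conj n').re + (κ / (4 * τ) * m) * (κ / (4 * τ) * m') := by
  have hu := normSq_phase κ τ s
  obtain ⟨k, hk, hk4⟩ := exists_half_sqrt hκ.le
  rw [frame_sphere hκ hτ, frame_sphere hκ hτ, dot_pair]
  generalize phase κ τ s = u at hu
  generalize κ / (4 * τ) * m = c
  generalize κ / (4 * τ) * m' = c'
  simp only [OnGroup, normSq_apply, hk4] at h hu
  simp only [hk, hk4, map_mul, map_sub, map_add, map_neg, map_pow, conj_I, conj_ofReal, Complex.conj_conj,
    mul_re, mul_im, sub_re, sub_im, add_re, add_im, neg_re, neg_im, I_re, I_im, ofReal_re, ofReal_im,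
    conj_re, conj_im, pow_two, one_re, one_im, zero_re, zero_im]
  linear_combination ((a.re * a.re + a.im * a.im + k ^ 2 * (b.re * b.re + b.im * b.im)) *
      (k ^ 2 * (n.re * n'.re + n.im * n'.im) + c * c')) * hu
    + (k ^ 2 * (n.re * n'.re + n.im * n'.im) + c * c') * h

theorem dot_proj_frame (hκ : 0 < κ) (hτ : τ ≠ 0) (n : ℂ) (m : ℝ) :
    dot (proj κ τ a b s) (frame κ τ a b s n m) = 0 := by
  obtain ⟨k, hk, hk4⟩ := exists_half_sqrt hκ.le
  rw [proj_sphere hκ hτ, frame_sphere hκ hτ, dot_pair]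
  generalize phase κ τ s = u
  generalize κ / (4 * τ) * m = c
  simp only [hk, hk4, map_mul, map_sub, map_add, map_neg, map_pow, conj_I, conj_ofReal, Complex.conj_conj,
    mul_re, mul_im, sub_re, sub_im, add_re, add_im, neg_re, neg_im, I_re, I_im, ofReal_re, ofReal_im,
    conj_re, conj_im, pow_two, one_re, one_im, zero_re, zero_im]
  ring

theorem dot_hopf_frame_frame (hκ : 0 < κ) (hτ : τ ≠ 0) (h : OnGroup κ a b) (n n' : ℂ) (m m' : ℝ) :
    dot (hopf (frame κ τ a b s n m)) (frame κ τ a b s n' m') = κ / 4 * (n * conj n').im := by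
  have hu := normSq_phase κ τ s
  obtain ⟨k, hk, hk4⟩ := exists_half_sqrt hκ.le
  rw [frame_sphere hκ hτ, frame_sphere hκ hτ, hopf_pair, dot_pair]
  generalize phase κ τ s = u at hu
  generalize κ / (4 * τ) * m = c
  generalize κ / (4 * τ) * m' = c'
  simp only [OnGroup, normSq_apply, hk4] at h hu
  simp only [hk, hk4, map_mul, map_sub, map_add, map_neg, map_pow, conj_I, conj_ofReal, Complex.conj_conj,
    mul_re, mul_im, sub_re, sub_im, add_re, add_im, neg_re, neg_im, I_re, I_im, ofReal_re, ofReal_im,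
    conj_re, conj_im, pow_two, one_re, one_im, zero_re, zero_im]
  linear_combination ((a.re * a.re + a.im * a.im + k ^ 2 * (b.re * b.re + b.im * b.im)) *
      (k ^ 2 * (n.im * n'.re - n.re * n'.im))) * hu
    + (k ^ 2 * (n.im * n'.re - n.re * n'.im)) * h

theorem normSq_smul_conj_div (ha : a ≠ 0) (x : ℂ) :
    (normSq a : ℂ) * (conj (b / a) * (x / a ^ 2)) = conj b * x / a := by
  have := (map_ne_zero (starRingEnd ℂ)).2 ha
  rw [← mul_conj, map_div₀]
  field_simp

theorem normSq_sq_smul_div (ha : a ≠ 0) (x y : ℂ) :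
    ((normSq a ^ 2 : ℝ) : ℂ) * (x / a ^ 2 * conj (y / a ^ 2)) = x * conj y := by
  have := (map_ne_zero (starRingEnd ℂ)).2 ha
  rw [ofReal_pow, ← mul_conj, map_div₀, map_pow]
  field_simp

theorem lam_proj (hκ : ¬0 < κ) (h : OnGroup κ a b) : lam κ (proj κ τ a b s) = normSq a := by
  have ha := h.ne_zero hκ
  have ha' : normSq a ≠ 0 := (normSq_pos.2 ha).ne'
  have hw : (b / a).re ^ 2 + (b / a).im ^ 2 = normSq b / normSq a := by
    rw [← normSq_div, normSq_apply]; ring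
  have : lam κ (proj κ τ a b s) = 1 / (1 + κ / 4 * ((b / a).re ^ 2 + (b / a).im ^ 2)) := by
    simp [lam, proj_nonpos hκ]
  rw [this, hw, one_div, inv_eq_iff_eq_inv]
  unfold OnGroup at h
  field_simp
  linear_combination 4 * h

theorem vertical_sphere (hκ : 0 < κ) (hτ : τ ≠ 0) (p : R4) :
    vertical κ τ p = (κ / (4 * τ)) • hopf p := by
  simp [vertical, hκ, hτ]

theorem frame_vertical (κ τ : ℝ) (a b : ℂ) (s : ℝ) :
    frame κ τ a b s 0 1 = vertical κ τ (proj κ τ a b s) := by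
  by_cases hκ : 0 < κ
  · by_cases hτ : τ = 0
    · subst hτ
      rw [frame_product hκ]
      funext i; fin_cases i <;> simp [vertical, hκ]
    · rw [frame_sphere hκ hτ, vertical_sphere hκ hτ, proj_sphere hκ hτ, hopf_pair]
      generalize κ / (4 * τ) = c
      funext i; fin_cases i <;> simp [pair] <;> ring
  · rw [frame_nonpos hκ]
    funext i; fin_cases i <;> simp [vertical, hκ]

/-- The adapted frame is orthonormal. -/
theorem metric_frame (h : OnGroup κ a b) (s : ℝ) (n n' : ℂ) (m m' : ℝ) :
    metric κ τ (proj κ τ a b s) (frame κ τ a b s n m) (frame κ τ a b s n' m')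
      = (n * conj n').re + m * m' := by
  by_cases hκ : 0 < κ
  · by_cases hτ : τ = 0
    · subst hτ
      simp only [metric, hκ, if_true, frame_product hκ, dot, Fin.sum_univ_four]
      obtain ⟨k, hk, hk4⟩ := exists_half_sqrt hκ.le
      have hk2 : √κ = 2 * k := by linarith
      simp only [OnGroup, normSq_apply, hk4] at h
      simp only [hk2, hk4, Matrix.cons_val, map_mul, map_sub, map_add, map_neg, map_pow, conj_I, conj_ofReal, Complex.conj_conj,
    mul_re, mul_im, sub_re, sub_im, add_re, add_im, neg_re, neg_im, I_re, I_im, ofReal_re, ofReal_im,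
    conj_re, conj_im, pow_two, one_re, one_im, zero_re, zero_im]
      linear_combination (a.re * a.re + a.im * a.im + k ^ 2 * (b.re * b.re + b.im * b.im) + 1)
        * (n.re * n'.re + n.im * n'.im) * h
    · simp only [metric, hκ, hτ, if_true, if_false]
      rw [dot_hopf_frame hκ hτ h, dot_hopf_frame hκ hτ h, dot_frame_frame hκ hτ h]
      field_simp
      ring
  · have ha := h.ne_zero hκ
    have hl := lam_proj (τ := τ) (s := s) hκ h
    simp only [metric, hκ, if_false, hl]
    have h1 : ∀ x : ℂ, normSq a * (conj (b / a) * (x / a ^ 2)).im = (conj b * x / a).im := by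
      intro x
      rw [← im_ofReal_mul, normSq_smul_conj_div ha]
    have h2 : normSq a ^ 2 * ((n / a ^ 2) * conj (n' / a ^ 2)).re = (n * conj n').re := by
      rw [← re_ofReal_mul, normSq_sq_smul_div ha]
    have h3 := h1 n
    have h4 := h1 n'
    simp only [frame_nonpos hκ, proj_nonpos hκ]
    simp only [Matrix.cons_val]
    rw [← h3, ← h4, ← h2]
    simp only [map_mul, map_sub, map_add, map_neg, map_pow, conj_I, conj_ofReal, Complex.conj_conj,
    mul_re, mul_im, sub_re, sub_im, add_re, add_im, neg_re, neg_im, I_re, I_im, ofReal_re, ofReal_im,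
    conj_re, conj_im, pow_two, one_re, one_im, zero_re, zero_im]
    ring

theorem proj_mem (h : OnGroup κ a b) (τ s : ℝ) : proj κ τ a b s ∈ carrier κ τ := by
  by_cases hκ : 0 < κ
  · by_cases hτ : τ = 0
    · subst hτ
      rw [proj_product hκ]
      obtain ⟨k, hk, hk4⟩ := exists_half_sqrt hκ.le
      have hk2 : √κ = 2 * k := by linarith
      have hk3 : κ = 4 * k ^ 2 := by linarith
      have hk0 : k ≠ 0 := by rintro rfl; simp [hk3] at hκ
      simp only [OnGroup, normSq_apply, hk4] at h
      simp only [carrier, hκ, if_true, Set.mem_ofPred_eq, Matrix.cons_val, hk2, hk4, normSq_apply,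
        map_mul, map_sub, map_add, map_neg, map_pow, conj_I, conj_ofReal, Complex.conj_conj,
    mul_re, mul_im, sub_re, sub_im, add_re, add_im, neg_re, neg_im, I_re, I_im, ofReal_re, ofReal_im,
    conj_re, conj_im, pow_two, one_re, one_im, zero_re, zero_im]
      rw [hk3]
      field_simp
      linear_combination (a.re * a.re + a.im * a.im + k ^ 2 * (b.re * b.re + b.im * b.im) + 1) * 4 * h
    · have hu := normSq_phase κ τ s
      obtain ⟨k, hk, hk4⟩ := exists_half_sqrt hκ.le
      simp only [OnGroup, normSq_apply, hk4] at h hu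
      simp only [carrier, hκ, hτ, if_true, if_false, Set.mem_ofPred_eq, proj_sphere, pair, ne_eq,
        not_false_eq_true, Matrix.cons_val, hk, map_mul, map_sub, map_add, map_neg, map_pow, conj_I, conj_ofReal, Complex.conj_conj,
    mul_re, mul_im, sub_re, sub_im, add_re, add_im, neg_re, neg_im, I_re, I_im, ofReal_re, ofReal_im,
    conj_re, conj_im, pow_two, one_re, one_im, zero_re, zero_im]
      generalize phase κ τ s = u at hu
      linear_combination (a.re * a.re + a.im * a.im + k ^ 2 * (b.re * b.re + b.im * b.im)) * hu + h
  · have hl := lam_proj (τ := τ) (s := s) hκ h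
    have ha := normSq_pos.2 (h.ne_zero hκ)
    simp only [carrier, hκ, if_false, Set.mem_ofPred_eq]
    refine ⟨?_, by simp [proj_nonpos hκ]⟩
    rw [lam] at hl
    exact one_div_pos.1 (hl ▸ ha)

theorem conormal_sphere (hκ : 0 < κ) (hτ : τ ≠ 0) (p : R4) : conormal κ τ p = τ • p := by
  simp [conormal, hκ, hτ]

theorem frame_mem_tangent (κ τ : ℝ) (a b : ℂ) (s : ℝ) (n : ℂ) (m : ℝ) :
    frame κ τ a b s n m ∈ tangent κ τ (proj κ τ a b s) := by
  rw [tangent, Set.mem_ofPred_eq]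
  by_cases hκ : 0 < κ
  · by_cases hτ : τ = 0
    · subst hτ
      obtain ⟨k, hk, hk4⟩ := exists_half_sqrt hκ.le
      have hk2 : √κ = 2 * k := by linarith
      have hk0 : k ≠ 0 := by rintro rfl; simp [hκ.ne', Real.sqrt_eq_zero', hκ.not_ge] at hk2
      rw [proj_product hκ, frame_product hκ]
      simp only [conormal, hκ, if_true, dot, Fin.sum_univ_four, Matrix.cons_val, hk2, hk4,
        normSq_apply, map_mul, map_sub, map_add, map_neg, map_pow, conj_I, conj_ofReal, Complex.conj_conj,
    mul_re, mul_im, sub_re, sub_im, add_re, add_im, neg_re, neg_im, I_re, I_im, ofReal_re, ofReal_im,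
    conj_re, conj_im, pow_two, one_re, one_im, zero_re, zero_im]
      field_simp
      ring
    · have := dot_proj_frame (a := a) (b := b) (s := s) hκ hτ n m
      rw [conormal_sphere hκ hτ]
      simp only [dot, Pi.smul_apply, smul_eq_mul, mul_assoc, ← Finset.mul_sum] at this ⊢
      rw [this, mul_zero]
  · rw [frame_nonpos hκ]
    simp [conormal, hκ, dot, Fin.sum_univ_four]

end Models

section ModelsTangent

open Complex ComplexConjugate

variable {κ τ : ℝ} {a b : ℂ} {s : ℝ}

theorem conormal_ne_zero (h : OnGroup κ a b) (s : ℝ) : conormal κ τ (proj κ τ a b s) ≠ 0 := by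
  have hm := proj_mem h τ s
  intro h0
  simp only [carrier, conormal, Set.mem_ofPred_eq] at hm h0
  split_ifs at hm h0 with hκ hτ
  · have e0 := congrFun h0 0
    have e1 := congrFun h0 1
    have e2 := congrFun h0 2
    simp only [Matrix.cons_val, Pi.zero_apply] at e0 e1 e2
    rw [e0, e1, e2] at hm
    have := one_div_pos.2 hκ
    norm_num at hm
    exact hκ.ne hm
  · rw [smul_eq_zero, or_iff_right hτ] at h0
    rw [h0] at hm
    simp at hm
  · simpa using congrFun h0 3

theorem frameL_injective (h : OnGroup κ a b) (s : ℝ) :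
    Function.Injective (frameL κ τ a b s) := by
  rw [← LinearMap.ker_eq_bot, LinearMap.ker_eq_bot']
  rintro ⟨n, m⟩ h0
  have h0' : frame κ τ a b s n m = 0 := h0
  have h00 : frame κ τ a b s 0 0 = 0 := (frameL κ τ a b s).map_zero
  have e := metric_frame (τ := τ) h s n n m m
  rw [h0'] at e
  have e' := metric_frame (τ := τ) h s 0 0 0 0
  rw [h00] at e'
  rw [e'] at e
  simp only [zero_mul, zero_re, add_zero, mul_conj, ofReal_re] at e
  have h1 := normSq_nonneg n
  have h2 := mul_self_nonneg m
  have h3 : normSq n = 0 := by linarith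
  have h4 : m * m = 0 := by linarith
  simp [normSq_eq_zero.1 h3, mul_self_eq_zero.1 h4]

/-- The covectors `u ↦ dot v u` as linear maps. -/
def dotL (v : R4) : R4 →ₗ[ℝ] ℝ where
  toFun u := dot v u
  map_add' u u' := by simp [dot, mul_add, Finset.sum_add_distrib]
  map_smul' c u := by
    simp only [dot, Pi.smul_apply, smul_eq_mul, RingHom.id_apply, Finset.mul_sum]
    exact Finset.sum_congr rfl fun i _ => by ring

/-- The adapted frame spans the tangent space. -/
theorem exists_frame_eq (h : OnGroup κ a b) {u : R4} (hu : u ∈ tangent κ τ (proj κ τ a b s)) :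
    ∃ n m, frame κ τ a b s n m = u := by
  set c := conormal κ τ (proj κ τ a b s) with hc
  have hle : (frameL κ τ a b s).range ≤ (dotL c).ker := by
    rintro _ ⟨v, rfl⟩
    exact frame_mem_tangent κ τ a b s v.1 v.2
  have h1 : Module.finrank ℝ (frameL κ τ a b s).range = 3 := by
    rw [LinearMap.finrank_range_of_inj (frameL_injective h s)]
    simp [Complex.finrank_real_complex]
  have hne : dotL c ≠ 0 := by
    intro h0
    apply conormal_ne_zero (τ := τ) h s
    have : dot c c = 0 := congrArg (fun f : R4 →ₗ[ℝ] ℝ => f c) h0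
    rw [dot, Finset.sum_eq_zero_iff_of_nonneg fun i _ => mul_self_nonneg _] at this
    exact funext fun i => mul_self_eq_zero.1 (this i (Finset.mem_univ i))
  have h2 : Module.finrank ℝ (dotL c).ker = 3 := by
    have h3 := (dotL c).finrank_range_add_finrank_ker
    rw [LinearMap.range_eq_top.2 (LinearMap.surjective_iff_ne_zero.2 hne), finrank_top] at h3
    simp at h3
    omega
  have heq := Submodule.eq_of_le_of_finrank_eq hle (h1.trans h2.symm)
  have hu' : u ∈ (dotL c).ker := hu
  rw [← heq] at hu'
  obtain ⟨v, hv⟩ := hu'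
  exact ⟨v.1, v.2, hv⟩

/-- The height which compensates, along the Hopf fibres, the multiplication of `(a, b)` by
`e^{iγ}`. -/
def gaugeS (κ τ s γ : ℝ) : ℝ := s + if 0 < κ then 4 * τ / κ * γ else 0

theorem phase_gaugeS (hκ : 0 < κ) (hτ : τ ≠ 0) (s γ : ℝ) :
    phase κ τ (gaugeS κ τ s γ) = phase κ τ s * exp (-(γ * I)) := by
  rw [phase, phase, ← exp_add, gaugeS, if_pos hκ]
  congr 1
  push_cast
  have h1 : (κ : ℂ) ≠ 0 := ofReal_ne_zero.2 hκ.ne'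
  have h2 : (τ : ℂ) ≠ 0 := ofReal_ne_zero.2 hτ
  field_simp
  ring

theorem OnGroup.gauge (h : OnGroup κ a b) (γ : ℝ) :
    OnGroup κ (exp (γ * I) * a) (exp (γ * I) * b) := by
  have : normSq (exp (γ * I)) = 1 := by rw [normSq_eq_norm_sq, norm_exp_ofReal_mul_I, one_pow]
  simpa [OnGroup, this] using h

theorem conj_exp_mul_I (γ : ℝ) : conj (exp (γ * I)) = exp (-(γ * I)) := by
  rw [← exp_conj]; simp

/-- The projection is invariant under the rotation of the adapted frame. -/
theorem proj_gauge (κ τ : ℝ) (a b : ℂ) (s γ : ℝ) :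
    proj κ τ (exp (γ * I) * a) (exp (γ * I) * b) (gaugeS κ τ s γ) = proj κ τ a b s := by
  have he : exp (-(γ * I)) * exp (γ * I) = 1 := by rw [← exp_add]; simp
  by_cases hκ : 0 < κ
  · by_cases hτ : τ = 0
    · subst hτ
      have : normSq (exp (γ * I)) = 1 := by rw [normSq_eq_norm_sq, norm_exp_ofReal_mul_I, one_pow]
      rw [proj_product hκ, proj_product hκ, map_mul, map_mul, map_mul, conj_exp_mul_I, this,
        show exp (-(γ * I)) * conj a * (exp (γ * I) * b) = conj a * b by
          linear_combination (conj a * b) * he]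
      simp [gaugeS]
    · rw [proj_sphere hκ hτ, proj_sphere hκ hτ, phase_gaugeS hκ hτ]
      congr 1
      · linear_combination phase κ τ s * a * he
      · linear_combination phase κ τ s * ((√κ / 2 : ℝ) : ℂ) * b * he
  · rw [proj_nonpos hκ, proj_nonpos hκ, mul_div_mul_left _ _ (exp_ne_zero _)]
    simp [gaugeS, hκ]

/-- The multiplication of `(a, b)` by `e^{iγ}` rotates the horizontal part of the frame by `2γ`. -/
theorem frame_gauge (κ τ : ℝ) (a b : ℂ) (s γ : ℝ) (n : ℂ) (m : ℝ) :
    frame κ τ (exp (γ * I) * a) (exp (γ * I) * b) (gaugeS κ τ s γ) n m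
      = frame κ τ a b s (exp (-(γ * I)) ^ 2 * n) m := by
  have he : exp (-(γ * I)) * exp (γ * I) = 1 := by rw [← exp_add]; simp
  have hne := exp_ne_zero (γ * I)
  have he' : exp (-(γ * I)) = (exp (γ * I))⁻¹ := exp_neg _
  have hc : conj (exp (-(γ * I))) = exp (γ * I) := by
    rw [← conj_exp_mul_I, Complex.conj_conj]
  by_cases hκ : 0 < κ
  · by_cases hτ : τ = 0
    · subst hτ
      rw [frame_product hκ, frame_product hκ]
      simp only [map_mul, map_pow, conj_exp_mul_I, hc]
      have e1 : (exp (-(γ * I)) * conj a) ^ 2 * n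
            - ((κ / 4 : ℝ) : ℂ) * (exp (γ * I) * b) ^ 2 * conj n
          = conj a ^ 2 * (exp (-(γ * I)) ^ 2 * n)
            - ((κ / 4 : ℝ) : ℂ) * b ^ 2 * (exp (γ * I) ^ 2 * conj n) := by ring
      have e2 : exp (-(γ * I)) * conj a * (exp (-(γ * I)) * conj b) * n
          = conj a * conj b * (exp (-(γ * I)) ^ 2 * n) := by ring
      rw [e1, e2]
    · rw [frame_sphere hκ hτ, frame_sphere hκ hτ, phase_gaugeS hκ hτ]
      simp only [map_mul, conj_exp_mul_I]
      congr 1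
      · linear_combination (- phase κ τ s * I * ((κ / (4 * τ) * m : ℝ) : ℂ) * a) * he
      · linear_combination (- phase κ τ s * ((√κ / 2 : ℝ) : ℂ) * I
          * ((κ / (4 * τ) * m : ℝ) : ℂ) * b) * he
  · rw [frame_nonpos hκ, frame_nonpos hκ]
    have e1 : n / (exp (γ * I) * a) ^ 2 = exp (-(γ * I)) ^ 2 * n / a ^ 2 := by
      rw [he', mul_pow, div_eq_mul_inv, mul_inv]; ring
    have e2 : conj (exp (γ * I) * b) * n / (exp (γ * I) * a)
        = conj b * (exp (-(γ * I)) ^ 2 * n) / a := by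
      rw [map_mul, conj_exp_mul_I, he', div_eq_mul_inv, mul_inv]; ring
    rw [e1, e2]

/-- The determinant of three vectors of `ℂ × ℝ`, identified with the oriented space `ℝ³`. -/
def det3 (n₁ : ℂ) (m₁ : ℝ) (n₂ : ℂ) (m₂ : ℝ) (n₃ : ℂ) (m₃ : ℝ) : ℝ :=
  m₁ * (conj n₂ * n₃).im + m₂ * (conj n₃ * n₁).im + m₃ * (conj n₁ * n₂).im

theorem frame_eq_sum (κ τ : ℝ) (a b : ℂ) (s : ℝ) (n : ℂ) (m : ℝ) :
    frame κ τ a b s n m = n.re • frame κ τ a b s 1 0 + n.im • frame κ τ a b s I 0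
      + m • frame κ τ a b s 0 1 := by
  rw [← frame_smul, ← frame_smul, ← frame_smul, ← frame_add, ← frame_add]
  simp [re_add_im]

/-- The orientation form in an adapted frame; it reduces `isDirect_frame` to the sign on one basis. -/
theorem det_conormal_frame (c : R4) (κ τ : ℝ) (a b : ℂ) (s : ℝ) (n₁ : ℂ) (m₁ : ℝ) (n₂ : ℂ) (m₂ : ℝ)
    (n₃ : ℂ) (m₃ : ℝ) : Matrix.det (Matrix.of ![c, frame κ τ a b s n₁ m₁,
      frame κ τ a b s n₂ m₂, frame κ τ a b s n₃ m₃]) = det3 n₁ m₁ n₂ m₂ n₃ m₃ *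
        Matrix.det (Matrix.of ![c, frame κ τ a b s 1 0, frame κ τ a b s I 0,
          frame κ τ a b s 0 1]) := by
  have hmul : Matrix.of ![c, frame κ τ a b s n₁ m₁, frame κ τ a b s n₂ m₂, frame κ τ a b s n₃ m₃]
      = !![1, 0, 0, 0; 0, n₁.re, n₁.im, m₁; 0, n₂.re, n₂.im, m₂; 0, n₃.re, n₃.im, m₃] *
        Matrix.of ![c, frame κ τ a b s 1 0, frame κ τ a b s I 0, frame κ τ a b s 0 1] := by
    rw [frame_eq_sum κ τ a b s n₁, frame_eq_sum κ τ a b s n₂, frame_eq_sum κ τ a b s n₃]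
    ext i j
    fin_cases i <;> simp [Matrix.mul_apply, Fin.sum_univ_four]
  have hdet : Matrix.det !![1, 0, 0, 0; 0, n₁.re, n₁.im, m₁; 0, n₂.re, n₂.im, m₂;
      0, n₃.re, n₃.im, m₃] = det3 n₁ m₁ n₂ m₂ n₃ m₃ := by
    simp [Matrix.det_succ_row_zero, Fin.sum_univ_succ, Fin.succAbove, det3]
    ring
  rw [hmul, Matrix.det_mul, hdet]

theorem det_conormal_frame_pos_of_nonpos (h : OnGroup κ a b) (s : ℝ) (hκ : ¬0 < κ) :
    0 < Matrix.det (Matrix.of ![conormal κ τ (proj κ τ a b s), frame κ τ a b s 1 0,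
      frame κ τ a b s I 0, frame κ τ a b s 0 1]) := by
  have ha := h.ne_zero hκ
  have : Matrix.det (Matrix.of ![conormal κ τ (proj κ τ a b s), frame κ τ a b s 1 0,
        frame κ τ a b s I 0, frame κ τ a b s 0 1]) = normSq (1 / a ^ 2) := by
    have e1 : I / a ^ 2 = I * (1 / a ^ 2) := by ring
    simp only [frame_nonpos hκ, conormal, hκ, if_false, e1]
    generalize 1 / a ^ 2 = c
    simp only [Matrix.det_succ_row_zero, Fin.sum_univ_succ, Matrix.of_apply,
        Matrix.submatrix_apply, Matrix.det_fin_zero, Fin.succAbove, normSq_apply]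
    simp only [Matrix.cons_val, map_mul, map_sub, map_add, map_neg, map_pow, conj_I, conj_ofReal, Complex.conj_conj,
    mul_re, mul_im, sub_re, sub_im, add_re, add_im, neg_re, neg_im, I_re, I_im, ofReal_re, ofReal_im,
    conj_re, conj_im, pow_two, one_re, one_im, zero_re, zero_im]
    simp
    ring
  rw [this]
  exact normSq_pos.2 (one_div_ne_zero (pow_ne_zero 2 ha))

theorem det_conormal_frame_pos (h : OnGroup κ a b) (s : ℝ) :
    0 < Matrix.det (Matrix.of ![conormal κ τ (proj κ τ a b s), frame κ τ a b s 1 0,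
      frame κ τ a b s I 0, frame κ τ a b s 0 1]) := by
  by_cases hκ : 0 < κ
  · obtain ⟨k, hk, hk4⟩ := exists_half_sqrt hκ.le
    have hk2 : √κ = 2 * k := by linarith
    have hk0 : 0 < k := by rw [← hk]; positivity
    have h0 := h
    simp only [OnGroup, normSq_apply, hk4] at h
    by_cases hτ : τ = 0
    · subst hτ
      have : Matrix.det (Matrix.of ![conormal κ 0 (proj κ 0 a b s), frame κ 0 a b s 1 0,
          frame κ 0 a b s I 0, frame κ 0 a b s 0 1])
          = (a.re * a.re + a.im * a.im + k ^ 2 * (b.re * b.re + b.im * b.im)) ^ 3 / (2 * k) := by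
        simp only [proj_product hκ, frame_product hκ, conormal, hκ, if_true]
        simp only [Matrix.det_succ_row_zero, Fin.sum_univ_succ, Matrix.of_apply,
          Matrix.submatrix_apply, Matrix.det_fin_zero, Fin.succAbove, hk2, hk4, normSq_apply]
        simp only [Matrix.cons_val, map_mul, map_sub, map_add, map_neg, map_pow, conj_I, conj_ofReal, Complex.conj_conj,
    mul_re, mul_im, sub_re, sub_im, add_re, add_im, neg_re, neg_im, I_re, I_im, ofReal_re, ofReal_im,
    conj_re, conj_im, pow_two, one_re, one_im, zero_re, zero_im]
        simp
        field_simp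
        ring
      rw [this, h]
      positivity
    · -- the gauge with `s = 0`, in which the phase disappears
      set γ : ℝ := -(κ / (4 * τ) * s) with hγ
      have hs : gaugeS κ τ s γ = 0 := by
        rw [gaugeS, if_pos hκ, hγ]; field_simp; ring
      have hp := proj_gauge κ τ a b s γ
      have hf := fun n m => frame_gauge κ τ a b s γ (exp (γ * I) ^ 2 * n) m
      have he : ∀ n, exp (-(γ * I)) ^ 2 * (exp (γ * I) ^ 2 * n) = n := by
        intro n
        rw [← mul_assoc, ← mul_pow, ← exp_add]; simp
      simp only [he, hs] at hf hp
      have h' := h0.gauge γ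
      rw [← hp, ← hf, ← hf, ← hf, det_conormal_frame]
      generalize exp (γ * I) * a = a' at *
      generalize exp (γ * I) * b = b' at *
      simp only [OnGroup, normSq_apply, hk4] at h'
      have hphase : phase κ τ 0 = 1 := by simp [phase]
      have : Matrix.det (Matrix.of ![conormal κ τ (proj κ τ a' b' 0), frame κ τ a' b' 0 1 0,
          frame κ τ a' b' 0 I 0, frame κ τ a' b' 0 0 1])
          = τ * (κ / (4 * τ)) * k ^ 2 * (a'.re * a'.re + a'.im * a'.im +
            k ^ 2 * (b'.re * b'.re + b'.im * b'.im)) ^ 2 := by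
        simp only [conormal_sphere hκ hτ, proj_sphere hκ hτ, frame_sphere hκ hτ, hphase]
        generalize κ / (4 * τ) = c
        simp only [Matrix.det_succ_row_zero, Fin.sum_univ_succ, Matrix.of_apply,
          Matrix.submatrix_apply, Matrix.det_fin_zero, Fin.succAbove, hk, hk4, normSq_apply, pair,
          one_mul]
        simp only [Matrix.cons_val, map_mul, map_sub, map_add, map_neg, map_pow, conj_I, conj_ofReal, Complex.conj_conj,
    mul_re, mul_im, sub_re, sub_im, add_re, add_im, neg_re, neg_im, I_re, I_im, ofReal_re, ofReal_im,
    conj_re, conj_im, pow_two, one_re, one_im, zero_re, zero_im]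
        simp
        ring
      rw [this, h', show τ * (κ / (4 * τ)) = κ / 4 by field_simp]
      have hd : det3 (exp (γ * I) ^ 2 * 1) 0 (exp (γ * I) ^ 2 * I) 0 (exp (γ * I) ^ 2 * 0) 1
          = 1 := by
        have e1 : conj (exp (γ * I) ^ 2 * 1) * (exp (γ * I) ^ 2 * I) = I := by
          rw [map_mul, map_pow, conj_exp_mul_I]
          have := he I
          simpa using this
        simp only [det3, e1]
        simp
      rw [hd]
      positivity
  · exact det_conormal_frame_pos_of_nonpos h s hκ

/-- The adapted frame is direct. -/
theorem isDirect_frame (h : OnGroup κ a b) (n₁ : ℂ) (m₁ : ℝ) (n₂ : ℂ) (m₂ : ℝ) (n₃ : ℂ)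
    (m₃ : ℝ) : IsDirect κ τ (proj κ τ a b s) (frame κ τ a b s n₁ m₁) (frame κ τ a b s n₂ m₂)
      (frame κ τ a b s n₃ m₃) ↔ 0 < det3 n₁ m₁ n₂ m₂ n₃ m₃ := by
  have hpos := det_conormal_frame_pos (τ := τ) h s
  rw [IsDirect, det_conormal_frame, mul_pos_iff_of_pos_right hpos]

end ModelsTangent

/-! ### The derivatives of the adapted frames -/

section ModelsDeriv

open Complex ComplexConjugate

theorem hasDerivAt_re {f : ℝ → ℂ} {f' : ℂ} {t : ℝ} (h : HasDerivAt f f' t) :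
    HasDerivAt (fun x => (f x).re) f'.re t :=
  reCLM.hasFDerivAt.comp_hasDerivAt t h

theorem hasDerivAt_im {f : ℝ → ℂ} {f' : ℂ} {t : ℝ} (h : HasDerivAt f f' t) :
    HasDerivAt (fun x => (f x).im) f'.im t :=
  imCLM.hasFDerivAt.comp_hasDerivAt t h

theorem hasDerivAt_conj {f : ℝ → ℂ} {f' : ℂ} {t : ℝ} (h : HasDerivAt f f' t) :
    HasDerivAt (fun x => conj (f x)) (conj f') t :=
  conjCLE.toContinuousLinearMap.hasFDerivAt.comp_hasDerivAt t h

theorem hasDerivAt_pair {z w : ℝ → ℂ} {z' w' : ℂ} {t : ℝ} (hz : HasDerivAt z z' t)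
    (hw : HasDerivAt w w' t) : HasDerivAt (fun x => pair (z x) (w x)) (pair z' w') t := by
  rw [hasDerivAt_pi]
  intro i
  fin_cases i
  · exact hasDerivAt_re hz
  · exact (hasDerivAt_im hz).neg
  · exact hasDerivAt_re hw
  · exact hasDerivAt_im hw

variable {κ τ : ℝ} {a b n : ℝ → ℂ} {s m : ℝ → ℝ} {φ n' : ℂ} {η β m' : ℝ} {t : ℝ}

theorem hasDerivAt_phase (hκ : 0 < κ) (hτ : τ ≠ 0)
    (hs : HasDerivAt s (mcS κ τ (a t) (b t) φ η β) t) :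
    HasDerivAt (fun x => phase κ τ (s x))
      (-(I * ((κ / (4 * τ) * η + β : ℝ) : ℂ)) * phase κ τ (s t)) t := by
  have h1 : HasDerivAt (fun x => -(((κ / (4 * τ) * s x : ℝ) : ℂ) * I))
      (-(((κ / (4 * τ) * mcS κ τ (a t) (b t) φ η β : ℝ) : ℂ) * I)) t :=
    (((hs.const_mul _).ofReal_comp).mul_const I).neg
  refine h1.cexp.congr_deriv ?_
  have : κ / (4 * τ) * mcS κ τ (a t) (b t) φ η β = κ / (4 * τ) * η + β := by
    rw [mcS, if_pos hκ]; field_simp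
  rw [this, phase]
  ring

/-- The derivative of the projection of a curve has, in the adapted frame, the horizontal and vertical
components `φ` and `η` of its Maurer-Cartan form. -/
theorem proj_hasDerivAt (hg : OnGroup κ (a t) (b t))
    (ha : HasDerivAt a (mcA κ (a t) (b t) φ β) t) (hb : HasDerivAt b (mcB (a t) (b t) φ β) t)
    (hs : HasDerivAt s (mcS κ τ (a t) (b t) φ η β) t) :
    HasDerivAt (fun x => proj κ τ (a x) (b x) (s x)) (frame κ τ (a t) (b t) (s t) φ η) t := by
  by_cases hκ : 0 < κ
  · by_cases hτ : τ = 0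
    · subst hτ
      simp only [proj_product hκ, frame_product hκ]
      have h1 := (hasDerivAt_conj ha).mul hb
      have h2 := (hasDerivAt_conj ha).mul ha
      have h3 := (hasDerivAt_conj hb).mul hb
      obtain ⟨k, hk, hk4⟩ := exists_half_sqrt hκ.le
      have hk2 : √κ = 2 * k := by linarith
      have hk0 : k ≠ 0 := by rintro rfl; simp [hκ.ne', Real.sqrt_eq_zero', hκ.not_ge] at hk2
      have e1 : conj (mcA κ (a t) (b t) φ β) * b t + conj (a t) * mcB (a t) (b t) φ β
          = conj (a t) ^ 2 * φ - ((κ / 4 : ℝ) : ℂ) * b t ^ 2 * conj φ := by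
        simp only [mcA, mcB, map_sub, map_mul, conj_I, conj_ofReal, Complex.conj_conj]
        ring
      rw [hasDerivAt_pi]
      intro i
      fin_cases i
      · exact (hasDerivAt_re h1).congr_deriv (by rw [e1]; rfl)
      · exact (hasDerivAt_im h1).congr_deriv (by rw [e1]; rfl)
      · have h4 := ((hasDerivAt_re h2).sub ((hasDerivAt_re h3).const_mul (κ / 4))).div_const √κ
        refine (h4.congr_of_eventuallyEq (Filter.Eventually.of_forall fun x => ?_)).congr_deriv ?_
        · simp [normSq_apply]
        · simp only [mcA, mcB, hk2, hk4, map_mul, map_sub, map_add, map_neg, map_pow, conj_I, conj_ofReal, Complex.conj_conj,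
    mul_re, mul_im, sub_re, sub_im, add_re, add_im, neg_re, neg_im, I_re, I_im, ofReal_re, ofReal_im,
    conj_re, conj_im, pow_two, one_re, one_im, zero_re, zero_im]
          simp only [Fin.reduceFinMk, Matrix.cons_val, map_mul, map_sub, map_add, map_neg, map_pow, conj_I, conj_ofReal, Complex.conj_conj,
    mul_re, mul_im, sub_re, sub_im, add_re, add_im, neg_re, neg_im, I_re, I_im, ofReal_re, ofReal_im,
    conj_re, conj_im, pow_two, one_re, one_im, zero_re, zero_im]
          field_simp
          ring
      · exact hs.congr_deriv (by simp [mcS])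
    · simp only [proj_sphere hκ hτ, frame_sphere hκ hτ]
      have hp := hasDerivAt_phase hκ hτ hs
      refine (hasDerivAt_pair (hp.mul ha) (hp.mul (hb.const_mul _))).congr_deriv ?_
      generalize phase κ τ (s t) = u
      congr 1
      · simp only [mcA]; push_cast; ring
      · simp only [mcB]; push_cast; ring
  · have hane := hg.ne_zero hκ
    simp only [proj_nonpos hκ, frame_nonpos hκ]
    have h1 := hb.div ha hane
    have e1 : (mcB (a t) (b t) φ β * a t - b t * mcA κ (a t) (b t) φ β) / a t ^ 2
        = φ / a t ^ 2 := by
      congr 1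
      have hg' : conj (a t) * a t + ((κ / 4 : ℝ) : ℂ) * (conj (b t) * b t) = 1 := by
        rw [← normSq_eq_conj_mul_self, ← normSq_eq_conj_mul_self]
        exact_mod_cast hg
      rw [mcA, mcB]
      linear_combination φ * hg'
    rw [e1] at h1
    rw [hasDerivAt_pi]
    intro i
    fin_cases i
    · exact hasDerivAt_re h1
    · exact hasDerivAt_im h1
    · exact hs.congr_deriv (by simp [mcS, hκ])
    · exact hasDerivAt_const _ _

end ModelsDeriv

/-! ### The Levi-Civita connection in adapted frames -/

section LeviCivita

open Complex ComplexConjugate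

variable {κ τ : ℝ}

theorem fderiv_eq_of_hasDerivAt_line {E F : Type*} [NormedAddCommGroup E] [NormedSpace ℝ E]
    [NormedAddCommGroup F] [NormedSpace ℝ F] {f : E → F} {p u : E} {d : F}
    (hf : DifferentiableAt ℝ f p) (h : HasDerivAt (fun t : ℝ => f (p + t • u)) d 0) :
    fderiv ℝ f p u = d := by
  have h1 : HasDerivAt (fun t : ℝ => p + t • u) u 0 := by
    have := ((hasDerivAt_id (0 : ℝ)).smul_const u).const_add p
    rwa [one_smul] at this
  have h2 : HasFDerivAt f (fderiv ℝ f p) (p + (0 : ℝ) • u) := by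
    simpa using hf.hasFDerivAt
  exact (h2.comp_hasDerivAt 0 h1).unique h

theorem dot_hopf_add_smul (p u v : R4) (t : ℝ) :
    dot (hopf (p + t • u)) v = dot (hopf p) v + t * dot (hopf u) v := by
  simp [dot, hopf, Fin.sum_univ_four]; ring

theorem dot_hopf_comm (u v : R4) : dot (hopf u) v = -dot (hopf v) u := by
  simp [dot, hopf, Fin.sum_univ_four]; ring

theorem differentiableAt_dot_hopf (p v : R4) :
    DifferentiableAt ℝ (fun q : R4 => dot (hopf q) v) p := by
  simp only [dot, hopf, Fin.sum_univ_four, Matrix.cons_val]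
  fun_prop

theorem fderiv_metric_product (hκ : 0 < κ) (p u v w : R4) :
    fderiv ℝ (fun q => metric κ 0 q v w) p u = 0 := by
  simp [metric, hκ]

theorem fderiv_metric_sphere (hκ : 0 < κ) (hτ : τ ≠ 0) (p u v w : R4) :
    fderiv ℝ (fun q => metric κ τ q v w) p u = 4 / κ * (4 * τ ^ 2 / κ - 1) *
      (dot (hopf u) v * dot (hopf p) w + dot (hopf p) v * dot (hopf u) w) := by
  simp only [metric, hκ, hτ, if_true, if_false]
  apply fderiv_eq_of_hasDerivAt_line
  · have h1 := differentiableAt_dot_hopf p v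
    have h2 := differentiableAt_dot_hopf p w
    fun_prop
  · simp only [dot_hopf_add_smul]
    have h : ∀ x : R4, HasDerivAt (fun t : ℝ => dot (hopf p) x + t * dot (hopf u) x)
        (dot (hopf u) x) 0 := fun x => by
      simpa using ((hasDerivAt_id (0 : ℝ)).mul_const (dot (hopf u) x)).const_add (dot (hopf p) x)
    refine (((((h v).mul (h w)).const_mul (4 * τ ^ 2 / κ - 1)).const_add (dot v w)).const_mul
      (4 / κ)).congr_deriv ?_
    simp
    ring

theorem christoffel_sphere (hκ : 0 < κ) (hτ : τ ≠ 0) (p u v w : R4) :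
    christoffel κ τ p u v w = 4 / κ * (4 * τ ^ 2 / κ - 1) *
      (dot (hopf p) v * dot (hopf u) w + dot (hopf p) u * dot (hopf v) w) := by
  simp only [christoffel, fderiv_metric_sphere hκ hτ]
  rw [dot_hopf_comm v u, dot_hopf_comm w u, dot_hopf_comm w v]
  ring

/-- The connection form of the fibration, `⟨ξ, v⟩` for `κ ≤ 0`. -/
def fiberForm (κ τ : ℝ) (p v : R4) : ℝ := τ * lam κ p * (p 1 * v 0 - p 0 * v 1) + v 2

theorem lam_line_hasDerivAt {p : R4} (hp : 0 < 1 + κ / 4 * (p 0 ^ 2 + p 1 ^ 2)) (u : R4) :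
    HasDerivAt (fun t : ℝ => lam κ (p + t • u))
      (-(lam κ p ^ 2 * (κ / 2) * (p 0 * u 0 + p 1 * u 1))) 0 := by
  have h : ∀ i, HasDerivAt (fun t : ℝ => p i + t * u i) (u i) 0 := fun i => by
    simpa using ((hasDerivAt_id (0 : ℝ)).mul_const (u i)).const_add (p i)
  have h2 := ((((h 0).pow 2).add ((h 1).pow 2)).const_mul (κ / 4)).const_add 1
  have h3 := h2.inv (by simpa using hp.ne')
  refine (h3.congr_of_eventuallyEq (Filter.Eventually.of_forall fun t => ?_)).congr_deriv ?_
  · simp [lam]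
  · simp [lam]
    field_simp
    ring

theorem fderiv_metric_nonpos (hκ : ¬0 < κ) {p : R4} (hp : 0 < 1 + κ / 4 * (p 0 ^ 2 + p 1 ^ 2))
    (u v w : R4) :
    fderiv ℝ (fun q => metric κ τ q v w) p u =
      -(lam κ p ^ 3 * κ * (p 0 * u 0 + p 1 * u 1)) * (v 0 * w 0 + v 1 * w 1)
      + (τ * (-(lam κ p ^ 2 * (κ / 2) * (p 0 * u 0 + p 1 * u 1)) * (p 1 * v 0 - p 0 * v 1)
          + lam κ p * (u 1 * v 0 - u 0 * v 1))) * fiberForm κ τ p w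
      + fiberForm κ τ p v * (τ * (-(lam κ p ^ 2 * (κ / 2) * (p 0 * u 0 + p 1 * u 1))
          * (p 1 * w 0 - p 0 * w 1) + lam κ p * (u 1 * w 0 - u 0 * w 1))) := by
  simp only [metric, hκ, if_false]
  apply fderiv_eq_of_hasDerivAt_line
  · have h1 : DifferentiableAt ℝ (fun q : R4 => lam κ q) p := by
      unfold lam
      fun_prop (disch := exact hp.ne')
    fun_prop
  · have hl := lam_line_hasDerivAt hp u
    have h : ∀ i, HasDerivAt (fun t : ℝ => (p + t • u) i) (u i) 0 := fun i => by
      simpa using ((hasDerivAt_id (0 : ℝ)).mul_const (u i)).const_add (p i)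
    have hA : ∀ x : R4, HasDerivAt (fun t : ℝ => τ * lam κ (p + t • u)
        * ((p + t • u) 1 * x 0 - (p + t • u) 0 * x 1) + x 2)
        (τ * (-(lam κ p ^ 2 * (κ / 2) * (p 0 * u 0 + p 1 * u 1)) * (p 1 * x 0 - p 0 * x 1)
          + lam κ p * (u 1 * x 0 - u 0 * x 1))) 0 := by
      intro x
      refine (((hl.const_mul τ).mul (((h 1).mul_const (x 0)).sub
        ((h 0).mul_const (x 1)))).add_const (x 2)).congr_deriv ?_
      simp
      ring
    refine ((((hl.pow 2).mul_const (v 0 * w 0 + v 1 * w 1)).add ((hA v).mul (hA w))).add_const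
      (v 3 * w 3)).congr_deriv ?_
    simp [fiberForm]
    ring

/-- The Christoffel symbols for `κ ≤ 0`, in the complex notation of the base. -/
theorem christoffel_nonpos (hκ : ¬0 < κ) {p : R4} (hp : 0 < 1 + κ / 4 * (p 0 ^ 2 + p 1 ^ 2))
    (u v w : R4) :
    christoffel κ τ p u v w =
      -(κ / 2) * lam κ p ^ 3 * ((p 0 * u 0 + p 1 * u 1) * (v 0 * w 0 + v 1 * w 1)
        + (p 0 * v 0 + p 1 * v 1) * (u 0 * w 0 + u 1 * w 1)
        - (p 0 * w 0 + p 1 * w 1) * (u 0 * v 0 + u 1 * v 1))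
      + τ * κ / 4 * lam κ p ^ 2 * ((p 0 * u 0 + p 1 * u 1) * (p 0 * v 1 - p 1 * v 0)
        + (p 0 * v 0 + p 1 * v 1) * (p 0 * u 1 - p 1 * u 0)) * fiberForm κ τ p w
      - τ * lam κ p ^ 2 * (u 0 * w 1 - u 1 * w 0) * fiberForm κ τ p v
      - τ * lam κ p ^ 2 * (v 0 * w 1 - v 1 * w 0) * fiberForm κ τ p u := by
  have hl : lam κ p * (1 + κ / 4 * (p 0 ^ 2 + p 1 ^ 2)) = 1 := by
    rw [lam, one_div, inv_mul_cancel₀ hp.ne']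
  simp only [christoffel, fderiv_metric_nonpos hκ hp]
  linear_combination (τ * lam κ p * ((u 0 * w 1 - u 1 * w 0) * fiberForm κ τ p v +
    (v 0 * w 1 - v 1 * w 0) * fiberForm κ τ p u)) * hl

theorem dot_add_left (u u' v : R4) : dot (u + u') v = dot u v + dot u' v := by
  simp [dot, add_mul, Finset.sum_add_distrib]

theorem dot_smul_left (c : ℝ) (u v : R4) : dot (c • u) v = c * dot u v := by
  simp [dot, Finset.mul_sum, mul_assoc]

theorem dot_comm (u v : R4) : dot u v = dot v u := by
  simp [dot, mul_comm]

theorem dot_add_right (u v v' : R4) : dot u (v + v') = dot u v + dot u v' := by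
  rw [dot_comm, dot_add_left, dot_comm v, dot_comm v']

theorem dot_smul_right (c : ℝ) (u v : R4) : dot u (c • v) = c * dot u v := by
  rw [dot_comm, dot_smul_left, dot_comm v]

theorem pair_add (z w z' w' : ℂ) : pair z w + pair z' w' = pair (z + z') (w + w') := by
  funext i
  fin_cases i <;> simp [pair]
  ring

theorem smul_pair (r : ℝ) (z w : ℂ) : r • pair z w = pair (r * z) (r * w) := by
  funext i
  fin_cases i <;> simp [pair]

theorem ofReal_re_eq (z : ℂ) : (z.re : ℂ) = (z + conj z) / 2 := by
  rw [add_conj]; push_cast; ring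

theorem ofReal_im_eq (z : ℂ) : (z.im : ℂ) = -I * (z - conj z) / 2 := by
  rw [sub_conj]; push_cast; linear_combination (z.im : ℂ) * I_mul_I

theorem dot_hopf_self (p : R4) : dot (hopf p) p = 0 := by
  simp [dot, hopf, Fin.sum_univ_four]; ring

theorem metric_comm (κ τ : ℝ) (p u v : R4) : metric κ τ p u v = metric κ τ p v u := by
  unfold metric
  rw [dot_comm u v]
  split_ifs <;> ring

theorem metric_add_left (κ τ : ℝ) (p u u' v : R4) :
    metric κ τ p (u + u') v = metric κ τ p u v + metric κ τ p u' v := by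
  unfold metric
  simp only [dot_add_left, dot_add_right, Pi.add_apply]
  split_ifs <;> ring

theorem metric_smul_left (κ τ : ℝ) (p : R4) (c : ℝ) (u v : R4) :
    metric κ τ p (c • u) v = c * metric κ τ p u v := by
  unfold metric
  simp only [dot_smul_left, dot_smul_right, Pi.smul_apply, smul_eq_mul]
  split_ifs <;> ring

section Frame

variable {a b n : ℝ → ℂ} {s m : ℝ → ℝ} {φ n' : ℂ} {η β m' : ℝ} {t : ℝ}

theorem frame_hasDerivAt_product {κ : ℝ} (hκ : 0 < κ)
    (ha : HasDerivAt a (mcA κ (a t) (b t) φ β) t) (hb : HasDerivAt b (mcB (a t) (b t) φ β) t)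
    (hn : HasDerivAt n n' t) (hm : HasDerivAt m m' t) :
    HasDerivAt (fun x => frame κ 0 (a x) (b x) (s x) (n x) (m x))
      (frame κ 0 (a t) (b t) (s t) (n' - 2 * I * β * n t) m'
        + (-(κ * (conj φ * n t).re)) • conormal κ 0 (proj κ 0 (a t) (b t) (s t))) t := by
  simp only [proj_product hκ, frame_product hκ]
  have hab := (hasDerivAt_conj ha).mul (hasDerivAt_conj hb)
  have h1 := (((hasDerivAt_conj ha).pow 2).mul hn).sub
    (((hb.pow 2).const_mul ((κ / 4 : ℝ) : ℂ)).mul (hasDerivAt_conj hn))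
  have h3 := (hasDerivAt_re (hab.mul hn)).const_mul (-√κ)
  obtain ⟨k, hk, hk4⟩ := exists_half_sqrt hκ.le
  have hk2 : √κ = 2 * k := by linarith
  have hk3 : κ = 4 * k ^ 2 := by linarith
  have hk0 : k ≠ 0 := by rintro rfl; simp [hκ.ne', Real.sqrt_eq_zero', hκ.not_ge] at hk2
  rw [hasDerivAt_pi]
  intro i
  fin_cases i
  · refine (hasDerivAt_re h1).congr_deriv ?_
    simp [conormal, hκ]
    simp only [mcA, mcB, map_mul, map_sub, map_add, map_neg, map_pow, conj_I, conj_ofReal, Complex.conj_conj,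
    mul_re, mul_im, sub_re, sub_im, add_re, add_im, neg_re, neg_im, I_re, I_im, ofReal_re, ofReal_im,
    conj_re, conj_im, pow_two, one_re, one_im, zero_re, zero_im, hk4]
    simp
    rw [hk3]
    ring
  · refine (hasDerivAt_im h1).congr_deriv ?_
    simp [conormal, hκ]
    simp only [mcA, mcB, map_mul, map_sub, map_add, map_neg, map_pow, conj_I, conj_ofReal, Complex.conj_conj,
    mul_re, mul_im, sub_re, sub_im, add_re, add_im, neg_re, neg_im, I_re, I_im, ofReal_re, ofReal_im,
    conj_re, conj_im, pow_two, one_re, one_im, zero_re, zero_im, hk4]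
    simp
    rw [hk3]
    ring
  · refine h3.congr_deriv ?_
    simp [conormal, hκ]
    simp only [mcA, mcB, map_mul, map_sub, map_add, map_neg, map_pow, conj_I, conj_ofReal, Complex.conj_conj,
    mul_re, mul_im, sub_re, sub_im, add_re, add_im, neg_re, neg_im, I_re, I_im, ofReal_re, ofReal_im,
    conj_re, conj_im, pow_two, one_re, one_im, zero_re, zero_im, hk4, hk2, normSq_apply]
    simp
    rw [hk3]
    field_simp
    ring
  · refine hm.congr_deriv ?_
    simp [conormal, hκ]

theorem frame_hasDerivAt_sphere (hκ : 0 < κ) (hτ : τ ≠ 0)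
    (ha : HasDerivAt a (mcA κ (a t) (b t) φ β) t) (hb : HasDerivAt b (mcB (a t) (b t) φ β) t)
    (hs : HasDerivAt s (mcS κ τ (a t) (b t) φ η β) t)
    (hn : HasDerivAt n n' t) (hm : HasDerivAt m m' t) :
    HasDerivAt (fun x => frame κ τ (a x) (b x) (s x) (n x) (m x))
      (frame κ τ (a t) (b t) (s t)
        (n' - I * (2 * β + κ / (4 * τ) * η) * n t - I * (κ / (4 * τ) * m t) * φ)
        (m' + τ * (conj φ * n t).im)
        + (-(κ / 4 * (conj φ * n t).re + (κ / (4 * τ)) ^ 2 * m t * η)) •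
          proj κ τ (a t) (b t) (s t)) t := by
  simp only [proj_sphere hκ hτ, frame_sphere hκ hτ]
  have hp := hasDerivAt_phase hκ hτ hs
  have hcm : HasDerivAt (fun x => ((κ / (4 * τ) * m x : ℝ) : ℂ)) ((κ / (4 * τ) * m' : ℝ) : ℂ) t :=
    (hm.const_mul (κ / (4 * τ))).ofReal_comp
  have h1 := hp.mul ((((hasDerivAt_conj hb).const_mul (-((κ / 4 : ℝ) : ℂ))).mul hn).sub
    ((hcm.const_mul I).mul ha))
  have h2 := hp.mul ((((hasDerivAt_conj ha).mul hn).sub ((hcm.const_mul I).mul hb)).const_mul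
    ((√κ / 2 : ℝ) : ℂ))
  refine (hasDerivAt_pair h1 h2).congr_deriv ?_
  obtain ⟨k, hk, hk4⟩ := exists_half_sqrt hκ.le
  have hc : κ / (4 * τ) * τ = k ^ 2 := by rw [← hk4]; field_simp
  rw [← ofReal_ofNat 2]
  have hcast : ((κ / (4 * τ) : ℝ) : ℂ) = (κ : ℂ) / (4 * τ) := by push_cast; rfl
  rw [← hcast]
  generalize κ / (4 * τ) = c at *
  generalize phase κ τ (s t) = u
  rw [smul_pair, pair_add]
  have hc' : (c : ℂ) * τ = (k : ℂ) ^ 2 := by exact_mod_cast hc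
  have hI := I_mul_I
  simp only [mcA, mcB, hk, hk4]
  push_cast
  rw [ofReal_re_eq, ofReal_im_eq]
  simp only [map_add, map_sub, map_mul, map_neg, map_pow, conj_I, conj_ofReal, Complex.conj_conj]
  simp only [Pi.mul_apply, Pi.sub_apply]
  generalize conj (a t) = a'
  generalize conj (b t) = b'
  generalize conj (n t) = nn'
  generalize conj φ = φ'
  congr 1
  · linear_combination (I * a t * u * (-I * (φ' * n t - φ * nn') / 2)) * hc'
      + (c ^ 2 * η * m t * a t * u - k ^ 2 * a t * u * (φ' * n t - φ * nn') / 2) * hI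
  · linear_combination (I * b t * u * k * (-I * (φ' * n t - φ * nn') / 2)) * hc'
      + k * (c ^ 2 * η * m t * b t * u - k ^ 2 * b t * u * (φ' * n t - φ * nn') / 2) * hI

theorem frame_hasDerivAt_nonpos (hκ : ¬0 < κ) (hg : OnGroup κ (a t) (b t))
    (ha : HasDerivAt a (mcA κ (a t) (b t) φ β) t) (hb : HasDerivAt b (mcB (a t) (b t) φ β) t)
    (hn : HasDerivAt n n' t) (hm : HasDerivAt m m' t) :
    HasDerivAt (fun x => frame κ τ (a x) (b x) (s x) (n x) (m x))
      (frame κ τ (a t) (b t) (s t)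
        (n' + n t * (-(2 * I * β) + ((κ / 2 : ℝ) : ℂ) * (conj (b t) * φ / a t)))
        (m' + τ * (n t * (conj φ - ((κ / 4 : ℝ) : ℂ) * (conj (b t) / a t)
          * (conj (b t) * φ / a t))).im)) t := by
  have hane := hg.ne_zero hκ
  simp only [frame_nonpos hκ]
  have h1 := hn.div (ha.pow 2) (pow_ne_zero 2 hane)
  have h2 := ((hasDerivAt_conj hb).mul hn).div ha hane
  have h3 := hm.add ((hasDerivAt_im h2).const_mul τ)
  rw [hasDerivAt_pi]
  intro i
  fin_cases i
  · refine (hasDerivAt_re h1).congr_deriv (congrArg re ?_)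
    simp only [mcA, Pi.pow_apply]
    field_simp
    push_cast
    ring
  · refine (hasDerivAt_im h1).congr_deriv (congrArg im ?_)
    simp only [mcA, Pi.pow_apply]
    field_simp
    push_cast
    ring
  · refine h3.congr_deriv ?_
    have hX : ((conj (mcB (a t) (b t) φ β) * n t + conj (b t) * n') * a t
        - conj (b t) * n t * mcA κ (a t) (b t) φ β) / a t ^ 2
        = n t * (conj φ - ((κ / 4 : ℝ) : ℂ) * (conj (b t) / a t) * (conj (b t) * φ / a t))
          + conj (b t) * (n' + n t * (-(2 * I * β) + ((κ / 2 : ℝ) : ℂ) * (conj (b t) * φ / a t)))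
            / a t := by
      simp only [mcA, mcB, map_add, map_mul, conj_I, conj_ofReal, Complex.conj_conj]
      field_simp
      push_cast
      ring
    simp only [Pi.mul_apply]
    rw [hX, add_im]
    simp
    ring
  · exact hasDerivAt_const _ _

/-- Pairings of frame vectors in the base chart, for `κ ≤ 0`. -/
theorem base_pairings {a b : ℂ} (hane : a ≠ 0) (x y : ℂ) :
    normSq a * ((b / a).re * (x / a ^ 2).re + (b / a).im * (x / a ^ 2).im)
        = (conj b / a * x).re ∧
    normSq a * ((b / a).re * (x / a ^ 2).im - (b / a).im * (x / a ^ 2).re)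
        = (conj b / a * x).im ∧
    normSq a ^ 2 * ((x / a ^ 2).re * (y / a ^ 2).re + (x / a ^ 2).im * (y / a ^ 2).im)
        = (x * conj y).re ∧
    normSq a ^ 2 * ((x / a ^ 2).re * (y / a ^ 2).im - (x / a ^ 2).im * (y / a ^ 2).re)
        = (conj x * y).im := by
  have hc : conj a ≠ 0 := by simpa using hane
  have h1 : ((normSq a : ℝ) : ℂ) * (conj (b / a) * (x / a ^ 2)) = conj b / a * x := by
    rw [← mul_conj, map_div₀]; field_simp
  have h2 : ((normSq a ^ 2 : ℝ) : ℂ) * ((x / a ^ 2) * conj (y / a ^ 2)) = x * conj y := by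
    rw [ofReal_pow, ← mul_conj, map_div₀, map_pow]; field_simp
  have h3 : ((normSq a ^ 2 : ℝ) : ℂ) * (conj (x / a ^ 2) * (y / a ^ 2)) = conj x * y := by
    rw [ofReal_pow, ← mul_conj, map_div₀, map_pow]; field_simp
  refine ⟨?_, ?_, ?_, ?_⟩
  · rw [← h1, re_ofReal_mul, mul_re, conj_re, conj_im]; ring
  · rw [← h1, im_ofReal_mul, mul_im, conj_re, conj_im]; ring
  · rw [← h2, re_ofReal_mul, mul_re, conj_re, conj_im]; ring
  · rw [← h3, im_ofReal_mul, mul_im, conj_re, conj_im]; ring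

theorem christoffel_frame_nonpos (hκ : ¬0 < κ) {a b : ℂ} {s : ℝ} (hg : OnGroup κ a b)
    (x y z : ℂ) (ξ η ζ : ℝ) :
    christoffel κ τ (proj κ τ a b s) (frame κ τ a b s x ξ) (frame κ τ a b s y η)
        (frame κ τ a b s z ζ) =
      -(κ / 2) * ((conj b / a * x).re * (y * conj z).re + (conj b / a * y).re * (x * conj z).re
        - (conj b / a * z).re * (x * conj y).re)
      + τ * κ / 4 * ((conj b / a * x).re * (conj b / a * y).im
        + (conj b / a * y).re * (conj b / a * x).im) * ζ
      - τ * (conj x * z).im * η - τ * (conj y * z).im * ξ := by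
  have hane := hg.ne_zero hκ
  have hp : 0 < 1 + κ / 4 * ((proj κ τ a b s) 0 ^ 2 + (proj κ τ a b s) 1 ^ 2) := by
    have := proj_mem hg τ s
    simp only [carrier, hκ, if_false, Set.mem_ofPred_eq] at this
    exact this.1
  have hl : lam κ (proj κ τ a b s) = normSq a := lam_proj hκ hg
  have hf : ∀ (w : ℂ) (r : ℝ), fiberForm κ τ (proj κ τ a b s) (frame κ τ a b s w r) = r := by
    intro w r
    have h := (base_pairings (b := b) hane w w).2.1
    rw [fiberForm, hl]
    simp only [proj_nonpos hκ, frame_nonpos hκ, Matrix.cons_val]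
    rw [← mul_div_right_comm] at h
    linear_combination -τ * h
  rw [christoffel_nonpos hκ hp]
  simp only [hf]
  rw [hl]
  simp only [proj_nonpos hκ, frame_nonpos hκ, Matrix.cons_val]
  obtain ⟨x1, x2, xy, -⟩ := base_pairings (b := b) hane x y
  obtain ⟨y1, y2, yz, yz'⟩ := base_pairings (b := b) hane y z
  obtain ⟨z1, z2, -, -⟩ := base_pairings (b := b) hane z x
  obtain ⟨-, -, xz, xz'⟩ := base_pairings (b := b) hane x z
  rw [← x1, ← x2, ← xy, ← y1, ← y2, ← yz, ← yz', ← z1, ← xz, ← xz']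
  ring

/-- The covariant derivative, for the Levi-Civita connection, of a vector field with coordinates
`(n, m)` in the adapted frame along a curve with velocity `(φ, η)`: the connection form of the
adapted frame has coefficients `-(2 β + τ η)` in the horizontal plane, and `τ` times the
rotation by `π/2` mixes the horizontal and the vertical directions. -/
theorem frame_leviCivita (hg : OnGroup κ (a t) (b t))
    (ha : HasDerivAt a (mcA κ (a t) (b t) φ β) t) (hb : HasDerivAt b (mcB (a t) (b t) φ β) t)
    (hs : HasDerivAt s (mcS κ τ (a t) (b t) φ η β) t)
    (hn : HasDerivAt n n' t) (hm : HasDerivAt m m' t) :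
    ∃ D, HasDerivAt (fun x => frame κ τ (a x) (b x) (s x) (n x) (m x)) D t ∧
      ∀ (n₂ : ℂ) (m₂ : ℝ), metric κ τ (proj κ τ (a t) (b t) (s t)) D
          (frame κ τ (a t) (b t) (s t) n₂ m₂)
        + christoffel κ τ (proj κ τ (a t) (b t) (s t)) (frame κ τ (a t) (b t) (s t) φ η)
          (frame κ τ (a t) (b t) (s t) (n t) (m t)) (frame κ τ (a t) (b t) (s t) n₂ m₂)
        = ((n' - I * ((2 * β + τ * η : ℝ) : ℂ) * n t - I * ((τ * m t : ℝ) : ℂ) * φ) * conj n₂).re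
          + (m' + τ * (n t * conj φ).im) * m₂ := by
  by_cases hκ : 0 < κ
  · by_cases hτ : τ = 0
    · subst hτ
      refine ⟨_, frame_hasDerivAt_product hκ ha hb hn hm, fun n₂ m₂ => ?_⟩
      have h0 : metric κ 0 (proj κ 0 (a t) (b t) (s t))
          (conormal κ 0 (proj κ 0 (a t) (b t) (s t))) (frame κ 0 (a t) (b t) (s t) n₂ m₂) = 0 := by
        have : dot _ _ = 0 := frame_mem_tangent κ 0 (a t) (b t) (s t) n₂ m₂
        simpa only [metric, hκ, if_true] using this
      rw [metric_add_left, metric_smul_left, h0, metric_frame hg]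
      simp only [christoffel, fderiv_metric_product hκ]
      simp
    · refine ⟨_, frame_hasDerivAt_sphere hκ hτ ha hb hs hn hm, fun n₂ m₂ => ?_⟩
      have h0 : metric κ τ (proj κ τ (a t) (b t) (s t))
          (proj κ τ (a t) (b t) (s t)) (frame κ τ (a t) (b t) (s t) n₂ m₂) = 0 := by
        simp only [metric, hκ, hτ, if_true, if_false]
        rw [dot_hopf_self, dot_proj_frame hκ hτ]
        ring
      rw [metric_add_left, metric_smul_left, h0, metric_frame hg, christoffel_sphere hκ hτ]
      simp only [dot_hopf_frame hκ hτ hg, dot_hopf_frame_frame hκ hτ hg]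
      have hc : κ / (4 * τ) * (4 / κ * (4 * τ ^ 2 / κ - 1)) * (κ / 4) = τ - κ / (4 * τ) := by
        field_simp
      have hcast : (κ : ℂ) / (4 * τ) = ((κ / (4 * τ) : ℝ) : ℂ) := by push_cast; rfl
      rw [hcast, ← ofReal_ofNat 2]
      generalize κ / (4 * τ) = c at *
      generalize 4 / κ * (4 * τ ^ 2 / κ - 1) = d at *
      generalize κ / 4 = e at *
      simp only [map_mul, map_sub, map_add, map_neg, map_pow, conj_I, conj_ofReal, Complex.conj_conj,
    mul_re, mul_im, sub_re, sub_im, add_re, add_im, neg_re, neg_im, I_re, I_im, ofReal_re, ofReal_im,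
    conj_re, conj_im, pow_two, one_re, one_im, zero_re, zero_im]
      linear_combination (m t * (φ.im * n₂.re - φ.re * n₂.im)
        + η * ((n t).im * n₂.re - (n t).re * n₂.im)) * hc
  · refine ⟨_, frame_hasDerivAt_nonpos hκ hg ha hb hn hm, fun n₂ m₂ => ?_⟩
    rw [metric_frame hg, christoffel_frame_nonpos hκ hg, mul_div_right_comm]
    generalize conj (b t) / a t = k
    rw [← ofReal_ofNat 2]
    simp only [map_mul, map_sub, map_add, map_neg, map_pow, conj_I, conj_ofReal, Complex.conj_conj,
    mul_re, mul_im, sub_re, sub_im, add_re, add_im, neg_re, neg_im, I_re, I_im, ofReal_re, ofReal_im,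
    conj_re, conj_im, pow_two, one_re, one_im, zero_re, zero_im]
    ring

end Frame

end LeviCivita

/-! ### Smoothness -/

section Smoothness

open Complex ComplexConjugate

variable {E : Type*} [NormedAddCommGroup E] [NormedSpace ℝ E] {U : Set E} {k : ℕ∞ω}
  {f g : E → ℂ} {r : E → ℝ}

@[fun_prop]
theorem contDiffOn_re (hf : ContDiffOn ℝ k f U) : ContDiffOn ℝ k (fun x => (f x).re) U :=
  reCLM.contDiff.comp_contDiffOn hf

@[fun_prop]
theorem contDiffOn_im (hf : ContDiffOn ℝ k f U) : ContDiffOn ℝ k (fun x => (f x).im) U :=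
  imCLM.contDiff.comp_contDiffOn hf

@[fun_prop]
theorem contDiffOn_conj (hf : ContDiffOn ℝ k f U) : ContDiffOn ℝ k (fun x => conj (f x)) U :=
  conjCLE.contDiff.comp_contDiffOn hf

@[fun_prop]
theorem contDiffOn_ofReal (hr : ContDiffOn ℝ k r U) : ContDiffOn ℝ k (fun x => (r x : ℂ)) U :=
  ofRealCLM.contDiff.comp_contDiffOn hr

@[fun_prop]
theorem contDiffOn_normSq (hf : ContDiffOn ℝ k f U) : ContDiffOn ℝ k (fun x => normSq (f x)) U := by
  simp only [normSq_apply]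
  fun_prop

theorem contDiffOn_complex_div (hf : ContDiffOn ℝ k f U) (hg : ContDiffOn ℝ k g U)
    (h : ∀ x ∈ U, g x ≠ 0) : ContDiffOn ℝ k (fun x => f x / g x) U := by
  simp only [div_eq_mul_inv]
  exact hf.mul (hg.inv h)

theorem contDiffOn_complex_exp (hf : ContDiffOn ℝ k f U) :
    ContDiffOn ℝ k (fun x => exp (f x)) U :=
  hf.cexp

variable {κ τ : ℝ} {a b n : E → ℂ} {s m : E → ℝ}

theorem contDiffOn_phase (κ τ : ℝ) (hs : ContDiffOn ℝ k s U) :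
    ContDiffOn ℝ k (fun x => phase κ τ (s x)) U := by
  refine contDiffOn_complex_exp ?_
  fun_prop

theorem contDiffOn_pair (hf : ContDiffOn ℝ k f U) (hg : ContDiffOn ℝ k g U) :
    ContDiffOn ℝ k (fun x => pair (f x) (g x)) U := by
  rw [contDiffOn_pi]
  intro i
  fin_cases i <;> simp [pair] <;> fun_prop

theorem contDiffOn_proj (hg : ∀ x ∈ U, OnGroup κ (a x) (b x)) (ha : ContDiffOn ℝ k a U)
    (hb : ContDiffOn ℝ k b U) (hs : ContDiffOn ℝ k s U) :
    ContDiffOn ℝ k (fun x => proj κ τ (a x) (b x) (s x)) U := by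
  by_cases hκ : 0 < κ
  · by_cases hτ : τ = 0
    · subst hτ
      simp only [proj_product hκ]
      rw [contDiffOn_pi]
      intro i
      fin_cases i
      · show ContDiffOn ℝ k (fun x => (conj (a x) * b x).re) U
        fun_prop
      · show ContDiffOn ℝ k (fun x => (conj (a x) * b x).im) U
        fun_prop
      · show ContDiffOn ℝ k (fun x => (normSq (a x) - κ / 4 * normSq (b x)) / √κ) U
        fun_prop
      · exact hs
    · simp only [proj_sphere hκ hτ]
      have hp := contDiffOn_phase κ τ hs
      apply contDiffOn_pair <;> fun_prop
  · simp only [proj_nonpos hκ]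
    have h := contDiffOn_complex_div hb ha fun x hx => (hg x hx).ne_zero hκ
    rw [contDiffOn_pi]
    intro i
    fin_cases i
    · exact contDiffOn_re h
    · exact contDiffOn_im h
    · exact hs
    · exact contDiffOn_const

theorem contDiffOn_frame (hg : ∀ x ∈ U, OnGroup κ (a x) (b x)) (ha : ContDiffOn ℝ k a U)
    (hb : ContDiffOn ℝ k b U) (hs : ContDiffOn ℝ k s U) (hn : ContDiffOn ℝ k n U)
    (hm : ContDiffOn ℝ k m U) :
    ContDiffOn ℝ k (fun x => frame κ τ (a x) (b x) (s x) (n x) (m x)) U := by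
  by_cases hκ : 0 < κ
  · by_cases hτ : τ = 0
    · subst hτ
      simp only [frame_product hκ]
      rw [contDiffOn_pi]
      intro i
      fin_cases i
      · show ContDiffOn ℝ k (fun x => (conj (a x) ^ 2 * n x
          - ((κ / 4 : ℝ) : ℂ) * b x ^ 2 * conj (n x)).re) U
        fun_prop
      · show ContDiffOn ℝ k (fun x => (conj (a x) ^ 2 * n x
          - ((κ / 4 : ℝ) : ℂ) * b x ^ 2 * conj (n x)).im) U
        fun_prop
      · show ContDiffOn ℝ k (fun x => -√κ * (conj (a x) * conj (b x) * n x).re) U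
        fun_prop
      · exact hm
    · simp only [frame_sphere hκ hτ]
      have hp := contDiffOn_phase κ τ hs
      apply contDiffOn_pair <;> fun_prop
  · simp only [frame_nonpos hκ]
    have h0 : ∀ x ∈ U, a x ≠ 0 := fun x hx => (hg x hx).ne_zero hκ
    have h := contDiffOn_complex_div hn (ha.pow 2) fun x hx => pow_ne_zero 2 (h0 x hx)
    have h' := contDiffOn_complex_div ((contDiffOn_conj hb).mul hn) ha h0
    rw [contDiffOn_pi]
    intro i
    fin_cases i
    · exact contDiffOn_re h
    · exact contDiffOn_im h
    · exact hm.add ((contDiffOn_im h').const_smul τ)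
    · exact contDiffOn_const

end Smoothness

/-! ### Adapted frames along a surface -/

section Lift

open Complex ComplexConjugate

/-- A smooth map `(a, b)` of the open set `U` of `ℂ` to the group, with Maurer-Cartan form
`(iβ, -κ/4 φ̄; φ, -iβ)`. -/
structure IsGroupLift (κ : ℝ) (U : Set ℂ) (a b : ℂ → ℂ) (φ : ℂ → ℂ →L[ℝ] ℂ)
    (β : ℂ → ℂ →L[ℝ] ℝ) : Prop where
  contDiffOn_a : ContDiffOn ℝ ∞ a U
  contDiffOn_b : ContDiffOn ℝ ∞ b U
  contDiffOn_φ : ContDiffOn ℝ ∞ φ U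
  contDiffOn_β : ContDiffOn ℝ ∞ β U
  onGroup : ∀ z ∈ U, OnGroup κ (a z) (b z)
  fderiv_a : ∀ z ∈ U, ∀ v, fderiv ℝ a z v = mcA κ (a z) (b z) (φ z v) (β z v)
  fderiv_b : ∀ z ∈ U, ∀ v, fderiv ℝ b z v = mcB (a z) (b z) (φ z v) (β z v)

/-- A lift of a map of the open set `U` of `ℂ` to `E(κ, τ)`: the map is
`z ↦ proj κ τ (a z) (b z) (s z)`, its differential at `z` has coordinates `φ z`, `η z` in the
adapted frame, and `β` is the remaining component of the Maurer-Cartan form. -/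
structure IsLift (κ τ : ℝ) (U : Set ℂ) (a b : ℂ → ℂ) (s : ℂ → ℝ) (φ : ℂ → ℂ →L[ℝ] ℂ)
    (η β : ℂ → ℂ →L[ℝ] ℝ) : Prop extends IsGroupLift κ U a b φ β where
  contDiffOn_s : ContDiffOn ℝ ∞ s U
  contDiffOn_η : ContDiffOn ℝ ∞ η U
  fderiv_s : ∀ z ∈ U, ∀ v, fderiv ℝ s z v = mcS κ τ (a z) (b z) (φ z v) (η z v) (β z v)

section Lines

variable {F : Type*} [NormedAddCommGroup F] [NormedSpace ℝ F] {f : ℂ → F} {U : Set ℂ} {z : ℂ}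
  {σ : ℂ → ℂ →L[ℝ] F}

/-- Derivatives are computed along lines, so that the formulas for curves apply. -/
theorem hasDerivAt_line (hf : DifferentiableAt ℝ f z) (v : ℂ) :
    HasDerivAt (fun t : ℝ => f (z + t • v)) (fderiv ℝ f z v) 0 := by
  have h1 : HasDerivAt (fun t : ℝ => z + t • v) v 0 := by
    have := ((hasDerivAt_id (0 : ℝ)).smul_const v).const_add z
    rwa [one_smul] at this
  have h2 : HasFDerivAt f (fderiv ℝ f z) (z + (0 : ℝ) • v) := by
    simpa using hf.hasFDerivAt
  exact h2.comp_hasDerivAt 0 h1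

theorem hasDerivAt_line_apply (hσ : DifferentiableAt ℝ σ z) (v w : ℂ) :
    HasDerivAt (fun t : ℝ => σ (z + t • v) w) (fderiv ℝ σ z v w) 0 := by
  simpa using (hasDerivAt_line hσ v).clm_apply (hasDerivAt_const (0 : ℝ) w)

theorem differentiableAt_of_contDiffOn (hU : IsOpen U) (hf : ContDiffOn ℝ ∞ f U) (hz : z ∈ U) :
    DifferentiableAt ℝ f z :=
  (hf.contDiffAt (hU.mem_nhds hz)).differentiableAt (by simp)

theorem contDiffOn_fderiv (hU : IsOpen U) (hf : ContDiffOn ℝ ∞ f U) :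
    ContDiffOn ℝ ∞ (fderiv ℝ f) U :=
  hf.fderiv_of_isOpen hU (by simp)

theorem eventually_line_mem (hU : IsOpen U) (hz : z ∈ U) (v : ℂ) :
    ∀ᶠ t : ℝ in nhds 0, z + t • v ∈ U := by
  have hc : Continuous fun t : ℝ => z + t • v := by fun_prop
  exact hc.continuousAt.preimage_mem_nhds (hU.mem_nhds (by simpa using hz))

/-- The exterior derivative of a 1-form on an open set of `ℂ`. -/
def curl (σ : ℂ → ℂ →L[ℝ] F) (z v w : ℂ) : F := fderiv ℝ σ z v w - fderiv ℝ σ z w v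

/-- The exterior derivative of a form given by `g`, from the derivatives of `g` along lines. -/
theorem curl_eq_of_line (hU : IsOpen U) (hz : z ∈ U) (hσ : DifferentiableAt ℝ σ z) {v w : ℂ}
    {g : ℂ → ℂ → F} (hg : ∀ z ∈ U, ∀ v, σ z v = g z v) {d d' : F}
    (h : HasDerivAt (fun t : ℝ => g (z + t • v) w) d 0)
    (h' : HasDerivAt (fun t : ℝ => g (z + t • w) v) d' 0) : curl σ z v w = d - d' := by
  have key : ∀ v w : ℂ, ∀ d, HasDerivAt (fun t : ℝ => g (z + t • v) w) d 0 →
      fderiv ℝ σ z v w = d := fun v w d h =>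
    (hasDerivAt_line_apply hσ v w).unique (h.congr_of_eventuallyEq
      ((eventually_line_mem hU hz v).mono fun t ht => hg _ ht w))
  rw [curl, key v w d h, key w v d' h']

theorem fderiv_fderiv_comm (hU : IsOpen U) (hf : ContDiffOn ℝ ∞ f U) (hz : z ∈ U) (v w : ℂ) :
    fderiv ℝ (fderiv ℝ f) z v w = fderiv ℝ (fderiv ℝ f) z w v :=
  (hf.contDiffAt (hU.mem_nhds hz)).isSymmSndFDerivAt (by
    rw [minSmoothness_of_isRCLikeNormedField]
    exact WithTop.coe_le_coe.2 le_top) v w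

end Lines

variable {κ τ : ℝ} {U : Set ℂ} {a b : ℂ → ℂ} {s : ℂ → ℝ} {φ : ℂ → ℂ →L[ℝ] ℂ}
  {η β : ℂ → ℂ →L[ℝ] ℝ} {z : ℂ}

theorem IsGroupLift.line_a (h : IsGroupLift κ U a b φ β) (hU : IsOpen U) (hz : z ∈ U) (v : ℂ) :
    HasDerivAt (fun t : ℝ => a (z + t • v)) (mcA κ (a z) (b z) (φ z v) (β z v)) 0 := by
  rw [← h.fderiv_a z hz]
  exact hasDerivAt_line (differentiableAt_of_contDiffOn hU h.contDiffOn_a hz) v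

theorem IsGroupLift.line_b (h : IsGroupLift κ U a b φ β) (hU : IsOpen U) (hz : z ∈ U) (v : ℂ) :
    HasDerivAt (fun t : ℝ => b (z + t • v)) (mcB (a z) (b z) (φ z v) (β z v)) 0 := by
  rw [← h.fderiv_b z hz]
  exact hasDerivAt_line (differentiableAt_of_contDiffOn hU h.contDiffOn_b hz) v

theorem IsLift.line_s (h : IsLift κ τ U a b s φ η β) (hU : IsOpen U) (hz : z ∈ U) (v : ℂ) :
    HasDerivAt (fun t : ℝ => s (z + t • v))
      (mcS κ τ (a z) (b z) (φ z v) (η z v) (β z v)) 0 := by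
  rw [← h.fderiv_s z hz]
  exact hasDerivAt_line (differentiableAt_of_contDiffOn hU h.contDiffOn_s hz) v

/-- The horizontal form in terms of the derivative of the map to the group. -/
theorem IsGroupLift.φ_eq (h : IsGroupLift κ U a b φ β) (hz : z ∈ U) (v : ℂ) :
    φ z v = a z * fderiv ℝ b z v - b z * fderiv ℝ a z v := by
  have hg : a z * conj (a z) + ((κ / 4 : ℝ) : ℂ) * (b z * conj (b z)) = 1 := by
    rw [mul_conj, mul_conj]; exact_mod_cast h.onGroup z hz
  rw [h.fderiv_a z hz, h.fderiv_b z hz, mcA, mcB]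
  linear_combination -(φ z v) * hg

/-- The connection form in terms of the derivative of the map to the group. -/
theorem IsGroupLift.β_eq (h : IsGroupLift κ U a b φ β) (hz : z ∈ U) (v : ℂ) :
    β z v = (conj (a z) * fderiv ℝ a z v
      + ((κ / 4 : ℝ) : ℂ) * (conj (b z) * fderiv ℝ b z v)).im := by
  have hg : a z * conj (a z) + ((κ / 4 : ℝ) : ℂ) * (b z * conj (b z)) = 1 := by
    rw [mul_conj, mul_conj]; exact_mod_cast h.onGroup z hz
  have : conj (a z) * fderiv ℝ a z v + ((κ / 4 : ℝ) : ℂ) * (conj (b z) * fderiv ℝ b z v)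
      = I * β z v := by
    rw [h.fderiv_a z hz, h.fderiv_b z hz, mcA, mcB]
    linear_combination (I * β z v) * hg
  rw [this]
  simp

/-- The structure equation for the horizontal form. -/
theorem IsGroupLift.curl_φ (h : IsGroupLift κ U a b φ β) (hU : IsOpen U) (hz : z ∈ U) (v w : ℂ) :
    curl φ z v w = 2 * I * (β z v * φ z w - β z w * φ z v) := by
  have hg : a z * conj (a z) + ((κ / 4 : ℝ) : ℂ) * (b z * conj (b z)) = 1 := by
    rw [mul_conj, mul_conj]; exact_mod_cast h.onGroup z hz
  have key : ∀ v w : ℂ, HasDerivAt (fun t : ℝ => a (z + t • v) * fderiv ℝ b (z + t • v) w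
      - b (z + t • v) * fderiv ℝ a (z + t • v) w)
      (mcA κ (a z) (b z) (φ z v) (β z v) * fderiv ℝ b z w + a z * fderiv ℝ (fderiv ℝ b) z v w
        - (mcB (a z) (b z) (φ z v) (β z v) * fderiv ℝ a z w
          + b z * fderiv ℝ (fderiv ℝ a) z v w)) 0 := by
    intro v w
    have ha := hasDerivAt_line_apply (differentiableAt_of_contDiffOn hU
      (contDiffOn_fderiv hU h.contDiffOn_a) hz) v w
    have hb := hasDerivAt_line_apply (differentiableAt_of_contDiffOn hU
      (contDiffOn_fderiv hU h.contDiffOn_b) hz) v w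
    refine (((h.line_a hU hz v).mul hb).sub ((h.line_b hU hz v).mul ha)).congr_deriv ?_
    simp
  rw [curl_eq_of_line hU hz (differentiableAt_of_contDiffOn hU h.contDiffOn_φ hz)
    (fun z hz v => h.φ_eq hz v) (key v w) (key w v),
    fderiv_fderiv_comm hU h.contDiffOn_a hz w v, fderiv_fderiv_comm hU h.contDiffOn_b hz w v,
    h.fderiv_a z hz, h.fderiv_b z hz, h.fderiv_a z hz, h.fderiv_b z hz]
  simp only [mcA, mcB]
  linear_combination (2 * I * (β z v * φ z w - β z w * φ z v)) * hg

/-- The structure equation for the connection form: `κ` is the curvature of the base. -/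
theorem IsGroupLift.curl_β (h : IsGroupLift κ U a b φ β) (hU : IsOpen U) (hz : z ∈ U) (v w : ℂ) :
    curl β z v w = κ / 2 * (conj (φ z v) * φ z w).im := by
  have hg := h.onGroup z hz
  have key : ∀ v w : ℂ, HasDerivAt (fun t : ℝ => (conj (a (z + t • v)) * fderiv ℝ a (z + t • v) w
      + ((κ / 4 : ℝ) : ℂ) * (conj (b (z + t • v)) * fderiv ℝ b (z + t • v) w)).im)
      ((conj (mcA κ (a z) (b z) (φ z v) (β z v)) * fderiv ℝ a z w
        + conj (a z) * fderiv ℝ (fderiv ℝ a) z v w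
        + ((κ / 4 : ℝ) : ℂ) * (conj (mcB (a z) (b z) (φ z v) (β z v)) * fderiv ℝ b z w
          + conj (b z) * fderiv ℝ (fderiv ℝ b) z v w)).im) 0 := by
    intro v w
    have ha := hasDerivAt_line_apply (differentiableAt_of_contDiffOn hU
      (contDiffOn_fderiv hU h.contDiffOn_a) hz) v w
    have hb := hasDerivAt_line_apply (differentiableAt_of_contDiffOn hU
      (contDiffOn_fderiv hU h.contDiffOn_b) hz) v w
    refine (hasDerivAt_im (((hasDerivAt_conj (h.line_a hU hz v)).mul ha).add
      (((hasDerivAt_conj (h.line_b hU hz v)).mul hb).const_mul _))).congr_deriv ?_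
    simp
  rw [curl_eq_of_line hU hz (differentiableAt_of_contDiffOn hU h.contDiffOn_β hz)
    (fun z hz v => h.β_eq hz v) (key v w) (key w v),
    fderiv_fderiv_comm hU h.contDiffOn_a hz w v, fderiv_fderiv_comm hU h.contDiffOn_b hz w v,
    h.fderiv_a z hz, h.fderiv_b z hz, h.fderiv_a z hz, h.fderiv_b z hz]
  simp only [OnGroup, normSq_apply] at hg
  simp only [mcA, mcB, map_mul, map_sub, map_add, map_neg, map_pow, conj_I, conj_ofReal, Complex.conj_conj,
    mul_re, mul_im, sub_re, sub_im, add_re, add_im, neg_re, neg_im, I_re, I_im, ofReal_re, ofReal_im,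
    conj_re, conj_im, pow_two, one_re, one_im, zero_re, zero_im]
  linear_combination (κ / 2 * ((φ z v).re * (φ z w).im - (φ z v).im * (φ z w).re)) * hg

/-- The exterior derivative of the differential of the height. -/
theorem IsGroupLift.curl_mcS (h : IsGroupLift κ U a b φ β) (hU : IsOpen U) (hz : z ∈ U)
    {σ : ℂ → ℂ →L[ℝ] ℝ} (hσ : ContDiffOn ℝ ∞ σ U) (hη : ContDiffOn ℝ ∞ η U)
    (hs : ∀ z ∈ U, ∀ v, σ z v = mcS κ τ (a z) (b z) (φ z v) (η z v) (β z v)) (v w : ℂ) :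
    curl σ z v w = curl η z v w + 2 * τ * (conj (φ z v) * φ z w).im := by
  have hσd := differentiableAt_of_contDiffOn hU hσ hz
  have hηd := differentiableAt_of_contDiffOn hU hη hz
  by_cases hκ : 0 < κ
  · simp only [mcS, hκ, if_true] at hs
    have key : ∀ v w : ℂ, HasDerivAt (fun t : ℝ => η (z + t • v) w + 4 * τ / κ * β (z + t • v) w)
        (fderiv ℝ η z v w + 4 * τ / κ * fderiv ℝ β z v w) 0 := fun v w =>
      (hasDerivAt_line_apply hηd v w).add ((hasDerivAt_line_apply
        (differentiableAt_of_contDiffOn hU h.contDiffOn_β hz) v w).const_mul _)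
    have hβ := h.curl_β hU hz v w
    rw [curl_eq_of_line hU hz hσd hs (key v w) (key w v)]
    rw [curl] at hβ ⊢
    have hk : 4 * τ / κ * (κ / 2) = 2 * τ := by field_simp; ring
    linear_combination (4 * τ / κ) * hβ + (conj (φ z v) * φ z w).im * hk
  · have hane := (h.onGroup z hz).ne_zero hκ
    simp only [mcS, hκ, if_false] at hs
    have key : ∀ v w : ℂ, HasDerivAt (fun t : ℝ => η (z + t • v) w
        + τ * (conj (b (z + t • v)) * φ (z + t • v) w / a (z + t • v)).im)
        (fderiv ℝ η z v w + τ * (((conj (mcB (a z) (b z) (φ z v) (β z v)) * φ z w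
          + conj (b z) * fderiv ℝ φ z v w) * a z
          - conj (b z) * φ z w * mcA κ (a z) (b z) (φ z v) (β z v)) / a z ^ 2).im) 0 := by
      intro v w
      have hd := ((hasDerivAt_conj (h.line_b hU hz v)).mul (hasDerivAt_line_apply
        (differentiableAt_of_contDiffOn hU h.contDiffOn_φ hz) v w)).div (h.line_a hU hz v)
        (by simpa using hane)
      refine ((hasDerivAt_line_apply hηd v w).add
        ((hasDerivAt_im hd).const_mul τ)).congr_deriv ?_
      simp
    have hφ := h.curl_φ hU hz v w
    rw [curl_eq_of_line hU hz hσd hs (key v w) (key w v)]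
    rw [curl, sub_eq_iff_eq_add] at hφ
    rw [curl, hφ]
    have e : ((conj (mcB (a z) (b z) (φ z v) (β z v)) * φ z w + conj (b z) *
          (2 * I * (β z v * φ z w - β z w * φ z v) + fderiv ℝ φ z w v)) * a z
          - conj (b z) * φ z w * mcA κ (a z) (b z) (φ z v) (β z v)) / a z ^ 2
        = ((conj (mcB (a z) (b z) (φ z w) (β z w)) * φ z v
          + conj (b z) * fderiv ℝ φ z w v) * a z
          - conj (b z) * φ z v * mcA κ (a z) (b z) (φ z w) (β z w)) / a z ^ 2
          + (conj (φ z v) * φ z w - conj (φ z w) * φ z v) := by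
      simp only [mcA, mcB, map_add, map_mul, conj_I, conj_ofReal, Complex.conj_conj]
      field_simp
      ring
    rw [e, add_im]
    simp only [map_mul, map_sub, map_add, map_neg, map_pow, conj_I, conj_ofReal, Complex.conj_conj,
    mul_re, mul_im, sub_re, sub_im, add_re, add_im, neg_re, neg_im, I_re, I_im, ofReal_re, ofReal_im,
    conj_re, conj_im, pow_two, one_re, one_im, zero_re, zero_im]
    ring

/-- The structure equation for the vertical form: `τ` is the curvature of the fibration. -/
theorem IsLift.curl_η (h : IsLift κ τ U a b s φ η β) (hU : IsOpen U) (hz : z ∈ U) (v w : ℂ) :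
    curl η z v w = -(2 * τ * (conj (φ z v) * φ z w).im) := by
  have h1 := h.curl_mcS hU hz (contDiffOn_fderiv hU h.contDiffOn_s) h.contDiffOn_η h.fderiv_s v w
  rw [curl, fderiv_fderiv_comm hU h.contDiffOn_s hz w v, sub_self] at h1
  linarith

/-- A smooth map to the group and a smooth height have a Maurer-Cartan form. -/
theorem exists_isLift (κ τ : ℝ) (hU : IsOpen U) (ha : ContDiffOn ℝ ∞ a U)
    (hb : ContDiffOn ℝ ∞ b U) (hs : ContDiffOn ℝ ∞ s U) (hg : ∀ z ∈ U, OnGroup κ (a z) (b z)) :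
    ∃ φ η β, IsLift κ τ U a b s φ η β := by
  have ha' := contDiffOn_fderiv hU ha
  have hb' := contDiffOn_fderiv hU hb
  have hs' := contDiffOn_fderiv hU hs
  let M := ContinuousLinearMap.mul ℝ ℂ
  let φ : ℂ → ℂ →L[ℝ] ℂ := fun z => (M (a z)).comp (fderiv ℝ b z) - (M (b z)).comp (fderiv ℝ a z)
  let β : ℂ → ℂ →L[ℝ] ℝ := fun z => imCLM.comp ((M (conj (a z))).comp (fderiv ℝ a z)
    + (M (((κ / 4 : ℝ) : ℂ) * conj (b z))).comp (fderiv ℝ b z))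
  let η : ℂ → ℂ →L[ℝ] ℝ := fun z => fderiv ℝ s z
    - if 0 < κ then (4 * τ / κ) • β z else τ • imCLM.comp ((M (conj (b z) / a z)).comp (φ z))
  have hM : ∀ f : ℂ → ℂ, ContDiffOn ℝ ∞ f U → ContDiffOn ℝ ∞ (fun z => M (f z)) U :=
    fun f hf => M.contDiff.comp_contDiffOn hf
  have hφ : ContDiffOn ℝ ∞ φ U := ((hM _ ha).clm_comp hb').sub ((hM _ hb).clm_comp ha')
  have hβ : ContDiffOn ℝ ∞ β U := contDiffOn_const.clm_comp
    (((hM _ (contDiffOn_conj ha)).clm_comp ha').add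
      ((hM _ (contDiffOn_const.mul (contDiffOn_conj hb))).clm_comp hb'))
  have hη : ContDiffOn ℝ ∞ η U := by
    by_cases hκ : 0 < κ
    · simp only [η, hκ, if_true]
      exact hs'.sub (hβ.const_smul _)
    · simp only [η, hκ, if_false]
      exact hs'.sub ((contDiffOn_const.clm_comp ((hM _ (contDiffOn_complex_div
        (contDiffOn_conj hb) ha fun z hz => (hg z hz).ne_zero hκ)).clm_comp hφ)).const_smul τ)
  have hre : ∀ z ∈ U, ∀ v, conj (a z) * fderiv ℝ a z v
      + ((κ / 4 : ℝ) : ℂ) * (conj (b z) * fderiv ℝ b z v) = I * β z v := by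
    intro z hz v
    have h1 : HasDerivAt (fun t : ℝ => normSq (a (z + t • v)) + κ / 4 * normSq (b (z + t • v)))
        (2 * (conj (a z) * fderiv ℝ a z v
          + ((κ / 4 : ℝ) : ℂ) * (conj (b z) * fderiv ℝ b z v)).re) 0 := by
      have la := hasDerivAt_line (differentiableAt_of_contDiffOn hU ha hz) v
      have lb := hasDerivAt_line (differentiableAt_of_contDiffOn hU hb hz) v
      simp only [normSq_apply]
      have ra := hasDerivAt_re la
      have ia := hasDerivAt_im la
      have rb := hasDerivAt_re lb
      have ib := hasDerivAt_im lb
      refine (((ra.mul ra).add (ia.mul ia)).add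
        (((rb.mul rb).add (ib.mul ib)).const_mul _)).congr_deriv ?_
      simp only [zero_smul, add_zero, map_mul, map_sub, map_add, map_neg, map_pow, conj_I, conj_ofReal, Complex.conj_conj,
    mul_re, mul_im, sub_re, sub_im, add_re, add_im, neg_re, neg_im, I_re, I_im, ofReal_re, ofReal_im,
    conj_re, conj_im, pow_two, one_re, one_im, zero_re, zero_im]
      ring
    have h2 : HasDerivAt (fun t : ℝ => normSq (a (z + t • v)) + κ / 4 * normSq (b (z + t • v)))
        0 0 := (hasDerivAt_const (0 : ℝ) (1 : ℝ)).congr_of_eventuallyEq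
      ((eventually_line_mem hU hz v).mono fun t ht => hg _ ht)
    have h3 := h1.unique h2
    apply Complex.ext
    · rw [I_mul_re, ofReal_im, neg_zero]
      linarith
    · simp [β, M, mul_assoc]
  have hgc : ∀ z ∈ U, a z * conj (a z) + ((κ / 4 : ℝ) : ℂ) * (b z * conj (b z)) = 1 := by
    intro z hz
    rw [mul_conj, mul_conj]; exact_mod_cast hg z hz
  refine ⟨φ, η, β, ⟨⟨ha, hb, hφ, hβ, hg, fun z hz v => ?_, fun z hz v => ?_⟩, hs, hη,
    fun z hz v => ?_⟩⟩
  · have h1 := hre z hz v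
    have h2 := hgc z hz
    have h3 := hgc z hz
    simp only [mcA]
    have : φ z v = a z * fderiv ℝ b z v - b z * fderiv ℝ a z v := rfl
    rw [this]
    linear_combination (-(fderiv ℝ a z v)) * h2 + a z * h1
  · have h1 := hre z hz v
    have h2 := hgc z hz
    simp only [mcB]
    have : φ z v = a z * fderiv ℝ b z v - b z * fderiv ℝ a z v := rfl
    rw [this]
    linear_combination (-(fderiv ℝ b z v)) * h2 + b z * h1
  · by_cases hκ : 0 < κ
    · simp [mcS, η, hκ]
    · have : conj (b z) * φ z v / a z = conj (b z) / a z * φ z v := by ring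
      simp only [mcS, η, hκ, if_false, this]
      simp [M]

end Lift

/-! ### First order jets, gauge changes and rigidity of lifts -/

section Rigidity

open Complex ComplexConjugate

variable {κ τ : ℝ} {U : Set ℂ} {a b a' b' n : ℂ → ℂ} {s s' m : ℂ → ℝ} {φ : ℂ → ℂ →L[ℝ] ℂ}
  {η β : ℂ → ℂ →L[ℝ] ℝ} {z : ℂ}

theorem IsLift.contDiffOn_proj (h : IsLift κ τ U a b s φ η β) :
    ContDiffOn ℝ ∞ (fun z => proj κ τ (a z) (b z) (s z)) U :=
  HomSpace.contDiffOn_proj h.onGroup h.contDiffOn_a h.contDiffOn_b h.contDiffOn_s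

/-- `φ` and `η` are the components in the adapted frame of the differential of the projection. -/
theorem IsLift.fderiv_proj (h : IsLift κ τ U a b s φ η β) (hU : IsOpen U) (hz : z ∈ U) (v : ℂ) :
    fderiv ℝ (fun z => proj κ τ (a z) (b z) (s z)) z v
      = frame κ τ (a z) (b z) (s z) (φ z v) (η z v) := by
  have h1 := hasDerivAt_line (differentiableAt_of_contDiffOn hU h.contDiffOn_proj hz) v
  have h2 := proj_hasDerivAt (κ := κ) (τ := τ) (a := fun t : ℝ => a (z + t • v))
    (b := fun t : ℝ => b (z + t • v)) (s := fun t : ℝ => s (z + t • v)) (t := 0) (φ := φ z v)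
    (η := η z v) (β := β z v)
    (by simpa using h.onGroup z hz) (by simpa using h.line_a hU hz v)
    (by simpa using h.line_b hU hz v) (by simpa using h.line_s hU hz v)
  simpa using h1.unique h2

theorem IsLift.contDiffOn_frame (h : IsLift κ τ U a b s φ η β) (hn : ContDiffOn ℝ ∞ n U)
    (hm : ContDiffOn ℝ ∞ m U) :
    ContDiffOn ℝ ∞ (fun z => frame κ τ (a z) (b z) (s z) (n z) (m z)) U :=
  HomSpace.contDiffOn_frame h.onGroup h.contDiffOn_a h.contDiffOn_b h.contDiffOn_s hn hm

/-- The inner product of the covariant derivative of a vector field along a surface with a tangent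
vector, in terms of the coordinates in an adapted frame. -/
theorem IsLift.covDeriv_frame (h : IsLift κ τ U a b s φ η β) (hU : IsOpen U)
    (hn : ContDiffOn ℝ ∞ n U) (hm : ContDiffOn ℝ ∞ m U) (hz : z ∈ U) (v : ℂ) (n₂ : ℂ) (m₂ : ℝ) :
    metric κ τ (proj κ τ (a z) (b z) (s z))
        (fderiv ℝ (fun z => frame κ τ (a z) (b z) (s z) (n z) (m z)) z v)
        (frame κ τ (a z) (b z) (s z) n₂ m₂)
      + christoffel κ τ (proj κ τ (a z) (b z) (s z))
        (frame κ τ (a z) (b z) (s z) (φ z v) (η z v))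
        (frame κ τ (a z) (b z) (s z) (n z) (m z)) (frame κ τ (a z) (b z) (s z) n₂ m₂)
      = ((fderiv ℝ n z v - I * ((2 * β z v + τ * η z v : ℝ) : ℂ) * n z
          - I * ((τ * m z : ℝ) : ℂ) * φ z v) * conj n₂).re
        + (fderiv ℝ m z v + τ * (n z * conj (φ z v)).im) * m₂ := by
  have h1 := hasDerivAt_line
    (differentiableAt_of_contDiffOn hU (h.contDiffOn_frame hn hm) hz) v
  obtain ⟨D, h2, h3⟩ := frame_leviCivita (κ := κ) (τ := τ) (a := fun t : ℝ => a (z + t • v))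
    (b := fun t : ℝ => b (z + t • v)) (s := fun t : ℝ => s (z + t • v))
    (n := fun t : ℝ => n (z + t • v)) (m := fun t : ℝ => m (z + t • v)) (t := 0) (φ := φ z v)
    (η := η z v) (β := β z v)
    (by simpa using h.onGroup z hz) (by simpa using h.line_a hU hz v)
    (by simpa using h.line_b hU hz v) (by simpa using h.line_s hU hz v)
    (hasDerivAt_line (differentiableAt_of_contDiffOn hU hn hz) v)
    (hasDerivAt_line (differentiableAt_of_contDiffOn hU hm hz) v)
  rw [h1.unique h2]
  simpa using h3 n₂ m₂

theorem IsLift.mono {V : Set ℂ} (h : IsLift κ τ U a b s φ η β) (hV : V ⊆ U) :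
    IsLift κ τ V a b s φ η β :=
  ⟨⟨h.contDiffOn_a.mono hV, h.contDiffOn_b.mono hV, h.contDiffOn_φ.mono hV,
    h.contDiffOn_β.mono hV, fun z hz => h.onGroup z (hV hz), fun z hz => h.fderiv_a z (hV hz),
    fun z hz => h.fderiv_b z (hV hz)⟩, h.contDiffOn_s.mono hV, h.contDiffOn_η.mono hV,
    fun z hz => h.fderiv_s z (hV hz)⟩

theorem IsLift.congr_forms {φ' : ℂ → ℂ →L[ℝ] ℂ} {η' β' : ℂ → ℂ →L[ℝ] ℝ}
    (h : IsLift κ τ U a b s φ η β) (hφ : ∀ z ∈ U, φ' z = φ z) (hη : ∀ z ∈ U, η' z = η z)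
    (hβ : ∀ z ∈ U, β' z = β z) : IsLift κ τ U a b s φ' η' β' :=
  ⟨⟨h.contDiffOn_a, h.contDiffOn_b, h.contDiffOn_φ.congr hφ,
    h.contDiffOn_β.congr hβ, h.onGroup, fun z hz => by rw [hφ z hz, hβ z hz]; exact h.fderiv_a z hz,
    fun z hz => by rw [hφ z hz, hβ z hz]; exact h.fderiv_b z hz⟩, h.contDiffOn_s,
    h.contDiffOn_η.congr hη,
    fun z hz => by rw [hφ z hz, hη z hz, hβ z hz]; exact h.fderiv_s z hz⟩

/-- A lift remains a lift after a rotation of the adapted frame by the angle `2 γ`. -/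
theorem IsLift.gauge {γ : ℂ → ℝ} {φ' : ℂ → ℂ →L[ℝ] ℂ} (h : IsLift κ τ U a b s φ η β)
    (hU : IsOpen U) (hγ : ContDiffOn ℝ ∞ γ U) (hφ' : ContDiffOn ℝ ∞ φ' U)
    (hφ : ∀ z ∈ U, ∀ v, φ' z v = exp (γ z * I) ^ 2 * φ z v) :
    IsLift κ τ U (fun z => exp (γ z * I) * a z) (fun z => exp (γ z * I) * b z)
      (fun z => gaugeS κ τ (s z) (γ z)) φ' η (fun z => β z + fderiv ℝ γ z) := by
  have he : ContDiffOn ℝ ∞ (fun z => exp (γ z * I)) U := contDiffOn_complex_exp (by fun_prop)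
  have hA := he.mul h.contDiffOn_a
  have hB := he.mul h.contDiffOn_b
  have hS : ContDiffOn ℝ ∞ (fun z => gaugeS κ τ (s z) (γ z)) U := by
    unfold gaugeS
    split_ifs
    · exact h.contDiffOn_s.add (hγ.const_smul (4 * τ / κ))
    · simpa using h.contDiffOn_s
  have hle : ∀ z ∈ U, ∀ v, HasDerivAt (fun t : ℝ => exp (γ (z + t • v) * I))
      (exp (γ z * I) * (fderiv ℝ γ z v * I)) 0 := by
    intro z hz v
    have h1 := (hasDerivAt_line (differentiableAt_of_contDiffOn hU hγ hz) v).ofReal_comp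
    simpa using (h1.mul_const I).cexp
  have hne : ∀ z, exp (-(γ z * I)) * exp (γ z * I) = 1 := fun z => by rw [← exp_add]; simp
  refine ⟨⟨hA, hB, hφ', h.contDiffOn_β.add (contDiffOn_fderiv hU hγ),
    fun z hz => (h.onGroup z hz).gauge _, fun z hz v => ?_, fun z hz v => ?_⟩, hS, h.contDiffOn_η,
    fun z hz v => ?_⟩
  · refine (hasDerivAt_line (differentiableAt_of_contDiffOn hU hA hz) v).unique ?_
    refine ((hle z hz v).mul (h.line_a hU hz v)).congr_deriv ?_
    rw [hφ z hz]
    simp only [mcA, zero_smul, add_zero, map_mul, conj_exp_mul_I, add_apply, ofReal_add]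
    linear_combination (exp (γ z * I) * ((κ / 4 : ℝ) : ℂ) * φ z v * conj (b z)) * hne z
  · refine (hasDerivAt_line (differentiableAt_of_contDiffOn hU hB hz) v).unique ?_
    refine ((hle z hz v).mul (h.line_b hU hz v)).congr_deriv ?_
    rw [hφ z hz]
    simp only [mcB, zero_smul, add_zero, map_mul, conj_exp_mul_I, add_apply, ofReal_add]
    linear_combination -(exp (γ z * I) * φ z v * conj (a z)) * hne z
  · refine (hasDerivAt_line (differentiableAt_of_contDiffOn hU hS hz) v).unique ?_
    rw [hφ z hz]
    by_cases hκ : 0 < κ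
    · simp only [gaugeS, mcS, hκ, if_true]
      refine ((h.line_s hU hz v).add ((hasDerivAt_line
        (differentiableAt_of_contDiffOn hU hγ hz) v).const_mul _)).congr_deriv ?_
      simp only [mcS, hκ, if_true, add_apply]
      ring
    · simp only [gaugeS, mcS, hκ, if_false, add_zero]
      refine (h.line_s hU hz v).congr_deriv ?_
      simp only [mcS, hκ, if_false, map_mul, conj_exp_mul_I]
      have hane := (h.onGroup z hz).ne_zero hκ
      have e : exp (-(γ z * I)) * conj (b z) * (exp (γ z * I) ^ 2 * φ z v)
          / (exp (γ z * I) * a z) = conj (b z) * φ z v / a z := by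
        have := exp_ne_zero (γ z * I)
        field_simp
        linear_combination (conj (b z) * φ z v) * hne z
      rw [e]

/-- Two lifts with the same Maurer-Cartan forms which agree at a point coincide. -/
theorem IsLift.eqOn (h : IsLift κ τ U a b s φ η β) (h' : IsLift κ τ U a' b' s' φ η β)
    (hU : IsOpen U) (hc : IsPreconnected U) {q : ℂ} (hq : q ∈ U) (ha : a' q = a q)
    (hb : b' q = b q) (hs : s' q = s q) : ∀ z ∈ U, a' z = a z ∧ b' z = b z ∧ s' z = s z := by
  have hgc : ∀ z ∈ U, a z * conj (a z) + ((κ / 4 : ℝ) : ℂ) * (b z * conj (b z)) = 1 := by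
    intro z hz
    rw [mul_conj, mul_conj]; exact_mod_cast h.onGroup z hz
  have hA : ∀ z ∈ U, a' z * conj (a z) + ((κ / 4 : ℝ) : ℂ) * (conj (b' z) * b z) = 1 := by
    intro z hz
    have hd : ContDiffOn ℝ ∞ (fun z => a' z * conj (a z)
        + ((κ / 4 : ℝ) : ℂ) * (conj (b' z) * b z)) U := by
      have := h.contDiffOn_a; have := h.contDiffOn_b
      have := h'.contDiffOn_a; have := h'.contDiffOn_b
      fun_prop
    have hconst := hU.is_const_of_fderiv_eq_zero hc (hd.differentiableOn (by simp)) (fun w hw => by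
      ext1 v
      refine (hasDerivAt_line (differentiableAt_of_contDiffOn hU hd hw) v).unique ?_
      refine (((h'.line_a hU hw v).mul (hasDerivAt_conj (h.line_a hU hw v))).add
        (((hasDerivAt_conj (h'.line_b hU hw v)).mul (h.line_b hU hw v)).const_mul _)).congr_deriv ?_
      simp only [mcA, mcB, map_add, map_sub, map_mul, conj_I, conj_ofReal, Complex.conj_conj,
        zero_smul, add_zero, Pi.zero_apply, zero_apply]
      ring) hz hq
    rw [hconst, ha, hb, mul_comm (conj (b q)), hgc q hq]
  have hB : ∀ z ∈ U, b' z * conj (a z) - conj (a' z) * b z = 0 := by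
    intro z hz
    have hd : ContDiffOn ℝ ∞ (fun z => b' z * conj (a z) - conj (a' z) * b z) U := by
      have := h.contDiffOn_a; have := h.contDiffOn_b
      have := h'.contDiffOn_a; have := h'.contDiffOn_b
      fun_prop
    have hconst := hU.is_const_of_fderiv_eq_zero hc (hd.differentiableOn (by simp)) (fun w hw => by
      ext1 v
      refine (hasDerivAt_line (differentiableAt_of_contDiffOn hU hd hw) v).unique ?_
      refine (((h'.line_b hU hw v).mul (hasDerivAt_conj (h.line_a hU hw v))).sub
        ((hasDerivAt_conj (h'.line_a hU hw v)).mul (h.line_b hU hw v))).congr_deriv ?_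
      simp only [mcA, mcB, map_add, map_sub, map_mul, conj_I, conj_ofReal, Complex.conj_conj,
        zero_smul, add_zero, Pi.zero_apply, zero_apply]
      ring) hz hq
    rw [hconst, ha, hb]
    ring
  have hab : ∀ z ∈ U, a' z = a z ∧ b' z = b z := by
    intro z hz
    have h1 := hgc z hz
    have h2 := hA z hz
    have h3 := hB z hz
    have h2' := congrArg conj h2
    have h3' := congrArg conj h3
    simp only [map_add, map_sub, map_mul, conj_ofReal, Complex.conj_conj, map_one, map_zero]
      at h2' h3'
    constructor
    · linear_combination (-(a' z)) * h1 + (a z) * h2 - ((κ / 4 : ℝ) : ℂ) * b z * h3'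
    · linear_combination (-(b' z)) * h1 + (b z) * h2' + a z * h3
  refine fun z hz => ⟨(hab z hz).1, (hab z hz).2, ?_⟩
  have hds : ContDiffOn ℝ ∞ (fun z => s' z - s z) U := h'.contDiffOn_s.sub h.contDiffOn_s
  have hconst := hU.is_const_of_fderiv_eq_zero hc (hds.differentiableOn (by simp)) (fun w hw => by
    ext1 v
    refine (hasDerivAt_line (differentiableAt_of_contDiffOn hU hds hw) v).unique ?_
    refine ((h'.line_s hU hw v).sub (h.line_s hU hw v)).congr_deriv ?_
    rw [(hab w hw).1, (hab w hw).2]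
    simp) hz hq
  linarith

end Rigidity

/-! ### Existence of lifts, and lifts of the same point -/

section LocalLift

open Complex ComplexConjugate

variable {κ τ : ℝ}

theorem phase_zero (κ τ : ℝ) : phase κ τ 0 = 1 := by simp [phase]

/-- A smooth map to `E(κ, τ)` has smooth local lifts to the group. -/
theorem exists_local_lift {U : Set ℂ} (hU : IsOpen U) {y : ℂ → R4} (hy : ContDiffOn ℝ ∞ y U)
    (hmem : ∀ z ∈ U, y z ∈ carrier κ τ) {z₀ : ℂ} (hz₀ : z₀ ∈ U) :
    ∃ V ⊆ U, IsOpen V ∧ z₀ ∈ V ∧ ∃ (a b : ℂ → ℂ) (s : ℂ → ℝ), ContDiffOn ℝ ∞ a V ∧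
      ContDiffOn ℝ ∞ b V ∧ ContDiffOn ℝ ∞ s V ∧ (∀ z ∈ V, OnGroup κ (a z) (b z)) ∧
      ∀ z ∈ V, proj κ τ (a z) (b z) (s z) = y z := by
  have hyi : ∀ i, ContDiffOn ℝ ∞ (fun z => y z i) U := fun i => contDiffOn_pi.1 hy i
  have hy0 := hyi 0
  have hy1 := hyi 1
  have hy2 := hyi 2
  have hy3 := hyi 3
  by_cases hκ : 0 < κ
  · have hsq : 0 < √κ := Real.sqrt_pos.2 hκ
    have hsq2 : √κ ^ 2 = κ := Real.sq_sqrt hκ.le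
    by_cases hτ : τ = 0
    · subst hτ
      simp only [carrier, hκ, if_true, Set.mem_ofPred_eq] at hmem
      have hns : ∀ z, normSq (y z 0 + y z 1 * I) = y z 0 ^ 2 + y z 1 ^ 2 := fun z => by
        rw [normSq_add_mul_I]
      by_cases ht : -1 < √κ * y z₀ 2
      · have hV : IsOpen (U ∩ (fun z => √κ * y z 2) ⁻¹' Set.Ioi (-1)) :=
          (contDiffOn_const.mul hy2).continuousOn.isOpen_inter_preimage hU isOpen_Ioi
        refine ⟨_, Set.inter_subset_left, hV, ⟨hz₀, ht⟩,
          fun z => (√((1 + √κ * y z 2) / 2) : ℝ),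
          fun z => (y z 0 + y z 1 * I) / (√((1 + √κ * y z 2) / 2) : ℝ), fun z => y z 3, ?_⟩
        have hpos : ∀ z ∈ U ∩ (fun z => √κ * y z 2) ⁻¹' Set.Ioi (-1),
            0 < (1 + √κ * y z 2) / 2 := fun z hz => by
          have : -1 < √κ * y z 2 := hz.2
          linarith
        have hr : ContDiffOn ℝ ∞ (fun z => √((1 + √κ * y z 2) / 2))
            (U ∩ (fun z => √κ * y z 2) ⁻¹' Set.Ioi (-1)) := by
          refine ContDiffOn.sqrt ?_ fun z hz => (hpos z hz).ne'
          have := hy2.mono (Set.inter_subset_left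
            (t := (fun z => √κ * y z 2) ⁻¹' Set.Ioi (-1)))
          fun_prop
        have hra := contDiffOn_ofReal hr
        have key : ∀ z ∈ U ∩ (fun z => √κ * y z 2) ⁻¹' Set.Ioi (-1),
            normSq ((√((1 + √κ * y z 2) / 2) : ℝ) : ℂ) = (1 + √κ * y z 2) / 2 ∧
            κ / 4 * normSq ((y z 0 + y z 1 * I) / (√((1 + √κ * y z 2) / 2) : ℝ))
              = (1 - √κ * y z 2) / 2 := by
          intro z hz
          have hp := hpos z hz
          have h1 : normSq ((√((1 + √κ * y z 2) / 2) : ℝ) : ℂ) = (1 + √κ * y z 2) / 2 := by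
            rw [normSq_ofReal, Real.mul_self_sqrt hp.le]
          refine ⟨h1, ?_⟩
          rw [normSq_div, h1, hns]
          have h2 := hmem z hz.1
          have h3 : y z 0 ^ 2 + y z 1 ^ 2 = (1 - (√κ * y z 2) ^ 2) / κ := by
            rw [mul_pow, hsq2, sub_div, ← h2]
            field_simp
            ring
          rw [h3]
          have : 1 + √κ * y z 2 ≠ 0 := by linarith
          field_simp
          ring
        refine ⟨hra, ?_, hy3.mono Set.inter_subset_left, fun z hz => ?_, fun z hz => ?_⟩
        · refine contDiffOn_complex_div ?_ hra fun z hz => ?_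
          · have := hy0.mono (Set.inter_subset_left
              (t := (fun z => √κ * y z 2) ⁻¹' Set.Ioi (-1)))
            have := hy1.mono (Set.inter_subset_left
              (t := (fun z => √κ * y z 2) ⁻¹' Set.Ioi (-1)))
            fun_prop
          · exact ofReal_ne_zero.2 (Real.sqrt_pos.2 (hpos z hz)).ne'
        · rw [OnGroup, (key z hz).1, (key z hz).2]
          ring
        · have hne : ((√((1 + √κ * y z 2) / 2) : ℝ) : ℂ) ≠ 0 :=
            ofReal_ne_zero.2 (Real.sqrt_pos.2 (hpos z hz)).ne'
          rw [proj_product hκ, conj_ofReal, mul_div_cancel₀ _ hne, (key z hz).1, (key z hz).2]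
          funext i
          fin_cases i
          · simp
          · simp
          · simp
            field_simp
            ring
          · rfl
      · have hV : IsOpen (U ∩ (fun z => √κ * y z 2) ⁻¹' Set.Iio 1) :=
          (contDiffOn_const.mul hy2).continuousOn.isOpen_inter_preimage hU isOpen_Iio
        refine ⟨_, Set.inter_subset_left, hV, ⟨hz₀, show √κ * y z₀ 2 < 1 by linarith⟩,
          fun z => conj (y z 0 + y z 1 * I) / (√(2 * (1 - √κ * y z 2) / κ) : ℝ),
          fun z => (√(2 * (1 - √κ * y z 2) / κ) : ℝ), fun z => y z 3, ?_⟩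
        have hpos : ∀ z ∈ U ∩ (fun z => √κ * y z 2) ⁻¹' Set.Iio 1,
            0 < 2 * (1 - √κ * y z 2) / κ := fun z hz => by
          have : √κ * y z 2 < 1 := hz.2
          have : 0 < 1 - √κ * y z 2 := by linarith
          positivity
        have hr : ContDiffOn ℝ ∞ (fun z => √(2 * (1 - √κ * y z 2) / κ))
            (U ∩ (fun z => √κ * y z 2) ⁻¹' Set.Iio 1) := by
          refine ContDiffOn.sqrt ?_ fun z hz => (hpos z hz).ne'
          have := hy2.mono (Set.inter_subset_left
            (t := (fun z => √κ * y z 2) ⁻¹' Set.Iio 1))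
          fun_prop
        have hra := contDiffOn_ofReal hr
        have key : ∀ z ∈ U ∩ (fun z => √κ * y z 2) ⁻¹' Set.Iio 1,
            κ / 4 * normSq ((√(2 * (1 - √κ * y z 2) / κ) : ℝ) : ℂ) = (1 - √κ * y z 2) / 2 ∧
            normSq (conj (y z 0 + y z 1 * I) / (√(2 * (1 - √κ * y z 2) / κ) : ℝ))
              = (1 + √κ * y z 2) / 2 := by
          intro z hz
          have hp := hpos z hz
          have h1 : normSq ((√(2 * (1 - √κ * y z 2) / κ) : ℝ) : ℂ)
              = 2 * (1 - √κ * y z 2) / κ := by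
            rw [normSq_ofReal, Real.mul_self_sqrt hp.le]
          refine ⟨by rw [h1]; field_simp; norm_num, ?_⟩
          rw [normSq_div, h1, normSq_conj, hns]
          have h2 := hmem z hz.1
          have h3 : y z 0 ^ 2 + y z 1 ^ 2 = (1 - (√κ * y z 2) ^ 2) / κ := by
            rw [mul_pow, hsq2, sub_div, ← h2]
            field_simp
            ring
          rw [h3]
          have h4 : √κ * y z 2 < 1 := hz.2
          have : 1 - √κ * y z 2 ≠ 0 := by linarith
          field_simp
          ring
        refine ⟨?_, hra, hy3.mono Set.inter_subset_left, fun z hz => ?_, fun z hz => ?_⟩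
        · refine contDiffOn_complex_div ?_ hra fun z hz => ?_
          · have := hy0.mono (Set.inter_subset_left
              (t := (fun z => √κ * y z 2) ⁻¹' Set.Iio 1))
            have := hy1.mono (Set.inter_subset_left
              (t := (fun z => √κ * y z 2) ⁻¹' Set.Iio 1))
            fun_prop
          · exact ofReal_ne_zero.2 (Real.sqrt_pos.2 (hpos z hz)).ne'
        · rw [OnGroup, (key z hz).1, (key z hz).2]
          ring
        · have hne : ((√(2 * (1 - √κ * y z 2) / κ) : ℝ) : ℂ) ≠ 0 :=
            ofReal_ne_zero.2 (Real.sqrt_pos.2 (hpos z hz)).ne'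
          rw [proj_product hκ, (key z hz).1, (key z hz).2, map_div₀, Complex.conj_conj,
            conj_ofReal, div_mul_cancel₀ _ hne]
          funext i
          fin_cases i
          · simp
          · simp
          · simp
            field_simp
            ring
          · rfl
    · simp only [carrier, hκ, hτ, if_true, if_false, Set.mem_ofPred_eq] at hmem
      refine ⟨U, subset_rfl, hU, hz₀, fun z => y z 0 - y z 1 * I,
        fun z => ((2 / √κ : ℝ) : ℂ) * (y z 2 + y z 3 * I), fun _ => 0, by fun_prop, by fun_prop,
        contDiffOn_const, fun z hz => ?_, fun z hz => ?_⟩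
      · have h1 : normSq ((2 / √κ : ℝ) : ℂ) = 4 / κ := by
          rw [normSq_ofReal, ← pow_two, div_pow, hsq2]; norm_num
        have h2 : normSq (y z 0 - y z 1 * I) = y z 0 ^ 2 + y z 1 ^ 2 := by
          simp [normSq_apply]; ring
        rw [OnGroup, map_mul, h1, h2, normSq_add_mul_I, ← hmem z hz]
        field_simp
        ring
      · rw [proj_sphere hκ hτ, phase_zero, one_mul, one_mul, ← mul_assoc, ← ofReal_mul]
        have : √κ / 2 * (2 / √κ) = 1 := by field_simp
        rw [this]
        funext i
        fin_cases i <;> simp [pair]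
  · simp only [carrier, hκ, if_false, Set.mem_ofPred_eq] at hmem
    have hr : ContDiffOn ℝ ∞ (fun z => √(1 + κ / 4 * (y z 0 ^ 2 + y z 1 ^ 2))) U :=
      ContDiffOn.sqrt (by fun_prop) fun z hz => (hmem z hz).1.ne'
    have hne : ∀ z ∈ U, √(1 + κ / 4 * (y z 0 ^ 2 + y z 1 ^ 2)) ≠ 0 := fun z hz =>
      (Real.sqrt_pos.2 (hmem z hz).1).ne'
    have hri := contDiffOn_ofReal (hr.inv hne)
    refine ⟨U, subset_rfl, hU, hz₀, fun z => ((√(1 + κ / 4 * (y z 0 ^ 2 + y z 1 ^ 2)))⁻¹ : ℝ),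
      fun z => ((√(1 + κ / 4 * (y z 0 ^ 2 + y z 1 ^ 2)))⁻¹ : ℝ) * (y z 0 + y z 1 * I),
      fun z => y z 2, hri, hri.mul (by fun_prop), hy2, fun z hz => ?_, fun z hz => ?_⟩
    · have h1 := (hmem z hz).1
      have h2 : normSq (((√(1 + κ / 4 * (y z 0 ^ 2 + y z 1 ^ 2)))⁻¹ : ℝ) : ℂ)
          = (1 + κ / 4 * (y z 0 ^ 2 + y z 1 ^ 2))⁻¹ := by
        rw [normSq_ofReal, ← mul_inv, Real.mul_self_sqrt h1.le]
      rw [OnGroup, map_mul, h2, normSq_add_mul_I]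
      have h3 := inv_mul_cancel₀ h1.ne'
      linear_combination h3
    · have h0 : (((√(1 + κ / 4 * (y z 0 ^ 2 + y z 1 ^ 2)))⁻¹ : ℝ) : ℂ) ≠ 0 :=
        ofReal_ne_zero.2 (inv_ne_zero (hne z hz))
      rw [proj_nonpos hκ, mul_div_cancel_left₀ _ h0]
      funext i
      fin_cases i
      · simp
      · simp
      · rfl
      · exact (hmem z hz).2.symm

/-- The group and the heights project onto `E(κ, τ)`. -/
theorem exists_proj_eq {p : R4} (hp : p ∈ carrier κ τ) :
    ∃ (a b : ℂ) (s : ℝ), OnGroup κ a b ∧ proj κ τ a b s = p := by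
  obtain ⟨V, -, -, hz, a, b, s, -, -, -, hg, hpr⟩ := exists_local_lift (κ := κ) (τ := τ)
    (y := fun _ => p) isOpen_univ contDiffOn_const (fun _ _ => hp) (Set.mem_univ 0)
  exact ⟨a 0, b 0, s 0, hg 0 hz, hpr 0 hz⟩

theorem exists_exp_of_normSq_eq_one {u : ℂ} (hu : normSq u = 1) : ∃ γ : ℝ, exp (γ * I) = u := by
  refine ⟨arg u, ?_⟩
  have h1 : ‖u‖ = 1 := by
    rw [normSq_eq_norm_sq] at hu
    exact (pow_eq_one_iff_of_nonneg (norm_nonneg u) two_ne_zero).1 hu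
  have := norm_mul_exp_arg_mul_I u
  rwa [h1, ofReal_one, one_mul] at this

/-- Two lifts of the same point of `E(κ, τ)` differ by a rotation of the adapted frame. -/
theorem exists_gauge_of_proj_eq {a b a' b' : ℂ} {s s' : ℝ} (h : OnGroup κ a b)
    (h' : OnGroup κ a' b') (hp : proj κ τ a' b' s' = proj κ τ a b s) :
    ∃ γ : ℝ, a' = exp (γ * I) * a ∧ b' = exp (γ * I) * b ∧ s' = gaugeS κ τ s γ := by
  by_cases hκ : 0 < κ
  · by_cases hτ : τ = 0
    · subst hτ
      rw [proj_product hκ, proj_product hκ] at hp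
      have h0 := congrFun hp 0
      have h1 := congrFun hp 1
      have h2 := congrFun hp 2
      have h3 := congrFun hp 3
      simp only [Matrix.cons_val] at h0 h1 h2 h3
      have hab : conj a' * b' = conj a * b := Complex.ext h0 h1
      have hsq : 0 < √κ := Real.sqrt_pos.2 hκ
      rw [div_left_inj' hsq.ne'] at h2
      have hna : normSq a' = normSq a := by rw [OnGroup] at h h'; linarith
      have hnb : normSq b' = normSq b := by
        have : κ / 4 * (normSq b' - normSq b) = 0 := by rw [OnGroup] at h h'; linarith
        have := (mul_eq_zero.1 this).resolve_left (by positivity)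
        linarith
      have hS : ∀ γ, s' = gaugeS κ 0 s γ := fun γ => by simp [gaugeS, h3]
      by_cases ha : a = 0
      · have ha' : a' = 0 := by rw [← normSq_eq_zero, hna, ha, map_zero]
        have hb : b ≠ 0 := by
          rintro rfl
          simp [OnGroup, ha] at h
        obtain ⟨γ, hγ⟩ := exists_exp_of_normSq_eq_one (u := b' / b) (by
          rw [normSq_div, hnb, div_self (by simpa using hb)])
        exact ⟨γ, by simp [ha, ha'], by rw [hγ, div_mul_cancel₀ _ hb], hS γ⟩
      · obtain ⟨γ, hγ⟩ := exists_exp_of_normSq_eq_one (u := a' / a) (by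
          rw [normSq_div, hna, div_self (by simpa using ha)])
        have ha' : a' ≠ 0 := by
          intro h0
          rw [h0, map_zero, eq_comm, normSq_eq_zero] at hna
          exact ha hna
        have hca : conj a' ≠ 0 := by simpa using ha'
        refine ⟨γ, by rw [hγ, div_mul_cancel₀ _ ha], ?_, hS γ⟩
        rw [hγ]
        apply mul_left_cancel₀ hca
        rw [hab]
        have : a' * conj a' = a * conj a := by rw [mul_conj, mul_conj, hna]
        field_simp
        linear_combination -b * this
    · rw [proj_sphere hκ hτ, proj_sphere hκ hτ] at hp
      have hpair : ∀ z w z' w' : ℂ, pair z w = pair z' w' → z = z' ∧ w = w' := by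
        intro z w z' w' hh
        have h0 := congrFun hh 0
        have h1 := congrFun hh 1
        have h2 := congrFun hh 2
        have h3 := congrFun hh 3
        simp only [pair, Matrix.cons_val] at h0 h1 h2 h3
        exact ⟨Complex.ext h0 (by linarith), Complex.ext h2 h3⟩
      obtain ⟨h1, h2⟩ := hpair _ _ _ _ hp
      have hk : ((√κ / 2 : ℝ) : ℂ) ≠ 0 := by
        have := Real.sqrt_pos.2 hκ
        exact ofReal_ne_zero.2 (by positivity)
      have hs' : s' = gaugeS κ τ s (κ / (4 * τ) * (s' - s)) := by
        rw [gaugeS, if_pos hκ]; field_simp; ring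
      have hph : phase κ τ s' * exp ((κ / (4 * τ) * (s' - s) : ℝ) * I) = phase κ τ s := by
        rw [hs', phase_gaugeS hκ hτ, ← hs', mul_assoc, ← exp_add, neg_add_cancel, exp_zero, mul_one]
      have hne : phase κ τ s' ≠ 0 := exp_ne_zero _
      refine ⟨κ / (4 * τ) * (s' - s), ?_, ?_, hs'⟩
      · apply mul_left_cancel₀ hne
        rw [h1, ← hph, mul_assoc]
      · apply mul_left_cancel₀ hne
        apply mul_left_cancel₀ hk
        linear_combination h2 - ((√κ / 2 : ℝ) : ℂ) * b * hph
  · have ha := h.ne_zero hκ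
    have ha' := h'.ne_zero hκ
    rw [proj_nonpos hκ, proj_nonpos hκ] at hp
    have h0 := congrFun hp 0
    have h1 := congrFun hp 1
    have h2 := congrFun hp 2
    simp only [Matrix.cons_val] at h0 h1 h2
    have hw : b' / a' = b / a := Complex.ext h0 h1
    have hnw : normSq b' / normSq a' = normSq b / normSq a := by
      rw [← normSq_div, ← normSq_div, hw]
    have hpa := normSq_pos.2 ha
    have hpa' := normSq_pos.2 ha'
    rw [div_eq_div_iff hpa'.ne' hpa.ne'] at hnw
    have hna : normSq a' = normSq a := by
      rw [OnGroup] at h h'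
      linear_combination (normSq a) * h' - (normSq a') * h - (κ / 4) * hnw
    obtain ⟨γ, hγ⟩ := exists_exp_of_normSq_eq_one (u := a' / a) (by
      rw [normSq_div, hna, div_self (by simpa using ha)])
    refine ⟨γ, by rw [hγ, div_mul_cancel₀ _ ha], ?_, by simp [gaugeS, hκ, h2]⟩
    rw [hγ]
    rw [div_eq_div_iff ha' ha] at hw
    field_simp
    linear_combination hw

end LocalLift

/-! ### Left translations and isometries of `E(κ, τ)` -/

section Isometry

open Complex ComplexConjugate

/-- First component of the product of the elements `(A, B)` and `(a, b)` of the group. -/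
def actA (κ : ℝ) (A B a b : ℂ) : ℂ := A * a - ((κ / 4 : ℝ) : ℂ) * conj B * b

/-- Second component of the product of the elements `(A, B)` and `(a, b)` of the group. -/
def actB (A B a b : ℂ) : ℂ := B * a + conj A * b

/-- The primitive `-(4/κ) log (1 - κ/4 u)` of `1 / (1 - κ/4 u)` (and `u` if `κ = 0`). -/
def shiftPrim (κ : ℝ) (u : ℂ) : ℂ :=
  if κ = 0 then u else -((4 / κ : ℝ) : ℂ) * log (1 - ((κ / 4 : ℝ) : ℂ) * u)

/-- The change of height, above the point `w` of the base, in the isometry of `E(κ, τ)` defined by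
the element `(A, B)` of the group: for `κ ≤ 0` the connection form of the fibration is invariant only
up to the differential of this function. -/
def shift (κ τ : ℝ) (A B w : ℂ) : ℝ :=
  if 0 < κ then 0 else τ * (shiftPrim κ (conj B / A * w)).im

/-- Height of the image of an element by the translation defined by `(A, B)` and `C`. -/
def actS (κ τ : ℝ) (A B : ℂ) (C : ℝ) (a b : ℂ) (s : ℝ) : ℝ := s + C + shift κ τ A B (b / a)

/-- The isometry of `E(κ, τ)` defined by the element `(A, B)` of the group and the vertical
translation `C`, extended to a map of `ℝ⁴`. -/
def translation (κ τ : ℝ) (A B : ℂ) (C : ℝ) (p : R4) : R4 :=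
  if 0 < κ then
    (if τ = 0 then
      ![(conj A ^ 2 * (p 0 + p 1 * I) - ((κ / 4 : ℝ) : ℂ) * B ^ 2 * conj (p 0 + p 1 * I)
          + conj A * B * ((√κ * p 2 : ℝ) : ℂ)).re,
        (conj A ^ 2 * (p 0 + p 1 * I) - ((κ / 4 : ℝ) : ℂ) * B ^ 2 * conj (p 0 + p 1 * I)
          + conj A * B * ((√κ * p 2 : ℝ) : ℂ)).im,
        (normSq A - κ / 4 * normSq B) * p 2 - √κ * (A * B * conj (p 0 + p 1 * I)).re, p 3 + C]
    else pair
      (phase κ τ C * (A * (p 0 - p 1 * I) - ((√κ / 2 : ℝ) : ℂ) * conj B * (p 2 + p 3 * I)))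
      (phase κ τ C * (((√κ / 2 : ℝ) : ℂ) * B * (p 0 - p 1 * I) + conj A * (p 2 + p 3 * I))))
  else
    ![((B + conj A * (p 0 + p 1 * I)) / (A - ((κ / 4 : ℝ) : ℂ) * conj B * (p 0 + p 1 * I))).re,
      ((B + conj A * (p 0 + p 1 * I)) / (A - ((κ / 4 : ℝ) : ℂ) * conj B * (p 0 + p 1 * I))).im,
      p 2 + C + shift κ τ A B (p 0 + p 1 * I), 0]

variable {κ τ : ℝ} {A B : ℂ} {C : ℝ}

theorem OnGroup.act {a b : ℂ} (hg : OnGroup κ A B) (h : OnGroup κ a b) :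
    OnGroup κ (actA κ A B a b) (actB A B a b) := by
  simp only [OnGroup, actA, actB, normSq_apply] at *
  simp only [map_mul, map_sub, map_add, map_neg, map_pow, conj_I, conj_ofReal, Complex.conj_conj,
    mul_re, mul_im, sub_re, sub_im, add_re, add_im, neg_re, neg_im, I_re, I_im, ofReal_re, ofReal_im,
    conj_re, conj_im, pow_two, one_re, one_im, zero_re, zero_im]
  linear_combination (a.re * a.re + a.im * a.im + κ / 4 * (b.re * b.re + b.im * b.im)) * hg + h

/-- The translations of `E(κ, τ)` lift to the left translations of the group. -/
theorem translation_proj {a b : ℂ} (ha : ¬0 < κ → a ≠ 0) (s : ℝ) :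
    translation κ τ A B C (proj κ τ a b s)
      = proj κ τ (actA κ A B a b) (actB A B a b) (actS κ τ A B C a b s) := by
  by_cases hκ : 0 < κ
  · have hS : actS κ τ A B C a b s = s + C := by simp [actS, shift, hκ]
    rw [hS]
    by_cases hτ : τ = 0
    · subst hτ
      obtain ⟨k, hk, hk4⟩ := exists_half_sqrt hκ.le
      have hk2 : √κ = 2 * k := by linarith
      have hk3 : κ = 4 * k ^ 2 := by linarith
      have hk0 : k ≠ 0 := by rintro rfl; simp [hκ.ne', Real.sqrt_eq_zero', hκ.not_ge] at hk2
      have hw : (((conj a * b).re : ℂ) + (conj a * b).im * I) = conj a * b := re_add_im _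
      simp only [translation, hκ, if_true, proj_product hκ, Matrix.cons_val, hw, actA, actB, hk4, hk2]
      funext i
      fin_cases i
      · simp only [normSq_apply, map_mul, map_sub, map_add, map_neg, map_pow, conj_I, conj_ofReal, Complex.conj_conj,
    mul_re, mul_im, sub_re, sub_im, add_re, add_im, neg_re, neg_im, I_re, I_im, ofReal_re, ofReal_im,
    conj_re, conj_im, pow_two, one_re, one_im, zero_re, zero_im, Matrix.cons_val]
        simp
        field_simp
        ring
      · simp only [normSq_apply, map_mul, map_sub, map_add, map_neg, map_pow, conj_I, conj_ofReal, Complex.conj_conj,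
    mul_re, mul_im, sub_re, sub_im, add_re, add_im, neg_re, neg_im, I_re, I_im, ofReal_re, ofReal_im,
    conj_re, conj_im, pow_two, one_re, one_im, zero_re, zero_im, Matrix.cons_val]
        simp
        field_simp
        ring
      · simp only [normSq_apply, map_mul, map_sub, map_add, map_neg, map_pow, conj_I, conj_ofReal, Complex.conj_conj,
    mul_re, mul_im, sub_re, sub_im, add_re, add_im, neg_re, neg_im, I_re, I_im, ofReal_re, ofReal_im,
    conj_re, conj_im, pow_two, one_re, one_im, zero_re, zero_im, Matrix.cons_val]
        simp
        field_simp
        ring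
      · simp
    · have hz : ∀ z w : ℂ, ((pair z w 0 : ℂ) - pair z w 1 * I) = z ∧
          ((pair z w 2 : ℂ) + pair z w 3 * I) = w := fun z w => by
        constructor <;> apply Complex.ext <;> simp [pair]
      have hph : phase κ τ (s + C) = phase κ τ C * phase κ τ s := by
        rw [phase, phase, phase, ← exp_add]
        congr 1
        push_cast
        ring
      obtain ⟨k, hk, hk4⟩ := exists_half_sqrt hκ.le
      simp only [translation, hκ, hτ, if_true, if_false, proj_sphere hκ hτ, (hz _ _).1, (hz _ _).2,
        hph, actA, actB, hk, hk4]
      congr 1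
      · push_cast; ring
      · ring
  · have ha := ha hκ
    have hw : (((b / a).re : ℂ) + (b / a).im * I) = b / a := re_add_im _
    simp only [translation, hκ, if_false, proj_nonpos hκ, Matrix.cons_val, hw, actA, actB, actS]
    have : (B + conj A * (b / a)) / (A - ((κ / 4 : ℝ) : ℂ) * conj B * (b / a))
        = (B * a + conj A * b) / (A * a - ((κ / 4 : ℝ) : ℂ) * conj B * b) := by
      rw [← mul_div_mul_right _ _ ha]
      congr 1 <;> field_simp
    rw [this]

theorem hasDerivAt_shiftPrim {u : ℂ} (hu : 0 < (1 - ((κ / 4 : ℝ) : ℂ) * u).re) :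
    HasDerivAt (shiftPrim κ) (1 / (1 - ((κ / 4 : ℝ) : ℂ) * u)) u := by
  by_cases hκ : κ = 0
  · have : shiftPrim κ = id := by funext u; simp [shiftPrim, hκ]
    rw [this]
    simpa [hκ] using hasDerivAt_id u
  · have : shiftPrim κ = fun u => -((4 / κ : ℝ) : ℂ) * log (1 - ((κ / 4 : ℝ) : ℂ) * u) := by
      funext u; simp [shiftPrim, hκ]
    rw [this]
    have h1 : HasDerivAt (fun u : ℂ => 1 - ((κ / 4 : ℝ) : ℂ) * u) (-((κ / 4 : ℝ) : ℂ)) u := by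
      simpa using ((hasDerivAt_id u).const_mul ((κ / 4 : ℝ) : ℂ)).const_sub 1
    refine ((h1.clog (Or.inl hu)).const_mul _).congr_deriv ?_
    have h2 : ((4 / κ : ℝ) : ℂ) * ((κ / 4 : ℝ) : ℂ) = 1 := by
      rw [← ofReal_mul, ← ofReal_one]; congr 1; field_simp
    linear_combination (1 / (1 - ((κ / 4 : ℝ) : ℂ) * u)) * h2

theorem contDiffAt_shiftPrim {u : ℂ} (hu : 0 < (1 - ((κ / 4 : ℝ) : ℂ) * u).re) :
    ContDiffAt ℝ ∞ (shiftPrim κ) u := by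
  by_cases hκ : κ = 0
  · have : shiftPrim κ = id := by funext u; simp [shiftPrim, hκ]
    rw [this]
    exact contDiffAt_id
  · have : shiftPrim κ = fun u => -((4 / κ : ℝ) : ℂ) * log (1 - ((κ / 4 : ℝ) : ℂ) * u) := by
      funext u; simp [shiftPrim, hκ]
    rw [this]
    have h1 : ContDiffAt ℂ ∞ (fun u => -((4 / κ : ℝ) : ℂ) * log (1 - ((κ / 4 : ℝ) : ℂ) * u)) u :=
      contDiffAt_const.mul (ContDiffAt.comp (g := log) u (contDiffAt_log (Or.inl hu)) (by fun_prop))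
    exact h1.restrict_scalars ℝ

/-- The argument of the logarithm in `shiftPrim` stays in the right half-plane, because `B / A` and
`b / a` lie in the disc of the base. -/
theorem shift_domain {a b : ℂ} (hκ : ¬0 < κ) (hg : OnGroup κ A B) (h : OnGroup κ a b) :
    0 < (1 - ((κ / 4 : ℝ) : ℂ) * (conj B / A * (b / a))).re := by
  have hA := hg.ne_zero hκ
  have ha := h.ne_zero hκ
  have key : ∀ {x y : ℂ}, OnGroup κ x y → x ≠ 0 → 0 ≤ -(κ / 4) * normSq (y / x) ∧
      -(κ / 4) * normSq (y / x) < 1 := by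
    intro x y hxy hx
    have hx' := normSq_pos.2 hx
    have := normSq_nonneg (y / x)
    refine ⟨by nlinarith, ?_⟩
    rw [normSq_div, mul_div_assoc', div_lt_one hx']
    rw [OnGroup] at hxy
    linarith
  obtain ⟨h1, h2⟩ := key hg hA
  obtain ⟨h3, h4⟩ := key h ha
  have hn : normSq (((κ / 4 : ℝ) : ℂ) * (conj B / A * (b / a))) < 1 := by
    have : normSq (((κ / 4 : ℝ) : ℂ) * (conj B / A * (b / a)))
        = (-(κ / 4) * normSq (B / A)) * (-(κ / 4) * normSq (b / a)) := by
      rw [map_mul, map_mul, normSq_ofReal, normSq_div, normSq_conj, normSq_div, normSq_div]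
      ring
    rw [this]
    exact mul_lt_one_of_nonneg_of_lt_one_left h1 h2 h4.le
  have h5 := normSq_apply (((κ / 4 : ℝ) : ℂ) * (conj B / A * (b / a)))
  rw [sub_re, one_re]
  nlinarith

section Curves

variable {a b : ℝ → ℂ} {s : ℝ → ℝ} {φ : ℂ} {η β : ℝ} {t : ℝ}

theorem actA_hasDerivAt (ha : HasDerivAt a (mcA κ (a t) (b t) φ β) t)
    (hb : HasDerivAt b (mcB (a t) (b t) φ β) t) :
    HasDerivAt (fun x => actA κ A B (a x) (b x))
      (mcA κ (actA κ A B (a t) (b t)) (actB A B (a t) (b t)) φ β) t := by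
  refine ((ha.const_mul A).sub (hb.const_mul (((κ / 4 : ℝ) : ℂ) * conj B))).congr_deriv ?_
  simp only [mcA, mcB, actA, actB, map_add, map_mul, Complex.conj_conj]
  ring

theorem actB_hasDerivAt (ha : HasDerivAt a (mcA κ (a t) (b t) φ β) t)
    (hb : HasDerivAt b (mcB (a t) (b t) φ β) t) :
    HasDerivAt (fun x => actB A B (a x) (b x))
      (mcB (actA κ A B (a t) (b t)) (actB A B (a t) (b t)) φ β) t := by
  refine ((ha.const_mul B).add (hb.const_mul (conj A))).congr_deriv ?_
  simp only [mcA, mcB, actA, actB, map_sub, map_mul, Complex.conj_conj, conj_ofReal]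
  ring

theorem actS_hasDerivAt (hg : OnGroup κ A B) (h : OnGroup κ (a t) (b t))
    (ha : HasDerivAt a (mcA κ (a t) (b t) φ β) t) (hb : HasDerivAt b (mcB (a t) (b t) φ β) t)
    (hs : HasDerivAt s (mcS κ τ (a t) (b t) φ η β) t) :
    HasDerivAt (fun x => actS κ τ A B C (a x) (b x) (s x))
      (mcS κ τ (actA κ A B (a t) (b t)) (actB A B (a t) (b t)) φ η β) t := by
  by_cases hκ : 0 < κ
  · simp only [actS, shift, hκ, if_true, add_zero, mcS] at hs ⊢
    exact hs.add_const C
  · simp only [actS, shift, hκ, if_false, mcS] at hs ⊢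
    have hA := hg.ne_zero hκ
    have hane := h.ne_zero hκ
    have hane' := (hg.act h).ne_zero hκ
    have hdom := shift_domain hκ hg h
    have hba := (hb.div ha hane).const_mul (conj B / A)
    have hp := (hasDerivAt_shiftPrim hdom).scomp t hba
    refine ((hs.add_const C).add ((hasDerivAt_im hp).const_mul τ)).congr_deriv ?_
    have hgc : a t * conj (a t) + ((κ / 4 : ℝ) : ℂ) * (b t * conj (b t)) = 1 := by
      rw [mul_conj, mul_conj]; exact_mod_cast h
    have e : conj (actB A B (a t) (b t)) * φ / actA κ A B (a t) (b t)
        = conj (b t) * φ / a t + (conj B / A * ((mcB (a t) (b t) φ β * a t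
          - b t * mcA κ (a t) (b t) φ β) / a t ^ 2)) •
          (1 / (1 - ((κ / 4 : ℝ) : ℂ) * (conj B / A * (b t / a t)))) := by
      have hd : 1 - ((κ / 4 : ℝ) : ℂ) * (conj B / A * (b t / a t))
          = actA κ A B (a t) (b t) / (A * a t) := by
        rw [actA]; field_simp
      have hm : mcB (a t) (b t) φ β * a t - b t * mcA κ (a t) (b t) φ β = φ := by
        simp only [mcA, mcB]
        linear_combination φ * hgc
      rw [hd, hm, smul_eq_mul]
      field_simp
      simp only [actA, actB, map_add, map_mul, Complex.conj_conj]
      linear_combination (φ * conj B) * hgc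
    rw [e, add_im]
    ring

end Curves

variable {U : Set ℂ} {a b : ℂ → ℂ} {s : ℂ → ℝ} {φ : ℂ → ℂ →L[ℝ] ℂ} {η β : ℂ → ℂ →L[ℝ] ℝ}

/-- The forms of a lift are invariant by left translations. -/
theorem IsLift.act (h : IsLift κ τ U a b s φ η β) (hU : IsOpen U) (hg : OnGroup κ A B) (C : ℝ) :
    IsLift κ τ U (fun z => actA κ A B (a z) (b z)) (fun z => actB A B (a z) (b z))
      (fun z => actS κ τ A B C (a z) (b z) (s z)) φ η β := by
  have hca := h.contDiffOn_a
  have hcb := h.contDiffOn_b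
  have hA : ContDiffOn ℝ ∞ (fun z => actA κ A B (a z) (b z)) U := by unfold actA; fun_prop
  have hB : ContDiffOn ℝ ∞ (fun z => actB A B (a z) (b z)) U := by unfold actB; fun_prop
  have hS : ContDiffOn ℝ ∞ (fun z => actS κ τ A B C (a z) (b z) (s z)) U := by
    unfold actS
    refine (h.contDiffOn_s.add contDiffOn_const).add ?_
    by_cases hκ : 0 < κ
    · simpa only [shift, hκ, if_true] using contDiffOn_const
    · simp only [shift, hκ, if_false]
      refine contDiffOn_const.mul (contDiffOn_im fun z hz => ?_)
      have hw := contDiffOn_const (c := conj B / A) |>.mul (contDiffOn_complex_div hcb hca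
        fun z hz => (h.onGroup z hz).ne_zero hκ)
      exact (contDiffAt_shiftPrim (shift_domain hκ hg (h.onGroup z hz))).comp_contDiffWithinAt z
        (hw z hz)
  refine ⟨⟨hA, hB, h.contDiffOn_φ, h.contDiffOn_β, fun z hz => hg.act (h.onGroup z hz),
    fun z hz v => ?_, fun z hz v => ?_⟩, hS, h.contDiffOn_η, fun z hz v => ?_⟩
  · refine (hasDerivAt_line (differentiableAt_of_contDiffOn hU hA hz) v).unique ?_
    simpa using actA_hasDerivAt (κ := κ) (A := A) (B := B) (a := fun t : ℝ => a (z + t • v))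
      (b := fun t : ℝ => b (z + t • v)) (t := 0) (φ := φ z v) (β := β z v)
      (by simpa using h.line_a hU hz v) (by simpa using h.line_b hU hz v)
  · refine (hasDerivAt_line (differentiableAt_of_contDiffOn hU hB hz) v).unique ?_
    simpa using actB_hasDerivAt (κ := κ) (A := A) (B := B) (a := fun t : ℝ => a (z + t • v))
      (b := fun t : ℝ => b (z + t • v)) (t := 0) (φ := φ z v) (β := β z v)
      (by simpa using h.line_a hU hz v) (by simpa using h.line_b hU hz v)
  · refine (hasDerivAt_line (differentiableAt_of_contDiffOn hU hS hz) v).unique ?_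
    simpa using actS_hasDerivAt (κ := κ) (τ := τ) (A := A) (B := B) (C := C)
      (a := fun t : ℝ => a (z + t • v)) (b := fun t : ℝ => b (z + t • v))
      (s := fun t : ℝ => s (z + t • v)) (t := 0) (φ := φ z v) (η := η z v) (β := β z v) hg
      (by simpa using h.onGroup z hz)
      (by simpa using h.line_a hU hz v) (by simpa using h.line_b hU hz v)
      (by simpa using h.line_s hU hz v)

theorem translation_contDiffAt (hg : OnGroup κ A B) {p : R4} (hp : p ∈ carrier κ τ) :
    ContDiffAt ℝ ∞ (translation κ τ A B C) p := by
  have hc : ∀ i, ContDiffAt ℝ ∞ (fun p : R4 => p i) p := fun i => by fun_prop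
  unfold translation
  by_cases hκ : 0 < κ
  · by_cases hτ : τ = 0
    · simp only [hκ, hτ, if_true]
      rw [← contDiffWithinAt_univ]
      refine ContDiffOn.contDiffWithinAt (s := Set.univ) ?_ (Set.mem_univ p)
      rw [contDiffOn_pi]
      intro i
      fin_cases i <;> simp only [Fin.zero_eta, Fin.mk_one, Fin.reduceFinMk, Matrix.cons_val] <;>
        fun_prop
    · simp only [hκ, hτ, if_true, if_false]
      rw [← contDiffWithinAt_univ]
      refine ContDiffOn.contDiffWithinAt (s := Set.univ) ?_ (Set.mem_univ p)
      apply contDiffOn_pair <;> fun_prop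
  · obtain ⟨a, b, s, h, rfl⟩ := exists_proj_eq hp
    have hdom := shift_domain hκ hg h
    have hA := hg.ne_zero hκ
    have hw : ((proj κ τ a b s 0 : ℂ) + proj κ τ a b s 1 * I) = b / a := by
      simp only [proj_nonpos hκ, Matrix.cons_val]
      exact re_add_im _
    simp only [hκ, if_false]
    have hcw : ContDiffAt ℝ ∞ (fun p : R4 => ((p 0 : ℂ) + p 1 * I)) (proj κ τ a b s) := by
      rw [← contDiffWithinAt_univ]
      refine ContDiffOn.contDiffWithinAt (s := Set.univ) ?_ (Set.mem_univ _)
      fun_prop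
    have hden : A - ((κ / 4 : ℝ) : ℂ) * conj B
        * ((proj κ τ a b s 0 : ℂ) + proj κ τ a b s 1 * I) ≠ 0 := by
      rw [hw]
      have : A - ((κ / 4 : ℝ) : ℂ) * conj B * (b / a)
          = A * (1 - ((κ / 4 : ℝ) : ℂ) * (conj B / A * (b / a))) := by field_simp
      rw [this]
      refine mul_ne_zero hA fun h0 => ?_
      rw [h0] at hdom
      simp at hdom
    have hq : ContDiffAt ℝ ∞ (fun p : R4 => (B + conj A * ((p 0 : ℂ) + p 1 * I))
        / (A - ((κ / 4 : ℝ) : ℂ) * conj B * ((p 0 : ℂ) + p 1 * I))) (proj κ τ a b s) := by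
      simp only [div_eq_mul_inv]
      exact (contDiffAt_const.add (contDiffAt_const.mul hcw)).mul
        ((contDiffAt_const.sub (contDiffAt_const.mul hcw)).inv hden)
    have hs : ContDiffAt ℝ ∞ (fun p : R4 => shiftPrim κ (conj B / A * ((p 0 : ℂ) + p 1 * I)))
        (proj κ τ a b s) := by
      refine ContDiffAt.comp (g := shiftPrim κ) (proj κ τ a b s) (contDiffAt_shiftPrim ?_)
        (contDiffAt_const.mul hcw)
      rw [hw]
      exact hdom
    rw [contDiffAt_pi]
    intro i
    fin_cases i
    · exact reCLM.contDiff.contDiffAt.comp _ hq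
    · exact imCLM.contDiff.contDiffAt.comp _ hq
    · simp only [shift, hκ, if_false]
      exact ((hc 2).add contDiffAt_const).add
        (contDiffAt_const.mul (imCLM.contDiff.contDiffAt.comp _ hs))
    · exact contDiffAt_const

theorem fderiv_translation_frame_curve (hg : OnGroup κ A B) {a b : ℝ → ℂ} {s : ℝ → ℝ} {n : ℂ}
    {m : ℝ} (h : OnGroup κ (a 0) (b 0)) (ha : HasDerivAt a (mcA κ (a 0) (b 0) n 0) 0)
    (hb : HasDerivAt b (mcB (a 0) (b 0) n 0) 0)
    (hs : HasDerivAt s (mcS κ τ (a 0) (b 0) n m 0) 0) :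
    fderiv ℝ (translation κ τ A B C) (proj κ τ (a 0) (b 0) (s 0))
        (frame κ τ (a 0) (b 0) (s 0) n m)
      = frame κ τ (actA κ A B (a 0) (b 0)) (actB A B (a 0) (b 0))
        (actS κ τ A B C (a 0) (b 0) (s 0)) n m := by
  have hp := proj_hasDerivAt (κ := κ) (τ := τ) h ha hb hs
  have hp' := proj_hasDerivAt (κ := κ) (τ := τ) (a := fun t => actA κ A B (a t) (b t))
    (b := fun t => actB A B (a t) (b t)) (s := fun t => actS κ τ A B C (a t) (b t) (s t))
    (hg.act h) (actA_hasDerivAt ha hb) (actB_hasDerivAt ha hb) (actS_hasDerivAt hg h ha hb hs)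
  have hd := (translation_contDiffAt (C := C) hg (proj_mem h τ (s 0))).differentiableAt (by simp)
  have hcomp := hd.hasFDerivAt.comp_hasDerivAt (0 : ℝ) hp
  have hev : ∀ᶠ t : ℝ in nhds 0, ¬0 < κ → a t ≠ 0 := by
    by_cases hκ : 0 < κ
    · exact Filter.Eventually.of_forall fun t h => absurd hκ h
    · exact (ha.continuousAt.eventually_ne (h.ne_zero hκ)).mono fun t ht _ => ht
  exact hcomp.unique (hp'.congr_of_eventuallyEq
    (hev.mono fun t ht => translation_proj (C := C) ht (s t)))

/-- The differential of a translation maps adapted frames to adapted frames. -/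
theorem fderiv_translation_frame (hg : OnGroup κ A B) {a b : ℂ} (h : OnGroup κ a b) (s : ℝ)
    (n : ℂ) (m : ℝ) :
    fderiv ℝ (translation κ τ A B C) (proj κ τ a b s) (frame κ τ a b s n m)
      = frame κ τ (actA κ A B a b) (actB A B a b) (actS κ τ A B C a b s) n m := by
  have hl : ∀ {F : Type} [NormedAddCommGroup F] [NormedSpace ℝ F] (x d : F),
      ∃ f : ℝ → F, f 0 = x ∧ HasDerivAt f d 0 := fun x d =>
    ⟨fun t => x + t • d, by simp, by
      have := ((hasDerivAt_id (0 : ℝ)).smul_const d).const_add x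
      rwa [one_smul] at this⟩
  obtain ⟨f, hf, hf'⟩ := hl a (mcA κ a b n 0)
  obtain ⟨g, hg0, hg'⟩ := hl b (mcB a b n 0)
  obtain ⟨r, hr, hr'⟩ := hl s (mcS κ τ a b n m 0)
  subst hf hg0 hr
  exact fderiv_translation_frame_curve hg h hf' hg' hr'

/-- The translations map adapted frames to adapted frames, which are orthonormal, direct and contain
`ξ`, hence they are isometries of the required kind. -/
theorem isOrientedIsometry_translation (κ τ : ℝ) (hg : OnGroup κ A B) (C : ℝ) :
    IsOrientedIsometry κ τ (translation κ τ A B C) := by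
  have hgc : A * conj A + ((κ / 4 : ℝ) : ℂ) * (B * conj B) = 1 := by
    rw [mul_conj, mul_conj]; exact_mod_cast hg
  have hmaps : Set.MapsTo (translation κ τ A B C) (carrier κ τ) (carrier κ τ) := by
    intro p hp
    obtain ⟨a, b, s, h, rfl⟩ := exists_proj_eq hp
    rw [translation_proj (fun hκ => h.ne_zero hκ)]
    exact proj_mem (hg.act h) τ _
  refine ⟨⟨hmaps, ?_, ?_⟩, fun p hp => translation_contDiffAt hg hp, ?_, ?_, ?_⟩
  · intro p hp q hq hpq
    obtain ⟨a, b, s, h, rfl⟩ := exists_proj_eq hp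
    obtain ⟨a', b', s', h', rfl⟩ := exists_proj_eq hq
    rw [translation_proj (fun hκ => h.ne_zero hκ), translation_proj (fun hκ => h'.ne_zero hκ)] at hpq
    obtain ⟨γ, h1, h2, h3⟩ := exists_gauge_of_proj_eq (hg.act h') (hg.act h) hpq
    have e1 : a = exp (γ * I) * a' := by
      simp only [actA, actB] at h1 h2
      linear_combination (-(a - exp (γ * I) * a')) * hgc + conj A * h1
        + ((κ / 4 : ℝ) : ℂ) * conj B * h2
    have e2 : b = exp (γ * I) * b' := by
      simp only [actA, actB] at h1 h2
      linear_combination (-(b - exp (γ * I) * b')) * hgc - B * h1 + A * h2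
    have e3 : s = gaugeS κ τ s' γ := by
      have : b / a = b' / a' := by rw [e1, e2, mul_div_mul_left _ _ (exp_ne_zero _)]
      rw [actS, this, actS] at h3
      simp only [gaugeS] at h3 ⊢
      linarith
    rw [e1, e2, e3, proj_gauge]
  · intro q hq
    obtain ⟨a', b', s', h', rfl⟩ := exists_proj_eq hq
    have h : OnGroup κ (conj A * a' + ((κ / 4 : ℝ) : ℂ) * conj B * b') (-B * a' + A * b') := by
      simp only [OnGroup, normSq_apply] at hg h' ⊢
      simp only [map_mul, map_sub, map_add, map_neg, map_pow, conj_I, conj_ofReal, Complex.conj_conj,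
    mul_re, mul_im, sub_re, sub_im, add_re, add_im, neg_re, neg_im, I_re, I_im, ofReal_re, ofReal_im,
    conj_re, conj_im, pow_two, one_re, one_im, zero_re, zero_im]
      linear_combination (a'.re * a'.re + a'.im * a'.im
        + κ / 4 * (b'.re * b'.re + b'.im * b'.im)) * hg + h'
    have e1 : actA κ A B (conj A * a' + ((κ / 4 : ℝ) : ℂ) * conj B * b') (-B * a' + A * b')
        = a' := by
      simp only [actA]
      linear_combination a' * hgc
    have e2 : actB A B (conj A * a' + ((κ / 4 : ℝ) : ℂ) * conj B * b') (-B * a' + A * b')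
        = b' := by
      simp only [actB]
      linear_combination b' * hgc
    refine ⟨_, proj_mem h τ (s' - C - shift κ τ A B ((-B * a' + A * b')
      / (conj A * a' + ((κ / 4 : ℝ) : ℂ) * conj B * b'))), ?_⟩
    rw [translation_proj (fun hκ => h.ne_zero hκ), e1, e2, actS]
    congr 1
    ring
  · intro p hp u hu v hv
    obtain ⟨a, b, s, h, rfl⟩ := exists_proj_eq hp
    obtain ⟨n, m, rfl⟩ := exists_frame_eq h hu
    obtain ⟨n', m', rfl⟩ := exists_frame_eq h hv
    rw [fderiv_translation_frame hg h, fderiv_translation_frame hg h,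
      translation_proj (fun hκ => h.ne_zero hκ), metric_frame (hg.act h), metric_frame h]
  · intro p hp
    obtain ⟨a, b, s, h, rfl⟩ := exists_proj_eq hp
    rw [translation_proj (fun hκ => h.ne_zero hκ), ← frame_vertical κ τ a b s,
      fderiv_translation_frame hg h, frame_vertical]
  · intro p hp u hu v hv w hw
    obtain ⟨a, b, s, h, rfl⟩ := exists_proj_eq hp
    obtain ⟨n, m, rfl⟩ := exists_frame_eq h hu
    obtain ⟨n', m', rfl⟩ := exists_frame_eq h hv
    obtain ⟨n'', m'', rfl⟩ := exists_frame_eq h hw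
    rw [fderiv_translation_frame hg h, fderiv_translation_frame hg h,
      fderiv_translation_frame hg h, translation_proj (fun hκ => h.ne_zero hκ),
      isDirect_frame h, isDirect_frame (hg.act h)]
    exact id

end Isometry

/-! ### Algebra of the adapted frame of a conformal immersion -/

section FrameAlgebra

open Complex ComplexConjugate

/-- A vector orthogonal to two orthogonal vectors `p`, `q` of square norm `ρ` and to their cross
product vanishes. -/
theorem eq_zero_of_orthogonal {p₁ p₂ p₃ q₁ q₂ q₃ x₁ x₂ x₃ ρ : ℝ} (hρ : 0 < ρ)
    (hp : p₁ ^ 2 + p₂ ^ 2 + p₃ ^ 2 = ρ) (hq : q₁ ^ 2 + q₂ ^ 2 + q₃ ^ 2 = ρ)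
    (hpq : p₁ * q₁ + p₂ * q₂ + p₃ * q₃ = 0) (hxp : x₁ * p₁ + x₂ * p₂ + x₃ * p₃ = 0)
    (hxq : x₁ * q₁ + x₂ * q₂ + x₃ * q₃ = 0)
    (hxc : x₁ * (p₂ * q₃ - p₃ * q₂) + x₂ * (p₃ * q₁ - p₁ * q₃) + x₃ * (p₁ * q₂ - p₂ * q₁) = 0) :
    x₁ = 0 ∧ x₂ = 0 ∧ x₃ = 0 := by
  have hc : (p₂ * q₃ - p₃ * q₂) ^ 2 + (p₃ * q₁ - p₁ * q₃) ^ 2 + (p₁ * q₂ - p₂ * q₁) ^ 2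
      = ρ ^ 2 := by
    linear_combination (q₁ ^ 2 + q₂ ^ 2 + q₃ ^ 2) * hp + ρ * hq
      - (p₁ * q₁ + p₂ * q₂ + p₃ * q₃) * hpq
  have hρ2 : ρ ^ 2 ≠ 0 := by positivity
  refine ⟨?_, ?_, ?_⟩ <;> apply mul_left_cancel₀ hρ2 <;> rw [mul_zero, ← hc]
  · linear_combination (p₂ * q₃ - p₃ * q₂) * hxc + ((p₃ * q₁ - p₁ * q₃) * p₃
      - (p₁ * q₂ - p₂ * q₁) * p₂) * hxq - ((p₃ * q₁ - p₁ * q₃) * q₃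
      - (p₁ * q₂ - p₂ * q₁) * q₂) * hxp
  · linear_combination (p₃ * q₁ - p₁ * q₃) * hxc + ((p₁ * q₂ - p₂ * q₁) * p₁
      - (p₂ * q₃ - p₃ * q₂) * p₃) * hxq - ((p₁ * q₂ - p₂ * q₁) * q₁
      - (p₂ * q₃ - p₃ * q₂) * q₃) * hxp
  · linear_combination (p₁ * q₂ - p₂ * q₁) * hxc + ((p₂ * q₃ - p₃ * q₂) * p₂
      - (p₃ * q₁ - p₁ * q₃) * p₁) * hxq - ((p₂ * q₃ - p₃ * q₂) * q₂
      - (p₃ * q₁ - p₁ * q₃) * q₁) * hxp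

/-- The direct unit vector orthogonal to two orthogonal vectors of square norm `ρ` is their cross
product divided by `ρ`. -/
theorem eq_cross_of_orthogonal {p₁ p₂ p₃ q₁ q₂ q₃ x₁ x₂ x₃ ρ : ℝ} (hρ : 0 < ρ)
    (hp : p₁ ^ 2 + p₂ ^ 2 + p₃ ^ 2 = ρ) (hq : q₁ ^ 2 + q₂ ^ 2 + q₃ ^ 2 = ρ)
    (hpq : p₁ * q₁ + p₂ * q₂ + p₃ * q₃ = 0) (hxp : x₁ * p₁ + x₂ * p₂ + x₃ * p₃ = 0)
    (hxq : x₁ * q₁ + x₂ * q₂ + x₃ * q₃ = 0) (hx : x₁ ^ 2 + x₂ ^ 2 + x₃ ^ 2 = 1)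
    (hd : 0 < x₁ * (p₂ * q₃ - p₃ * q₂) + x₂ * (p₃ * q₁ - p₁ * q₃)
      + x₃ * (p₁ * q₂ - p₂ * q₁)) :
    ρ * x₁ = p₂ * q₃ - p₃ * q₂ ∧ ρ * x₂ = p₃ * q₁ - p₁ * q₃ ∧ ρ * x₃ = p₁ * q₂ - p₂ * q₁ := by
  have hc : (p₂ * q₃ - p₃ * q₂) ^ 2 + (p₃ * q₁ - p₁ * q₃) ^ 2 + (p₁ * q₂ - p₂ * q₁) ^ 2
      = ρ ^ 2 := by
    linear_combination (q₁ ^ 2 + q₂ ^ 2 + q₃ ^ 2) * hp + ρ * hq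
      - (p₁ * q₁ + p₂ * q₂ + p₃ * q₃) * hpq
  set d := x₁ * (p₂ * q₃ - p₃ * q₂) + x₂ * (p₃ * q₁ - p₁ * q₃) + x₃ * (p₁ * q₂ - p₂ * q₁) with hdd
  have hρ2 : ρ ^ 2 ≠ 0 := by positivity
  -- `ρ² x - d (p × q)` is orthogonal to `p`, `q` and `p × q`
  obtain ⟨h1, h2, h3⟩ := eq_zero_of_orthogonal (x₁ := ρ ^ 2 * x₁ - d * (p₂ * q₃ - p₃ * q₂))
    (x₂ := ρ ^ 2 * x₂ - d * (p₃ * q₁ - p₁ * q₃)) (x₃ := ρ ^ 2 * x₃ - d * (p₁ * q₂ - p₂ * q₁))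
    hρ hp hq hpq (by linear_combination ρ ^ 2 * hxp) (by linear_combination ρ ^ 2 * hxq)
    (by linear_combination -d * hc - ρ ^ 2 * hdd)
  have hdρ : d = ρ := by
    have h4 : ρ ^ 2 * (d ^ 2 - ρ ^ 2) = 0 := by
      have e1 : ρ ^ 2 * ρ ^ 2 = d ^ 2 * ρ ^ 2 := by
        linear_combination -(ρ ^ 2 * ρ ^ 2) * hx + d ^ 2 * hc
          + (ρ ^ 2 * x₁ + d * (p₂ * q₃ - p₃ * q₂)) * h1
          + (ρ ^ 2 * x₂ + d * (p₃ * q₁ - p₁ * q₃)) * h2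
          + (ρ ^ 2 * x₃ + d * (p₁ * q₂ - p₂ * q₁)) * h3
      linear_combination -e1
    have h5 := (mul_eq_zero.1 h4).resolve_left hρ2
    have h6 : (d - ρ) * (d + ρ) = 0 := by linear_combination h5
    have := (mul_eq_zero.1 h6).resolve_right (by positivity)
    linarith
  rw [hdρ] at h1 h2 h3
  refine ⟨?_, ?_, ?_⟩ <;> apply mul_left_cancel₀ hρ.ne'
  · linear_combination h1
  · linear_combination h2
  · linear_combination h3

/-- In an adapted frame, `(P, e)` and `(Q, f)` are the derivatives of a conformal immersion in the
directions `1` and `i`, `ρ` is the conformal factor of the induced metric, and `(n, ν)` is the unit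
normal. -/
structure ConformalFrame (P Q : ℂ) (e f : ℝ) (n : ℂ) (ν ρ : ℝ) : Prop where
  pos : 0 < ρ
  normSq_left : normSq P + e ^ 2 = ρ
  normSq_right : normSq Q + f ^ 2 = ρ
  inner_eq : (P * conj Q).re + e * f = 0
  normal_eq : (ρ : ℂ) * n = I * (e * Q - f * P)
  angle_eq : ρ * ν = (conj P * Q).im

/-- A unit vector orthogonal to a conformal immersion and compatible with the orientations is the
normalized cross product of the images of `1` and `i`. -/
theorem conformalFrame_of_normal {P Q n : ℂ} {e f ν ρ : ℝ} (hρ : 0 < ρ)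
    (hp : normSq P + e ^ 2 = ρ) (hq : normSq Q + f ^ 2 = ρ) (hpq : (P * conj Q).re + e * f = 0)
    (hnp : (n * conj P).re + ν * e = 0) (hnq : (n * conj Q).re + ν * f = 0)
    (hn : normSq n + ν ^ 2 = 1) (hd : 0 < det3 P e Q f n ν) : ConformalFrame P Q e f n ν ρ := by
  simp only [det3] at hd
  simp only [normSq_apply, map_mul, map_sub, map_add, map_neg, map_pow, conj_I, conj_ofReal, Complex.conj_conj,
    mul_re, mul_im, sub_re, sub_im, add_re, add_im, neg_re, neg_im, I_re, I_im, ofReal_re, ofReal_im,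
    conj_re, conj_im, pow_two, one_re, one_im, zero_re, zero_im] at hp hq hpq hnp hnq hn hd
  obtain ⟨h1, h2, h3⟩ := eq_cross_of_orthogonal (p₁ := P.re) (p₂ := P.im) (p₃ := e)
    (q₁ := Q.re) (q₂ := Q.im) (q₃ := f) (x₁ := n.re) (x₂ := n.im) (x₃ := ν) hρ
    (by linarith) (by linarith) (by linarith) (by linarith) (by linarith) (by linarith)
    (by linarith)
  refine ⟨hρ, ?_, ?_, ?_, Complex.ext ?_ ?_, ?_⟩ <;> simp only [normSq_apply, map_mul, map_sub, map_add, map_neg, map_pow, conj_I, conj_ofReal, Complex.conj_conj,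
    mul_re, mul_im, sub_re, sub_im, add_re, add_im, neg_re, neg_im, I_re, I_im, ofReal_re, ofReal_im,
    conj_re, conj_im, pow_two, one_re, one_im, zero_re, zero_im]
  · linarith
  · linarith
  · linarith
  · linarith
  · linarith
  · linarith

namespace ConformalFrame

variable {P Q n : ℂ} {e f ν ρ : ℝ}

theorem normal_re (h : ConformalFrame P Q e f n ν ρ) : ρ * n.re = -(e * Q.im - f * P.im) := by
  have := congrArg re h.normal_eq
  simp only [map_mul, map_sub, map_add, map_neg, map_pow, conj_I, conj_ofReal, Complex.conj_conj,
    mul_re, mul_im, sub_re, sub_im, add_re, add_im, neg_re, neg_im, I_re, I_im, ofReal_re, ofReal_im,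
    conj_re, conj_im, pow_two, one_re, one_im, zero_re, zero_im] at this
  linarith

theorem normal_im (h : ConformalFrame P Q e f n ν ρ) : ρ * n.im = e * Q.re - f * P.re := by
  have := congrArg im h.normal_eq
  simp only [map_mul, map_sub, map_add, map_neg, map_pow, conj_I, conj_ofReal, Complex.conj_conj,
    mul_re, mul_im, sub_re, sub_im, add_re, add_im, neg_re, neg_im, I_re, I_im, ofReal_re, ofReal_im,
    conj_re, conj_im, pow_two, one_re, one_im, zero_re, zero_im] at this
  linarith

theorem im_left (h : ConformalFrame P Q e f n ν ρ) : (n * conj P).im = -f := by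
  apply mul_left_cancel₀ h.pos.ne'
  have h1 := h.normSq_left
  have h2 := h.inner_eq
  simp only [normSq_apply, map_mul, map_sub, map_add, map_neg, map_pow, conj_I, conj_ofReal, Complex.conj_conj,
    mul_re, mul_im, sub_re, sub_im, add_re, add_im, neg_re, neg_im, I_re, I_im, ofReal_re, ofReal_im,
    conj_re, conj_im, pow_two, one_re, one_im, zero_re, zero_im] at h1 h2 ⊢
  linear_combination P.re * h.normal_im - P.im * h.normal_re + e * h2 - f * h1

theorem im_right (h : ConformalFrame P Q e f n ν ρ) : (n * conj Q).im = e := by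
  apply mul_left_cancel₀ h.pos.ne'
  have h1 := h.normSq_right
  have h2 := h.inner_eq
  simp only [normSq_apply, map_mul, map_sub, map_add, map_neg, map_pow, conj_I, conj_ofReal, Complex.conj_conj,
    mul_re, mul_im, sub_re, sub_im, add_re, add_im, neg_re, neg_im, I_re, I_im, ofReal_re, ofReal_im,
    conj_re, conj_im, pow_two, one_re, one_im, zero_re, zero_im] at h1 h2 ⊢
  linear_combination Q.re * h.normal_im - Q.im * h.normal_re + e * h1 - f * h2

theorem re_left (h : ConformalFrame P Q e f n ν ρ) : (n * conj P).re + ν * e = 0 := by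
  apply mul_left_cancel₀ h.pos.ne'
  have h3 := h.angle_eq
  simp only [normSq_apply, map_mul, map_sub, map_add, map_neg, map_pow, conj_I, conj_ofReal, Complex.conj_conj,
    mul_re, mul_im, sub_re, sub_im, add_re, add_im, neg_re, neg_im, I_re, I_im, ofReal_re, ofReal_im,
    conj_re, conj_im, pow_two, one_re, one_im, zero_re, zero_im] at h3 ⊢
  linear_combination P.re * h.normal_re + P.im * h.normal_im + e * h3

theorem re_right (h : ConformalFrame P Q e f n ν ρ) : (n * conj Q).re + ν * f = 0 := by
  apply mul_left_cancel₀ h.pos.ne'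
  have h3 := h.angle_eq
  simp only [normSq_apply, map_mul, map_sub, map_add, map_neg, map_pow, conj_I, conj_ofReal, Complex.conj_conj,
    mul_re, mul_im, sub_re, sub_im, add_re, add_im, neg_re, neg_im, I_re, I_im, ofReal_re, ofReal_im,
    conj_re, conj_im, pow_two, one_re, one_im, zero_re, zero_im] at h3 ⊢
  linear_combination Q.re * h.normal_re + Q.im * h.normal_im + f * h3

theorem sq_angle (h : ConformalFrame P Q e f n ν ρ) : ρ * ν ^ 2 + e ^ 2 + f ^ 2 = ρ := by
  apply mul_left_cancel₀ h.pos.ne'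
  have h1 := h.normSq_left
  have h2 := h.normSq_right
  have h3 := h.inner_eq
  have h4 := h.angle_eq
  simp only [normSq_apply, map_mul, map_sub, map_add, map_neg, map_pow, conj_I, conj_ofReal, Complex.conj_conj,
    mul_re, mul_im, sub_re, sub_im, add_re, add_im, neg_re, neg_im, I_re, I_im, ofReal_re, ofReal_im,
    conj_re, conj_im, pow_two, one_re, one_im, zero_re, zero_im] at h1 h2 h3 h4 ⊢
  -- `|P|² |Q|² = (Re P Q̄)² + (Im P Q̄)²`
  linear_combination (ρ * ν + (P.re * Q.im - P.im * Q.re)) * h4 + (Q.re * Q.re + Q.im * Q.im) * h1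
    + (ρ - e ^ 2) * h2 - (P.re * Q.re + P.im * Q.im - e * f) * h3

theorem unit_normal (h : ConformalFrame P Q e f n ν ρ) : normSq n + ν ^ 2 = 1 := by
  apply mul_left_cancel₀ (pow_ne_zero 2 h.pos.ne')
  have h1 := h.normSq_left
  have h2 := h.normSq_right
  have h3 := h.inner_eq
  have h5 := h.sq_angle
  have h6 := h.normal_re
  have h7 := h.normal_im
  simp only [normSq_apply, map_mul, map_sub, map_add, map_neg, map_pow, conj_I, conj_ofReal, Complex.conj_conj,
    mul_re, mul_im, sub_re, sub_im, add_re, add_im, neg_re, neg_im, I_re, I_im, ofReal_re, ofReal_im,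
    conj_re, conj_im, pow_two, one_re, one_im, zero_re, zero_im] at h1 h2 h3 ⊢
  linear_combination (ρ * n.re - (e * Q.im - f * P.im)) * h6 + (ρ * n.im + (e * Q.re - f * P.re)) * h7
    + f ^ 2 * h1 + e ^ 2 * h2 - 2 * e * f * h3 + ρ * h5

theorem direct (h : ConformalFrame P Q e f n ν ρ) : 0 < det3 P e Q f n ν := by
  have h1 : det3 P e Q f n ν = ρ := by
    have h2 := h.im_left
    have h3 := h.im_right
    have h4 := h.sq_angle
    rw [det3, ← h.angle_eq]
    simp only [map_mul, map_sub, map_add, map_neg, map_pow, conj_I, conj_ofReal, Complex.conj_conj,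
    mul_re, mul_im, sub_re, sub_im, add_re, add_im, neg_re, neg_im, I_re, I_im, ofReal_re, ofReal_im,
    conj_re, conj_im, pow_two, one_re, one_im, zero_re, zero_im] at h2 h3 ⊢
    linear_combination h4 + e * h3 - f * h2
  rw [h1]
  exact h.pos

theorem exists_ne_zero (h : ConformalFrame P Q e f n ν ρ) : P ≠ 0 ∨ Q ≠ 0 := by
  by_contra! hc
  have h1 := h.normSq_left
  have h2 := h.normSq_right
  have h3 := h.inner_eq
  have h4 := h.pos
  rw [hc.1, map_zero, zero_add] at h1
  rw [hc.2, map_zero, zero_add] at h2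
  rw [hc.1, zero_mul, zero_re, zero_add] at h3
  have h5 : (e * f) ^ 2 = ρ * ρ := by rw [mul_pow, h1, h2]
  rw [h3] at h5
  nlinarith

/-- A connection form `δ` which rotates neither the tangent plane (to first order) nor the normal
vanishes. -/
theorem eq_zero_of_rotation (h : ConformalFrame P Q e f n ν ρ) {δ₁ δ₂ : ℝ}
    (hδ : (δ₁ : ℂ) * Q = δ₂ * P) (h1 : δ₁ * (n * conj P).im = 0) (h1' : δ₁ * (n * conj Q).im = 0)
    (h2 : δ₂ * (n * conj P).im = 0) (h2' : δ₂ * (n * conj Q).im = 0) : δ₁ = 0 ∧ δ₂ = 0 := by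
  rw [h.im_left] at h1 h2
  rw [h.im_right] at h1' h2'
  by_cases hef : e = 0 ∧ f = 0
  · obtain ⟨rfl, rfl⟩ := hef
    have h3 := h.normSq_left
    have h4 := h.inner_eq
    have h5 := h.normSq_right
    have h6 := h.pos
    have hr := congrArg re hδ
    have hi := congrArg im hδ
    simp only [normSq_apply, map_mul, map_sub, map_add, map_neg, map_pow, conj_I, conj_ofReal, Complex.conj_conj,
    mul_re, mul_im, sub_re, sub_im, add_re, add_im, neg_re, neg_im, I_re, I_im, ofReal_re, ofReal_im,
    conj_re, conj_im, pow_two, one_re, one_im, zero_re, zero_im] at h3 h4 h5 hr hi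
    constructor
    · have : ρ * δ₁ = 0 := by
        linear_combination Q.re * hr + Q.im * hi - δ₁ * h5 + δ₂ * h4
      exact (mul_eq_zero.1 this).resolve_left h6.ne'
    · have : ρ * δ₂ = 0 := by
        linear_combination -P.re * hr - P.im * hi - δ₂ * h3 + δ₁ * h4
      exact (mul_eq_zero.1 this).resolve_left h6.ne'
  · rw [not_and_or] at hef
    rcases hef with he | hf
    · exact ⟨(mul_eq_zero.1 h1').resolve_right he, (mul_eq_zero.1 h2').resolve_right he⟩
    · exact ⟨(mul_eq_zero.1 h1).resolve_right (neg_ne_zero.2 hf),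
        (mul_eq_zero.1 h2).resolve_right (neg_ne_zero.2 hf)⟩

end ConformalFrame

/-- Inner product of the covariant derivative, with coordinates `(n', ν')` before the connection
terms, of the field `(n, ν)` in the direction `(φv, ηv)` with the vector `(φw, ηw)`. -/
def covForm (τ : ℝ) (n n' φv φw : ℂ) (ν ν' ηv ηw βv : ℝ) : ℝ :=
  ((n' - I * ((2 * βv + τ * ηv : ℝ) : ℂ) * n - I * ((τ * ν : ℝ) : ℂ) * φv) * conj φw).re
    + (ν' + τ * (n * conj φv).im) * ηw

/-- The covariant derivative, with the rotation terms gathered. -/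
theorem covForm_eq (τ : ℝ) (n n' φv φw : ℂ) (ν ν' ηv ηw βv : ℝ) :
    covForm τ n n' φv φw ν ν' ηv ηw βv = (n' * conj φw).re
      + (2 * βv + τ * ηv) * (n * conj φw).im + τ * ν * (φv * conj φw).im
      + (ν' + τ * (n * conj φv).im) * ηw := by
  rw [covForm]
  simp only [map_mul, map_sub, map_add, map_neg, map_pow, conj_I, conj_ofReal, Complex.conj_conj,
    mul_re, mul_im, sub_re, sub_im, add_re, add_im, neg_re, neg_im, I_re, I_im, ofReal_re, ofReal_im,
    conj_re, conj_im, pow_two, one_re, one_im, zero_re, zero_im]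
  ring

/-- The shape operators of two immersions related by the sister correspondence. -/
theorem ConformalFrame.covForm_sister {P Q n : ℂ} {e f ν ρ : ℝ} (h : ConformalFrame P Q e f n ν ρ)
    {C S τ₁ τ₂ H₁ H₂ : ℝ} (hτ : τ₁ = C * τ₂ + S * H₂) (hH : H₁ = C * H₂ - S * τ₂)
    (x y p q b : ℝ) (n' : ℂ) (ν' : ℝ) :
    covForm τ₂ n n' (((C * x + S * y : ℝ) : ℂ) * P + ((-S * x + C * y : ℝ) : ℂ) * Q)
        ((p : ℂ) * P + (q : ℂ) * Q) ν ν' ((C * x + S * y) * e + (-S * x + C * y) * f) (p * e + q * f)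
        (b + S * ((H₂ * x - τ₂ * y) * e + (H₂ * y + τ₂ * x) * f))
      = covForm τ₁ n n' ((x : ℂ) * P + (y : ℂ) * Q) ((p : ℂ) * P + (q : ℂ) * Q) ν ν'
          (x * e + y * f) (p * e + q * f) b
        + H₁ * (ρ * (x * p + y * q))
        - H₂ * (ρ * ((C * x + S * y) * p + (-S * x + C * y) * q)) := by
  have hl : ∀ x y : ℝ, (n * conj ((x : ℂ) * P + (y : ℂ) * Q)).im = -(x * f) + y * e := by
    intro x y
    have h1 := h.im_left
    have h2 := h.im_right
    simp only [map_mul, map_sub, map_add, map_neg, map_pow, conj_I, conj_ofReal, Complex.conj_conj,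
    mul_re, mul_im, sub_re, sub_im, add_re, add_im, neg_re, neg_im, I_re, I_im, ofReal_re, ofReal_im,
    conj_re, conj_im, pow_two, one_re, one_im, zero_re, zero_im] at h1 h2 ⊢
    linear_combination x * h1 + y * h2
  have hc : ∀ x y p q : ℝ, (((x : ℂ) * P + (y : ℂ) * Q) * conj ((p : ℂ) * P + (q : ℂ) * Q)).im
      = -(ρ * ν) * (x * q - y * p) := by
    intro x y p q
    rw [h.angle_eq]
    simp only [map_mul, map_sub, map_add, map_neg, map_pow, conj_I, conj_ofReal, Complex.conj_conj,
    mul_re, mul_im, sub_re, sub_im, add_re, add_im, neg_re, neg_im, I_re, I_im, ofReal_re, ofReal_im,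
    conj_re, conj_im, pow_two, one_re, one_im, zero_re, zero_im]
    ring
  simp only [covForm_eq, hl, hc]
  rw [hτ, hH]
  linear_combination (-S * ((τ₂ * x + H₂ * y) * p + (τ₂ * y - H₂ * x) * q)) * h.sq_angle

/-- The Maurer-Cartan equation for the horizontal form of the sister immersion. -/
theorem ConformalFrame.curl_sister {P Q n : ℂ} {e f ν ρ : ℝ} (h : ConformalFrame P Q e f n ν ρ)
    {C S τ₁ τ₂ H₁ H₂ : ℝ} (hτ : τ₁ = C * τ₂ + S * H₂) (hH : H₁ = C * H₂ - S * τ₂)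
    {b₁ b₂ : ℝ} {div crl : ℂ}
    (hdiv : div = 2 * I * ((b₁ + τ₁ * e : ℝ) : ℂ) * P + 2 * I * ((b₂ + τ₁ * f : ℝ) : ℂ) * Q
      + 2 * ((ρ * H₁ : ℝ) : ℂ) * n)
    (hcrl : crl = 2 * I * (b₁ * Q - b₂ * P)) :
    S * div + C * crl
      = 2 * I * (((b₁ + S * (H₂ * e + τ₂ * f) : ℝ) : ℂ) * (S * P + C * Q)
        - ((b₂ + S * (H₂ * f - τ₂ * e) : ℝ) : ℂ) * (C * P - S * Q)) := by
  have h1 := h.normal_eq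
  rw [hdiv, hcrl, hτ, hH]
  push_cast
  linear_combination (2 * S * (C * H₂ - S * τ₂) : ℂ) * h1

/-- The mean curvature equation of a conformal immersion in an adapted frame. Here `X₁` is the
derivative of `X` in the direction `1` and `X₂` its derivative in the direction `i`. -/
theorem ConformalFrame.mean_curvature {P Q n : ℂ} {e f ν ρ : ℝ}
    (h : ConformalFrame P Q e f n ν ρ) {τ H b₁ b₂ : ℝ} {P₁ P₂ Q₁ Q₂ n₁ n₂ : ℂ}
    {e₁ e₂ f₁ f₂ ν₁ ν₂ : ℝ}
    (hcP : Q₁ - P₂ = 2 * I * (b₁ * Q - b₂ * P)) (hce : f₁ - e₂ = -(2 * τ * (conj P * Q).im))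
    (hl₁ : (P₁ * conj P).re + e * e₁ = (Q₁ * conj Q).re + f * f₁)
    (hl₂ : (P₂ * conj P).re + e * e₂ = (Q₂ * conj Q).re + f * f₂)
    (ho₁ : (P₁ * conj Q).re + (P * conj Q₁).re + e₁ * f + e * f₁ = 0)
    (ho₂ : (P₂ * conj Q).re + (P * conj Q₂).re + e₂ * f + e * f₂ = 0)
    (hn₁ : (n₁ * conj P).re + (n * conj P₁).re + ν₁ * e + ν * e₁ = 0)
    (hn₂ : (n₂ * conj Q).re + (n * conj Q₂).re + ν₂ * f + ν * f₂ = 0)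
    (htr : covForm τ n n₁ P P ν ν₁ e e b₁ + covForm τ n n₂ Q Q ν ν₂ f f b₂ = -(2 * H * ρ)) :
    P₁ + Q₂ = 2 * I * ((b₁ + τ * e : ℝ) : ℂ) * P + 2 * I * ((b₂ + τ * f : ℝ) : ℂ) * Q
      + 2 * ((ρ * H : ℝ) : ℂ) * n ∧ e₁ + f₂ = 2 * ρ * H * ν := by
  set W := P₁ + Q₂ - (2 * I * ((b₁ + τ * e : ℝ) : ℂ) * P + 2 * I * ((b₂ + τ * f : ℝ) : ℂ) * Q
      + 2 * ((ρ * H : ℝ) : ℂ) * n) with hW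
  have hWr := congrArg re hW
  have hWi := congrArg im hW
  have hcr := congrArg re hcP
  have hci := congrArg im hcP
  have g1 := h.normSq_left
  have g2 := h.normSq_right
  have g3 := h.inner_eq
  have g4 := h.unit_normal
  have g5 := h.re_left
  have g6 := h.re_right
  have g7 := h.im_left
  have g8 := h.im_right
  have g9 := h.normal_re
  have g10 := h.normal_im
  have g11 := h.angle_eq
  rw [← ofReal_ofNat 2] at hWr hWi hcr hci
  simp only [covForm_eq, normSq_apply, map_mul, map_sub, map_add, map_neg, map_pow, conj_I, conj_ofReal, Complex.conj_conj,
    mul_re, mul_im, sub_re, sub_im, add_re, add_im, neg_re, neg_im, I_re, I_im, ofReal_re, ofReal_im,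
    conj_re, conj_im, pow_two, one_re, one_im, zero_re, zero_im] at *
  have hP : W.re * P.re + W.im * P.im + (e₁ + f₂ - 2 * ρ * H * ν) * e = 0 := by
    linear_combination P.re * hWr + P.im * hWi + hl₁ + ho₂ + Q.re * hcr + Q.im * hci + f * hce
      - 2 * ρ * H * g5
  have hQ : W.re * Q.re + W.im * Q.im + (e₁ + f₂ - 2 * ρ * H * ν) * f = 0 := by
    linear_combination Q.re * hWr + Q.im * hWi + ho₁ - hl₂ - P.re * hcr - P.im * hci - e * hce
      - 2 * ρ * H * g6
  have hN : W.re * (P.im * f - e * Q.im) + W.im * (e * Q.re - P.re * f)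
      + (e₁ + f₂ - 2 * ρ * H * ν) * (P.re * Q.im - P.im * Q.re) = 0 := by
    have : W.re * n.re + W.im * n.im + (e₁ + f₂ - 2 * ρ * H * ν) * ν = 0 := by
      linear_combination n.re * hWr + n.im * hWi + hn₁ + hn₂ - htr - 2 * ρ * H * g4
    linear_combination ρ * this - W.re * g9 - W.im * g10 - (e₁ + f₂ - 2 * ρ * H * ν) * g11
  obtain ⟨w1, w2, w3⟩ := eq_zero_of_orthogonal h.pos (by linarith) (by linarith) (by linarith)
    hP hQ hN
  refine ⟨?_, by linarith⟩
  rw [← sub_eq_zero, ← hW]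
  exact Complex.ext w1 w2

end FrameAlgebra

/-! ### Lifts of conformal immersions of constant mean curvature -/

section SurfaceLift

open Complex ComplexConjugate

/-- First order jet at a point of a surface and of a vector field along it: the point `x`, the
vector `N`, and their differentials. -/
structure Jet where
  x : R4
  N : R4
  d : ℂ →L[ℝ] R4
  dN : ℂ →L[ℝ] R4

/-- The jet at `z` of a surface `y` and of a field `M` along it. -/
def jet (y M : ℂ → R4) (z : ℂ) : Jet := ⟨y z, M z, fderiv ℝ y z, fderiv ℝ M z⟩

/-- The induced metric. -/
def Jet.inner (κ τ : ℝ) (j : Jet) (v w : ℂ) : ℝ := metric κ τ j.x (j.d v) (j.d w)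

/-- The inner product of the covariant derivative of the field with a tangent vector. -/
def Jet.cov (κ τ : ℝ) (j : Jet) (v w : ℂ) : ℝ :=
  metric κ τ j.x (j.dN v) (j.d w) + christoffel κ τ j.x (j.d v) j.N (j.d w)

/-- `j` is the jet of a conformal immersion into `E(κ, τ)` and of its unit normal. -/
structure IsSurfaceJet (κ τ : ℝ) (j : Jet) : Prop where
  mem : j.x ∈ carrier κ τ
  conformal : ∃ ρ : ℝ, 0 < ρ ∧ ∀ v w : ℂ, j.inner κ τ v w = ρ * (v * conj w).re
  tangent : j.N ∈ tangent κ τ j.x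
  unit : metric κ τ j.x j.N j.N = 1
  orthogonal : ∀ v, metric κ τ j.x j.N (j.d v) = 0
  direct : IsDirect κ τ j.x (j.d 1) (j.d I) j.N

/-- The jet of a surface has mean curvature `H`: the trace of the second fundamental form, for the
basis `(1, i)` orthogonal with vectors of the same norm, is `2 H` times their squared norm. -/
def Jet.HasMeanCurvature (κ τ H : ℝ) (j : Jet) : Prop :=
  j.cov κ τ 1 1 + j.cov κ τ I I = -(2 * H * j.inner κ τ 1 1)

theorem clm_apply_eq {F : Type*} [NormedAddCommGroup F] [NormedSpace ℝ F] (L : ℂ →L[ℝ] F) (v : ℂ) :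
    L v = v.re • L 1 + v.im • L I := by
  conv_lhs => rw [← re_add_im v]
  rw [map_add, ← map_smul, ← map_smul]
  simp

/-- A lift of a conformal immersion with conformal factor `ρ` and unit normal of coordinates
`(n, ν)` in the adapted frame. -/
structure IsSurfaceLift (κ τ : ℝ) (U : Set ℂ) (a b : ℂ → ℂ) (s : ℂ → ℝ) (φ : ℂ → ℂ →L[ℝ] ℂ)
    (η β : ℂ → ℂ →L[ℝ] ℝ) (n : ℂ → ℂ) (ν ρ : ℂ → ℝ) : Prop extends IsLift κ τ U a b s φ η β where
  contDiffOn_n : ContDiffOn ℝ ∞ n U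
  contDiffOn_ν : ContDiffOn ℝ ∞ ν U
  conformalFrame : ∀ z ∈ U, ConformalFrame (φ z 1) (φ z I) (η z 1) (η z I) (n z) (ν z) (ρ z)

variable {κ τ : ℝ} {U : Set ℂ} {a b n : ℂ → ℂ} {s ν ρ : ℂ → ℝ} {φ : ℂ → ℂ →L[ℝ] ℂ}
  {η β : ℂ → ℂ →L[ℝ] ℝ} {z : ℂ}

/-- A lift of the map `y` together with the coordinates of a vector field `M` along it. -/
def LiftsTo (κ τ : ℝ) (U : Set ℂ) (a b : ℂ → ℂ) (s : ℂ → ℝ) (n : ℂ → ℂ) (ν : ℂ → ℝ)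
    (y M : ℂ → R4) : Prop :=
  ∀ z ∈ U, y z = proj κ τ (a z) (b z) (s z) ∧ M z = frame κ τ (a z) (b z) (s z) (n z) (ν z)

theorem IsLift.fderiv_eq (h : IsLift κ τ U a b s φ η β) (hU : IsOpen U) {y : ℂ → R4}
    (hy : ∀ z ∈ U, y z = proj κ τ (a z) (b z) (s z)) (hz : z ∈ U) (v : ℂ) :
    fderiv ℝ y z v = frame κ τ (a z) (b z) (s z) (φ z v) (η z v) := by
  have : y =ᶠ[nhds z] fun z => proj κ τ (a z) (b z) (s z) :=
    Filter.eventually_of_mem (hU.mem_nhds hz) hy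
  rw [this.fderiv_eq, h.fderiv_proj hU hz]

theorem IsLift.jet_inner (h : IsLift κ τ U a b s φ η β) (hU : IsOpen U) {y M : ℂ → R4}
    (hy : ∀ z ∈ U, y z = proj κ τ (a z) (b z) (s z)) (hz : z ∈ U) (v w : ℂ) :
    (jet y M z).inner κ τ v w = (φ z v * conj (φ z w)).re + η z v * η z w := by
  simp only [Jet.inner, jet]
  rw [h.fderiv_eq hU hy hz, h.fderiv_eq hU hy hz, hy z hz, metric_frame (h.onGroup z hz)]

theorem IsLift.jet_cov (h : IsLift κ τ U a b s φ η β) (hU : IsOpen U) (hn : ContDiffOn ℝ ∞ n U)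
    (hν : ContDiffOn ℝ ∞ ν U) {y M : ℂ → R4} (hy : LiftsTo κ τ U a b s n ν y M) (hz : z ∈ U)
    (v w : ℂ) :
    (jet y M z).cov κ τ v w = covForm τ (n z) (fderiv ℝ n z v) (φ z v) (φ z w) (ν z)
      (fderiv ℝ ν z v) (η z v) (η z w) (β z v) := by
  have hM : M =ᶠ[nhds z] fun z => frame κ τ (a z) (b z) (s z) (n z) (ν z) :=
    Filter.eventually_of_mem (hU.mem_nhds hz) fun z hz => (hy z hz).2
  have hy' := fun z hz => (hy z hz).1
  simp only [Jet.cov, jet]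
  rw [h.fderiv_eq hU hy' hz, h.fderiv_eq hU hy' hz, hM.fderiv_eq, (hy z hz).1, (hy z hz).2,
    h.covDeriv_frame hU hn hν hz, covForm]

/-- A conformal immersion has local lifts in which its unit normal has smooth coordinates. -/
theorem exists_isSurfaceLift (hU : IsOpen U) {y M : ℂ → R4} (hy : ContDiffOn ℝ ∞ y U)
    (hj : ∀ z ∈ U, IsSurfaceJet κ τ (jet y M z)) {z₀ : ℂ} (hz₀ : z₀ ∈ U) :
    ∃ V ⊆ U, IsOpen V ∧ z₀ ∈ V ∧ ∃ a b s φ η β n ν ρ,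
      IsSurfaceLift κ τ V a b s φ η β n ν ρ ∧ LiftsTo κ τ V a b s n ν y M := by
  obtain ⟨V, hVU, hV, hz₀V, a, b, s, ha, hb, hs, hg, hpr⟩ :=
    exists_local_lift hU hy (fun z hz => (hj z hz).mem) hz₀
  obtain ⟨φ, η, β, hl⟩ := exists_isLift κ τ hV ha hb hs hg
  have hpr' := fun z hz => (hpr z hz).symm
  have hmain : ∀ z ∈ V, ∃ (n : ℂ) (ν : ℝ),
      ConformalFrame (φ z 1) (φ z I) (η z 1) (η z I) n ν (normSq (φ z 1) + η z 1 ^ 2) ∧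
      M z = frame κ τ (a z) (b z) (s z) n ν := by
    intro z hz
    have hjz := hj z (hVU hz)
    obtain ⟨ρ, hρ, hconf⟩ := hjz.conformal
    have ht := hjz.tangent
    have hin := hl.jet_inner hV (M := M) hpr' hz
    have hd := fun v => hl.fderiv_eq hV hpr' hz v
    have h11 := hconf 1 1
    have hII := hconf I I
    have h1I := hconf 1 I
    have ho := hjz.orthogonal
    have hu := hjz.unit
    have hdir := hjz.direct
    rw [hin] at h11 hII h1I
    simp only [jet] at ht ho hu hdir
    rw [← hpr z hz] at ht hu
    simp only [← hpr z hz, hd] at ho hdir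
    obtain ⟨n, ν, hM⟩ := exists_frame_eq (hg z hz) ht
    rw [← hM, metric_frame (hg z hz)] at hu
    simp only [← hM, metric_frame (hg z hz)] at ho
    rw [← hM, isDirect_frame (hg z hz)] at hdir
    refine ⟨n, ν, ?_, hM.symm⟩
    have e : normSq (φ z 1) + η z 1 ^ 2 = ρ := by
      rw [mul_conj, ofReal_re] at h11
      simp at h11
      linarith
    rw [e]
    refine conformalFrame_of_normal hρ e ?_ ?_ (ho 1) (ho I) ?_ hdir
    · rw [mul_conj, ofReal_re] at hII
      simp at hII
      linarith
    · simp only [one_mul, conj_I, neg_re, I_re, neg_zero, mul_zero] at h1I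
      exact h1I
    · rw [mul_conj, ofReal_re] at hu
      linarith
  have hev : ∀ v : ℂ, ContDiffOn ℝ ∞ (fun z => φ z v) V ∧ ContDiffOn ℝ ∞ (fun z => η z v) V :=
    fun v => ⟨hl.contDiffOn_φ.clm_apply contDiffOn_const,
      hl.contDiffOn_η.clm_apply contDiffOn_const⟩
  have hφ1 := (hev 1).1
  have hφI := (hev I).1
  have hη1 := (hev 1).2
  have hηI := (hev I).2
  have hρ : ContDiffOn ℝ ∞ (fun z => normSq (φ z 1) + η z 1 ^ 2) V := by fun_prop
  have hpos : ∀ z ∈ V, 0 < normSq (φ z 1) + η z 1 ^ 2 := fun z hz => by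
    obtain ⟨n, ν, hc, -⟩ := hmain z hz
    exact hc.pos
  refine ⟨V, hVU, hV, hz₀V, a, b, s, φ, η, β,
    fun z => I * (η z 1 * φ z I - η z I * φ z 1) / ((normSq (φ z 1) + η z 1 ^ 2 : ℝ) : ℂ),
    fun z => (conj (φ z 1) * φ z I).im / (normSq (φ z 1) + η z 1 ^ 2),
    fun z => normSq (φ z 1) + η z 1 ^ 2, ⟨hl, ?_, ?_, ?_⟩, ?_⟩
  · refine contDiffOn_complex_div (by fun_prop) (contDiffOn_ofReal hρ) fun z hz => ?_
    exact ofReal_ne_zero.2 (hpos z hz).ne'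
  · exact ContDiffOn.div (by fun_prop) hρ fun z hz => (hpos z hz).ne'
  · intro z hz
    obtain ⟨n, ν, hc, -⟩ := hmain z hz
    have hne : ((normSq (φ z 1) + η z 1 ^ 2 : ℝ) : ℂ) ≠ 0 := ofReal_ne_zero.2 hc.pos.ne'
    have e1 : n = I * (η z 1 * φ z I - η z I * φ z 1) / ((normSq (φ z 1) + η z 1 ^ 2 : ℝ) : ℂ) := by
      rw [eq_div_iff hne, mul_comm, hc.normal_eq]
    have e2 : ν = (conj (φ z 1) * φ z I).im / (normSq (φ z 1) + η z 1 ^ 2) := by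
      rw [eq_div_iff hc.pos.ne', mul_comm, hc.angle_eq]
    rw [← e1, ← e2]
    exact hc
  · intro z hz
    obtain ⟨n, ν, hc, hM⟩ := hmain z hz
    have hne : ((normSq (φ z 1) + η z 1 ^ 2 : ℝ) : ℂ) ≠ 0 := ofReal_ne_zero.2 hc.pos.ne'
    have e1 : n = I * (η z 1 * φ z I - η z I * φ z 1) / ((normSq (φ z 1) + η z 1 ^ 2 : ℝ) : ℂ) := by
      rw [eq_div_iff hne, mul_comm, hc.normal_eq]
    have e2 : ν = (conj (φ z 1) * φ z I).im / (normSq (φ z 1) + η z 1 ^ 2) := by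
      rw [eq_div_iff hc.pos.ne', mul_comm, hc.angle_eq]
    refine ⟨hpr' z hz, ?_⟩
    rw [hM]
    beta_reduce
    rw [← e1, ← e2]

/-- If a real function vanishes on an open set, so do its derivatives along lines. -/
theorem line_deriv_eq_zero (hU : IsOpen U) {g : ℂ → ℝ} (hg : ∀ z ∈ U, g z = 0) (hz : z ∈ U) {v : ℂ}
    {d : ℝ} (h : HasDerivAt (fun t : ℝ => g (z + t • v)) d 0) : d = 0 :=
  h.unique ((hasDerivAt_const (0 : ℝ) (0 : ℝ)).congr_of_eventuallyEq
    ((eventually_line_mem hU hz v).mono fun _ ht => hg _ ht))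

/-- Derivative of the inner product of two fields along a line. -/
theorem inner_hasDerivAt {f g : ℝ → ℂ} {p q : ℝ → ℝ} {f' g' : ℂ} {p' q' t : ℝ}
    (hf : HasDerivAt f f' t) (hg : HasDerivAt g g' t) (hp : HasDerivAt p p' t)
    (hq : HasDerivAt q q' t) :
    HasDerivAt (fun x => (f x * conj (g x)).re + p x * q x)
      ((f' * conj (g t)).re + (f t * conj g').re + p' * q t + p t * q') t := by
  refine ((hasDerivAt_re (hf.mul (hasDerivAt_conj hg))).add (hp.mul hq)).congr_deriv ?_
  rw [add_re]
  ring

/-- The mean curvature equations in a lift. -/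
theorem IsSurfaceLift.mean_curvature (h : IsSurfaceLift κ τ U a b s φ η β n ν ρ) (hU : IsOpen U)
    {y M : ℂ → R4} (hy : LiftsTo κ τ U a b s n ν y M) {H : ℝ} (hz : z ∈ U)
    (hH : (jet y M z).HasMeanCurvature κ τ H) :
    fderiv ℝ φ z 1 1 + fderiv ℝ φ z I I
        = 2 * I * ((β z 1 + τ * η z 1 : ℝ) : ℂ) * φ z 1 + 2 * I * ((β z I + τ * η z I : ℝ) : ℂ) * φ z I
          + 2 * ((ρ z * H : ℝ) : ℂ) * n z ∧
      fderiv ℝ η z 1 1 + fderiv ℝ η z I I = 2 * ρ z * H * ν z := by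
  have hc := h.conformalFrame z hz
  have dφ := fun v w => hasDerivAt_line_apply (differentiableAt_of_contDiffOn hU h.contDiffOn_φ hz)
    v w
  have dη := fun v w => hasDerivAt_line_apply (differentiableAt_of_contDiffOn hU h.contDiffOn_η hz)
    v w
  have dn := hasDerivAt_line (differentiableAt_of_contDiffOn hU h.contDiffOn_n hz)
  have dν := hasDerivAt_line (differentiableAt_of_contDiffOn hU h.contDiffOn_ν hz)
  have hns : ∀ z ∈ U, ((φ z 1 * conj (φ z 1)).re + η z 1 * η z 1)
      - ((φ z I * conj (φ z I)).re + η z I * η z I) = 0 := fun z hz => by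
    have h1 := (h.conformalFrame z hz).normSq_left
    have h2 := (h.conformalFrame z hz).normSq_right
    rw [mul_conj, mul_conj, ofReal_re, ofReal_re]
    linarith
  have hl := fun v => line_deriv_eq_zero hU hns hz
    ((inner_hasDerivAt (dφ v 1) (dφ v 1) (dη v 1) (dη v 1)).sub
      (inner_hasDerivAt (dφ v I) (dφ v I) (dη v I) (dη v I)))
  have ho := fun v => line_deriv_eq_zero hU (fun z hz => (h.conformalFrame z hz).inner_eq) hz
    (inner_hasDerivAt (dφ v 1) (dφ v I) (dη v 1) (dη v I))
  have hn1 := line_deriv_eq_zero hU (fun z hz => (h.conformalFrame z hz).re_left) hz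
    (inner_hasDerivAt (dn 1) (dφ 1 1) (dν 1) (dη 1 1))
  have hnI := line_deriv_eq_zero hU (fun z hz => (h.conformalFrame z hz).re_right) hz
    (inner_hasDerivAt (dn I) (dφ I I) (dν I) (dη I I))
  simp only [zero_smul, add_zero] at hl ho hn1 hnI
  have hcφ := h.curl_φ hU hz 1 I
  have hcη := h.curl_η hU hz 1 I
  rw [curl] at hcφ hcη
  rw [Jet.HasMeanCurvature, h.jet_cov hU h.contDiffOn_n h.contDiffOn_ν hy hz,
    h.jet_cov hU h.contDiffOn_n h.contDiffOn_ν hy hz,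
    h.jet_inner hU (fun z hz => (hy z hz).1) hz] at hH
  have hρ : (φ z 1 * conj (φ z 1)).re + η z 1 * η z 1 = ρ z := by
    rw [mul_conj, ofReal_re, ← hc.normSq_left]; ring
  rw [hρ] at hH
  have hcomm : ∀ x y : ℂ, (x * conj y).re = (y * conj x).re := fun x y => by
    simp only [map_mul, map_sub, map_add, map_neg, map_pow, conj_I, conj_ofReal, Complex.conj_conj,
    mul_re, mul_im, sub_re, sub_im, add_re, add_im, neg_re, neg_im, I_re, I_im, ofReal_re, ofReal_im,
    conj_re, conj_im, pow_two, one_re, one_im, zero_re, zero_im]; ring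
  refine hc.mean_curvature (P₁ := fderiv ℝ φ z 1 1) (P₂ := fderiv ℝ φ z I 1)
    (Q₁ := fderiv ℝ φ z 1 I) (Q₂ := fderiv ℝ φ z I I) (e₁ := fderiv ℝ η z 1 1)
    (e₂ := fderiv ℝ η z I 1) (f₁ := fderiv ℝ η z 1 I) (f₂ := fderiv ℝ η z I I)
    hcφ hcη ?_ ?_ ?_ ?_ ?_ ?_ hH
  · have := hl 1
    rw [hcomm (φ z 1), hcomm (φ z I)] at this
    linarith
  · have := hl I
    rw [hcomm (φ z 1), hcomm (φ z I)] at this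
    linarith
  · linarith [ho 1]
  · linarith [ho I]
  · linarith [hn1]
  · linarith [hnI]

end SurfaceLift

/-! ### Integration of the Maurer-Cartan equations -/

section Integration

open Complex ComplexConjugate Metric

/-- The left-invariant system satisfied by the elements of the group with given Maurer-Cartan
form. -/
def mcMap (κ : ℝ) (φ : ℂ) (β : ℝ) : ℂ × ℂ →L[ℝ] ℂ × ℂ :=
  LinearMap.toContinuousLinearMap
    { toFun := fun y => (mcA κ y.1 y.2 φ β, mcB y.1 y.2 φ β)
      map_add' := fun x y => by
        simp only [mcA, mcB, Prod.fst_add, Prod.snd_add, map_add, Prod.mk_add_mk]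
        congr 1 <;> ring
      map_smul' := fun c y => by
        simp only [mcA, mcB, Prod.smul_fst, Prod.smul_snd, Complex.real_smul, map_mul, conj_ofReal,
          Prod.smul_mk, RingHom.id_apply]
        congr 1 <;> ring }

theorem mcMap_apply (κ : ℝ) (φ : ℂ) (β : ℝ) (y : ℂ × ℂ) :
    mcMap κ φ β y = (mcA κ y.1 y.2 φ β, mcB y.1 y.2 φ β) := rfl

/-- `mcMap` as a linear map of the Maurer-Cartan form. -/
def mcMapL (κ : ℝ) : ℂ × ℝ →L[ℝ] ℂ × ℂ →L[ℝ] ℂ × ℂ :=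
  LinearMap.toContinuousLinearMap
    { toFun := fun p => mcMap κ p.1 p.2
      map_add' := fun p q => by
        refine ContinuousLinearMap.ext fun y => ?_
        simp only [mcMap_apply, add_apply, mcA, mcB, Prod.fst_add, Prod.snd_add, Prod.mk_add_mk,
          ofReal_add]
        congr 1 <;> ring
      map_smul' := fun c p => by
        refine ContinuousLinearMap.ext fun y => ?_
        simp only [mcMap_apply, smul_apply, mcA, mcB, Prod.smul_fst, Prod.smul_snd,
          Complex.real_smul, Prod.smul_mk, RingHom.id_apply, smul_eq_mul, ofReal_mul]
        congr 1 <;> ring }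

theorem mcMapL_apply (κ : ℝ) (p : ℂ × ℝ) (y : ℂ × ℂ) :
    mcMapL κ p y = (mcA κ y.1 y.2 p.1 p.2, mcB y.1 y.2 p.1 p.2) := rfl

variable {κ τ : ℝ} {U : Set ℂ} {φ : ℂ → ℂ →L[ℝ] ℂ} {η β : ℂ → ℂ →L[ℝ] ℝ}

/-- The coefficients of the linear total differential equation with Maurer-Cartan form `(φ, β)`. -/
def mcForm (κ : ℝ) (φ : ℂ → ℂ →L[ℝ] ℂ) (β : ℂ → ℂ →L[ℝ] ℝ) (z : ℂ) :
    ℂ →L[ℝ] ℂ × ℂ →L[ℝ] ℂ × ℂ :=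
  ((mcMapL κ).comp (ContinuousLinearMap.inl ℝ ℂ ℝ)).comp (φ z)
    + ((mcMapL κ).comp (ContinuousLinearMap.inr ℝ ℂ ℝ)).comp (β z)

theorem mcForm_apply (z v : ℂ) (y : ℂ × ℂ) :
    mcForm κ φ β z v y = (mcA κ y.1 y.2 (φ z v) (β z v), mcB y.1 y.2 (φ z v) (β z v)) := by
  have : mcForm κ φ β z v = mcMapL κ (φ z v, β z v) := by
    simp only [mcForm, add_apply, ContinuousLinearMap.comp_apply]
    rw [← map_add]
    simp
  rw [this, mcMapL_apply]

theorem contDiffOn_mcForm (hφ : ContDiffOn ℝ ∞ φ U) (hβ : ContDiffOn ℝ ∞ β U) :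
    ContDiffOn ℝ ∞ (mcForm κ φ β) U :=
  (contDiffOn_const.clm_comp hφ).add (contDiffOn_const.clm_comp hβ)

theorem fderiv_mcForm (hU : IsOpen U) (hφ : ContDiffOn ℝ ∞ φ U) (hβ : ContDiffOn ℝ ∞ β U) {z : ℂ}
    (hz : z ∈ U) (u v : ℂ) (y : ℂ × ℂ) :
    fderiv ℝ (mcForm κ φ β) z u v y
      = mcMapL κ (fderiv ℝ φ z u v, fderiv ℝ β z u v) y := by
  have h1 := hasDerivAt_line_apply (differentiableAt_of_contDiffOn hU
    (contDiffOn_mcForm (κ := κ) hφ hβ) hz) u v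
  have h2 : HasDerivAt (fun t : ℝ => mcForm κ φ β (z + t • u) v)
      (mcMapL κ (fderiv ℝ φ z u v, fderiv ℝ β z u v)) 0 := by
    have hp := (hasDerivAt_line_apply (differentiableAt_of_contDiffOn hU hφ hz) u v).prodMk
      (hasDerivAt_line_apply (differentiableAt_of_contDiffOn hU hβ hz) u v)
    have h3 := ((mcMapL κ).hasFDerivAt (x := (φ (z + (0 : ℝ) • u) v, β (z + (0 : ℝ) • u) v))).comp_hasDerivAt
      (0 : ℝ) hp
    refine h3.congr_of_eventuallyEq (Filter.Eventually.of_forall fun t => ?_)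
    refine ContinuousLinearMap.ext fun y => ?_
    rw [mcForm_apply]
    rfl
  rw [h1.unique h2]

/-- The Maurer-Cartan equations are the integrability condition of the total differential equation
satisfied by a map to the group. -/
theorem mcForm_flat (hU : IsOpen U) (hφ : ContDiffOn ℝ ∞ φ U) (hβ : ContDiffOn ℝ ∞ β U)
    (hcφ : ∀ z ∈ U, ∀ v w, curl φ z v w = 2 * I * (β z v * φ z w - β z w * φ z v))
    (hcβ : ∀ z ∈ U, ∀ v w, curl β z v w = κ / 2 * (conj (φ z v) * φ z w).im) {z : ℂ} (hz : z ∈ U)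
    (u v : ℂ) :
    fderiv ℝ (mcForm κ φ β) z u v - fderiv ℝ (mcForm κ φ β) z v u
      = (mcForm κ φ β z u) ∘L (mcForm κ φ β z v) - (mcForm κ φ β z v) ∘L (mcForm κ φ β z u) := by
  refine ContinuousLinearMap.ext fun y => ?_
  have h1 := hcφ z hz u v
  have h2 := hcβ z hz u v
  rw [curl] at h1 h2
  have h3 : fderiv ℝ (mcForm κ φ β) z u v y - fderiv ℝ (mcForm κ φ β) z v u y
      = mcMapL κ (2 * I * (β z u * φ z v - β z v * φ z u), κ / 2 * (conj (φ z u) * φ z v).im) y := by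
    rw [fderiv_mcForm hU hφ hβ hz, fderiv_mcForm hU hφ hβ hz, ← sub_apply, ← map_sub, Prod.mk_sub_mk,
      h1, h2]
  rw [sub_apply, h3]
  simp only [sub_apply, ContinuousLinearMap.comp_apply, mcForm_apply, mcMapL_apply, Prod.mk_sub_mk]
  have him : (((κ / 2 * (conj (φ z u) * φ z v).im : ℝ)) : ℂ)
      = ((κ / 4 : ℝ) : ℂ) * (-I * (conj (φ z u) * φ z v - φ z u * conj (φ z v))) := by
    rw [ofReal_mul, ofReal_im_eq]
    simp only [map_mul, Complex.conj_conj]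
    push_cast
    ring
  have hI := I_mul_I
  congr 1
  · simp only [mcA, mcB, him, map_add, map_sub, map_mul, conj_I, conj_ofReal, Complex.conj_conj]
    linear_combination (-((κ / 4 : ℝ) : ℂ) * (conj (φ z u) * φ z v - φ z u * conj (φ z v)) * y.1) * hI
  · simp only [mcA, mcB, him, map_add, map_sub, map_mul, conj_I, conj_ofReal, Complex.conj_conj]
    linear_combination (-((κ / 4 : ℝ) : ℂ) * (conj (φ z u) * φ z v - φ z u * conj (φ z v)) * y.2) * hI

/-- Forms satisfying the structure equations of `E(κ, τ)` are the forms of a lift, with arbitrary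
initial value, on a disc which does not depend on the initial value. -/
theorem exists_isLift_of_forms (hU : IsOpen U) (hφ : ContDiffOn ℝ ∞ φ U)
    (hη : ContDiffOn ℝ ∞ η U) (hβ : ContDiffOn ℝ ∞ β U)
    (hcφ : ∀ z ∈ U, ∀ v w, curl φ z v w = 2 * I * (β z v * φ z w - β z w * φ z v))
    (hcη : ∀ z ∈ U, ∀ v w, curl η z v w = -(2 * τ * (conj (φ z v) * φ z w).im))
    (hcβ : ∀ z ∈ U, ∀ v w, curl β z v w = κ / 2 * (conj (φ z v) * φ z w).im) {p : ℂ}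
    (hp : p ∈ U) :
    ∃ r > 0, ball p r ⊆ U ∧ ∀ q ∈ ball p r, ∀ (a₀ b₀ : ℂ) (s₀ : ℝ), OnGroup κ a₀ b₀ →
      ∃ a b s, IsLift κ τ (ball p r) a b s φ η β ∧ a q = a₀ ∧ b q = b₀ ∧ s q = s₀ := by
  obtain ⟨r, hr, hR⟩ := exists_totalDifferential_solution hU
    ((contDiffOn_mcForm (κ := κ) hφ hβ).of_le (WithTop.coe_le_coe.2 le_top)) hp
    (fun z hz u v => mcForm_flat hU hφ hβ hcφ hcβ hz u v)
  obtain ⟨hsub, hsol⟩ := hR r le_rfl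
  refine ⟨r, hr, hsub, fun q hq a₀ b₀ s₀ h₀ => ?_⟩
  have hB : IsOpen (ball p r) := isOpen_ball
  obtain ⟨y, hyq, hy⟩ := hsol q hq (a₀, b₀)
  have hφ' := hφ.mono hsub
  have hη' := hη.mono hsub
  have hβ' := hβ.mono hsub
  have hys := contDiffOn_of_totalDifferential hB (contDiffOn_mcForm (κ := κ) hφ' hβ') hy
  have ha : ContDiffOn ℝ ∞ (fun z => (y z).1) (ball p r) := contDiff_fst.comp_contDiffOn hys
  have hb : ContDiffOn ℝ ∞ (fun z => (y z).2) (ball p r) := contDiff_snd.comp_contDiffOn hys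
  have hfa : ∀ z ∈ ball p r, ∀ v, fderiv ℝ (fun z => (y z).1) z v
      = mcA κ (y z).1 (y z).2 (φ z v) (β z v) := by
    intro z hz v
    rw [((hy z hz).fst).fderiv]
    show ((mcForm κ φ β z) v (y z)).1 = _
    rw [mcForm_apply]
  have hfb : ∀ z ∈ ball p r, ∀ v, fderiv ℝ (fun z => (y z).2) z v
      = mcB (y z).1 (y z).2 (φ z v) (β z v) := by
    intro z hz v
    rw [((hy z hz).snd).fderiv]
    show ((mcForm κ φ β z) v (y z)).2 = _
    rw [mcForm_apply]
  have hg : ∀ z ∈ ball p r, OnGroup κ (y z).1 (y z).2 := by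
    intro z hz
    have hd : ContDiffOn ℝ ∞ (fun z => normSq (y z).1 + κ / 4 * normSq (y z).2) (ball p r) := by
      fun_prop
    have hconst := hB.is_const_of_fderiv_eq_zero (convex_ball p r).isPreconnected
      (hd.differentiableOn (by simp)) (fun w hw => by
        ext1 v
        refine (hasDerivAt_line (differentiableAt_of_contDiffOn hB hd hw) v).unique ?_
        have la := hasDerivAt_line (differentiableAt_of_contDiffOn hB ha hw) v
        have lb := hasDerivAt_line (differentiableAt_of_contDiffOn hB hb hw) v
        rw [hfa w hw] at la
        rw [hfb w hw] at lb
        simp only [normSq_apply]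
        have ra := hasDerivAt_re la
        have ia := hasDerivAt_im la
        have rb := hasDerivAt_re lb
        have ib := hasDerivAt_im lb
        refine (((ra.mul ra).add (ia.mul ia)).add
          (((rb.mul rb).add (ib.mul ib)).const_mul _)).congr_deriv ?_
        simp only [mcA, mcB, zero_smul, add_zero, map_mul, map_sub, map_add, map_neg, map_pow, conj_I, conj_ofReal, Complex.conj_conj,
    mul_re, mul_im, sub_re, sub_im, add_re, add_im, neg_re, neg_im, I_re, I_im, ofReal_re, ofReal_im,
    conj_re, conj_im, pow_two, one_re, one_im, zero_re, zero_im, Pi.zero_apply, zero_apply]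
        ring) hz hq
    have : normSq (y z).1 + κ / 4 * normSq (y z).2 = normSq (y q).1 + κ / 4 * normSq (y q).2 :=
      hconst
    rw [OnGroup, this, hyq]
    exact h₀
  have hgl : IsGroupLift κ (ball p r) (fun z => (y z).1) (fun z => (y z).2) φ β :=
    ⟨ha, hb, hφ', hβ', hg, hfa, hfb⟩
  obtain ⟨σ, hσ, hσs⟩ : ∃ σ : ℂ → ℂ →L[ℝ] ℝ, ContDiffOn ℝ ∞ σ (ball p r) ∧
      ∀ z ∈ ball p r, ∀ v, σ z v = mcS κ τ (y z).1 (y z).2 (φ z v) (η z v) (β z v) := by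
    by_cases hκ : 0 < κ
    · refine ⟨fun z => η z + (4 * τ / κ) • β z, hη'.add (hβ'.const_smul _), fun z hz v => ?_⟩
      simp [mcS, hκ]
    · have hM : ContDiffOn ℝ ∞ (fun z => ContinuousLinearMap.mul ℝ ℂ (conj (y z).2 / (y z).1))
          (ball p r) := (ContinuousLinearMap.mul ℝ ℂ).contDiff.comp_contDiffOn
        (contDiffOn_complex_div (contDiffOn_conj hb) ha fun z hz => (hg z hz).ne_zero hκ)
      refine ⟨fun z => η z + τ • imCLM.comp
        ((ContinuousLinearMap.mul ℝ ℂ (conj (y z).2 / (y z).1)).comp (φ z)),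
        hη'.add ((contDiffOn_const.clm_comp (hM.clm_comp hφ')).const_smul τ), fun z hz v => ?_⟩
      have : conj (y z).2 * φ z v / (y z).1 = conj (y z).2 / (y z).1 * φ z v := by ring
      simp only [mcS, hκ, if_false, this]
      simp
  obtain ⟨f, hf⟩ := (convex_ball p r).exists_forall_hasFDerivAt_of_fderiv_symmetric hB
    (hσ.differentiableOn (by simp)) (fun z hz v w => by
      have h1 := hgl.curl_mcS hB hz hσ hη' hσs v w
      rw [hcη z (hsub hz), neg_add_cancel, curl] at h1
      exact sub_eq_zero.1 h1)
  have hfs : ContDiffOn ℝ ∞ f (ball p r) := by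
    rw [contDiffOn_infty_iff_fderiv_of_isOpen hB]
    exact ⟨fun z hz => (hf z hz).differentiableAt.differentiableWithinAt,
      hσ.congr fun z hz => (hf z hz).fderiv⟩
  refine ⟨fun z => (y z).1, fun z => (y z).2, fun z => f z + (s₀ - f q),
    ⟨hgl, hfs.add contDiffOn_const, hη', fun z hz v => ?_⟩, by simp [hyq], by simp [hyq], by simp⟩
  rw [((hf z hz).add_const _).fderiv]
  exact hσs z hz v

end Integration

/-! ### The sister forms -/

section Sister

open Complex ComplexConjugate Metric

/-- The rotation by the angle `-θ`, as a continuous real linear map. -/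
def rotCLM (θ : ℝ) : ℂ →L[ℝ] ℂ := ContinuousLinearMap.mul ℝ ℂ (exp (-(θ * I)))

theorem rotCLM_apply (θ : ℝ) (v : ℂ) : rotCLM θ v = exp (-(θ * I)) * v := rfl

theorem rotCLM_re (θ : ℝ) (v : ℂ) :
    (rotCLM θ v).re = Real.cos θ * v.re + Real.sin θ * v.im := by
  rw [rotCLM_apply, ← neg_mul, ← ofReal_neg, mul_re, exp_ofReal_mul_I_re, exp_ofReal_mul_I_im,
    Real.cos_neg, Real.sin_neg]
  ring

theorem rotCLM_im (θ : ℝ) (v : ℂ) :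
    (rotCLM θ v).im = -Real.sin θ * v.re + Real.cos θ * v.im := by
  rw [rotCLM_apply, ← neg_mul, ← ofReal_neg, mul_im, exp_ofReal_mul_I_re, exp_ofReal_mul_I_im,
    Real.cos_neg, Real.sin_neg]
  ring

section

variable {F : Type*} [NormedAddCommGroup F] [NormedSpace ℝ F]

/-- The form `v ↦ σ (e^{-θJ} v)`. -/
def sisterForm (θ : ℝ) (σ : ℂ → ℂ →L[ℝ] F) (z : ℂ) : ℂ →L[ℝ] F := (σ z).comp (rotCLM θ)

theorem sisterForm_apply (θ : ℝ) (σ : ℂ → ℂ →L[ℝ] F) (z v : ℂ) :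
    sisterForm θ σ z v = (Real.cos θ * v.re + Real.sin θ * v.im) • σ z 1
      + (-Real.sin θ * v.re + Real.cos θ * v.im) • σ z I := by
  rw [sisterForm, ContinuousLinearMap.comp_apply, clm_apply_eq (σ z), rotCLM_re, rotCLM_im]

theorem contDiffOn_sisterForm {U : Set ℂ} {σ : ℂ → ℂ →L[ℝ] F} (θ : ℝ)
    (hσ : ContDiffOn ℝ ∞ σ U) : ContDiffOn ℝ ∞ (sisterForm θ σ) U :=
  hσ.clm_comp contDiffOn_const

theorem fderiv_clm_comp_const {U : Set ℂ} {σ : ℂ → ℂ →L[ℝ] F} (hU : IsOpen U)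
    (hσ : ContDiffOn ℝ ∞ σ U) (L : ℂ →L[ℝ] ℂ) {z : ℂ} (hz : z ∈ U) (v w : ℂ) :
    fderiv ℝ (fun z => (σ z).comp L) z v w = fderiv ℝ σ z v (L w) := by
  have h1 : ContDiffOn ℝ ∞ (fun z => (σ z).comp L) U := hσ.clm_comp contDiffOn_const
  exact (hasDerivAt_line_apply (differentiableAt_of_contDiffOn hU h1 hz) v w).unique
    (hasDerivAt_line_apply (differentiableAt_of_contDiffOn hU hσ hz) v (L w))

theorem curl_eq_smul (σ : ℂ → ℂ →L[ℝ] F) (z v w : ℂ) :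
    curl σ z v w = (v.re * w.im - v.im * w.re) • curl σ z 1 I := by
  have h : ∀ u w : ℂ, fderiv ℝ σ z u w = (u.re * w.re) • fderiv ℝ σ z 1 1
      + (u.re * w.im) • fderiv ℝ σ z 1 I + (u.im * w.re) • fderiv ℝ σ z I 1
      + (u.im * w.im) • fderiv ℝ σ z I I := fun u w => by
    rw [clm_apply_eq (fderiv ℝ σ z) u, add_apply, smul_apply, smul_apply,
      clm_apply_eq (fderiv ℝ σ z 1) w, clm_apply_eq (fderiv ℝ σ z I) w]
    module
  rw [curl, curl, h v w, h w v]
  module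

/-- The exterior derivative of the rotated form mixes the exterior derivative and the divergence of
the original form. -/
theorem curl_sisterForm {U : Set ℂ} {σ : ℂ → ℂ →L[ℝ] F} (hU : IsOpen U)
    (hσ : ContDiffOn ℝ ∞ σ U) (θ : ℝ) {z : ℂ} (hz : z ∈ U) :
    curl (sisterForm θ σ) z 1 I = Real.sin θ • (fderiv ℝ σ z 1 1 + fderiv ℝ σ z I I)
      + Real.cos θ • curl σ z 1 I := by
  have h := fun v w => fderiv_clm_comp_const hU hσ (rotCLM θ) hz v w
  have h' : ∀ v w : ℂ, fderiv ℝ (sisterForm θ σ) z v w = fderiv ℝ σ z v (rotCLM θ w) := h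
  rw [curl, h', h', clm_apply_eq (fderiv ℝ σ z 1), clm_apply_eq (fderiv ℝ σ z I), rotCLM_re,
    rotCLM_im, rotCLM_re, rotCLM_im, curl]
  simp
  module

end

/-- The connection form of the sister immersion. The correction is the only one for which the shape
operator is the rotated one, see `exists_isLift_sister`. -/
def sisterConn (θ τ₂ H₂ : ℝ) (η β : ℂ → ℂ →L[ℝ] ℝ) (z : ℂ) : ℂ →L[ℝ] ℝ :=
  β z + (η z).comp (ContinuousLinearMap.mul ℝ ℂ (Real.sin θ * (H₂ + I * τ₂)))

theorem sisterConn_apply (θ τ₂ H₂ : ℝ) (η β : ℂ → ℂ →L[ℝ] ℝ) (z v : ℂ) :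
    sisterConn θ τ₂ H₂ η β z v = β z v + Real.sin θ * ((H₂ * v.re - τ₂ * v.im) * η z 1
      + (H₂ * v.im + τ₂ * v.re) * η z I) := by
  rw [sisterConn, add_apply, ContinuousLinearMap.comp_apply, clm_apply_eq (η z)]
  simp [-ofReal_sin]
  ring

variable {κ₁ τ₁ κ₂ τ₂ H₁ H₂ θ : ℝ}

/-- The relation `τ₂ + i H₂ = e^{iθ} (τ₁ + i H₁)` solved for `τ₁` and `H₁`. -/
theorem sister_parameters
    (hθ : (τ₂ : ℂ) + I * H₂ = exp (θ * I) * (τ₁ + I * H₁)) :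
    τ₁ = Real.cos θ * τ₂ + Real.sin θ * H₂ ∧ H₁ = Real.cos θ * H₂ - Real.sin θ * τ₂ := by
  have hr := congrArg re hθ
  have hi := congrArg im hθ
  simp only [mul_re, mul_im, exp_ofReal_mul_I_re, exp_ofReal_mul_I_im, add_re, add_im, ofReal_re,
    ofReal_im, I_re, I_im] at hr hi
  have hcs := Real.sin_sq_add_cos_sq θ
  constructor
  · linear_combination (-τ₁) * hcs - Real.cos θ * hr - Real.sin θ * hi
  · linear_combination (-H₁) * hcs + Real.sin θ * hr - Real.cos θ * hi

theorem ConformalFrame.rotate {P Q n : ℂ} {e f ν ρ : ℝ} (h : ConformalFrame P Q e f n ν ρ)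
    (θ : ℝ) : ConformalFrame (Real.cos θ • P + (-Real.sin θ) • Q) (Real.sin θ • P + Real.cos θ • Q)
      (Real.cos θ • e + (-Real.sin θ) • f) (Real.sin θ • e + Real.cos θ • f) n ν ρ := by
  have hcs := Real.sin_sq_add_cos_sq θ
  generalize Real.sin θ = S at *
  generalize Real.cos θ = C at *
  have h1 := h.normSq_left
  have h2 := h.normSq_right
  have h3 := h.inner_eq
  have h4 := h.normal_eq
  have h5 := h.angle_eq
  have hcs' : (S : ℂ) ^ 2 + (C : ℂ) ^ 2 = 1 := by exact_mod_cast hcs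
  simp only [Complex.real_smul, smul_eq_mul]
  refine ⟨h.pos, ?_, ?_, ?_, ?_, ?_⟩
  · simp only [normSq_apply, map_mul, map_sub, map_add, map_neg, map_pow, conj_I, conj_ofReal, Complex.conj_conj,
    mul_re, mul_im, sub_re, sub_im, add_re, add_im, neg_re, neg_im, I_re, I_im, ofReal_re, ofReal_im,
    conj_re, conj_im, pow_two, one_re, one_im, zero_re, zero_im] at h1 h2 h3 ⊢
    linear_combination C * C * h1 + S * S * h2 - 2 * C * S * h3 + ρ * hcs
  · simp only [normSq_apply, map_mul, map_sub, map_add, map_neg, map_pow, conj_I, conj_ofReal, Complex.conj_conj,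
    mul_re, mul_im, sub_re, sub_im, add_re, add_im, neg_re, neg_im, I_re, I_im, ofReal_re, ofReal_im,
    conj_re, conj_im, pow_two, one_re, one_im, zero_re, zero_im] at h1 h2 h3 ⊢
    linear_combination S * S * h1 + C * C * h2 + 2 * C * S * h3 + ρ * hcs
  · simp only [normSq_apply, map_mul, map_sub, map_add, map_neg, map_pow, conj_I, conj_ofReal, Complex.conj_conj,
    mul_re, mul_im, sub_re, sub_im, add_re, add_im, neg_re, neg_im, I_re, I_im, ofReal_re, ofReal_im,
    conj_re, conj_im, pow_two, one_re, one_im, zero_re, zero_im] at h1 h2 h3 ⊢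
    linear_combination S * C * h1 - S * C * h2 + (C * C - S * S) * h3
  · rw [h4]
    push_cast
    linear_combination (-(I * (e * Q - f * P))) * hcs'
  · rw [h5]
    simp only [normSq_apply, map_mul, map_sub, map_add, map_neg, map_pow, conj_I, conj_ofReal, Complex.conj_conj,
    mul_re, mul_im, sub_re, sub_im, add_re, add_im, neg_re, neg_im, I_re, I_im, ofReal_re, ofReal_im,
    conj_re, conj_im, pow_two, one_re, one_im, zero_re, zero_im]
    linear_combination (-(P.re * Q.im - P.im * Q.re)) * hcs

theorem ConformalFrame.inner_apply {P Q n : ℂ} {e f ν ρ : ℝ} (h : ConformalFrame P Q e f n ν ρ)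
    (x y p q : ℝ) : ((x • P + y • Q) * conj (p • P + q • Q)).re
      + (x • e + y • f) * (p • e + q • f) = ρ * (x * p + y * q) := by
  have h1 := h.normSq_left
  have h2 := h.normSq_right
  have h3 := h.inner_eq
  simp only [Complex.real_smul, smul_eq_mul]
  simp only [normSq_apply, map_mul, map_sub, map_add, map_neg, map_pow, conj_I, conj_ofReal, Complex.conj_conj,
    mul_re, mul_im, sub_re, sub_im, add_re, add_im, neg_re, neg_im, I_re, I_im, ofReal_re, ofReal_im,
    conj_re, conj_im, pow_two, one_re, one_im, zero_re, zero_im] at h1 h2 h3 ⊢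
  linear_combination x * p * h1 + y * q * h2 + (x * q + y * p) * h3

theorem ConformalFrame.orthogonal_apply {P Q n : ℂ} {e f ν ρ : ℝ}
    (h : ConformalFrame P Q e f n ν ρ) (x y : ℝ) :
    (n * conj (x • P + y • Q)).re + ν * (x • e + y • f) = 0 := by
  have h1 := h.re_left
  have h2 := h.re_right
  simp only [Complex.real_smul, smul_eq_mul]
  simp only [map_mul, map_sub, map_add, map_neg, map_pow, conj_I, conj_ofReal, Complex.conj_conj,
    mul_re, mul_im, sub_re, sub_im, add_re, add_im, neg_re, neg_im, I_re, I_im, ofReal_re, ofReal_im,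
    conj_re, conj_im, pow_two, one_re, one_im, zero_re, zero_im] at h1 h2 ⊢
  linear_combination x * h1 + y * h2

variable {U : Set ℂ} {a b n : ℂ → ℂ} {s ν ρ : ℂ → ℝ} {φ : ℂ → ℂ →L[ℝ] ℂ}
  {η β : ℂ → ℂ →L[ℝ] ℝ} {z : ℂ}

/-- The rotation of the forms in the tangent plane preserves the induced metric and the coordinates of
the unit normal. -/
theorem conformalFrame_sister (θ : ℝ)
    (h : ConformalFrame (φ z 1) (φ z I) (η z 1) (η z I) (n z) (ν z) (ρ z)) :
    ConformalFrame (sisterForm θ φ z 1) (sisterForm θ φ z I) (sisterForm θ η z 1)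
      (sisterForm θ η z I) (n z) (ν z) (ρ z) := by
  have := h.rotate θ
  simpa [sisterForm_apply, -neg_smul] using this

/-- The shape operator of an immersion with the sister forms: it is the rotated trace-free part of the
original one plus `H₂`. -/
theorem covForm_sisterForm
    (h : ConformalFrame (φ z 1) (φ z I) (η z 1) (η z I) (n z) (ν z) (ρ z))
    (hτ : τ₁ = Real.cos θ * τ₂ + Real.sin θ * H₂) (hH : H₁ = Real.cos θ * H₂ - Real.sin θ * τ₂)
    (n' : ℂ) (ν' : ℝ) (v w : ℂ) :
    covForm τ₂ (n z) n' (sisterForm θ φ z v) (sisterForm θ φ z w) (ν z) ν' (sisterForm θ η z v)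
        (sisterForm θ η z w) (sisterConn θ τ₂ H₂ η β z v)
      = covForm τ₁ (n z) n' (φ z v) (φ z (rotCLM θ w)) (ν z) ν' (η z v) (η z (rotCLM θ w)) (β z v)
        + H₁ * ((φ z v * conj (φ z (rotCLM θ w))).re + η z v * η z (rotCLM θ w))
        - H₂ * ((φ z v * conj (φ z w)).re + η z v * η z w) := by
  have key := h.covForm_sister hτ hH v.re v.im (rotCLM θ w).re (rotCLM θ w).im (β z v) n' ν'
  have e1 : ((φ z v * conj (φ z (rotCLM θ w))).re + η z v * η z (rotCLM θ w))
      = ρ z * (v.re * (rotCLM θ w).re + v.im * (rotCLM θ w).im) := by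
    rw [clm_apply_eq (φ z) v, clm_apply_eq (φ z) (rotCLM θ w), clm_apply_eq (η z) v,
      clm_apply_eq (η z) (rotCLM θ w), h.inner_apply]
  have e2 : ((φ z v * conj (φ z w)).re + η z v * η z w)
      = ρ z * ((Real.cos θ * v.re + Real.sin θ * v.im) * (rotCLM θ w).re
        + (-Real.sin θ * v.re + Real.cos θ * v.im) * (rotCLM θ w).im) := by
    rw [clm_apply_eq (φ z) v, clm_apply_eq (φ z) w, clm_apply_eq (η z) v,
      clm_apply_eq (η z) w, h.inner_apply, rotCLM_re, rotCLM_im]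
    linear_combination (-(ρ z * (v.re * w.re + v.im * w.im))) * Real.sin_sq_add_cos_sq θ
  have f1 : ∀ x y : ℝ, (x : ℂ) * φ z 1 + (y : ℂ) * φ z I = x • φ z 1 + y • φ z I :=
    fun x y => by simp only [Complex.real_smul]
  have f2 : ∀ x y : ℝ, x * η z 1 + y * η z I = x • η z 1 + y • η z I :=
    fun x y => by simp only [smul_eq_mul]
  have f3 : φ z (rotCLM θ w) = sisterForm θ φ z w := rfl
  have f4 : η z (rotCLM θ w) = sisterForm θ η z w := rfl
  rw [← sisterConn_apply] at key
  simp only [f1, f2] at key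
  rw [← sisterForm_apply, ← sisterForm_apply, ← clm_apply_eq (φ z) v, ← clm_apply_eq (η z) v,
    ← clm_apply_eq (φ z) (rotCLM θ w), ← clm_apply_eq (η z) (rotCLM θ w), ← e1, ← e2, f3, f4] at key
  rw [f3, f4]
  exact key

theorem contDiffOn_sisterConn (hη : ContDiffOn ℝ ∞ η U) (hβ : ContDiffOn ℝ ∞ β U) :
    ContDiffOn ℝ ∞ (sisterConn θ τ₂ H₂ η β) U :=
  hβ.add (hη.clm_comp contDiffOn_const)

/-- The sister forms satisfy the structure equation for the horizontal form. The divergence which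
appears through the rotation is given by the constancy of the mean curvature. -/
theorem curl_sisterForm_φ (h : IsSurfaceLift κ₁ τ₁ U a b s φ η β n ν ρ) (hU : IsOpen U)
    (hz : z ∈ U) (hτ : τ₁ = Real.cos θ * τ₂ + Real.sin θ * H₂)
    (hH : H₁ = Real.cos θ * H₂ - Real.sin θ * τ₂)
    {y M : ℂ → R4} (hy : LiftsTo κ₁ τ₁ U a b s n ν y M)
    (hmc : (jet y M z).HasMeanCurvature κ₁ τ₁ H₁) (v w : ℂ) :
    curl (sisterForm θ φ) z v w = 2 * I * (sisterConn θ τ₂ H₂ η β z v * sisterForm θ φ z w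
      - sisterConn θ τ₂ H₂ η β z w * sisterForm θ φ z v) := by
  obtain ⟨hdiv, -⟩ := h.mean_curvature hU hy hz hmc
  have key := (h.conformalFrame z hz).curl_sister hτ hH hdiv (h.curl_φ hU hz 1 I)
  have h1 : curl (sisterForm θ φ) z 1 I
      = 2 * I * (sisterConn θ τ₂ H₂ η β z 1 * sisterForm θ φ z I
        - sisterConn θ τ₂ H₂ η β z I * sisterForm θ φ z 1) := by
    rw [curl_sisterForm hU h.contDiffOn_φ θ hz, Complex.real_smul, Complex.real_smul, key,
      sisterConn_apply, sisterConn_apply, sisterForm_apply, sisterForm_apply]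
    simp only [Complex.real_smul, one_re, one_im, I_re, I_im]
    push_cast
    ring
  rw [curl_eq_smul, h1, clm_apply_eq (sisterConn θ τ₂ H₂ η β z) v,
    clm_apply_eq (sisterConn θ τ₂ H₂ η β z) w, clm_apply_eq (sisterForm θ φ z) v,
    clm_apply_eq (sisterForm θ φ z) w]
  simp only [Complex.real_smul, smul_eq_mul]
  push_cast
  ring

theorem im_conj_sisterForm (θ : ℝ) (v w : ℂ) :
    (conj (sisterForm θ φ z v) * sisterForm θ φ z w).im
      = (v.re * w.im - v.im * w.re) * (conj (φ z 1) * φ z I).im := by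
  rw [sisterForm_apply, sisterForm_apply]
  simp only [Complex.real_smul]
  simp only [map_mul, map_sub, map_add, map_neg, map_pow, conj_I, conj_ofReal, Complex.conj_conj,
    mul_re, mul_im, sub_re, sub_im, add_re, add_im, neg_re, neg_im, I_re, I_im, ofReal_re, ofReal_im,
    conj_re, conj_im, pow_two, one_re, one_im, zero_re, zero_im]
  linear_combination ((v.re * w.im - v.im * w.re)
    * ((φ z 1).re * (φ z I).im - (φ z 1).im * (φ z I).re)) * Real.sin_sq_add_cos_sq θ

/-- The sister forms satisfy the structure equation for the vertical form. -/
theorem curl_sisterForm_η (h : IsSurfaceLift κ₁ τ₁ U a b s φ η β n ν ρ) (hU : IsOpen U)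
    (hz : z ∈ U) (hτ : τ₁ = Real.cos θ * τ₂ + Real.sin θ * H₂)
    (hH : H₁ = Real.cos θ * H₂ - Real.sin θ * τ₂)
    {y M : ℂ → R4} (hy : LiftsTo κ₁ τ₁ U a b s n ν y M)
    (hmc : (jet y M z).HasMeanCurvature κ₁ τ₁ H₁) (v w : ℂ) :
    curl (sisterForm θ η) z v w
      = -(2 * τ₂ * (conj (sisterForm θ φ z v) * sisterForm θ φ z w).im) := by
  obtain ⟨-, hdiv⟩ := h.mean_curvature hU hy hz hmc
  rw [curl_eq_smul, curl_sisterForm hU h.contDiffOn_η θ hz, hdiv, h.curl_η hU hz 1 I,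
    im_conj_sisterForm, ← (h.conformalFrame z hz).angle_eq, hτ, hH]
  simp only [smul_eq_mul]
  linear_combination (-2 * τ₂ * (v.re * w.im - v.im * w.re) * ρ z * ν z)
    * Real.sin_sq_add_cos_sq θ

/-- The sister forms satisfy the structure equation for the connection form. This is where the equality
of the numbers `κ - 4τ²` is used. -/
theorem curl_sisterConn (h : IsSurfaceLift κ₁ τ₁ U a b s φ η β n ν ρ) (hU : IsOpen U)
    (hz : z ∈ U) (hτ : τ₁ = Real.cos θ * τ₂ + Real.sin θ * H₂)
    (hH : H₁ = Real.cos θ * H₂ - Real.sin θ * τ₂) (hκ : κ₁ - 4 * τ₁ ^ 2 = κ₂ - 4 * τ₂ ^ 2)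
    {y M : ℂ → R4} (hy : LiftsTo κ₁ τ₁ U a b s n ν y M)
    (hmc : (jet y M z).HasMeanCurvature κ₁ τ₁ H₁) (v w : ℂ) :
    curl (sisterConn θ τ₂ H₂ η β) z v w
      = κ₂ / 2 * (conj (sisterForm θ φ z v) * sisterForm θ φ z w).im := by
  obtain ⟨-, hdiv⟩ := h.mean_curvature hU hy hz hmc
  have hβ := h.curl_β hU hz 1 I
  have hη := h.curl_η hU hz 1 I
  have hd : ∀ v w : ℂ, fderiv ℝ (sisterConn θ τ₂ H₂ η β) z v w = fderiv ℝ β z v w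
      + fderiv ℝ η z v (ContinuousLinearMap.mul ℝ ℂ (Real.sin θ * (H₂ + I * τ₂)) w) := by
    intro v w
    have h1 := hasDerivAt_line_apply (differentiableAt_of_contDiffOn hU (contDiffOn_sisterConn
      (θ := θ) (τ₂ := τ₂) (H₂ := H₂) h.contDiffOn_η h.contDiffOn_β) hz) v w
    exact h1.unique ((hasDerivAt_line_apply (differentiableAt_of_contDiffOn hU h.contDiffOn_β hz)
      v w).add (hasDerivAt_line_apply (differentiableAt_of_contDiffOn hU h.contDiffOn_η hz) v _))
  rw [curl_eq_smul, im_conj_sisterForm, curl, hd, hd, clm_apply_eq (fderiv ℝ η z 1),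
    clm_apply_eq (fderiv ℝ η z I)]
  rw [curl] at hβ hη
  rw [← (h.conformalFrame z hz).angle_eq] at hβ hη ⊢
  have hk : κ₁ = κ₂ + 4 * τ₁ ^ 2 - 4 * τ₂ ^ 2 := by linarith
  have hcs := Real.sin_sq_add_cos_sq θ
  simp [-ofReal_sin]
  generalize Real.sin θ = S at *
  generalize Real.cos θ = C at *
  rw [hk] at hβ
  rw [hτ] at hβ hη
  rw [hH] at hdiv
  linear_combination (v.re * w.im - v.im * w.re) * (hβ - S * τ₂ * hdiv + S * H₂ * hη
    + 2 * τ₂ ^ 2 * ρ z * ν z * hcs)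

end Sister

/-! ### Local existence and local normal form of the sister immersions -/

section LocalSister

open Complex ComplexConjugate Metric

/-- `j₂` is the jet of a sister immersion of the immersion with jet `j₁`: the conditions of
`IsSister` at a point, as equalities of bilinear forms. -/
structure IsSisterJet (κ₁ τ₁ κ₂ τ₂ H₁ H₂ θ : ℝ) (j₁ j₂ : Jet) : Prop where
  mem : j₂.x ∈ carrier κ₂ τ₂
  tangent : j₂.N ∈ tangent κ₂ τ₂ j₂.x
  unit : metric κ₂ τ₂ j₂.x j₂.N j₂.N = 1
  orthogonal : ∀ v, metric κ₂ τ₂ j₂.x j₂.N (j₂.d v) = 0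
  direct : IsDirect κ₂ τ₂ j₂.x (j₂.d 1) (j₂.d I) j₂.N
  inner_eq : ∀ v w, j₂.inner κ₂ τ₂ v w = j₁.inner κ₁ τ₁ v w
  cov_eq : ∀ v w, j₂.cov κ₂ τ₂ v w = j₁.cov κ₁ τ₁ v (rotCLM θ w)
    + H₁ * j₁.inner κ₁ τ₁ v (rotCLM θ w) - H₂ * j₁.inner κ₁ τ₁ v w
  vertical_eq : ∀ w, metric κ₂ τ₂ j₂.x (vertical κ₂ τ₂ j₂.x) (j₂.d w)
    = metric κ₁ τ₁ j₁.x (vertical κ₁ τ₁ j₁.x) (j₁.d (rotCLM θ w))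
  angle_eq : metric κ₂ τ₂ j₂.x j₂.N (vertical κ₂ τ₂ j₂.x)
    = metric κ₁ τ₁ j₁.x j₁.N (vertical κ₁ τ₁ j₁.x)

theorem IsSisterJet.isSurfaceJet {κ₁ τ₁ κ₂ τ₂ H₁ H₂ θ : ℝ} {j₁ j₂ : Jet}
    (h : IsSisterJet κ₁ τ₁ κ₂ τ₂ H₁ H₂ θ j₁ j₂) (h₁ : IsSurfaceJet κ₁ τ₁ j₁) :
    IsSurfaceJet κ₂ τ₂ j₂ := by
  obtain ⟨ρ, hρ, hc⟩ := h₁.conformal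
  exact ⟨h.mem, ⟨ρ, hρ, fun v w => by rw [h.inner_eq, hc]⟩, h.tangent, h.unit, h.orthogonal,
    h.direct⟩

variable {κ₁ τ₁ κ₂ τ₂ H₁ H₂ θ : ℝ} {U : Set ℂ} {a b n : ℂ → ℂ} {s ν ρ : ℂ → ℝ}
  {φ : ℂ → ℂ →L[ℝ] ℂ} {η β : ℂ → ℂ →L[ℝ] ℝ} {z : ℂ} {y M : ℂ → R4}

theorem IsLift.vertical_frame {κ τ : ℝ} (h : IsLift κ τ U a b s φ η β) (hU : IsOpen U)
    (hy : ∀ z ∈ U, y z = proj κ τ (a z) (b z) (s z)) (hz : z ∈ U) (w : ℂ) :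
    metric κ τ (y z) (vertical κ τ (y z)) (fderiv ℝ y z w) = η z w := by
  rw [h.fderiv_eq hU hy hz, hy z hz, ← frame_vertical κ τ (a z) (b z) (s z),
    metric_frame (h.onGroup z hz)]
  simp

theorem IsLift.angle_frame {κ τ : ℝ} (h : IsLift κ τ U a b s φ η β)
    (hy : LiftsTo κ τ U a b s n ν y M) (hz : z ∈ U) :
    metric κ τ (y z) (M z) (vertical κ τ (y z)) = ν z := by
  rw [(hy z hz).1, (hy z hz).2, ← frame_vertical κ τ (a z) (b z) (s z),
    metric_frame (h.onGroup z hz)]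
  simp

/-- An immersion with the sister forms is a sister immersion. -/
theorem IsLift.isSisterJet (h₁ : IsSurfaceLift κ₁ τ₁ U a b s φ η β n ν ρ) (hU : IsOpen U)
    (hy₁ : LiftsTo κ₁ τ₁ U a b s n ν y M)
    (hτ : τ₁ = Real.cos θ * τ₂ + Real.sin θ * H₂) (hH : H₁ = Real.cos θ * H₂ - Real.sin θ * τ₂)
    {V : Set ℂ} (hV : IsOpen V) (hVU : V ⊆ U) {a₂ b₂ : ℂ → ℂ} {s₂ : ℂ → ℝ} {y₂ M₂ : ℂ → R4}
    (h₂ : IsLift κ₂ τ₂ V a₂ b₂ s₂ (sisterForm θ φ) (sisterForm θ η) (sisterConn θ τ₂ H₂ η β))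
    (hy₂ : LiftsTo κ₂ τ₂ V a₂ b₂ s₂ n ν y₂ M₂) (hz : z ∈ V) :
    IsSisterJet κ₁ τ₁ κ₂ τ₂ H₁ H₂ θ (jet y M z) (jet y₂ M₂ z) := by
  have hc₁ := h₁.conformalFrame z (hVU hz)
  have hc := conformalFrame_sister θ hc₁
  have hg := h₂.onGroup z hz
  have hy₁' := fun z hz => (hy₁ z hz).1
  have hy₂' := fun z hz => (hy₂ z hz).1
  have hn := h₁.contDiffOn_n
  have hν := h₁.contDiffOn_ν
  have hd := h₂.fderiv_eq hV hy₂' hz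
  have e1 := (hy₂ z hz).1
  have e2 := (hy₂ z hz).2
  refine ⟨?_, ?_, ?_, fun v => ?_, ?_, fun v w => ?_, fun v w => ?_, fun w => ?_, ?_⟩
  · rw [jet, e1]
    exact proj_mem hg τ₂ _
  · rw [jet, e1, e2]
    exact frame_mem_tangent _ _ _ _ _ _ _
  · simp only [jet]
    rw [e1, e2, metric_frame hg, mul_conj, ofReal_re, ← pow_two, hc.unit_normal]
  · simp only [jet]
    rw [hd, e1, e2, metric_frame hg, clm_apply_eq (sisterForm θ φ z) v,
      clm_apply_eq (sisterForm θ η z) v, hc.orthogonal_apply]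
  · simp only [jet]
    rw [hd, hd, e1, e2, isDirect_frame hg]
    exact hc.direct
  · rw [h₂.jet_inner hV hy₂' hz, h₁.jet_inner hU hy₁' (hVU hz),
      clm_apply_eq (sisterForm θ φ z) v, clm_apply_eq (sisterForm θ η z) v,
      clm_apply_eq (sisterForm θ φ z) w, clm_apply_eq (sisterForm θ η z) w, hc.inner_apply,
      clm_apply_eq (φ z) v, clm_apply_eq (η z) v,
      clm_apply_eq (φ z) w, clm_apply_eq (η z) w, hc₁.inner_apply]
  · rw [h₂.jet_cov hV (hn.mono hVU) (hν.mono hVU) hy₂ hz, h₁.jet_cov hU hn hν hy₁ (hVU hz),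
      h₁.jet_inner hU hy₁' (hVU hz), h₁.jet_inner hU hy₁' (hVU hz)]
    exact covForm_sisterForm hc₁ hτ hH _ _ v w
  · simp only [jet]
    rw [h₂.vertical_frame hV hy₂' hz, h₁.vertical_frame hU hy₁' (hVU hz)]
    rfl
  · simp only [jet]
    rw [h₂.angle_frame hy₂ hz, h₁.angle_frame hy₁ (hVU hz)]

/-- Two conformal frames with the same vertical components differ by a rotation. -/
theorem ConformalFrame.exists_rotation {P Q P' Q' n n' : ℂ} {e f ν ρ : ℝ}
    (h : ConformalFrame P Q e f n ν ρ) (h' : ConformalFrame P' Q' e f n' ν ρ) :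
    normSq ((P' * conj P + Q' * conj Q) / ((normSq P + normSq Q : ℝ) : ℂ)) = 1 ∧
    P' = (P' * conj P + Q' * conj Q) / ((normSq P + normSq Q : ℝ) : ℂ) * P ∧
    Q' = (P' * conj P + Q' * conj Q) / ((normSq P + normSq Q : ℝ) : ℂ) * Q ∧
    n' = (P' * conj P + Q' * conj Q) / ((normSq P + normSq Q : ℝ) : ℂ) * n := by
  have hD : 0 < normSq P + normSq Q := by
    rcases h.exists_ne_zero with hP | hQ
    · have := normSq_pos.2 hP
      have := normSq_nonneg Q
      linarith
    · have := normSq_pos.2 hQ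
      have := normSq_nonneg P
      linarith
  have hD' : ((normSq P + normSq Q : ℝ) : ℂ) ≠ 0 := ofReal_ne_zero.2 hD.ne'
  have hPP : normSq P' = normSq P := by linarith [h.normSq_left, h'.normSq_left]
  have hQQ : normSq Q' = normSq Q := by linarith [h.normSq_right, h'.normSq_right]
  have hPQ : P' * conj Q' = P * conj Q := by
    have h1 := h.inner_eq
    have h2 := h'.inner_eq
    have h3 := h.angle_eq
    have h4 := h'.angle_eq
    apply Complex.ext
    · linarith
    · simp only [map_mul, map_sub, map_add, map_neg, map_pow, conj_I, conj_ofReal, Complex.conj_conj,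
    mul_re, mul_im, sub_re, sub_im, add_re, add_im, neg_re, neg_im, I_re, I_im, ofReal_re, ofReal_im,
    conj_re, conj_im, pow_two, one_re, one_im, zero_re, zero_im] at h3 h4 ⊢
      linarith
  have hPP' : P' * conj P' = P * conj P := by rw [mul_conj, mul_conj, hPP]
  have hQQ' : Q' * conj Q' = Q * conj Q := by rw [mul_conj, mul_conj, hQQ]
  have hQP : conj P' * Q' = conj P * Q := by
    have := congrArg conj hPQ
    simpa using this
  set u := (P' * conj P + Q' * conj Q) / ((normSq P + normSq Q : ℝ) : ℂ) with hu
  have hDe : ((normSq P + normSq Q : ℝ) : ℂ) = P * conj P + Q * conj Q := by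
    rw [mul_conj, mul_conj, ofReal_add]
  have huD : u * (P * conj P + Q * conj Q) = P' * conj P + Q' * conj Q := by
    rw [hu, ← hDe, div_mul_cancel₀ _ hD']
  rw [hDe] at hD'
  have e1 : P' = u * P := by
    apply mul_right_cancel₀ hD'
    linear_combination (-P) * huD + Q' * hPQ - P' * hQQ'
  have e2 : Q' = u * Q := by
    apply mul_right_cancel₀ hD'
    linear_combination (-Q) * huD + P' * hQP - Q' * hPP'
  refine ⟨?_, e1, e2, ?_⟩
  · have h1 : normSq u * (normSq P + normSq Q) = 1 * (normSq P + normSq Q) := by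
      rw [mul_add, ← map_mul, ← map_mul, ← e1, ← e2, hPP, hQQ, one_mul]
    exact mul_right_cancel₀ hD.ne' h1
  · have hρ : ((ρ : ℝ) : ℂ) ≠ 0 := ofReal_ne_zero.2 h.pos.ne'
    apply mul_left_cancel₀ hρ
    rw [h'.normal_eq, e1, e2]
    linear_combination (-u) * h.normal_eq

/-- A smooth unit complex function is locally the square of a smooth exponential. -/
theorem exists_gauge_angle (hU : IsOpen U) {u : ℂ → ℂ} (hu : ContDiffOn ℝ ∞ u U)
    (h1 : ∀ z ∈ U, normSq (u z) = 1) {z₀ : ℂ} (hz₀ : z₀ ∈ U) :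
    ∃ V ⊆ U, IsOpen V ∧ z₀ ∈ V ∧ ∃ γ : ℂ → ℝ, ContDiffOn ℝ ∞ γ V ∧
      ∀ z ∈ V, exp (-(γ z * I)) ^ 2 = u z := by
  have hd : ContDiffOn ℝ ∞ (fun z => u z * conj (u z₀)) U := hu.mul contDiffOn_const
  have hV := hd.continuousOn.isOpen_inter_preimage hU isOpen_slitPlane
  -- after division by its value at `z₀`, the function has a logarithm near `z₀`
  obtain ⟨γ₀, hγ₀⟩ := exists_exp_of_normSq_eq_one (h1 z₀ hz₀)
  refine ⟨_, Set.inter_subset_left, hV, ⟨hz₀, ?_⟩,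
    fun z => -(γ₀ + (log (u z * conj (u z₀))).im) / 2, ?_, fun z hz => ?_⟩
  · show u z₀ * conj (u z₀) ∈ slitPlane
    rw [mul_conj, h1 z₀ hz₀]
    simp
  · have hl : ContDiffOn ℝ ∞ (fun z => log (u z * conj (u z₀)))
        (U ∩ (fun z => u z * conj (u z₀)) ⁻¹' slitPlane) := fun z hz => by
      have hlog : ContDiffAt ℝ ∞ log (u z * conj (u z₀)) :=
        (contDiffAt_log (n := ∞) (x := u z * conj (u z₀)) hz.2).restrict_scalars ℝ
      exact hlog.comp_contDiffWithinAt z ((hd z hz.1).mono Set.inter_subset_left)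
    exact ((contDiffOn_const.add (contDiffOn_im hl)).neg.div_const 2)
  · have hns : normSq (u z * conj (u z₀)) = 1 := by
      rw [map_mul, normSq_conj, h1 z hz.1, h1 z₀ hz₀, one_mul]
    have hne : u z * conj (u z₀) ≠ 0 := by
      intro h0
      rw [h0, map_zero] at hns
      exact zero_ne_one hns
    have hlog : exp ((log (u z * conj (u z₀))).im * I) = u z * conj (u z₀) := by
      have hre : (log (u z * conj (u z₀))).re = 0 := by
        rw [log_re]
        have : ‖u z * conj (u z₀)‖ = 1 := by
          rw [normSq_eq_norm_sq] at hns
          exact (pow_eq_one_iff_of_nonneg (norm_nonneg _) two_ne_zero).1 hns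
        rw [this, Real.log_one]
      conv_rhs => rw [← exp_log hne, ← re_add_im (log (u z * conj (u z₀))), hre]
      simp
    rw [← exp_nat_mul]
    have : ((2 : ℕ) : ℂ) * -(((-(γ₀ + (log (u z * conj (u z₀))).im) / 2 : ℝ) : ℂ) * I)
        = γ₀ * I + (log (u z * conj (u z₀))).im * I := by
      push_cast
      ring
    rw [this, exp_add, hγ₀, hlog]
    have h3 : u z₀ * conj (u z₀) = 1 := by rw [mul_conj, h1 z₀ hz₀, ofReal_one]
    linear_combination (u z) * h3

/-- A sister immersion has a local lift with the sister forms: the rotation of the adapted frame is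
determined by the horizontal form, and then the connection form is determined by the shape
operator. -/
theorem exists_isLift_sister (h₁ : IsSurfaceLift κ₁ τ₁ U a b s φ η β n ν ρ) (hU : IsOpen U)
    (hy₁ : LiftsTo κ₁ τ₁ U a b s n ν y M)
    (hτ : τ₁ = Real.cos θ * τ₂ + Real.sin θ * H₂) (hH : H₁ = Real.cos θ * H₂ - Real.sin θ * τ₂)
    (hmc : ∀ z ∈ U, (jet y M z).HasMeanCurvature κ₁ τ₁ H₁)
    (hj₁ : ∀ z ∈ U, IsSurfaceJet κ₁ τ₁ (jet y M z))
    {V : Set ℂ} (hV : IsOpen V) (hVU : V ⊆ U) {y₂ M₂ : ℂ → R4} (hs₂ : ContDiffOn ℝ ∞ y₂ V)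
    (hj : ∀ z ∈ V, IsSisterJet κ₁ τ₁ κ₂ τ₂ H₁ H₂ θ (jet y M z) (jet y₂ M₂ z)) {z₀ : ℂ}
    (hz₀ : z₀ ∈ V) :
    ∃ W ⊆ V, IsOpen W ∧ z₀ ∈ W ∧ ∃ a₂ b₂ s₂,
      IsLift κ₂ τ₂ W a₂ b₂ s₂ (sisterForm θ φ) (sisterForm θ η) (sisterConn θ τ₂ H₂ η β) ∧
      LiftsTo κ₂ τ₂ W a₂ b₂ s₂ n ν y₂ M₂ := by
  obtain ⟨W₁, hW₁V, hW₁, hz₁, a', b', s', φ', η', β', n', ν', ρ', h', hy'⟩ :=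
    exists_isSurfaceLift hV hs₂ (fun z hz => (hj z hz).isSurfaceJet (hj₁ z (hVU hz))) hz₀
  have hy₁' := fun z hz => (hy₁ z hz).1
  have hy'' := fun z hz => (hy' z hz).1
  have hη' : ∀ z ∈ W₁, ∀ w, η' z w = sisterForm θ η z w := fun z hz w => by
    rw [← h'.vertical_frame hW₁ hy'' hz]
    exact ((hj z (hW₁V hz)).vertical_eq w).trans
      (h₁.vertical_frame hU hy₁' (hVU (hW₁V hz)) (rotCLM θ w))
  have hν' : ∀ z ∈ W₁, ν' z = ν z := fun z hz => by
    rw [← h'.angle_frame hy' hz, ← h₁.angle_frame hy₁ (hVU (hW₁V hz))]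
    exact (hj z (hW₁V hz)).angle_eq
  have hρ' : ∀ z ∈ W₁, ρ' z = ρ z := fun z hz => by
    have e := (hj z (hW₁V hz)).inner_eq 1 1
    rw [h'.jet_inner hW₁ hy'' hz, h₁.jet_inner hU hy₁' (hVU (hW₁V hz)), mul_conj, mul_conj,
      ofReal_re, ofReal_re] at e
    have e1 := (h'.conformalFrame z hz).normSq_left
    have e2 := (h₁.conformalFrame z (hVU (hW₁V hz))).normSq_left
    linarith
  have hc' : ∀ z ∈ W₁, ConformalFrame (φ' z 1) (φ' z I) (sisterForm θ η z 1) (sisterForm θ η z I)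
      (n' z) (ν z) (ρ z) := fun z hz => by
    have := h'.conformalFrame z hz
    rwa [hη' z hz, hη' z hz, hν' z hz, hρ' z hz] at this
  have hc : ∀ z ∈ W₁, ConformalFrame (sisterForm θ φ z 1) (sisterForm θ φ z I)
      (sisterForm θ η z 1) (sisterForm θ η z I) (n z) (ν z) (ρ z) := fun z hz =>
    conformalFrame_sister θ (h₁.conformalFrame z (hVU (hW₁V hz)))
  have hφs : ContDiffOn ℝ ∞ (sisterForm θ φ) W₁ :=
    contDiffOn_sisterForm θ (h₁.contDiffOn_φ.mono (hW₁V.trans hVU))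
  have hev : ∀ v : ℂ, ContDiffOn ℝ ∞ (fun z => φ' z v) W₁ ∧
      ContDiffOn ℝ ∞ (fun z => sisterForm θ φ z v) W₁ := fun v =>
    ⟨h'.contDiffOn_φ.clm_apply contDiffOn_const, hφs.clm_apply contDiffOn_const⟩
  -- the unit function `u` such that `φ' = u φ₂`, where `φ₂` is the sister form
  let u : ℂ → ℂ := fun z => (φ' z 1 * conj (sisterForm θ φ z 1)
    + φ' z I * conj (sisterForm θ φ z I))
      / ((normSq (sisterForm θ φ z 1) + normSq (sisterForm θ φ z I) : ℝ) : ℂ)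
  have hrot := fun z hz => (hc z hz).exists_rotation (hc' z hz)
  have hu : ContDiffOn ℝ ∞ u W₁ := by
    have g1 := (hev 1).1
    have g2 := (hev I).1
    have g3 := (hev 1).2
    have g4 := (hev I).2
    refine contDiffOn_complex_div (by fun_prop) (by fun_prop) fun z hz h0 => ?_
    have := (hrot z hz).1
    rw [h0, div_zero, map_zero] at this
    exact zero_ne_one this
  obtain ⟨W, hWW₁, hW, hz₀W, γ, hγ, hγu⟩ := exists_gauge_angle hW₁ hu (fun z hz => (hrot z hz).1) hz₁
  have hφu : ∀ z ∈ W, ∀ v, φ' z v = u z * sisterForm θ φ z v := fun z hz v => by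
    have e1 : φ' z 1 = u z * sisterForm θ φ z 1 := (hrot z (hWW₁ hz)).2.1
    have e2 : φ' z I = u z * sisterForm θ φ z I := (hrot z (hWW₁ hz)).2.2.1
    rw [clm_apply_eq (φ' z) v, e1, e2, clm_apply_eq (sisterForm θ φ z) v]
    simp only [Complex.real_smul]
    ring
  have hgl := (h'.toIsLift.mono hWW₁).gauge hW hγ (hφs.mono hWW₁) (fun z hz v => by
    rw [hφu z hz, ← hγu z hz, ← mul_assoc, ← mul_pow, ← exp_add]
    simp)
  have hyW : LiftsTo κ₂ τ₂ W (fun z => exp (γ z * I) * a' z) (fun z => exp (γ z * I) * b' z)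
      (fun z => gaugeS κ₂ τ₂ (s' z) (γ z)) n ν y₂ M₂ := by
    intro z hz
    refine ⟨?_, ?_⟩
    · rw [proj_gauge]
      exact (hy' z (hWW₁ hz)).1
    · rw [frame_gauge, hγu z hz, (hy' z (hWW₁ hz)).2, hν' z (hWW₁ hz)]
      congr 1
      exact (hrot z (hWW₁ hz)).2.2.2
  refine ⟨W, hWW₁.trans hW₁V, hW, hz₀W, _, _, _, hgl.congr_forms (fun _ _ => rfl)
    (fun z hz => ContinuousLinearMap.ext fun w => (hη' z (hWW₁ hz) w).symm) (fun z hz => ?_), hyW⟩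
  have hzU := hVU (hW₁V (hWW₁ hz))
  set β'' : ℂ → ℂ →L[ℝ] ℝ := fun z => β' z + fderiv ℝ γ z with hβ''
  have hcurl := hgl.curl_φ hW hz 1 I
  rw [curl_sisterForm_φ h₁ hU hzU hτ hH hy₁ (hmc z hzU)] at hcurl
  -- the difference `δ` of the connection forms satisfies `δ ∧ φ = 0` by the structure equation, and
  -- vanishes against the tangential rotation of the normal by the equality of the shape operators
  have hcov : ∀ v w, (sisterConn θ τ₂ H₂ η β z v - β'' z v)
      * (n z * conj (sisterForm θ φ z w)).im = 0 := by
    intro v w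
    have e1 := (hj z (hW₁V (hWW₁ hz))).cov_eq v w
    have hVW := hWW₁.trans (hW₁V.trans hVU)
    rw [hgl.jet_cov hW (h₁.contDiffOn_n.mono hVW) (h₁.contDiffOn_ν.mono hVW) hyW hz,
      h₁.jet_cov hU h₁.contDiffOn_n h₁.contDiffOn_ν hy₁ hzU, h₁.jet_inner hU hy₁' hzU,
      h₁.jet_inner hU hy₁' hzU, ← covForm_sisterForm (h₁.conformalFrame z hzU) hτ hH,
      covForm_eq, covForm_eq, hη' z (hWW₁ hz), hη' z (hWW₁ hz)] at e1
    linarith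
  obtain ⟨d1, d2⟩ := (hc z (hWW₁ hz)).eq_zero_of_rotation
    (δ₁ := sisterConn θ τ₂ H₂ η β z 1 - β'' z 1) (δ₂ := sisterConn θ τ₂ H₂ η β z I - β'' z I) (by
      have h2I : (2 * I : ℂ) ≠ 0 := by simp
      have := mul_left_cancel₀ h2I hcurl
      push_cast
      linear_combination this) (hcov 1 1) (hcov 1 I) (hcov I 1) (hcov I I)
  refine ContinuousLinearMap.ext fun v => ?_
  rw [clm_apply_eq (sisterConn θ τ₂ H₂ η β z) v]
  show _ = β'' z v
  rw [clm_apply_eq (β'' z) v, sub_eq_zero.1 d1, sub_eq_zero.1 d2]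

end LocalSister

/-! ### Rigidity of the sister immersions of a domain of the plane -/

section Rigidity

open Complex ComplexConjugate Metric Filter Topology

/-- The surface and the vector field with jet `j'` are the images by `Φ` of those with jet `j`, up
to the first order for the surface and to the order zero for the vector field. -/
structure Jet.MovedBy (Φ : R4 → R4) (j j' : Jet) : Prop where
  point : j'.x = Φ j.x
  normal : j'.N = fderiv ℝ Φ j.x j.N
  deriv : ∀ v, j'.d v = fderiv ℝ Φ j.x (j.d v)

variable {κ τ : ℝ} {U : Set ℂ} {a b a' b' n : ℂ → ℂ} {s s' ν ρ : ℂ → ℝ}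
  {φ : ℂ → ℂ →L[ℝ] ℂ} {η β : ℂ → ℂ →L[ℝ] ℝ} {z q : ℂ} {y M y' M' : ℂ → R4}

theorem frame_injective {κ τ s : ℝ} {a b n n' : ℂ} {m : ℝ} (h : OnGroup κ a b)
    (he : frame κ τ a b s n m = frame κ τ a b s n' m) : n = n' :=
  congrArg Prod.fst (frameL_injective (τ := τ) h s (a₁ := (n, m)) (a₂ := (n', m)) he)

/-- Two surfaces with the same forms which differ by a translation at a point, up to the first
order, differ by this translation. -/
theorem IsLift.movedBy {A B : ℂ} {C : ℝ} (h : IsLift κ τ U a b s φ η β)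
    (h' : IsLift κ τ U a' b' s' φ η β) (hU : IsOpen U) (hc : IsPreconnected U)
    (hy : LiftsTo κ τ U a b s n ν y M) (hy' : LiftsTo κ τ U a' b' s' n ν y' M')
    (hg : OnGroup κ A B) (hq : q ∈ U) (hφ : φ q 1 ≠ 0 ∨ φ q I ≠ 0)
    (hm : Jet.MovedBy (translation κ τ A B C) (jet y M q) (jet y' M' q)) (hz : z ∈ U) :
    Jet.MovedBy (translation κ τ A B C) (jet y M z) (jet y' M' z) := by
  -- the lifts `g L` and `L'` lie over the same point at `q`, so they differ by a gauge change `γ`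
  have hL := h.act hU hg C
  have hp := fun z hz => (hy z hz).1
  have hp' := fun z hz => (hy' z hz).1
  have h1 := hm.point
  simp only [jet] at h1
  rw [(hy' q hq).1, (hy q hq).1, translation_proj fun hκ => (h.onGroup q hq).ne_zero hκ] at h1
  obtain ⟨γ, e1, e2, e3⟩ := exists_gauge_of_proj_eq (hg.act (h.onGroup q hq)) (h'.onGroup q hq) h1
  -- as the differentials agree and `φ` does not vanish at `q`, this gauge change fixes the frames
  have hd : ∀ v, φ q v = exp (-(γ * I)) ^ 2 * φ q v := fun v => by
    have h2 := hm.deriv v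
    simp only [jet] at h2
    rw [h'.fderiv_eq hU hp' hq, h.fderiv_eq hU hp hq, (hy q hq).1,
      fderiv_translation_frame hg (h.onGroup q hq), e1, e2, e3, frame_gauge] at h2
    exact (frame_injective (hg.act (h.onGroup q hq)) h2).symm
  have he : exp (-(γ * I)) ^ 2 = 1 := by
    rcases hφ with h0 | h0
    · exact (mul_right_cancel₀ h0 ((one_mul _).trans (hd 1))).symm
    · exact (mul_right_cancel₀ h0 ((one_mul _).trans (hd I))).symm
  have he' : exp (γ * I) ^ 2 = 1 := by
    have : exp (-(γ * I)) ^ 2 * exp (γ * I) ^ 2 = 1 := by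
      rw [← mul_pow, ← exp_add]
      simp
    rwa [he, one_mul] at this
  have hG := (hL.gauge (γ := fun _ => γ) hU contDiffOn_const h.contDiffOn_φ
    (fun z _ v => by rw [he', one_mul])).congr_forms (φ' := φ) (η' := η) (β' := β)
    (fun _ _ => rfl) (fun _ _ => rfl) (fun z _ => by simp)
  obtain ⟨f1, f2, f3⟩ := hG.eqOn h' hU hc hq e1 e2 e3 z hz
  have hfr : ∀ n m, frame κ τ (a' z) (b' z) (s' z) n m
      = fderiv ℝ (translation κ τ A B C) (y z) (frame κ τ (a z) (b z) (s z) n m) := fun n m => by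
    rw [(hy z hz).1, fderiv_translation_frame hg (h.onGroup z hz), f1, f2, f3, frame_gauge, he,
      one_mul]
  refine ⟨?_, ?_, fun v => ?_⟩
  · simp only [jet]
    rw [(hy' z hz).1, (hy z hz).1, translation_proj fun hκ => (h.onGroup z hz).ne_zero hκ, f1, f2,
      f3, proj_gauge]
  · simp only [jet]
    rw [(hy' z hz).2, hfr, ← (hy z hz).2]
  · simp only [jet]
    rw [h'.fderiv_eq hU hp' hz, h.fderiv_eq hU hp hz, hfr]

/-- Two surfaces with the same forms differ at each point by a translation, up to the first
order. -/
theorem exists_movedBy (h : IsLift κ τ U a b s φ η β)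
    (h' : IsLift κ τ U a' b' s' φ η β) (hU : IsOpen U)
    (hy : LiftsTo κ τ U a b s n ν y M) (hy' : LiftsTo κ τ U a' b' s' n ν y' M') (hq : q ∈ U) :
    ∃ A B C, OnGroup κ A B ∧
      Jet.MovedBy (translation κ τ A B C) (jet y M q) (jet y' M' q) := by
  have hp := fun z hz => (hy z hz).1
  have hp' := fun z hz => (hy' z hz).1
  have hg := h.onGroup q hq
  have hg' := h'.onGroup q hq
  have hgc : a q * conj (a q) + ((κ / 4 : ℝ) : ℂ) * (b q * conj (b q)) = 1 := by
    rw [mul_conj, mul_conj]; exact_mod_cast hg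
  have hgc' : a' q * conj (a' q) + ((κ / 4 : ℝ) : ℂ) * (b' q * conj (b' q)) = 1 := by
    rw [mul_conj, mul_conj]; exact_mod_cast hg'
  -- `(A, B)` is the quotient in the group of `(a' q, b' q)` by `(a q, b q)`
  set A := a' q * conj (a q) + ((κ / 4 : ℝ) : ℂ) * (conj (b' q) * b q) with hA
  set B := b' q * conj (a q) - conj (a' q) * b q with hB
  have hAB : OnGroup κ A B := by
    have : A * conj A + ((κ / 4 : ℝ) : ℂ) * (B * conj B) = 1 := by
      rw [hA, hB]
      simp only [map_add, map_sub, map_mul, conj_ofReal, Complex.conj_conj]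
      linear_combination (a q * conj (a q) + ((κ / 4 : ℝ) : ℂ) * (b q * conj (b q))) * hgc' + hgc
    rw [mul_conj, mul_conj] at this
    exact_mod_cast this
  have e1 : actA κ A B (a q) (b q) = a' q := by
    rw [actA, hA, hB]
    simp only [map_sub, map_mul, Complex.conj_conj]
    linear_combination a' q * hgc
  have e2 : actB A B (a q) (b q) = b' q := by
    rw [actB, hA, hB]
    simp only [map_add, map_mul, conj_ofReal, Complex.conj_conj]
    linear_combination b' q * hgc
  have e3 : actS κ τ A B (s' q - s q - shift κ τ A B (b q / a q)) (a q) (b q) (s q) = s' q := by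
    rw [actS]
    ring
  refine ⟨A, B, s' q - s q - shift κ τ A B (b q / a q), hAB, ?_, ?_, fun v => ?_⟩
  · simp only [jet]
    rw [(hy' q hq).1, (hy q hq).1, translation_proj fun hκ => hg.ne_zero hκ, e1, e2, e3]
  · simp only [jet]
    rw [(hy' q hq).2, (hy q hq).2, (hy q hq).1, fderiv_translation_frame hAB hg, e1, e2, e3]
  · simp only [jet]
    rw [h'.fderiv_eq hU hp' hq, h.fderiv_eq hU hp hq, (hy q hq).1,
      fderiv_translation_frame hAB hg, e1, e2, e3]

/-- The identity is a translation. -/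
theorem translation_one {a b : ℂ} (h : OnGroup κ a b) (s : ℝ) :
    translation κ τ 1 0 0 (proj κ τ a b s) = proj κ τ a b s ∧
    ∀ n m, fderiv ℝ (translation κ τ 1 0 0) (proj κ τ a b s) (frame κ τ a b s n m)
      = frame κ τ a b s n m := by
  have hg : OnGroup κ 1 0 := by simp [OnGroup]
  have e1 : actA κ 1 0 a b = a := by simp [actA]
  have e2 : actB 1 0 a b = b := by simp [actB]
  have e3 : actS κ τ 1 0 0 a b s = s := by simp [actS, shift, shiftPrim]
  refine ⟨?_, fun n m => ?_⟩
  · rw [translation_proj fun hκ => h.ne_zero hκ, e1, e2, e3]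
  · rw [fderiv_translation_frame hg h, e1, e2, e3]

/-- A vector tangent to `E(κ, τ)`, orthogonal to a surface and to its normal, vanishes. -/
theorem IsSurfaceLift.eq_zero_of_orthogonal (h : IsSurfaceLift κ τ U a b s φ η β n ν ρ)
    (hU : IsOpen U) (hy : LiftsTo κ τ U a b s n ν y M) (hz : z ∈ U) {u : R4}
    (hu : u ∈ tangent κ τ (y z)) (h₁ : ∀ w, metric κ τ (y z) u (fderiv ℝ y z w) = 0)
    (h₂ : metric κ τ (y z) u (M z) = 0) : u = 0 := by
  have hg := h.onGroup z hz
  have hd := h.fderiv_eq hU (fun z hz => (hy z hz).1) hz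
  rw [(hy z hz).1] at hu
  obtain ⟨x, m, rfl⟩ := exists_frame_eq hg hu
  simp only [(hy z hz).1, hd, metric_frame hg] at h₁
  rw [(hy z hz).1, (hy z hz).2, metric_frame hg] at h₂
  have hc := h.conformalFrame z hz
  have e1 := h₁ 1
  have e2 := h₁ I
  have c1 := hc.normSq_left
  have c2 := hc.normSq_right
  have c3 := hc.inner_eq
  have c4 := hc.normal_re
  have c5 := hc.normal_im
  have c6 := hc.angle_eq
  simp only [normSq_apply, map_mul, map_sub, map_add, map_neg, map_pow, conj_I, conj_ofReal, Complex.conj_conj,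
    mul_re, mul_im, sub_re, sub_im, add_re, add_im, neg_re, neg_im, I_re, I_im, ofReal_re, ofReal_im,
    conj_re, conj_im, pow_two, one_re, one_im, zero_re, zero_im] at e1 e2 c1 c2 c3 c4 c5 c6 h₂
  obtain ⟨f1, f2, f3⟩ := HomSpace.eq_zero_of_orthogonal (p₁ := (φ z 1).re) (p₂ := (φ z 1).im)
    (p₃ := η z 1) (q₁ := (φ z I).re) (q₂ := (φ z I).im) (q₃ := η z I) (x₁ := x.re) (x₂ := x.im)
    (x₃ := m) hc.pos (by linarith) (by linarith) (by linarith) (by linarith) (by linarith)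
    (by linear_combination ρ z * h₂ - x.re * c4 - x.im * c5 - m * c6)
  have hx : x = 0 := Complex.ext f1 f2
  rw [hx, f3]
  exact (frameL κ τ (a z) (b z) (s z)).map_zero

/-- The second fundamental form is symmetric. -/
theorem IsSurfaceLift.jet_cov_comm (h : IsSurfaceLift κ τ U a b s φ η β n ν ρ) (hU : IsOpen U)
    (hy : LiftsTo κ τ U a b s n ν y M) (hz : z ∈ U) (v w : ℂ) :
    (jet y M z).cov κ τ v w = (jet y M z).cov κ τ w v := by
  have ho : ∀ v w, (fderiv ℝ n z v * conj (φ z w)).re + (n z * conj (fderiv ℝ φ z v w)).re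
      + fderiv ℝ ν z v * η z w + ν z * fderiv ℝ η z v w = 0 := by
    intro v w
    have dφ := hasDerivAt_line_apply (differentiableAt_of_contDiffOn hU h.contDiffOn_φ hz) v w
    have dη := hasDerivAt_line_apply (differentiableAt_of_contDiffOn hU h.contDiffOn_η hz) v w
    have dn := hasDerivAt_line (differentiableAt_of_contDiffOn hU h.contDiffOn_n hz) v
    have dν := hasDerivAt_line (differentiableAt_of_contDiffOn hU h.contDiffOn_ν hz) v
    have dc : HasDerivAt (fun t : ℝ => conj (φ (z + t • v) w)) (conj (fderiv ℝ φ z v w)) 0 :=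
      dφ.star
    have dr : HasDerivAt (fun t : ℝ => (n (z + t • v) * conj (φ (z + t • v) w)).re) _ 0 :=
      (reCLM.hasFDerivAt).comp_hasDerivAt 0 (dn.mul dc)
    have h1 := dr.add (dν.mul dη)
    have h2 : HasDerivAt (fun t : ℝ => (n (z + t • v) * conj (φ (z + t • v) w)).re
        + ν (z + t • v) * η (z + t • v) w) 0 0 := by
      refine (hasDerivAt_const (0 : ℝ) (0 : ℝ)).congr_of_eventuallyEq ?_
      filter_upwards [eventually_line_mem hU hz v] with t ht
      have := (h.conformalFrame _ ht).orthogonal_apply w.re w.im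
      rwa [← clm_apply_eq, ← clm_apply_eq] at this
    have h3 := h1.unique h2
    simp at h3
    simp only [map_mul, map_sub, map_add, map_neg, map_pow, conj_I, conj_ofReal, Complex.conj_conj,
    mul_re, mul_im, sub_re, sub_im, add_re, add_im, neg_re, neg_im, I_re, I_im, ofReal_re, ofReal_im,
    conj_re, conj_im, pow_two, one_re, one_im, zero_re, zero_im]
    linarith
  have hn := h.contDiffOn_n
  have hν := h.contDiffOn_ν
  rw [h.jet_cov hU hn hν hy hz, h.jet_cov hU hn hν hy hz, covForm_eq, covForm_eq]
  have h1 := ho v w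
  have h2 := ho w v
  have h3 := congrArg re (h.curl_φ hU hz v w)
  have h3' := congrArg im (h.curl_φ hU hz v w)
  have h4 := h.curl_η hU hz v w
  simp only [curl] at h3 h3' h4
  have hre2 : (2 : ℂ).re = 2 := rfl
  have him2 : (2 : ℂ).im = 0 := rfl
  simp only [map_mul, map_sub, map_add, map_neg, map_pow, conj_I, conj_ofReal, Complex.conj_conj,
    mul_re, mul_im, sub_re, sub_im, add_re, add_im, neg_re, neg_im, I_re, I_im, ofReal_re, ofReal_im,
    conj_re, conj_im, pow_two, one_re, one_im, zero_re, zero_im, hre2, him2] at h1 h2 h3 h3' h4 ⊢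
  linear_combination h1 - h2 - (n z).re * h3 - (n z).im * h3' - ν z * h4

end Rigidity

/-! ### The sister immersions in a disc of the plane -/

section DiscSister

open Complex ComplexConjugate Metric Filter Topology

variable {κ₁ τ₁ κ₂ τ₂ H₁ H₂ θ : ℝ} {U V : Set ℂ} {z₀ q : ℂ} {y₁ M₁ y₂ M₂ y₂' M₂' : ℂ → R4}

/-- `y₁` is a conformal immersion of `U` of constant mean curvature `H`, with unit normal `M₁`. -/
structure IsCMC (κ τ H : ℝ) (U : Set ℂ) (y M : ℂ → R4) : Prop where
  smooth : ContDiffOn ℝ ∞ y U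
  isSurfaceJet : ∀ z ∈ U, IsSurfaceJet κ τ (jet y M z)
  hasMeanCurvature : ∀ z ∈ U, (jet y M z).HasMeanCurvature κ τ H

/-- Around each point, a disc where there is a sister immersion, and to which each sister immersion
near a point of the disc extends, after a modification which keeps its first order jet at this
point. -/
theorem IsCMC.exists_disc (h₁ : IsCMC κ₁ τ₁ H₁ U y₁ M₁) (hU : IsOpen U) (hz₀ : z₀ ∈ U)
    (hκ : κ₁ - 4 * τ₁ ^ 2 = κ₂ - 4 * τ₂ ^ 2)
    (hτ : τ₁ = Real.cos θ * τ₂ + Real.sin θ * H₂)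
    (hH : H₁ = Real.cos θ * H₂ - Real.sin θ * τ₂) :
    ∃ r > 0, ball z₀ r ⊆ U ∧
      (∃ y M, ContDiffOn ℝ ∞ y (ball z₀ r) ∧ ContDiffOn ℝ ∞ M (ball z₀ r) ∧
        ∀ z ∈ ball z₀ r, IsSisterJet κ₁ τ₁ κ₂ τ₂ H₁ H₂ θ (jet y₁ M₁ z) (jet y M z)) ∧
      ∀ V ⊆ ball z₀ r, IsOpen V → ∀ q ∈ V, ∀ y₂ M₂, ContDiffOn ℝ ∞ y₂ V →
        (∀ z ∈ V, IsSisterJet κ₁ τ₁ κ₂ τ₂ H₁ H₂ θ (jet y₁ M₁ z) (jet y₂ M₂ z)) →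
        ∃ y M, ContDiffOn ℝ ∞ y (ball z₀ r) ∧ ContDiffOn ℝ ∞ M (ball z₀ r) ∧
          (∀ z ∈ ball z₀ r, IsSisterJet κ₁ τ₁ κ₂ τ₂ H₁ H₂ θ (jet y₁ M₁ z) (jet y M z)) ∧
          y q = y₂ q ∧ M q = M₂ q ∧ fderiv ℝ y q = fderiv ℝ y₂ q := by
  obtain ⟨W, hWU, hW, hzW, a, b, s, φ, η, β, n, ν, ρ, hl, hy⟩ :=
    exists_isSurfaceLift hU h₁.smooth h₁.isSurfaceJet hz₀
  have hmc := fun z hz => h₁.hasMeanCurvature z (hWU hz)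
  obtain ⟨r, hr, hrW, hex⟩ := exists_isLift_of_forms (κ := κ₂) (τ := τ₂) hW
    (contDiffOn_sisterForm θ hl.contDiffOn_φ) (contDiffOn_sisterForm θ hl.contDiffOn_η)
    (contDiffOn_sisterConn (θ := θ) (τ₂ := τ₂) (H₂ := H₂) hl.contDiffOn_η hl.contDiffOn_β)
    (fun z hz v w => curl_sisterForm_φ hl hW hz hτ hH hy (hmc z hz) v w)
    (fun z hz v w => curl_sisterForm_η hl hW hz hτ hH hy (hmc z hz) v w)
    (fun z hz v w => curl_sisterConn hl hW hz hτ hH hκ hy (hmc z hz) v w) hzW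
  have hsol : ∀ a₂ b₂ s₂, IsLift κ₂ τ₂ (ball z₀ r) a₂ b₂ s₂ (sisterForm θ φ) (sisterForm θ η)
      (sisterConn θ τ₂ H₂ η β) →
      ContDiffOn ℝ ∞ (fun z => proj κ₂ τ₂ (a₂ z) (b₂ z) (s₂ z)) (ball z₀ r) ∧
      ContDiffOn ℝ ∞ (fun z => frame κ₂ τ₂ (a₂ z) (b₂ z) (s₂ z) (n z) (ν z)) (ball z₀ r) ∧
      ∀ z ∈ ball z₀ r, IsSisterJet κ₁ τ₁ κ₂ τ₂ H₁ H₂ θ (jet y₁ M₁ z)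
        (jet (fun z => proj κ₂ τ₂ (a₂ z) (b₂ z) (s₂ z))
          (fun z => frame κ₂ τ₂ (a₂ z) (b₂ z) (s₂ z) (n z) (ν z)) z) :=
    fun a₂ b₂ s₂ h₂ => ⟨h₂.contDiffOn_proj,
      h₂.contDiffOn_frame (hl.contDiffOn_n.mono hrW) (hl.contDiffOn_ν.mono hrW),
      fun z hz => IsLift.isSisterJet hl hW hy hτ hH isOpen_ball hrW h₂ (fun _ _ => ⟨rfl, rfl⟩) hz⟩
  refine ⟨r, hr, hrW.trans hWU, ?_, fun V hV hVo q hq y₂ M₂ hy₂ hs₂ => ?_⟩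
  · obtain ⟨a₂, b₂, s₂, h₂, -⟩ := hex z₀ (mem_ball_self hr) 1 0 0 (by simp [OnGroup])
    exact ⟨_, _, hsol a₂ b₂ s₂ h₂⟩
  · obtain ⟨W', hW'V, hW', hqW', a', b', s', h', hy'⟩ := exists_isLift_sister hl hW hy hτ hH hmc
      (fun z hz => h₁.isSurfaceJet z (hWU hz)) hVo (hV.trans hrW) hy₂ hs₂ hq
    obtain ⟨a₂, b₂, s₂, h₂, e1, e2, e3⟩ := hex q (hV hq) (a' q) (b' q) (s' q) (h'.onGroup q hqW')
    obtain ⟨g1, g2, g3⟩ := hsol a₂ b₂ s₂ h₂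
    refine ⟨_, _, g1, g2, g3, ?_, ?_, ?_⟩
    · rw [e1, e2, e3]
      exact (hy' q hqW').1.symm
    · rw [e1, e2, e3]
      exact (hy' q hqW').2.symm
    · refine ContinuousLinearMap.ext fun v => ?_
      rw [h₂.fderiv_proj isOpen_ball (hV hq), h'.fderiv_eq hW' (fun z hz => (hy' z hz).1) hqW', e1,
        e2, e3]

/-- Two sister immersions differ at each point by a translation up to the first order, and if they
differ by a translation at a point, up to the first order, they do so nearby. -/
theorem IsCMC.rigidity (h₁ : IsCMC κ₁ τ₁ H₁ U y₁ M₁) (hU : IsOpen U)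
    (hτ : τ₁ = Real.cos θ * τ₂ + Real.sin θ * H₂)
    (hH : H₁ = Real.cos θ * H₂ - Real.sin θ * τ₂) (hV : IsOpen V) (hVU : V ⊆ U) (hz₀ : z₀ ∈ V)
    (hy₂ : ContDiffOn ℝ ∞ y₂ V) (hy₂' : ContDiffOn ℝ ∞ y₂' V)
    (hs : ∀ z ∈ V, IsSisterJet κ₁ τ₁ κ₂ τ₂ H₁ H₂ θ (jet y₁ M₁ z) (jet y₂ M₂ z))
    (hs' : ∀ z ∈ V, IsSisterJet κ₁ τ₁ κ₂ τ₂ H₁ H₂ θ (jet y₁ M₁ z) (jet y₂' M₂' z)) :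
    ∃ W ⊆ V, IsOpen W ∧ z₀ ∈ W ∧
      (∃ A B C, OnGroup κ₂ A B ∧
        Jet.MovedBy (translation κ₂ τ₂ A B C) (jet y₂ M₂ z₀) (jet y₂' M₂' z₀)) ∧
      ∀ A B C, OnGroup κ₂ A B → ∀ q ∈ W, ∀ z ∈ W,
        Jet.MovedBy (translation κ₂ τ₂ A B C) (jet y₂ M₂ q) (jet y₂' M₂' q) →
        Jet.MovedBy (translation κ₂ τ₂ A B C) (jet y₂ M₂ z) (jet y₂' M₂' z) := by
  obtain ⟨X, hXU, hX, hzX, a, b, s, φ, η, β, n, ν, ρ, hl, hy⟩ :=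
    exists_isSurfaceLift hU h₁.smooth h₁.isSurfaceJet (hVU hz₀)
  have hmc := fun z hz => h₁.hasMeanCurvature z (hXU hz)
  have hj := fun z hz => h₁.isSurfaceJet z (hXU hz)
  have hVX := hV.inter hX
  obtain ⟨W₁, hW₁, hW₁o, hz₁, a₂, b₂, s₂, h₂, hl₂⟩ := exists_isLift_sister hl hX hy hτ hH hmc hj hVX
    Set.inter_subset_right (hy₂.mono Set.inter_subset_left) (fun z hz => hs z hz.1) ⟨hz₀, hzX⟩
  obtain ⟨W₂, hW₂, hW₂o, hz₂, a₂', b₂', s₂', h₂', hl₂'⟩ := exists_isLift_sister hl hX hy hτ hH hmc hj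
    hVX Set.inter_subset_right (hy₂'.mono Set.inter_subset_left) (fun z hz => hs' z hz.1)
    ⟨hz₀, hzX⟩
  obtain ⟨r, hr, hrW⟩ := Metric.isOpen_iff.1 (hW₁o.inter hW₂o) z₀ ⟨hz₁, hz₂⟩
  have k₂ := h₂.mono (hrW.trans Set.inter_subset_left)
  have k₂' := h₂'.mono (hrW.trans Set.inter_subset_right)
  have m₂ : LiftsTo κ₂ τ₂ (ball z₀ r) a₂ b₂ s₂ n ν y₂ M₂ := fun z hz => hl₂ z (hrW hz).1
  have m₂' : LiftsTo κ₂ τ₂ (ball z₀ r) a₂' b₂' s₂' n ν y₂' M₂' := fun z hz => hl₂' z (hrW hz).2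
  refine ⟨ball z₀ r, fun z hz => (hW₁ (hrW hz).1).1, isOpen_ball, mem_ball_self hr,
    exists_movedBy k₂ k₂' isOpen_ball m₂ m₂' (mem_ball_self hr), fun A B C hg q hq z hz hm => ?_⟩
  exact k₂.movedBy k₂' isOpen_ball (convex_ball z₀ r).isPreconnected m₂ m₂' hg hq
    (conformalFrame_sister θ (hl.conformalFrame q (hW₁ (hrW hq).1).2)).exists_ne_zero hm hz

/-! ### Jets in another complex coordinate -/

/-- The jet in another coordinate `ζ`, where `c` is the derivative of the old coordinate with respect
to `ζ`. -/
def Jet.scale (c : ℂ) (j : Jet) : Jet :=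
  ⟨j.x, j.N, j.d.comp (ContinuousLinearMap.mul ℝ ℂ c), j.dN.comp (ContinuousLinearMap.mul ℝ ℂ c)⟩

variable {κ τ : ℝ} {c : ℂ} {j j' j₁ j₂ : Jet}

theorem Jet.scale_inner (v w : ℂ) : (j.scale c).inner κ τ v w = j.inner κ τ (c * v) (c * w) := rfl

theorem Jet.scale_cov (v w : ℂ) : (j.scale c).cov κ τ v w = j.cov κ τ (c * v) (c * w) := rfl

theorem Jet.scale_scale_inv (hc : c ≠ 0) (j : Jet) : (j.scale c).scale c⁻¹ = j := by
  have h : ∀ L : ℂ →L[ℝ] R4, (L.comp (ContinuousLinearMap.mul ℝ ℂ c)).comp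
      (ContinuousLinearMap.mul ℝ ℂ c⁻¹) = L := fun L => by
    refine ContinuousLinearMap.ext fun v => ?_
    simp [mul_inv_cancel_left₀ hc]
  simp only [Jet.scale, h]

/-- The multiplication by a complex number preserves the orientation of the tangent plane. -/
theorem isDirect_scale (hc : c ≠ 0) (L : ℂ →L[ℝ] R4) {p N : R4}
    (h : IsDirect κ τ p (L 1) (L I) N) : IsDirect κ τ p (L (c * 1)) (L (c * I)) N := by
  have h1 : L (c * 1) = c.re • L 1 + c.im • L I := by rw [mul_one, clm_apply_eq L c]
  have h2 : L (c * I) = (-c.im) • L 1 + c.re • L I := by rw [clm_apply_eq L (c * I)]; simp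
  have h3 : 0 < c.re ^ 2 + c.im ^ 2 := by
    have := normSq_pos.2 hc
    rw [normSq_apply] at this
    linarith
  rw [IsDirect] at h ⊢
  have := mul_pos h3 h
  refine this.trans_eq ?_
  rw [h1, h2]
  generalize conormal κ τ p = w
  generalize L 1 = u
  generalize L I = v
  simp only [Matrix.det_succ_row_zero, Matrix.det_fin_three, Fin.sum_univ_four, Fin.sum_univ_succ,
    Matrix.of_apply, Matrix.submatrix_apply]
  simp [Fin.succAbove, Fin.lt_def]
  ring

theorem IsSurfaceJet.scale (h : IsSurfaceJet κ τ j) (hc : c ≠ 0) : IsSurfaceJet κ τ (j.scale c) := by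
  obtain ⟨ρ, hρ, hr⟩ := h.conformal
  refine ⟨h.mem, ⟨ρ * normSq c, mul_pos hρ (normSq_pos.2 hc), fun v w => ?_⟩, h.tangent, h.unit,
    fun v => h.orthogonal _, isDirect_scale hc j.d h.direct⟩
  rw [Jet.scale_inner, hr, normSq_apply]
  simp only [map_mul, map_sub, map_add, map_neg, map_pow, conj_I, conj_ofReal, Complex.conj_conj,
    mul_re, mul_im, sub_re, sub_im, add_re, add_im, neg_re, neg_im, I_re, I_im, ofReal_re, ofReal_im,
    conj_re, conj_im, pow_two, one_re, one_im, zero_re, zero_im]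
  ring

theorem IsSisterJet.scale (h : IsSisterJet κ₁ τ₁ κ₂ τ₂ H₁ H₂ θ j₁ j₂) (hc : c ≠ 0) :
    IsSisterJet κ₁ τ₁ κ₂ τ₂ H₁ H₂ θ (j₁.scale c) (j₂.scale c) := by
  have hr : ∀ w, c * rotCLM θ w = rotCLM θ (c * w) := fun w => by
    rw [rotCLM_apply, rotCLM_apply]
    ring
  refine ⟨h.mem, h.tangent, h.unit, fun v => h.orthogonal _, isDirect_scale hc j₂.d h.direct,
    fun v w => h.inner_eq _ _, fun v w => ?_, fun w => ?_, h.angle_eq⟩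
  · rw [Jet.scale_cov, Jet.scale_cov, Jet.scale_inner, Jet.scale_inner, hr, h.cov_eq]
  · have := h.vertical_eq (c * w)
    rw [← hr] at this
    exact this

theorem Jet.MovedBy.scale {Φ : R4 → R4} (h : Jet.MovedBy Φ j j') :
    Jet.MovedBy Φ (j.scale c) (j'.scale c) :=
  ⟨h.point, h.normal, fun _ => h.deriv _⟩

theorem isSisterJet_scale_iff (hc : c ≠ 0) :
    IsSisterJet κ₁ τ₁ κ₂ τ₂ H₁ H₂ θ (j₁.scale c) (j₂.scale c)
      ↔ IsSisterJet κ₁ τ₁ κ₂ τ₂ H₁ H₂ θ j₁ j₂ := by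
  refine ⟨fun h => ?_, fun h => h.scale hc⟩
  have := h.scale (inv_ne_zero hc)
  rwa [Jet.scale_scale_inv hc, Jet.scale_scale_inv hc] at this

theorem isSurfaceJet_scale_iff (hc : c ≠ 0) :
    IsSurfaceJet κ τ (j.scale c) ↔ IsSurfaceJet κ τ j := by
  refine ⟨fun h => ?_, fun h => h.scale hc⟩
  have := h.scale (inv_ne_zero hc)
  rwa [Jet.scale_scale_inv hc] at this

theorem movedBy_scale_iff {Φ : R4 → R4} (hc : c ≠ 0) :
    Jet.MovedBy Φ (j.scale c) (j'.scale c) ↔ Jet.MovedBy Φ j j' := by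
  refine ⟨fun h => ?_, fun h => h.scale⟩
  have := h.scale (c := c⁻¹)
  rwa [Jet.scale_scale_inv hc, Jet.scale_scale_inv hc] at this

/-- The mean curvature of a jet, from the trace of a shape operator in another coordinate. -/
theorem hasMeanCurvature_of_trace (hc : c ≠ 0) (h : IsSurfaceJet κ τ (j.scale c)) {H : ℝ}
    {A : ℂ →ₗ[ℝ] ℂ} (hA : ∀ v w, (j.scale c).inner κ τ (A v) w = -(j.scale c).cov κ τ v w)
    (ht : (A 1).re + (A I).im = 2 * H) : j.HasMeanCurvature κ τ H := by
  obtain ⟨ρ, hρ, hr⟩ := h.conformal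
  have hlin : ∀ v : ℂ, A v = v.re • A 1 + v.im • A I := fun v =>
    clm_apply_eq A.toContinuousLinearMap v
  have hcov : ∀ v w, j.cov κ τ v w = -(ρ * (A (c⁻¹ * v) * conj (c⁻¹ * w)).re) := fun v w => by
    have := hA (c⁻¹ * v) (c⁻¹ * w)
    rw [hr, Jet.scale_cov, mul_inv_cancel_left₀ hc, mul_inv_cancel_left₀ hc] at this
    linarith
  have hin : j.inner κ τ 1 1 = ρ * (c⁻¹ * conj c⁻¹).re := by
    have := hr (c⁻¹ * 1) (c⁻¹ * 1)
    rw [Jet.scale_inner, mul_inv_cancel_left₀ hc, mul_one] at this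
    exact this
  rw [Jet.HasMeanCurvature, hcov, hcov, hin, hlin (c⁻¹ * 1), hlin (c⁻¹ * I)]
  generalize c⁻¹ = e
  simp only [Complex.real_smul]
  simp only [map_mul, map_sub, map_add, map_neg, map_pow, conj_I, conj_ofReal, Complex.conj_conj,
    mul_re, mul_im, sub_re, sub_im, add_re, add_im, neg_re, neg_im, I_re, I_im, ofReal_re, ofReal_im,
    conj_re, conj_im, pow_two, one_re, one_im, zero_re, zero_im]
  linear_combination (-ρ * (e.re * e.re + e.im * e.im)) * ht

end DiscSister

/-! ### Surfaces read in the charts of the Riemann surface -/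

section Charts

open Complex ComplexConjugate Metric Filter Topology

variable {S : Type*} [TopologicalSpace S] [ChartedSpace ℂ S]

/-- A Riemann surface is a smooth real manifold. -/
theorem isManifold_real [IsManifold 𝓘(ℂ) ω S] : IsManifold 𝓘(ℝ, ℂ) ∞ S := by
  refine isManifold_of_contDiffOn _ _ _ fun e e' he he' => ?_
  have h := (contDiffGroupoid ω 𝓘(ℂ)).compatible he he'
  rw [contDiffGroupoid, mem_groupoid_of_pregroupoid] at h
  have h1 : ContDiffOn ℂ ω _ _ := h.1
  exact (h1.restrict_scalars ℝ).of_le le_top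

/-- The differential of a chart of a Riemann surface is complex linear. -/
theorem exists_diff_eq [IsManifold 𝓘(ℂ) ω S] {p₀ q : S} (hq : q ∈ (chartAt ℂ p₀).source) :
    ∃ c : ℂ, c ≠ 0 ∧ ∀ x : S → R4, MDifferentiableAt 𝓘(ℝ, ℂ) 𝓘(ℝ, R4) x q →
      diff x q = (fderiv ℝ (x ∘ (chartAt ℂ p₀).symm) (chartAt ℂ p₀ q)).comp
        (ContinuousLinearMap.mul ℝ ℂ c) := by
  have hR : IsManifold 𝓘(ℝ, ℂ) ∞ S := isManifold_real
  have hR1 : IsManifold 𝓘(ℝ, ℂ) 1 S := IsManifold.of_le (n := ∞) (by simp)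
  have hC1 : IsManifold 𝓘(ℂ) 1 S := IsManifold.of_le (n := ω) le_top
  set e := chartAt ℂ p₀ with he
  have hd := (mdifferentiable_chart (I := 𝓘(ℂ)) p₀).mdifferentiableAt hq
  set D : ℂ →L[ℂ] ℂ := mfderiv 𝓘(ℂ) 𝓘(ℂ) e q with hD
  have hinj : Function.Injective D := (mdifferentiable_chart (I := 𝓘(ℂ)) p₀).mfderiv_injective hq
  have hDm : ∀ v, D v = D 1 * v := fun v => by
    have := D.map_smul v 1
    simp only [smul_eq_mul, mul_one] at this
    rw [this, mul_comm]
  have hre : HasMFDerivAt 𝓘(ℝ, ℂ) 𝓘(ℝ, ℂ) e q (ContinuousLinearMap.mul ℝ ℂ (D 1)) := by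
    have h1 : HasMFDerivAt 𝓘(ℂ) 𝓘(ℂ) e q D := hd.hasMFDerivAt
    have h2 : HasFDerivWithinAt (writtenInExtChartAt 𝓘(ℂ) 𝓘(ℂ) q e) D (Set.range 𝓘(ℂ))
      (extChartAt 𝓘(ℂ) q q) := h1.2
    have h3 := h2.restrictScalars ℝ
    have h4 : D.restrictScalars ℝ = ContinuousLinearMap.mul ℝ ℂ (D 1) :=
      ContinuousLinearMap.ext hDm
    rw [h4] at h3
    exact ⟨h1.1, h3⟩
  refine ⟨D 1, fun h0 => ?_, fun x hx => ?_⟩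
  · have : D 1 = D 0 := by rw [h0, map_zero]
    exact one_ne_zero (hinj this)
  · have hs : MDifferentiableAt 𝓘(ℝ, ℂ) 𝓘(ℝ, ℂ) e.symm (e q) :=
      (mdifferentiable_chart (I := 𝓘(ℝ, ℂ)) p₀).mdifferentiableAt_symm (e.map_source hq)
    have hx' : MDifferentiableAt 𝓘(ℝ, ℂ) 𝓘(ℝ, R4) x (e.symm (e q)) := by
      rwa [e.left_inv hq]
    have hxs : MDifferentiableAt 𝓘(ℝ, ℂ) 𝓘(ℝ, R4) (x ∘ e.symm) (e q) := hx'.comp (e q) hs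
    have hcomp := hxs.hasMFDerivAt.comp q hre
    have heq : x =ᶠ[𝓝 q] (x ∘ e.symm) ∘ e := by
      filter_upwards [e.open_source.mem_nhds hq] with q' hq'
      simp [e.left_inv hq']
    have := (hcomp.congr_of_eventuallyEq heq).mfderiv
    rw [mfderiv_eq_fderiv] at this
    exact this

/-- The jet at a point of a map to `ℝ⁴` and of a vector field along it. -/
def surfaceJet (x N : S → R4) (p : S) : Jet := ⟨x p, N p, diff x p, diff N p⟩

/-- The jet at a point, read in a chart around it: the factor `c` does not depend on the surface. -/
theorem exists_surfaceJet_eq [IsManifold 𝓘(ℂ) ω S] {p₀ q : S} (hq : q ∈ (chartAt ℂ p₀).source) :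
    ∃ c : ℂ, c ≠ 0 ∧ ∀ x N : S → R4, MDifferentiableAt 𝓘(ℝ, ℂ) 𝓘(ℝ, R4) x q →
      MDifferentiableAt 𝓘(ℝ, ℂ) 𝓘(ℝ, R4) N q →
      surfaceJet x N q = (jet (x ∘ (chartAt ℂ p₀).symm) (N ∘ (chartAt ℂ p₀).symm)
        (chartAt ℂ p₀ q)).scale c := by
  obtain ⟨c, hc, h⟩ := exists_diff_eq hq
  refine ⟨c, hc, fun x N hx hN => ?_⟩
  simp only [surfaceJet, Jet.scale, jet, h x hx, h N hN, Function.comp_apply,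
    (chartAt ℂ p₀).left_inv hq]

theorem contDiffOn_comp_symm [IsManifold 𝓘(ℂ) ω S] {x : S → R4} {p₀ : S} {V : Set S}
    (hx : ∀ q ∈ V, ContMDiffAt 𝓘(ℝ, ℂ) 𝓘(ℝ, R4) ∞ x q) :
    ContDiffOn ℝ ∞ (x ∘ (chartAt ℂ p₀).symm)
      ((chartAt ℂ p₀).target ∩ (chartAt ℂ p₀).symm ⁻¹' V) := by
  have hR : IsManifold 𝓘(ℝ, ℂ) ∞ S := isManifold_real
  have h : ContMDiffOn 𝓘(ℝ, ℂ) 𝓘(ℝ, R4) ∞ (x ∘ (chartAt ℂ p₀).symm)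
      ((chartAt ℂ p₀).target ∩ (chartAt ℂ p₀).symm ⁻¹' V) := fun z hz =>
    (hx _ hz.2).comp_contMDiffWithinAt z
      ((contMDiffOn_chart_symm (I := 𝓘(ℝ, ℂ)) z hz.1).mono Set.inter_subset_left)
  exact h.contDiffOn

theorem contMDiffAt_comp_chart [IsManifold 𝓘(ℂ) ω S] {y : ℂ → R4} {p₀ q : S} {V : Set ℂ}
    (hV : IsOpen V) (hy : ContDiffOn ℝ ∞ y V) (hq : q ∈ (chartAt ℂ p₀).source)
    (hqV : chartAt ℂ p₀ q ∈ V) :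
    ContMDiffAt 𝓘(ℝ, ℂ) 𝓘(ℝ, R4) ∞ (y ∘ chartAt ℂ p₀) q := by
  have hR : IsManifold 𝓘(ℝ, ℂ) ∞ S := isManifold_real
  exact (hy.contDiffAt (hV.mem_nhds hqV)).contMDiffAt.comp q
    ((contMDiffOn_chart (I := 𝓘(ℝ, ℂ))).contMDiffAt ((chartAt ℂ p₀).open_source.mem_nhds hq))

theorem jet_congr {y y' M M' : ℂ → R4} {z : ℂ} (hy : y =ᶠ[𝓝 z] y') (hM : M =ᶠ[𝓝 z] M') :
    jet y M z = jet y' M' z := by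
  simp only [jet, hy.eq_of_nhds, hM.eq_of_nhds, hy.fderiv_eq, hM.fderiv_eq]

end Charts

/-! ### Global sister immersions -/

section GlobalSister

open Complex ComplexConjugate Metric Filter Topology

variable {S : Type*} [TopologicalSpace S] [ChartedSpace ℂ S]

/-- `x` is a conformal immersion of constant mean curvature `H` with unit normal `N`: it is so in
the charts of the Riemann surface. -/
structure IsCMCSurface (κ τ H : ℝ) (x N : S → R4) : Prop where
  smooth : ContMDiff 𝓘(ℝ, ℂ) 𝓘(ℝ, R4) ∞ x
  smooth_normal : ContMDiff 𝓘(ℝ, ℂ) 𝓘(ℝ, R4) ∞ N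
  isCMC : ∀ p, IsCMC κ τ H (chartAt ℂ p).target (x ∘ (chartAt ℂ p).symm) (N ∘ (chartAt ℂ p).symm)

/-- `x` is a sister immersion of `x₁` on the set `V`, with unit normal `N`. -/
structure IsSisterOn (κ₁ τ₁ κ₂ τ₂ H₁ H₂ θ : ℝ) (x₁ N₁ x N : S → R4) (V : Set S) : Prop where
  smooth : ∀ q ∈ V, ContMDiffAt 𝓘(ℝ, ℂ) 𝓘(ℝ, R4) ∞ x q
  smooth_normal : ∀ q ∈ V, ContMDiffAt 𝓘(ℝ, ℂ) 𝓘(ℝ, R4) ∞ N q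
  isSisterJet : ∀ q ∈ V, IsSisterJet κ₁ τ₁ κ₂ τ₂ H₁ H₂ θ (surfaceJet x₁ N₁ q) (surfaceJet x N q)

variable {κ τ κ₁ τ₁ κ₂ τ₂ H₁ H₂ θ : ℝ} {x₁ N₁ x N x' N' : S → R4} {V : Set S}

theorem IsSisterOn.mono {W : Set S} (h : IsSisterOn κ₁ τ₁ κ₂ τ₂ H₁ H₂ θ x₁ N₁ x N V) (hW : W ⊆ V) :
    IsSisterOn κ₁ τ₁ κ₂ τ₂ H₁ H₂ θ x₁ N₁ x N W :=
  ⟨fun q hq => h.smooth q (hW hq), fun q hq => h.smooth_normal q (hW hq),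
    fun q hq => h.isSisterJet q (hW hq)⟩

theorem surfaceJet_congr {q : S} (hx : x =ᶠ[𝓝 q] x') (hN : N =ᶠ[𝓝 q] N') :
    surfaceJet x N q = surfaceJet x' N' q := by
  have h1 : diff x q = diff x' q := hx.mfderiv_eq
  have h2 : diff N q = diff N' q := hN.mfderiv_eq
  simp only [surfaceJet, hx.eq_of_nhds, hN.eq_of_nhds, h1, h2]

theorem mdifferentiableAt_of_contMDiffAt {x : S → R4} {q : S}
    (h : ContMDiffAt 𝓘(ℝ, ℂ) 𝓘(ℝ, R4) ∞ x q) : MDifferentiableAt 𝓘(ℝ, ℂ) 𝓘(ℝ, R4) x q :=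
  h.mdifferentiableAt (by simp)

variable [IsManifold 𝓘(ℂ) ω S]

/-- A sister immersion read in a chart. -/
theorem IsSisterOn.inChart (h₁ : IsCMCSurface κ₁ τ₁ H₁ x₁ N₁)
    (h : IsSisterOn κ₁ τ₁ κ₂ τ₂ H₁ H₂ θ x₁ N₁ x N V) (p : S) {z : ℂ}
    (hz : z ∈ (chartAt ℂ p).target ∩ (chartAt ℂ p).symm ⁻¹' V) :
    IsSisterJet κ₁ τ₁ κ₂ τ₂ H₁ H₂ θ (jet (x₁ ∘ (chartAt ℂ p).symm) (N₁ ∘ (chartAt ℂ p).symm) z)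
      (jet (x ∘ (chartAt ℂ p).symm) (N ∘ (chartAt ℂ p).symm) z) := by
  obtain ⟨c, hc, hcx⟩ := exists_surfaceJet_eq ((chartAt ℂ p).map_target hz.1)
  have := h.isSisterJet _ hz.2
  rwa [hcx x₁ N₁ (mdifferentiableAt_of_contMDiffAt h₁.smooth.contMDiffAt)
      (mdifferentiableAt_of_contMDiffAt h₁.smooth_normal.contMDiffAt),
    hcx x N (mdifferentiableAt_of_contMDiffAt (h.smooth _ hz.2))
      (mdifferentiableAt_of_contMDiffAt (h.smooth_normal _ hz.2)), isSisterJet_scale_iff hc,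
    (chartAt ℂ p).right_inv hz.1] at this

/-- A sister immersion constructed in a chart. -/
theorem isSisterOn_of_chart (h₁ : IsCMCSurface κ₁ τ₁ H₁ x₁ N₁) (p : S) {B : Set ℂ} (hB : IsOpen B)
    (hBt : B ⊆ (chartAt ℂ p).target)
    {y M : ℂ → R4} (hy : ContDiffOn ℝ ∞ y B) (hM : ContDiffOn ℝ ∞ M B)
    (h : ∀ z ∈ B, IsSisterJet κ₁ τ₁ κ₂ τ₂ H₁ H₂ θ
      (jet (x₁ ∘ (chartAt ℂ p).symm) (N₁ ∘ (chartAt ℂ p).symm) z) (jet y M z)) :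
    IsSisterOn κ₁ τ₁ κ₂ τ₂ H₁ H₂ θ x₁ N₁ (y ∘ chartAt ℂ p) (M ∘ chartAt ℂ p)
      ((chartAt ℂ p).source ∩ chartAt ℂ p ⁻¹' B) := by
  have hs := fun (q : S) (hq : q ∈ (chartAt ℂ p).source ∩ chartAt ℂ p ⁻¹' B) =>
    contMDiffAt_comp_chart hB hy hq.1 hq.2
  have hsM := fun (q : S) (hq : q ∈ (chartAt ℂ p).source ∩ chartAt ℂ p ⁻¹' B) =>
    contMDiffAt_comp_chart hB hM hq.1 hq.2
  refine ⟨hs, hsM, fun q hq => ?_⟩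
  obtain ⟨c, hc, hcx⟩ := exists_surfaceJet_eq hq.1
  have hcomp : ∀ y : ℂ → R4, (y ∘ chartAt ℂ p) ∘ (chartAt ℂ p).symm =ᶠ[𝓝 (chartAt ℂ p q)] y :=
    fun y => Filter.eventually_of_mem (hB.mem_nhds hq.2) fun z hz => by
      simp [(chartAt ℂ p).right_inv (hBt hz)]
  rw [hcx x₁ N₁ (mdifferentiableAt_of_contMDiffAt h₁.smooth.contMDiffAt)
      (mdifferentiableAt_of_contMDiffAt h₁.smooth_normal.contMDiffAt),
    hcx _ _ (mdifferentiableAt_of_contMDiffAt (hs q hq))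
      (mdifferentiableAt_of_contMDiffAt (hsM q hq)), isSisterJet_scale_iff hc,
    jet_congr (hcomp y) (hcomp M)]
  exact h _ hq.2

/-- Two sister immersions differ at each point by a translation up to the first order, and if they
differ by a translation at a point, up to the first order, they do so nearby. -/
theorem IsSisterOn.rigidity (h₁ : IsCMCSurface κ₁ τ₁ H₁ x₁ N₁)
    (hτ : τ₁ = Real.cos θ * τ₂ + Real.sin θ * H₂)
    (hH : H₁ = Real.cos θ * H₂ - Real.sin θ * τ₂) (hV : IsOpen V)
    (h : IsSisterOn κ₁ τ₁ κ₂ τ₂ H₁ H₂ θ x₁ N₁ x N V)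
    (h' : IsSisterOn κ₁ τ₁ κ₂ τ₂ H₁ H₂ θ x₁ N₁ x' N' V) {p : S} (hp : p ∈ V) :
    ∃ W ⊆ V, IsOpen W ∧ p ∈ W ∧
      (∃ A B C, OnGroup κ₂ A B ∧
        Jet.MovedBy (translation κ₂ τ₂ A B C) (surfaceJet x N p) (surfaceJet x' N' p)) ∧
      ∀ A B C, OnGroup κ₂ A B → ∀ q ∈ W, ∀ r ∈ W,
        Jet.MovedBy (translation κ₂ τ₂ A B C) (surfaceJet x N q) (surfaceJet x' N' q) →
        Jet.MovedBy (translation κ₂ τ₂ A B C) (surfaceJet x N r) (surfaceJet x' N' r) := by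
  set e := chartAt ℂ p with he
  have hpe : p ∈ e.source := mem_chart_source ℂ p
  have hmem : ∀ q ∈ e.source, q ∈ V → e q ∈ e.target ∩ e.symm ⁻¹' V := fun q hq hqV =>
    ⟨e.map_source hq, by rwa [Set.mem_preimage, e.left_inv hq]⟩
  obtain ⟨W, hWV, hW, hpW, hex, hprop⟩ := (h₁.isCMC p).rigidity e.open_target hτ hH
    (e.isOpen_inter_preimage_symm hV) Set.inter_subset_left (hmem p hpe hp)
    (contDiffOn_comp_symm h.smooth) (contDiffOn_comp_symm h'.smooth)
    (fun z hz => h.inChart h₁ p hz) (fun z hz => h'.inChart h₁ p hz)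
  have key : ∀ q ∈ e.source, q ∈ V → ∀ Φ,
      Jet.MovedBy Φ (surfaceJet x N q) (surfaceJet x' N' q) ↔
      Jet.MovedBy Φ (jet (x ∘ e.symm) (N ∘ e.symm) (e q))
        (jet (x' ∘ e.symm) (N' ∘ e.symm) (e q)) := fun q hq hqV Φ => by
    obtain ⟨c, hc, hcx⟩ := exists_surfaceJet_eq (p₀ := p) hq
    rw [hcx x N (mdifferentiableAt_of_contMDiffAt (h.smooth q hqV))
        (mdifferentiableAt_of_contMDiffAt (h.smooth_normal q hqV)),
      hcx x' N' (mdifferentiableAt_of_contMDiffAt (h'.smooth q hqV))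
        (mdifferentiableAt_of_contMDiffAt (h'.smooth_normal q hqV)), movedBy_scale_iff hc]
  have hin : ∀ q ∈ e.source ∩ e ⁻¹' W, q ∈ V := fun q hq => by
    have := (hWV hq.2).2
    rwa [Set.mem_preimage, e.left_inv hq.1] at this
  refine ⟨e.source ∩ e ⁻¹' W, hin, e.isOpen_inter_preimage hW, ⟨hpe, hpW⟩, ?_,
    fun A B C hg q hq r hr hm => ?_⟩
  · obtain ⟨A, B, C, hg, hm⟩ := hex
    exact ⟨A, B, C, hg, (key p hpe hp _).2 hm⟩
  · exact (key r hr.1 (hin r hr) _).2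
      (hprop A B C hg _ hq.2 _ hr.2 ((key q hq.1 (hin q hq) _).1 hm))

/-- Unique continuation: two sister immersions of a connected open set which differ by a translation
at a point, up to the first order, differ by this translation. -/
theorem IsSisterOn.movedBy (h₁ : IsCMCSurface κ₁ τ₁ H₁ x₁ N₁)
    (hτ : τ₁ = Real.cos θ * τ₂ + Real.sin θ * H₂)
    (hH : H₁ = Real.cos θ * H₂ - Real.sin θ * τ₂) (hV : IsOpen V) (hc : IsPreconnected V)
    (h : IsSisterOn κ₁ τ₁ κ₂ τ₂ H₁ H₂ θ x₁ N₁ x N V)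
    (h' : IsSisterOn κ₁ τ₁ κ₂ τ₂ H₁ H₂ θ x₁ N₁ x' N' V) {A B : ℂ} {C : ℝ} (hg : OnGroup κ₂ A B)
    {q r : S} (hq : q ∈ V) (hr : r ∈ V)
    (hm : Jet.MovedBy (translation κ₂ τ₂ A B C) (surfaceJet x N q) (surfaceJet x' N' q)) :
    Jet.MovedBy (translation κ₂ τ₂ A B C) (surfaceJet x N r) (surfaceJet x' N' r) := by
  refine (hc.induction₂ (fun q r =>
    Jet.MovedBy (translation κ₂ τ₂ A B C) (surfaceJet x N q) (surfaceJet x' N' q) ↔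
    Jet.MovedBy (translation κ₂ τ₂ A B C) (surfaceJet x N r) (surfaceJet x' N' r))
    (fun p hp => ?_) (fun _ _ _ _ _ _ => Iff.trans) (fun _ _ _ _ => Iff.symm) hq hr).1 hm
  obtain ⟨W, -, hW, hpW, -, hprop⟩ := h.rigidity h₁ hτ hH hV h' hp
  filter_upwards [mem_nhdsWithin_of_mem_nhds (hW.mem_nhds hpW)] with r hr
  exact ⟨hprop A B C hg p hpW r hr, hprop A B C hg r hr p hpW⟩

theorem translation_one_of_mem {p : R4} (hp : p ∈ carrier κ τ) :
    translation κ τ 1 0 0 p = p ∧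
      ∀ u ∈ tangent κ τ p, fderiv ℝ (translation κ τ 1 0 0) p u = u := by
  obtain ⟨a, b, s, hg, rfl⟩ := exists_proj_eq hp
  refine ⟨(translation_one hg s).1, fun u hu => ?_⟩
  obtain ⟨n, m, rfl⟩ := exists_frame_eq hg hu
  exact (translation_one hg s).2 n m

/-- The differential of a map to `E(κ, τ)` takes its values in the tangent spaces. -/
theorem fderiv_mem_tangent {U : Set ℂ} (hU : IsOpen U) {y : ℂ → R4} (hy : ContDiffOn ℝ ∞ y U)
    (hmem : ∀ z ∈ U, y z ∈ carrier κ τ) {z : ℂ} (hz : z ∈ U) (v : ℂ) :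
    fderiv ℝ y z v ∈ tangent κ τ (y z) := by
  obtain ⟨V, -, hV, hzV, a, b, s, ha, hb, hs, hg, hpr⟩ := exists_local_lift hU hy hmem hz
  obtain ⟨φ, η, β, hl⟩ := exists_isLift κ τ hV ha hb hs hg
  rw [hl.fderiv_eq hV (fun z hz => (hpr z hz).symm) hzV, ← hpr z hzV]
  exact frame_mem_tangent _ _ _ _ _ _ _

theorem diff_mem_tangent (hV : IsOpen V) (hx : ∀ q ∈ V, ContMDiffAt 𝓘(ℝ, ℂ) 𝓘(ℝ, R4) ∞ x q)
    (hmem : ∀ q ∈ V, x q ∈ carrier κ τ) {q : S} (hq : q ∈ V) (v : ℂ) :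
    diff x q v ∈ tangent κ τ (x q) := by
  obtain ⟨c, -, h⟩ := exists_diff_eq (mem_chart_source ℂ q)
  rw [h x (mdifferentiableAt_of_contMDiffAt (hx q hq))]
  have := fderiv_mem_tangent ((chartAt ℂ q).isOpen_inter_preimage_symm hV)
    (contDiffOn_comp_symm (p₀ := q) hx) (fun z hz => hmem _ hz.2) (z := chartAt ℂ q q)
    ⟨mem_chart_target ℂ q, by
      rwa [Set.mem_preimage, (chartAt ℂ q).left_inv (mem_chart_source ℂ q)]⟩ (c * v)
  rwa [Function.comp_apply, (chartAt ℂ q).left_inv (mem_chart_source ℂ q)] at this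

/-- Two jets of sister immersions differ by the identity if and only if they coincide up to the
first order for the surface and the order zero for the normal. -/
theorem IsSisterOn.movedBy_one_iff (hV : IsOpen V)
    (h : IsSisterOn κ₁ τ₁ κ₂ τ₂ H₁ H₂ θ x₁ N₁ x N V) {q : S} (hq : q ∈ V) :
    Jet.MovedBy (translation κ₂ τ₂ 1 0 0) (surfaceJet x N q) (surfaceJet x' N' q) ↔
      x q = x' q ∧ N q = N' q ∧ diff x q = diff x' q := by
  have hj := h.isSisterJet q hq
  obtain ⟨t1, t2⟩ := translation_one_of_mem hj.mem
  have ht := fun v => t2 _ (diff_mem_tangent hV h.smooth (fun q hq => (h.isSisterJet q hq).mem) hq v)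
  have hN := t2 _ hj.tangent
  simp only [surfaceJet] at t1 t2 ht hN
  constructor
  · rintro ⟨m1, m2, m3⟩
    simp only [surfaceJet] at m1 m2 m3
    exact ⟨(m1.trans t1).symm, (m2.trans hN).symm,
      ContinuousLinearMap.ext fun v => ((m3 v).trans (ht v)).symm⟩
  · rintro ⟨m1, m2, m3⟩
    refine ⟨?_, ?_, fun v => ?_⟩
    · simp only [surfaceJet]
      rw [t1, m1]
    · simp only [surfaceJet]
      rw [hN, m2]
    · simp only [surfaceJet]
      rw [ht, m3]

/-- The problem solved by the sister immersions, for the field of the first order jets of the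
surface and of its normal. -/
def SisterProblem (κ₁ τ₁ κ₂ τ₂ H₁ H₂ θ : ℝ) (x₁ N₁ : S → R4) (F : S → R4 × R4 × (ℂ →L[ℝ] R4))
    (p : S) : Prop :=
  ∃ V : Set S, IsOpen V ∧ p ∈ V ∧
    IsSisterOn κ₁ τ₁ κ₂ τ₂ H₁ H₂ θ x₁ N₁ (fun q => (F q).1) (fun q => (F q).2.1) V ∧
    ∀ q ∈ V, (F q).2.2 = diff (fun q => (F q).1) q

/-- Two solutions have the same value at a point if and only if they differ there by the
identity. -/
theorem IsSisterOn.eq_iff_movedBy_one (hV : IsOpen V) {F G : S → R4 × R4 × (ℂ →L[ℝ] R4)}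
    (h : IsSisterOn κ₁ τ₁ κ₂ τ₂ H₁ H₂ θ x₁ N₁ (fun q => (F q).1) (fun q => (F q).2.1) V)
    (hF : ∀ q ∈ V, (F q).2.2 = diff (fun q => (F q).1) q)
    (hG : ∀ q ∈ V, (G q).2.2 = diff (fun q => (G q).1) q)
    {q : S} (hq : q ∈ V) :
    F q = G q ↔ Jet.MovedBy (translation κ₂ τ₂ 1 0 0)
      (surfaceJet (fun q => (F q).1) (fun q => (F q).2.1) q)
      (surfaceJet (fun q => (G q).1) (fun q => (G q).2.1) q) := by
  rw [h.movedBy_one_iff hV hq, ← hF q hq, ← hG q hq, Prod.ext_iff, Prod.ext_iff]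

/-- A constant mean curvature surface which is simply connected has a sister immersion. -/
theorem IsCMCSurface.exists_sister [SimplyConnectedSpace S]
    (h₁ : IsCMCSurface κ₁ τ₁ H₁ x₁ N₁)
    (hκ : κ₁ - 4 * τ₁ ^ 2 = κ₂ - 4 * τ₂ ^ 2)
    (hτ : τ₁ = Real.cos θ * τ₂ + Real.sin θ * H₂)
    (hH : H₁ = Real.cos θ * H₂ - Real.sin θ * τ₂) :
    ∃ x N, IsSisterOn κ₁ τ₁ κ₂ τ₂ H₁ H₂ θ x₁ N₁ x N Set.univ := by
  have hg : OnGroup κ₂ 1 0 := by simp [OnGroup]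
  have : LocallyPathConnectedSpace S := ChartedSpace.locallyPathConnectedSpace ℂ S
  have hdisc := fun p : S => (h₁.isCMC p).exists_disc (chartAt ℂ p).open_target
    (mem_chart_target ℂ p) hκ hτ hH
  suffices h : ∃ F : S → R4 × R4 × (ℂ →L[ℝ] R4),
      ∀ p, SisterProblem κ₁ τ₁ κ₂ τ₂ H₁ H₂ θ x₁ N₁ F p by
    obtain ⟨F, hF⟩ := h
    refine ⟨fun q => (F q).1, fun q => (F q).2.1, fun q _ => ?_, fun q _ => ?_, fun q _ => ?_⟩
    all_goals obtain ⟨V, -, hqV, hs, -⟩ := hF q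
    exacts [hs.smooth q hqV, hs.smooth_normal q hqV, hs.isSisterJet q hqV]
  refine exists_global_solution _ ?_ ?_ ?_ ?_ ?_
  · rintro F p ⟨V, hV, hpV, h⟩
    exact Filter.eventually_of_mem (hV.mem_nhds hpV) fun q hq => ⟨V, hV, hq, h⟩
  · rintro F G p ⟨V, hV, hpV, hs, hd⟩ hFG
    obtain ⟨W, hWs, hW, hpW⟩ := mem_nhds_iff.1 hFG
    have hx : ∀ q ∈ V ∩ W, (fun q => (F q).1) =ᶠ[𝓝 q] fun q => (G q).1 := fun q hq =>
      Filter.eventually_of_mem (hW.mem_nhds hq.2) fun r hr => congrArg Prod.fst (hWs hr)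
    have hN : ∀ q ∈ V ∩ W, (fun q => (F q).2.1) =ᶠ[𝓝 q] fun q => (G q).2.1 := fun q hq =>
      Filter.eventually_of_mem (hW.mem_nhds hq.2) fun r hr => congrArg (fun y => y.2.1) (hWs hr)
    refine ⟨V ∩ W, hV.inter hW, ⟨hpV, hpW⟩, ⟨fun q hq => ?_, fun q hq => ?_, fun q hq => ?_⟩,
      fun q hq => ?_⟩
    · exact (hs.smooth q hq.1).congr_of_eventuallyEq (hx q hq).symm
    · exact (hs.smooth_normal q hq.1).congr_of_eventuallyEq (hN q hq).symm
    · rw [← surfaceJet_congr (hx q hq) (hN q hq)]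
      exact hs.isSisterJet q hq.1
    · have e1 : F q = G q := hWs hq.2
      have e2 : diff (fun q => (F q).1) q = diff (fun q => (G q).1) q := (hx q hq).mfderiv_eq
      rw [← e1, ← e2, hd q hq.1]
  · rintro F G p ⟨V, hV, hpV, hs, hd⟩ ⟨V', hV', hpV', hs', hd'⟩ hFG
    have hs := hs.mono (W := V ∩ V') Set.inter_subset_left
    have hs' := hs'.mono (W := V ∩ V') Set.inter_subset_right
    have hVV := hV.inter hV'
    have hiff := fun q hq => hs.eq_iff_movedBy_one hVV (G := G) (fun q hq => hd q hq.1)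
      (fun q hq => hd' q hq.2) (q := q) hq
    obtain ⟨W, hWV, hW, hpW, -, hprop⟩ := hs.rigidity h₁ hτ hH hVV hs' ⟨hpV, hpV'⟩
    exact Filter.eventually_of_mem (hW.mem_nhds hpW) fun q hq => (hiff q (hWV hq)).2
      (hprop 1 0 0 hg p hpW q hq ((hiff p ⟨hpV, hpV'⟩).1 hFG))
  · intro p
    obtain ⟨r, hr, hrt, -, hext⟩ := hdisc p
    set e := chartAt ℂ p with he
    have hUo : IsOpen (e.source ∩ e ⁻¹' ball (e p) r) := e.isOpen_inter_preimage isOpen_ball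
    have hUc : IsPreconnected (e.source ∩ e ⁻¹' ball (e p) r) := by
      have := (convex_ball (e p) r).isPreconnected.image e.symm
        (e.continuousOn_symm.mono hrt)
      rwa [e.symm_image_eq_source_inter_preimage hrt] at this
    refine ⟨_, hUo, ⟨mem_chart_source ℂ p, mem_ball_self hr⟩, ?_, ?_⟩
    · rintro q hq F ⟨V, hV, hqV, hs, hd⟩
      have hs := hs.mono (W := V ∩ (e.source ∩ e ⁻¹' ball (e p) r)) Set.inter_subset_left
      have hVV := hV.inter hUo
      obtain ⟨y, M, hy, hM, hyM, v1, v2, v3⟩ := hext _ (fun z hz => by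
          have := hz.2.2.2
          rwa [Set.mem_preimage, e.right_inv hz.1] at this) (e.isOpen_inter_preimage_symm hVV)
        (e q) ⟨e.map_source hq.1, by
          rw [Set.mem_preimage, e.left_inv hq.1]; exact ⟨hqV, hq⟩⟩ _ _
        (contDiffOn_comp_symm hs.smooth) (fun z hz => hs.inChart h₁ p hz)
      have hs' := isSisterOn_of_chart h₁ p isOpen_ball hrt hy hM hyM
      refine ⟨fun q => (y (e q), M (e q), diff (y ∘ e) q), ?_, fun q' hq' =>
        ⟨_, hUo, hq', hs', fun _ _ => rfl⟩⟩
      have hdd : diff (y ∘ e) q = (F q).2.2 := by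
        obtain ⟨c, -, hc⟩ := exists_diff_eq hq.1
        rw [hd q hqV, hc _ (mdifferentiableAt_of_contMDiffAt (hs'.smooth q hq)),
          hc _ (mdifferentiableAt_of_contMDiffAt (hs.smooth q ⟨hqV, hq⟩)), ← v3]
        have : (y ∘ e) ∘ e.symm =ᶠ[𝓝 (e q)] y :=
          Filter.eventually_of_mem (isOpen_ball.mem_nhds hq.2) fun z hz => by
            simp [e.right_inv (hrt hz)]
        rw [this.fderiv_eq]
      simp only [v1, v2, hdd, Function.comp_apply, ← he, e.left_inv hq.1]
    · intro F G hF hG q hq hFG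
      have hsF : IsSisterOn κ₁ τ₁ κ₂ τ₂ H₁ H₂ θ x₁ N₁ (fun q => (F q).1) (fun q => (F q).2.1)
          (e.source ∩ e ⁻¹' ball (e p) r) := by
        refine ⟨fun q hq => ?_, fun q hq => ?_, fun q hq => ?_⟩
        all_goals obtain ⟨V, -, hqV, hs, -⟩ := hF q hq
        exacts [hs.smooth q hqV, hs.smooth_normal q hqV, hs.isSisterJet q hqV]
      have hsG : IsSisterOn κ₁ τ₁ κ₂ τ₂ H₁ H₂ θ x₁ N₁ (fun q => (G q).1) (fun q => (G q).2.1)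
          (e.source ∩ e ⁻¹' ball (e p) r) := by
        refine ⟨fun q hq => ?_, fun q hq => ?_, fun q hq => ?_⟩
        all_goals obtain ⟨V, -, hqV, hs, -⟩ := hG q hq
        exacts [hs.smooth q hqV, hs.smooth_normal q hqV, hs.isSisterJet q hqV]
      have hiff := fun q hq => hsF.eq_iff_movedBy_one hUo
        (fun q hq => by obtain ⟨V, -, hqV, -, hd⟩ := hF q hq; exact hd q hqV)
        (fun q hq => by obtain ⟨V, -, hqV, -, hd⟩ := hG q hq; exact hd q hqV) (q := q) hq
      exact fun r hr => (hiff r hr).2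
        (hsF.movedBy h₁ hτ hH hUo hUc hsG hg hq hr ((hiff q hq).1 hFG))
  · have hne : Nonempty S := inferInstance
    obtain ⟨p⟩ := hne
    obtain ⟨r, hr, hrt, ⟨y, M, hy, hM, hyM⟩, -⟩ := hdisc p
    exact ⟨fun q => (y (chartAt ℂ p q), M (chartAt ℂ p q), diff (y ∘ chartAt ℂ p) q), p, _,
      (chartAt ℂ p).isOpen_inter_preimage isOpen_ball, ⟨mem_chart_source ℂ p, mem_ball_self hr⟩,
      isSisterOn_of_chart h₁ p isOpen_ball hrt hy hM hyM, fun _ _ => rfl⟩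

end GlobalSister

/-! ### From jets to shape operators -/

section ShapeOperator

open Complex ComplexConjugate Metric Filter Topology

variable {S : Type*} [TopologicalSpace S] [ChartedSpace ℂ S]
  {κ τ κ₁ τ₁ κ₂ τ₂ H H₁ H₂ θ : ℝ} {x N x₁ N₁ x₂ N₂ : S → R4} {A A₁ A₂ : S → ℂ →ₗ[ℝ] ℂ}
  {T₁ : S → ℂ} {ν : S → ℝ}

theorem trace_eq (A : ℂ →ₗ[ℝ] ℂ) : LinearMap.trace ℝ ℂ A = (A 1).re + (A I).im := by
  rw [LinearMap.trace_eq_matrix_trace ℝ basisOneI, Matrix.trace, Fin.sum_univ_two]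
  simp [LinearMap.toMatrix_apply]

theorem rot_apply (θ : ℝ) (v : ℂ) : rot θ v = exp (θ * I) * v := rfl

/-- The adjoint of the rotation by `θ` is the rotation by `-θ`. -/
theorem re_rot_mul_conj (θ : ℝ) (v w : ℂ) :
    (rot θ v * conj w).re = (v * conj (rotCLM θ w)).re := by
  rw [rot_apply, rotCLM_apply, map_mul, ← exp_conj]
  simp only [map_neg, map_mul, conj_ofReal, conj_I, mul_neg, neg_neg]
  congr 1
  ring

theorem isSurfaceJet_of_isUnitNormal (hx : IsConformalImmersion κ τ x) (hN : IsUnitNormal κ τ x N)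
    (p : S) : IsSurfaceJet κ τ (surfaceJet x N p) :=
  ⟨hx.mem p, hx.conformal p, hN.tangent p, hN.unit p, hN.orthogonal p, hN.direct p⟩

theorem metric_vertical (hT₁ : IsTangentPart κ τ x T₁) (p : S) (w : ℂ) :
    metric κ τ (x p) (vertical κ τ (x p)) (diff x p w) = inducedMetric κ τ x p (T₁ p) w := by
  have h := hT₁ p w
  rw [sub_eq_add_neg, ← neg_one_smul ℝ, metric_add_left, metric_smul_left] at h
  rw [inducedMetric]
  linarith

/-- A sister immersion, in terms of jets. -/
theorem IsSister.isSisterOn (hx₁ : IsConformalImmersion κ₁ τ₁ x₁)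
    (hA₁ : IsShapeOperator κ₁ τ₁ x₁ N₁ A₁) (hT₁ : IsTangentPart κ₁ τ₁ x₁ T₁)
    (hν : ∀ p, ν p = metric κ₁ τ₁ (x₁ p) (N₁ p) (vertical κ₁ τ₁ (x₁ p)))
    (h : IsSister κ₁ τ₁ κ₂ τ₂ H₁ H₂ θ x₁ A₁ T₁ ν x₂ N₂) :
    IsSisterOn κ₁ τ₁ κ₂ τ₂ H₁ H₂ θ x₁ N₁ x₂ N₂ Set.univ := by
  refine ⟨fun q _ => h.immersion.smooth.contMDiffAt, fun q _ => h.normal.smooth.contMDiffAt,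
    fun q _ => ⟨h.immersion.mem q, h.normal.tangent q, h.normal.unit q, h.normal.orthogonal q,
      h.normal.direct q, h.metric_eq q, fun v w => ?_, fun w => ?_, ?_⟩⟩
  · obtain ⟨ρ, hρ, hr⟩ := hx₁.conformal q
    have h1 := h.shape_eq q v w
    have h2 := hA₁ q v (rotCLM θ w)
    rw [h.metric_eq] at h1
    show covDerivInner κ₂ τ₂ x₂ N₂ q v w = covDerivInner κ₁ τ₁ x₁ N₁ q v (rotCLM θ w)
      + H₁ * inducedMetric κ₁ τ₁ x₁ q v (rotCLM θ w) - H₂ * inducedMetric κ₁ τ₁ x₁ q v w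
    rw [hr] at h1 h2 ⊢
    rw [hr]
    simp only [LinearMap.add_apply, LinearMap.comp_apply, LinearMap.sub_apply, LinearMap.smul_apply,
      LinearMap.id_apply, map_sub, sub_mul, add_mul, add_re, sub_re, re_rot_mul_conj, map_smul,
      smul_mul_assoc, smul_re, smul_eq_mul] at h1
    linear_combination h1 - h2
  · obtain ⟨ρ, hρ, hr⟩ := hx₁.conformal q
    have h1 := metric_vertical hT₁ q (rotCLM θ w)
    simp only [surfaceJet]
    rw [h1, h.vertical_eq, metric_add_left, metric_smul_left, h.normal.orthogonal, mul_zero, add_zero]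
    have h2 := h.metric_eq q (rot θ (T₁ q)) w
    rw [inducedMetric] at h2
    rw [h2, hr, hr, re_rot_mul_conj]
  · simp only [surfaceJet]
    rw [← hν, metric_comm, h.vertical_eq, metric_add_left, metric_smul_left, h.normal.unit,
      metric_comm, h.normal.orthogonal]
    ring

variable [IsManifold 𝓘(ℂ) ω S]

theorem exists_isSurfaceLift_chart (hx : ContMDiff 𝓘(ℝ, ℂ) 𝓘(ℝ, R4) ∞ x)
    (hN : ContMDiff 𝓘(ℝ, ℂ) 𝓘(ℝ, R4) ∞ N) (hj : ∀ p, IsSurfaceJet κ τ (surfaceJet x N p)) (p : S) :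
    ∃ V : Set ℂ, IsOpen V ∧ chartAt ℂ p p ∈ V ∧ ∃ a b s φ η β n ν ρ,
      IsSurfaceLift κ τ V a b s φ η β n ν ρ ∧
      LiftsTo κ τ V a b s n ν (x ∘ (chartAt ℂ p).symm) (N ∘ (chartAt ℂ p).symm) := by
  have hs := (contDiffOn_comp_symm (x := x) (p₀ := p) (V := Set.univ) fun q _ => hx.contMDiffAt)
  rw [Set.preimage_univ, Set.inter_univ] at hs
  obtain ⟨V, -, hV, hpV, h⟩ := exists_isSurfaceLift (κ := κ) (τ := τ)
    (M := N ∘ (chartAt ℂ p).symm) (chartAt ℂ p).open_target hs (fun z hz => by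
      obtain ⟨c, hc, hcx⟩ := exists_surfaceJet_eq ((chartAt ℂ p).map_target hz)
      have := hj ((chartAt ℂ p).symm z)
      rwa [hcx x N (mdifferentiableAt_of_contMDiffAt hx.contMDiffAt)
        (mdifferentiableAt_of_contMDiffAt hN.contMDiffAt), isSurfaceJet_scale_iff hc,
        (chartAt ℂ p).right_inv hz] at this) (mem_chart_target ℂ p)
  exact ⟨V, hV, hpV, h⟩

/-- A vector tangent to `E(κ, τ)`, orthogonal to a surface and to its normal, vanishes. -/
theorem eq_zero_of_orthogonal_surface (hx : ContMDiff 𝓘(ℝ, ℂ) 𝓘(ℝ, R4) ∞ x)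
    (hN : ContMDiff 𝓘(ℝ, ℂ) 𝓘(ℝ, R4) ∞ N) (hj : ∀ p, IsSurfaceJet κ τ (surfaceJet x N p)) {p : S}
    {u : R4} (hu : u ∈ tangent κ τ (x p)) (h₁ : ∀ w, metric κ τ (x p) u (diff x p w) = 0)
    (h₂ : metric κ τ (x p) u (N p) = 0) : u = 0 := by
  obtain ⟨V, hV, hpV, a, b, s, φ, η, β, n, ν, ρ, hl, hy⟩ := exists_isSurfaceLift_chart hx hN hj p
  obtain ⟨c, hc, hcx⟩ := exists_diff_eq (mem_chart_source ℂ p)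
  have hp := (chartAt ℂ p).left_inv (mem_chart_source ℂ p)
  refine hl.eq_zero_of_orthogonal hV hy hpV ?_ (fun w => ?_) ?_
  · rwa [Function.comp_apply, hp]
  · have := h₁ (c⁻¹ * w)
    rw [hcx x (mdifferentiableAt_of_contMDiffAt hx.contMDiffAt), ContinuousLinearMap.comp_apply,
      ContinuousLinearMap.mul_apply', mul_inv_cancel_left₀ hc] at this
    rwa [Function.comp_apply, hp]
  · rwa [Function.comp_apply, Function.comp_apply, hp]

/-- The second fundamental form of a surface is symmetric. -/
theorem covDerivInner_comm (hx : ContMDiff 𝓘(ℝ, ℂ) 𝓘(ℝ, R4) ∞ x)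
    (hN : ContMDiff 𝓘(ℝ, ℂ) 𝓘(ℝ, R4) ∞ N) (hj : ∀ p, IsSurfaceJet κ τ (surfaceJet x N p)) (p : S)
    (v w : ℂ) : covDerivInner κ τ x N p v w = covDerivInner κ τ x N p w v := by
  obtain ⟨V, hV, hpV, a, b, s, φ, η, β, n, ν, ρ, hl, hy⟩ := exists_isSurfaceLift_chart hx hN hj p
  obtain ⟨c, hc, hcx⟩ := exists_surfaceJet_eq (mem_chart_source ℂ p)
  show (surfaceJet x N p).cov κ τ v w = (surfaceJet x N p).cov κ τ w v
  rw [hcx x N (mdifferentiableAt_of_contMDiffAt hx.contMDiffAt)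
    (mdifferentiableAt_of_contMDiffAt hN.contMDiffAt), Jet.scale_cov, Jet.scale_cov,
    hl.jet_cov_comm hV hy hpV]

/-- The hypothesis on the trace of the shape operator, in the charts. -/
theorem isCMCSurface_of_shapeOperator (hx : IsConformalImmersion κ τ x) (hN : IsUnitNormal κ τ x N)
    (hA : IsShapeOperator κ τ x N A) (hH : HasConstantMeanCurvature A H) :
    IsCMCSurface κ τ H x N := by
  have hs := fun p => contDiffOn_comp_symm (x := x) (p₀ := p) (V := Set.univ) fun q _ =>
    hx.smooth.contMDiffAt
  simp only [Set.preimage_univ, Set.inter_univ] at hs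
  refine ⟨hx.smooth, hN.smooth, fun p => ⟨hs p, fun z hz => ?_, fun z hz => ?_⟩⟩
  all_goals
    obtain ⟨c, hc, hcx⟩ := exists_surfaceJet_eq ((chartAt ℂ p).map_target hz)
    have hcx := hcx x N (mdifferentiableAt_of_contMDiffAt hx.smooth.contMDiffAt)
      (mdifferentiableAt_of_contMDiffAt hN.smooth.contMDiffAt)
    rw [(chartAt ℂ p).right_inv hz] at hcx
    have hj := isSurfaceJet_of_isUnitNormal hx hN ((chartAt ℂ p).symm z)
    rw [hcx] at hj
  · exact (isSurfaceJet_scale_iff hc).1 hj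
  · refine hasMeanCurvature_of_trace hc hj (A := A ((chartAt ℂ p).symm z)) (fun v w => ?_) ?_
    · rw [← hcx]
      exact hA _ v w
    · have := hH ((chartAt ℂ p).symm z)
      rw [trace_eq] at this
      linarith

/-- The relation `ξ₂ = dx₂(e^{θJ} T₁) + ν N₂` follows from the equality of the inner products of both
sides with the tangent vectors of the surface and with its normal, which span the tangent space. -/
theorem IsSisterOn.isSister (hx₁ : IsConformalImmersion κ₁ τ₁ x₁) (hN₁ : IsUnitNormal κ₁ τ₁ x₁ N₁)
    (hA₁ : IsShapeOperator κ₁ τ₁ x₁ N₁ A₁) (hT₁ : IsTangentPart κ₁ τ₁ x₁ T₁)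
    (hν : ∀ p, ν p = metric κ₁ τ₁ (x₁ p) (N₁ p) (vertical κ₁ τ₁ (x₁ p)))
    (h : IsSisterOn κ₁ τ₁ κ₂ τ₂ H₁ H₂ θ x₁ N₁ x₂ N₂ Set.univ) :
    IsSister κ₁ τ₁ κ₂ τ₂ H₁ H₂ θ x₁ A₁ T₁ ν x₂ N₂ := by
  have hj := fun p => h.isSisterJet p (Set.mem_univ p)
  have hx₂ : ContMDiff 𝓘(ℝ, ℂ) 𝓘(ℝ, R4) ∞ x₂ := fun p => h.smooth p (Set.mem_univ p)
  have hN₂ : ContMDiff 𝓘(ℝ, ℂ) 𝓘(ℝ, R4) ∞ N₂ := fun p => h.smooth_normal p (Set.mem_univ p)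
  have hj₂ := fun p => (hj p).isSurfaceJet (isSurfaceJet_of_isUnitNormal hx₁ hN₁ p)
  have hmet : ∀ p v w, inducedMetric κ₂ τ₂ x₂ p v w = inducedMetric κ₁ τ₁ x₁ p v w :=
    fun p => (hj p).inner_eq
  refine ⟨⟨hx₂, fun p => (hj p).mem, fun p => (hj₂ p).conformal⟩,
    ⟨hN₂, fun p => (hj p).tangent, fun p => (hj p).unit, fun p => (hj p).orthogonal,
      fun p => (hj p).direct⟩, hmet, fun p v w => ?_, fun p => ?_⟩
  · obtain ⟨ρ, hρ, hr⟩ := hx₁.conformal p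
    have h1 : covDerivInner κ₂ τ₂ x₂ N₂ p v w = covDerivInner κ₁ τ₁ x₁ N₁ p v (rotCLM θ w)
      + H₁ * inducedMetric κ₁ τ₁ x₁ p v (rotCLM θ w) - H₂ * inducedMetric κ₁ τ₁ x₁ p v w :=
      (hj p).cov_eq v w
    have h2 := hA₁ p v (rotCLM θ w)
    rw [hr, hr] at h1
    rw [hr] at h2
    rw [hmet, hr]
    simp only [LinearMap.add_apply, LinearMap.comp_apply, LinearMap.sub_apply, LinearMap.smul_apply,
      LinearMap.id_apply, map_sub, sub_mul, add_mul, add_re, sub_re, re_rot_mul_conj, map_smul,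
      smul_mul_assoc, smul_re, smul_eq_mul]
    linear_combination h1 + h2
  · obtain ⟨ρ, hρ, hr⟩ := hx₁.conformal p
    have hort : ∀ w, metric κ₂ τ₂ (x₂ p) (N₂ p) (diff x₂ p w) = 0 := (hj p).orthogonal
    have hunit : metric κ₂ τ₂ (x₂ p) (N₂ p) (N₂ p) = 1 := (hj p).unit
    have htan : N₂ p ∈ tangent κ₂ τ₂ (x₂ p) := (hj p).tangent
    have hang : metric κ₂ τ₂ (x₂ p) (N₂ p) (vertical κ₂ τ₂ (x₂ p)) = ν p :=
      (hj p).angle_eq.trans (hν p).symm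
    have hver : ∀ w, metric κ₂ τ₂ (x₂ p) (vertical κ₂ τ₂ (x₂ p)) (diff x₂ p w)
      = metric κ₁ τ₁ (x₁ p) (vertical κ₁ τ₁ (x₁ p)) (diff x₁ p (rotCLM θ w)) := (hj p).vertical_eq
    have hmem : x₂ p ∈ carrier κ₂ τ₂ := (hj p).mem
    have hdt := diff_mem_tangent (κ := κ₂) (τ := τ₂) isOpen_univ h.smooth (fun q _ => (hj q).mem)
      (Set.mem_univ p) (rot θ (T₁ p))
    have hvt : vertical κ₂ τ₂ (x₂ p) ∈ tangent κ₂ τ₂ (x₂ p) := by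
      obtain ⟨a, b, s, -, hp⟩ := exists_proj_eq hmem
      rw [← hp, ← frame_vertical]
      exact frame_mem_tangent _ _ _ _ _ _ _
    have key : vertical κ₂ τ₂ (x₂ p) + (-1 : ℝ) • diff x₂ p (rot θ (T₁ p)) + (-ν p) • N₂ p = 0 := by
      refine eq_zero_of_orthogonal_surface (p := p) hx₂ hN₂ hj₂ ?_ (fun w => ?_) ?_
      · rw [tangent, Set.mem_ofPred_eq] at hdt hvt htan ⊢
        rw [dot_add_right, dot_add_right, dot_smul_right, dot_smul_right, hdt, hvt, htan]
        simp
      · have h2 := hmet p (rot θ (T₁ p)) w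
        rw [inducedMetric, hr] at h2
        rw [metric_add_left, metric_add_left, metric_smul_left, metric_smul_left, hort, hver,
          metric_vertical hT₁, h2, hr, re_rot_mul_conj]
        ring
      · rw [metric_add_left, metric_add_left, metric_smul_left, metric_smul_left, hunit,
          metric_comm, hang, metric_comm, hort]
        ring
    have : vertical κ₂ τ₂ (x₂ p) = (vertical κ₂ τ₂ (x₂ p) + (-1 : ℝ) • diff x₂ p (rot θ (T₁ p))
        + (-ν p) • N₂ p) + (diff x₂ p (rot θ (T₁ p)) + ν p • N₂ p) := by
      module
    rw [this, key, zero_add]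

/-- A trace-free symmetric operator of the plane remains trace-free after a rotation. Hence a sister
immersion of a surface of constant mean curvature has constant mean curvature. -/
theorem IsSister.hasConstantMeanCurvature (hx₁ : IsConformalImmersion κ₁ τ₁ x₁)
    (hN₁ : IsUnitNormal κ₁ τ₁ x₁ N₁) (hA₁ : IsShapeOperator κ₁ τ₁ x₁ N₁ A₁)
    (hcmc : HasConstantMeanCurvature A₁ H₁)
    (h : IsSister κ₁ τ₁ κ₂ τ₂ H₁ H₂ θ x₁ A₁ T₁ ν x₂ N₂) (hA₂ : IsShapeOperator κ₂ τ₂ x₂ N₂ A₂) :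
    HasConstantMeanCurvature A₂ H₂ := by
  intro p
  obtain ⟨ρ, hρ, hr⟩ := hx₁.conformal p
  have h2 : ∀ v, A₂ p v = rot θ (A₁ p v - H₁ • v) + H₂ • v := fun v => by
    have key : ∀ w : ℂ, ((A₂ p v - (rot θ (A₁ p v - H₁ • v) + H₂ • v)) * conj w).re = 0 := fun w => by
      have e1 := hA₂ p v w
      have e2 := h.shape_eq p v w
      rw [h.metric_eq, hr] at e1 e2
      apply mul_left_cancel₀ hρ.ne'
      simp only [LinearMap.add_apply, LinearMap.comp_apply, LinearMap.sub_apply,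
        LinearMap.smul_apply, LinearMap.id_apply] at e2
      rw [sub_mul, sub_re]
      linear_combination e1 - e2
    have k1 := key 1
    have k2 := key I
    simp only [map_one, mul_one, conj_I, mul_neg, neg_re, mul_I_re, neg_neg] at k1 k2
    exact sub_eq_zero.1 (Complex.ext k1 k2)
  have hsym : (A₁ p 1).im = (A₁ p I).re := by
    have e1 := hA₁ p 1 I
    have e2 := hA₁ p I 1
    rw [covDerivInner_comm hx₁.smooth hN₁.smooth (isSurfaceJet_of_isUnitNormal hx₁ hN₁) p I 1,
      ← e1, hr, hr] at e2
    have := mul_left_cancel₀ hρ.ne' e2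
    simp at this
    linarith
  have htr := hcmc p
  rw [trace_eq] at htr ⊢
  rw [h2, h2, rot_apply, rot_apply]
  simp only [add_re, add_im, mul_re, mul_im, sub_re, sub_im, smul_re, smul_im, smul_eq_mul, one_re,
    one_im, I_re, I_im]
  linear_combination (exp (θ * I)).re * htr - (exp (θ * I)).im / 2 * hsym

end ShapeOperator

end HomSpace

end

theorem theorem5p2
    (κ₁ τ₁ κ₂ τ₂ H₁ H₂ θ : ℝ)
    (hiso : κ₁ - 4 * τ₁ ^ 2 ≠ 0)
    (hκ : κ₁ - 4 * τ₁ ^ 2 = κ₂ - 4 * τ₂ ^ 2)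
    (hH : τ₁ ^ 2 + H₁ ^ 2 = τ₂ ^ 2 + H₂ ^ 2)
    (hθ : (τ₂ : ℂ) + Complex.I * H₂ = Complex.exp (θ * Complex.I) * (τ₁ + Complex.I * H₁))
    {S : Type*} [TopologicalSpace S] [T2Space S] [SimplyConnectedSpace S]
    [ChartedSpace ℂ S] [IsManifold 𝓘(ℂ) ω S]
    (x₁ N₁ : S → HomSpace.R4) (A₁ : S → ℂ →ₗ[ℝ] ℂ) (T₁ : S → ℂ) (ν : S → ℝ)
    (hx₁ : HomSpace.IsConformalImmersion κ₁ τ₁ x₁)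
    (hN₁ : HomSpace.IsUnitNormal κ₁ τ₁ x₁ N₁)
    (hA₁ : HomSpace.IsShapeOperator κ₁ τ₁ x₁ N₁ A₁)
    (hT₁ : HomSpace.IsTangentPart κ₁ τ₁ x₁ T₁)
    (hν : ∀ p, ν p = HomSpace.metric κ₁ τ₁ (x₁ p) (N₁ p) (HomSpace.vertical κ₁ τ₁ (x₁ p)))
    (hcmc : HomSpace.HasConstantMeanCurvature A₁ H₁) :
    (∃ x₂ N₂ : S → HomSpace.R4,
      HomSpace.IsSister κ₁ τ₁ κ₂ τ₂ H₁ H₂ θ x₁ A₁ T₁ ν x₂ N₂) ∧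
    (∀ x₂ N₂ x₂' N₂' : S → HomSpace.R4,
      HomSpace.IsSister κ₁ τ₁ κ₂ τ₂ H₁ H₂ θ x₁ A₁ T₁ ν x₂ N₂ →
      HomSpace.IsSister κ₁ τ₁ κ₂ τ₂ H₁ H₂ θ x₁ A₁ T₁ ν x₂' N₂' →
      ∃ Φ : HomSpace.R4 → HomSpace.R4,
        HomSpace.IsOrientedIsometry κ₂ τ₂ Φ ∧ ∀ p, x₂' p = Φ (x₂ p)) ∧
    (∀ x₂ N₂ : S → HomSpace.R4,
      HomSpace.IsSister κ₁ τ₁ κ₂ τ₂ H₁ H₂ θ x₁ A₁ T₁ ν x₂ N₂ →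
      ∀ A₂ : S → ℂ →ₗ[ℝ] ℂ, HomSpace.IsShapeOperator κ₂ τ₂ x₂ N₂ A₂ →
        HomSpace.HasConstantMeanCurvature A₂ H₂) := by
  have hg : HomSpace.IsCMCSurface κ₁ τ₁ H₁ x₁ N₁ :=
    HomSpace.isCMCSurface_of_shapeOperator hx₁ hN₁ hA₁ hcmc
  obtain ⟨hτ, hHH⟩ := HomSpace.sister_parameters hθ
  refine ⟨?_, fun x₂ N₂ x₂' N₂' h h' => ?_, fun x₂ N₂ h A₂ hA₂ =>
    h.hasConstantMeanCurvature hx₁ hN₁ hA₁ hcmc hA₂⟩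
  · obtain ⟨x₂, N₂, h⟩ := hg.exists_sister hκ hτ hHH
    exact ⟨x₂, N₂, h.isSister hx₁ hN₁ hA₁ hT₁ hν⟩
  · have hs := h.isSisterOn hx₁ hA₁ hT₁ hν
    have hs' := h'.isSisterOn hx₁ hA₁ hT₁ hν
    have hne : Nonempty S := inferInstance
    obtain ⟨p⟩ := hne
    obtain ⟨-, -, -, -, ⟨A, B, C, hAB, hm⟩, -⟩ :=
      hs.rigidity hg hτ hHH isOpen_univ hs' (Set.mem_univ p)
    exact ⟨HomSpace.translation κ₂ τ₂ A B C, HomSpace.isOrientedIsometry_translation κ₂ τ₂ hAB C,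
      fun q => (hs.movedBy hg hτ hHH isOpen_univ isPreconnected_univ hs' hAB (Set.mem_univ p)
        (Set.mem_univ q) hm).point⟩
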